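/- Notation. Let $\lambda\ge 1$ and let $Z_\lambda$ be either $\mathbb R$ or the torus $\mathbb R/2\pi\lambda\mathbb Z$. The frequency group $Z_\lambda^*$ is $\mathbb R$ with Lebesgue measure, respectively $\lambda^{-1}\mathbb Z$ with $\lambda^{-1}$ times counting measure. For functions on $\mathbb R\times Z_\lambda$ put $$\tilde u(\tau,\xi)=\frac1{2\pi}\int_{\mathbb R}\int_{Z_\lambda}e^{-i(t\tau+x\xi)}u(t,x)\,dx\,dt,\qquad (\tau,\xi)\in\mathbb R\times Z_\lambda^*,$$ and extend this to distributions as usual. Let $\langle a\rangle=(1+a^2)^{1/2}$, and $$\|u\|_{X^{s,b}}=\|\langle\xi\rangle^s\langle\tau+\xi^2\rangle^b\tilde u\|_{L^2_\xi L^2_\tau},\qquad \|u\|_{Y^s}=\|\langle\xi\rangle^s\tilde u\|_{L^2_\xi L^1_\tau}.$$ Let $P_\Omega$ be the spacetime Fourier projection onto $\Omega$, and let $\Lambda^{-1}$ and $\omega_\lambda^2$ be the Fourier multipliers with symbols $\langle\tau+\xi^2\rangle^{-1}$ and $\lambda^2\xi^2/(1+\lambda^2\xi^2)$. For $-\frac12<s\le-\frac14$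 let $$\|u\|_{W^s}=\|P_{\{\langle\tau+\xi^2\rangle\le\langle\xi\rangle\}}u\|_{X^{s,1}}+\|P_{\{\langle\tau+\xi^2\rangle\ge\langle\xi\rangle\}}u\|_{X^{s+1,0}}+\|P_{\{\langle\tau+\xi^2\rangle\ge\langle\xi\rangle^2\}}u\|_{Y^s},$$ and let $$\begin{aligned}\|u\|_{W^{-1/2}}={}&\|P_{\{\langle\tau+\xi^2\rangle\le\langle\xi\rangle\}}u\|_{X^{-1/2,1}}+\|P_{\{\langle\xi\rangle\le\langle\tau+\xi^2\rangle\le\langle\xi\rangle^2\}}u\|_{X^{1/2,0}}\\&+\sum_{M=2^j,\ j\ge0}\|P_{\{M\le\langle\tau+\xi^2\rangle<2M\}\cap\{\langle\tau+\xi^2\rangle\ge\langle\xi\rangle^2\}}u\|_{X^{1/2,0}}+\|P_{\{\langle\tau+\xi^2\rangle\ge\langle\xi\rangle^2\}}u\|_{Y^{-1/2}}.\end{aligned}$$ $W^s$ is the space of distributions $u$ on $\mathbb R\times Z_\lambda$ whose Fourier transform is a measurable function and for which $\|u\|_{W^s}<\infty$. Products of elements of $W^s$ are defined by the convolution formula $$\widetilde{uv}(\tau,\xi)=\frac1{2\pi}\int_{Z_\lambda^*}\int_{\mathbb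 R}\tilde u(\tau_1,\xi_1)\,\tilde v(\tau-\tau_1,\xi-\xi_1)\,d\tau_1\,d\xi_1,\qquad \tilde{\bar u}(\tau,\xi)=\overline{\tilde u(-\tau,-\xi)}.$$ Proposition. Let $-\frac12\le s\le-\frac14$. There is a constant $C$ depending only on $s$ such that the following holds for every $\lambda\ge1$ and for both choices of $Z_\lambda$. Let $$C_s(\lambda)=\begin{cases}\lambda^{-2s-1/2},&-\frac12\le s<-\frac14,\\(\log(1+\lambda))^{1/2},&s=-\frac14.\end{cases}$$ For all $u,v\in W^s$, the convolution integrals defining the Fourier transforms of $u\bar v$, $uv$ and $\bar u\bar v$ converge absolutely at almost every $(\tau,\xi)$ with $\xi\ne0$ (so that $\omega_\lambda^2(u\bar v)$, $\omega_\lambda^2(uv)$ and $\omega_\lambda^2(\bar u\bar v)$ are well defined, the symbol of $\omega_\lambda^2$ being $0$ at $\xi=0$), the functions $\Lambda^{-1}\omega_\lambda^2(u\bar v)$, $\Lambda^{-1}\omega_\lambda^2(uv)$ and $\Lambda^{-1}\omega_\lambda^2(\bar u\bar v)$ belong to $W^s$, and $$\|\Lambda^{-1}\omega_\lambda^2(u\bar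 v)\|_{W^s}\le C\,C_s(\lambda)\,\|u\|_{W^s}\|v\|_{W^s},$$ $$\|\Lambda^{-1}\omega_\lambda^2(uv)\|_{W^s}\le C\,\|u\|_{W^s}\|v\|_{W^s},\qquad \|\Lambda^{-1}\omega_\lambda^2(\bar u\bar v)\|_{W^s}\le C\,\|u\|_{W^s}\|v\|_{W^s}.$$ In particular, the same three estimates, with the same $C$, hold for all Schwartz functions $u,v$ on $\mathbb R\times Z_\lambda$ (for the torus: smooth functions that, with all their derivatives, decrease rapidly in $t$) with the pointwise products. -/

import Mathlib

open MeasureTheory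
open scoped ENNReal NNReal SchwartzMap ContDiff ComplexConjugate

noncomputable section

namespace GoodBoussinesq

/-- The two spatial settings: the real line, and the torus of period `2 * π * lam`. -/
inductive Geometry
  | line
  | torus

/-- The Japanese bracket `⟨x⟩ = (1 + x ^ 2) ^ (1 / 2)`. -/
def bracket (x : ℝ) : ℝ := Real.sqrt (1 + x ^ 2)

/-- The measure on the spatial frequencies `ξ`: Lebesgue measure for the line, and for the torus the
counting measure on the lattice `ℤ / lam`, normalized by `1 / lam`. -/
def freqMeasure : Geometry → ℝ → Measure ℝ
  | .line, _ => volume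
  | .torus, lam =>
      Measure.sum fun n : ℤ => ENNReal.ofReal (1 / lam) • Measure.dirac ((n : ℝ) / lam)

/-- The measure `dτ dξ` on the spacetime frequencies `(τ, ξ)`. -/
def specMeasure (Z : Geometry) (lam : ℝ) : Measure (ℝ × ℝ) :=
  (volume : Measure ℝ).prod (freqMeasure Z lam)

/-- The measure on physical space: all of `ℝ`, or one period of the torus. -/
def spaceMeasure : Geometry → ℝ → Measure ℝ
  | .line, _ => volume
  | .torus, lam => volume.restrict (Set.Ioc 0 (2 * Real.pi * lam))

/-- The modulation bracket `⟨τ + ξ ^ 2⟩` at the frequency `q = (τ, ξ)`. -/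
def modulation (q : ℝ × ℝ) : ℝ := bracket (q.1 + q.2 ^ 2)

/-- The mixed norm `‖F‖` in `L²_ξ L^p_τ`. -/
def mixedNorm (Z : Geometry) (lam : ℝ) (p : ℝ≥0∞) (F : ℝ × ℝ → ℂ) : ℝ≥0∞ :=
  eLpNorm (fun ξ : ℝ => eLpNorm (fun τ : ℝ => F (τ, ξ)) p volume) 2 (freqMeasure Z lam)

/-- The `X^{s,b}` norm of the distribution with spacetime Fourier transform `f`. -/
def xNorm (Z : Geometry) (lam s b : ℝ) (f : ℝ × ℝ → ℂ) : ℝ≥0∞ :=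
  mixedNorm Z lam 2 fun q => ((bracket q.2 ^ s * modulation q ^ b : ℝ) : ℂ) * f q

/-- The `Y^s` norm of the distribution with spacetime Fourier transform `f`. -/
def yNorm (Z : Geometry) (lam s : ℝ) (f : ℝ × ℝ → ℂ) : ℝ≥0∞ :=
  mixedNorm Z lam 1 fun q => ((bracket q.2 ^ s : ℝ) : ℂ) * f q

/-- The frequencies with `⟨τ + ξ ^ 2⟩ ≤ ⟨ξ⟩`. -/
def nearRegion : Set (ℝ × ℝ) := {q | modulation q ≤ bracket q.2}

/-- The frequencies with `⟨τ + ξ ^ 2⟩ ≥ ⟨ξ⟩`. -/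
def awayRegion : Set (ℝ × ℝ) := {q | bracket q.2 ≤ modulation q}

/-- The frequencies with `⟨ξ⟩ ≤ ⟨τ + ξ ^ 2⟩ ≤ ⟨ξ⟩ ^ 2`. -/
def middleRegion : Set (ℝ × ℝ) :=
  {q | bracket q.2 ≤ modulation q ∧ modulation q ≤ bracket q.2 ^ 2}

/-- The frequencies with `⟨τ + ξ ^ 2⟩ ≥ ⟨ξ⟩ ^ 2`. -/
def farRegion : Set (ℝ × ℝ) := {q | bracket q.2 ^ 2 ≤ modulation q}

/-- The frequencies with `⟨τ + ξ ^ 2⟩ ∼ M` for the dyadic number `M = 2 ^ j`. -/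
def dyadicRegion (j : ℕ) : Set (ℝ × ℝ) :=
  {q | (2 : ℝ) ^ j ≤ modulation q ∧ modulation q < (2 : ℝ) ^ (j + 1)}

open Classical in
/-- The `W^s` norm of the distribution with spacetime Fourier transform `f`; a Fourier projection
onto a set of frequencies is multiplication of `f` by its indicator. -/
def wNorm (Z : Geometry) (lam s : ℝ) (f : ℝ × ℝ → ℂ) : ℝ≥0∞ :=
  if s = -1 / 2 then
    xNorm Z lam (-1 / 2) 1 (nearRegion.indicator f)
      + xNorm Z lam (1 / 2) 0 (middleRegion.indicator f)
      + ∑' j : ℕ, xNorm Z lam (1 / 2) 0 ((dyadicRegion j ∩ farRegion).indicator f)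
      + yNorm Z lam (-1 / 2) (farRegion.indicator f)
  else
    xNorm Z lam s 1 (nearRegion.indicator f)
      + xNorm Z lam (s + 1) 0 (awayRegion.indicator f)
      + yNorm Z lam s (farRegion.indicator f)

/-- `f` is the spacetime Fourier transform of an element of `W^s`. (A distribution of finite `W^s`
norm has a locally square integrable Fourier transform, and is determined by it.) -/
def MemW (Z : Geometry) (lam s : ℝ) (f : ℝ × ℝ → ℂ) : Prop :=
  AEStronglyMeasurable f (specMeasure Z lam) ∧ wNorm Z lam s f < ⊤

/-- On the Fourier side, the multiplier `Λ^σ`. -/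
def lambdaPow (σ : ℝ) (f : ℝ × ℝ → ℂ) : ℝ × ℝ → ℂ :=
  fun q => ((modulation q ^ σ : ℝ) : ℂ) * f q

/-- On the Fourier side, the multiplier `ω_lam²`. -/
def omegaSq (lam : ℝ) (f : ℝ × ℝ → ℂ) : ℝ × ℝ → ℂ :=
  fun q => ((lam ^ 2 * q.2 ^ 2 / (1 + lam ^ 2 * q.2 ^ 2) : ℝ) : ℂ) * f q

/-- On the Fourier side, complex conjugation `u ↦ ū`. -/
def conjHat (f : ℝ × ℝ → ℂ) : ℝ × ℝ → ℂ := fun q => conj (f (-q))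

/-- The convolution integral for the product at the frequency `q` converges absolutely. -/
def ProdHatExistsAt (Z : Geometry) (lam : ℝ) (f g : ℝ × ℝ → ℂ) (q : ℝ × ℝ) : Prop :=
  Integrable (fun p => f p * g (q - p)) (specMeasure Z lam)

/-- On the Fourier side, the product `(u, v) ↦ u v`, as a convolution. -/
def prodHat (Z : Geometry) (lam : ℝ) (f g : ℝ × ℝ → ℂ) : ℝ × ℝ → ℂ :=
  fun q => ((1 / (2 * Real.pi) : ℝ) : ℂ) * ∫ p, f p * g (q - p) ∂(specMeasure Z lam)

/-- The spacetime Fourier transform of an integrable function `u (t, x)` on `ℝ × Z_lam`. -/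
def stFourier (Z : Geometry) (lam : ℝ) (u : ℝ × ℝ → ℂ) : ℝ × ℝ → ℂ :=
  fun q => ((1 / (2 * Real.pi) : ℝ) : ℂ) *
    ∫ p, Complex.exp (-Complex.I * ((p.1 * q.1 + p.2 * q.2 : ℝ) : ℂ)) * u p
      ∂((volume : Measure ℝ).prod (spaceMeasure Z lam))

/-- Schwartz functions on `ℝ × Z_lam`. For the torus these are the smooth functions of `(t, x)` that
are `2 * π * lam`-periodic in `x` and, with all their derivatives, rapidly decreasing in `t`. -/
def IsSchwartz : Geometry → ℝ → (ℝ × ℝ → ℂ) → Prop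
  | .line, _, u => ∃ φ : 𝓢(ℝ × ℝ, ℂ), ⇑φ = u
  | .torus, lam, u =>
      ContDiff ℝ ∞ u ∧ (∀ t x : ℝ, u (t, x + 2 * Real.pi * lam) = u (t, x)) ∧
        ∀ k n : ℕ, ∃ C : ℝ, ∀ t x : ℝ, |t| ^ k * ‖iteratedFDeriv ℝ n u (t, x)‖ ≤ C

open Classical in
/-- The factor `C_s(lam)`. -/
def lossFactor (s lam : ℝ) : ℝ :=
  if s = -1 / 4 then Real.log (1 + lam) ^ (1 / 2 : ℝ) else lam ^ (-2 * s - 1 / 2)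

/-- For the elements `u`, `v` of `W^s` with Fourier transforms `f`, `g`: the Fourier transform of
`u v` is well defined by an absolutely convergent convolution at almost every frequency that
`ω_lam²` does not annihilate, and `Λ⁻¹ ω_lam² (u v)` is in `W^s` with norm at most `B`. -/
def ProductBound (Z : Geometry) (lam s : ℝ) (f g : ℝ × ℝ → ℂ) (B : ℝ≥0∞) : Prop :=
  (∀ᵐ q ∂(specMeasure Z lam), q.2 ≠ 0 → ProdHatExistsAt Z lam f g q) ∧
    MemW Z lam s (lambdaPow (-1) (omegaSq lam (prodHat Z lam f g))) ∧
    wNorm Z lam s (lambdaPow (-1) (omegaSq lam (prodHat Z lam f g))) ≤ B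

/-- For an integrable function `w` on `ℝ × Z_lam`: the `W^s` norm of `Λ⁻¹ ω_lam² w`. -/
def forcingNorm (Z : Geometry) (lam s : ℝ) (w : ℝ × ℝ → ℂ) : ℝ≥0∞ :=
  wNorm Z lam s (lambdaPow (-1) (omegaSq lam (stFourier Z lam w)))

end GoodBoussinesq

end

/-!
The estimates only involve the absolute values of the Fourier transforms, so they are estimates for
convolutions of nonnegative functions. Such convolutions always have a value in `[0, ∞]`, and the
almost everywhere absolute convergence is read off at the end from the finiteness of the bound
(`exists_ae_prodHatExistsAt`). Of the norm of a factor three parts are used: an `L²` norm with weight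
`⟨ξ⟩ ^ s min (⟨τ ± ξ ^ 2⟩, ⟨ξ⟩)`, the `L²_ξ L¹_τ` norm, and, for `s = -1/2`, the `ℓ¹` sum over dyadic
modulations (`sqNorm`, `exists_sqNorm_le_wNorm`); the sign is `-` for a complex conjugate, whose
transform lives near the reflected parabola (`sqNorm_neg`). The line and the torus are treated
together: `IsFreqMeasure` collects the symmetries of the frequency measure and its bound on the
measure of balls, and nothing else about it enters.

The mechanism is the resonance identity. If the frequencies of the factors are `(τ₁, ξ₁)` and
`(τ₂, ξ₂)`, with sum `(τ, ξ)`, then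
`(τ + ξ²) - (τ₁ + ε₁ ξ₁²) - (τ₂ + ε₂ ξ₂²) = ξ² - ε₁ ξ₁² - ε₂ ξ₂²`,
so that one of the three modulations is at least a third of the right hand side, the resonance
(`resonance_identity`, `abs_resonance_le_add`).

*Output frequencies `|ξ| ≥ 1`* (`exists_high_le`). Unless `|ξ₁| ≤ 1` or `|ξ₂| ≤ 1`, the resonance is
at least a multiple of `⟨ξ⟩ min (⟨ξ₁⟩, ⟨ξ₂⟩)` (`low_resonance_ge`, `high_resonance_ge`). The
convolution is cut into pieces according to which frequency is the low one and which modulation is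
the large one. On each piece the weights leave a kernel, and the Cauchy–Schwarz inequality reduces
the estimate to a bound of the integral of this kernel, over the frequency of a factor for a fixed
output frequency or the other way around (`bilinear_of_output`, `bilinear_of_input`), or over the
spatial frequency only, if one factor is measured in `L²_ξ L¹_τ` (`bilinear_lOne_lTwo`). Those
integrals are uniformly bounded because the phase, as a function of the remaining spatial frequency,
is linear with slope at least `1` or quadratic with leading coefficient `±2`
(`exists_lintegral_output_phase_le`, `exists_lintegral_gain_low_le`, `exists_lintegral_gain_high_le`).
At `s = -1/2` one kernel is `⟨ξ₁⟩⁻¹`, which fails to be integrable by a logarithm; there the modulation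
of the first factor is comparable to `⟨ξ⟩⟨ξ₁⟩`, each dyadic modulation sees one dyadic shell of `ξ₁`,
and the `ℓ¹` sum in the norm of `W^{-1/2}` adds up the shells (`exists_lowIn_le_of_endpoint`). If
the output carries the resonance, then its dyadic modulation localizes the frequencies of the factors,
up to tails measured by `dyadicDecay`, and the sum over dyadic modulations is done by the
Cauchy–Schwarz inequality (`exists_highOut_le`).

*Output frequencies `0 < |ξ| ≤ 1`* (`lTwo_low_le`, `exists_tsum_low_le`). Here `⟨ξ₁⟩ ∼ ⟨ξ₂⟩`. For `u v`
and `ū v̄` one modulation is at least a multiple of `⟨ξ₁⟩`, and nothing is lost (`isLowBound_same`).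
For `u v̄` the resonance `2 ξ (ξ - ξ₁)` only gives `|ξ|⟨ξ₁⟩`, and this costs the factor `|ξ| ^ (2 s)`. The
convolution itself is bounded in `L^∞_ξ L²_τ`, so that the loss is the `L²` norm of
`ω_lam² |ξ| ^ (2 s)` over `0 < |ξ| ≤ 1`. As `ω_lam²` cuts off the frequencies below `1 / lam`, this
norm is of the order `lam ^ (-2 s - 1/2)` if `s < -1/4`, and `(log (1 + lam)) ^ (1/2)` if `s = -1/4`
(`lintegral_min_one_rpow_le`, `exists_isLowBound_conj`).

The `L²_ξ L¹_τ` norm of the output needs only modulations at least `⟨ξ⟩²`, where `⟨ξ⟩ / ⟨τ + ξ²⟩` is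
square integrable in `τ` uniformly in `ξ` (`exists_far_le`).

For Schwartz functions the Fourier transform of the product is the convolution of the transforms: by
integration by parts the transforms are integrable (`HasSmoothDecay.integrable_stFourier`), hence the
inversion formula holds (`HasSmoothDecay.isInvertible`), and inserting it into the transform of the
product gives the convolution (`IsInvertible.stFourier_mul`).
-/

namespace GoodBoussinesq

/-! ### The Japanese bracket -/

lemma bracket_sq (x : ℝ) : bracket x ^ 2 = 1 + x ^ 2 := by
  unfold bracket; exact Real.sq_sqrt (by positivity)

lemma one_le_bracket (x : ℝ) : 1 ≤ bracket x := by
  unfold bracket; exact Real.one_le_sqrt.mpr (by nlinarith [sq_nonneg x])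

lemma bracket_pos (x : ℝ) : 0 < bracket x := lt_of_lt_of_le one_pos (one_le_bracket x)

lemma abs_le_bracket (x : ℝ) : |x| ≤ bracket x := by
  unfold bracket; exact Real.abs_le_sqrt (by linarith)

lemma bracket_le_one_add_abs (x : ℝ) : bracket x ≤ 1 + |x| := by
  unfold bracket
  rw [Real.sqrt_le_left (by positivity)]
  nlinarith [abs_nonneg x, sq_abs x]

@[simp] lemma bracket_neg (x : ℝ) : bracket (-x) = bracket x := by simp [bracket]

lemma bracket_abs (x : ℝ) : bracket |x| = bracket x := by simp [bracket]

lemma bracket_le_bracket {x y : ℝ} (h : |x| ≤ |y|) : bracket x ≤ bracket y := by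
  unfold bracket; exact Real.sqrt_le_sqrt (by nlinarith [sq_le_sq.mpr h])

lemma bracket_add_le (x y : ℝ) : bracket (x + y) ≤ bracket x + |y| := by
  have h1 := abs_le_bracket x
  have h2 := bracket_sq x
  have h3 := bracket_sq (x + y)
  have h4 := bracket_pos x
  refine abs_le_of_sq_le_sq' ?_ (by positivity) |>.2
  have : x * y ≤ bracket x * |y| := by
    calc x * y ≤ |x * y| := le_abs_self _
      _ = |x| * |y| := abs_mul _ _
      _ ≤ _ := by gcongr
  nlinarith [sq_abs y]

lemma bracket_add_le' (x y : ℝ) : bracket (x + y) ≤ bracket x + bracket y :=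
  (bracket_add_le x y).trans (by linarith [abs_le_bracket y])

lemma bracket_le_two_mul_abs {x : ℝ} (h : 1 ≤ |x|) : bracket x ≤ 3 / 2 * |x| := by
  refine abs_le_of_sq_le_sq' ?_ (by positivity) |>.2
  rw [bracket_sq]
  nlinarith [sq_abs x]

lemma bracket_le_of_abs_le_one {x : ℝ} (h : |x| ≤ 1) : bracket x ≤ 3 / 2 := by
  refine abs_le_of_sq_le_sq' ?_ (by norm_num) |>.2
  rw [bracket_sq]
  nlinarith [sq_abs x, abs_nonneg x]

@[fun_prop] lemma continuous_bracket : Continuous bracket := by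
  unfold bracket; fun_prop

@[fun_prop] lemma Measurable.bracket {α : Type*} [MeasurableSpace α] {f : α → ℝ}
    (hf : Measurable f) : Measurable fun a => bracket (f a) :=
  continuous_bracket.measurable.comp hf

/-! ### The frequency measures -/

/-- What the estimates use of the measure on the spatial frequencies: it is invariant under the
reflections `y ↦ x - y` (for `x` in its support) and `y ↦ -y`, and it is at most of unit density
at scales above one and, away from zero frequency, also around the origin. -/
structure IsFreqMeasure (μ : Measure ℝ) : Prop where
  reflect : ∀ᵐ x ∂μ, MeasurePreserving (fun y => x - y) μ μ
  neg : MeasurePreserving (fun y : ℝ => -y) μ μ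
  ball : ∀ c r : ℝ, 0 ≤ r → μ (Metric.closedBall c r) ≤ ENNReal.ofReal (2 * r + 1)
  punctured : ∀ r : ℝ, 0 ≤ r → μ {x | 0 < |x| ∧ |x| ≤ r} ≤ ENNReal.ofReal (2 * r)

instance (Z : Geometry) (lam : ℝ) : SFinite (freqMeasure Z lam) := by
  cases Z <;> unfold freqMeasure <;> infer_instance

lemma isFreqMeasure_line (lam : ℝ) : IsFreqMeasure (freqMeasure .line lam) where
  reflect := .of_forall fun x => Measure.measurePreserving_sub_left volume x
  neg := Measure.measurePreserving_neg volume
  ball c r hr := by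
    simp only [freqMeasure, Real.volume_closedBall]
    gcongr; linarith
  punctured r hr := by
    calc (volume : Measure ℝ) {x | 0 < |x| ∧ |x| ≤ r} ≤ volume (Metric.closedBall (0 : ℝ) r) :=
          measure_mono fun x hx => by simpa using hx.2
      _ = _ := by simp [Real.volume_closedBall]

lemma measurableEmbedding_lattice {lam : ℝ} (h : lam ≠ 0) :
    MeasurableEmbedding fun n : ℤ => (n : ℝ) / lam :=
  MeasurableEmbedding.of_measurable_inverse (g := fun x => round (x * lam)) (by fun_prop)
    (Set.countable_range _).measurableSet
    (by
      have : Measurable (round : ℝ → ℤ) := by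
        rw [show (round : ℝ → ℤ) = fun x => ⌊x + 1 / 2⌋ from funext round_eq]
        exact Int.measurable_floor.comp (by fun_prop)
      fun_prop)
    (fun n => by simp [h])

lemma freqMeasure_torus_eq_map {lam : ℝ} :
    freqMeasure .torus lam =
      (ENNReal.ofReal (1 / lam) • (Measure.count : Measure ℤ)).map fun n : ℤ => (n : ℝ) / lam := by
  ext s hs
  have hm : Measurable fun n : ℤ => (n : ℝ) / lam := by fun_prop
  rw [Measure.map_apply hm hs, freqMeasure, Measure.sum_apply _ hs, Measure.smul_apply,
    Measure.count_apply (hm hs)]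
  simp only [Measure.smul_apply, Measure.dirac_apply' _ hs, smul_eq_mul]
  rw [ENNReal.tsum_mul_left, ← ENNReal.tsum_set_one,
    tsum_subtype ((fun n : ℤ => (n : ℝ) / lam) ⁻¹' s) (fun _ => (1 : ℝ≥0∞))]
  rfl

lemma card_le_of_abs_sub_le {s : Set ℤ} {c r : ℝ} (hr : 0 ≤ r) (hs : ∀ n ∈ s, |(n : ℝ) - c| ≤ r) :
    Measure.count s ≤ ENNReal.ofReal (2 * r + 1) := by
  have hsub : s ⊆ (Finset.Icc ⌈c - r⌉ ⌊c + r⌋ : Finset ℤ) := by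
    intro n hn
    have := abs_le.mp (hs n hn)
    simp only [Finset.coe_Icc, Set.mem_Icc, Int.ceil_le, Int.le_floor]
    constructor <;> linarith
  refine (measure_mono hsub).trans ?_
  rw [Measure.count_apply_finset, Int.card_Icc]
  have h1 : ((⌊c + r⌋ + 1 - ⌈c - r⌉).toNat : ℝ) ≤ 2 * r + 1 := by
    rcases le_total 0 (⌊c + r⌋ + 1 - ⌈c - r⌉) with h | h
    · have : ((⌊c + r⌋ + 1 - ⌈c - r⌉).toNat : ℝ) = ((⌊c + r⌋ + 1 - ⌈c - r⌉ : ℤ) : ℝ) := by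
        exact_mod_cast Int.toNat_of_nonneg h
      rw [this]; push_cast
      linarith [Int.floor_le (c + r), Int.le_ceil (c - r)]
    · rw [Int.toNat_of_nonpos h]; simp; linarith
  calc (((⌊c + r⌋ + 1 - ⌈c - r⌉).toNat : ℕ) : ℝ≥0∞)
      = ENNReal.ofReal ((⌊c + r⌋ + 1 - ⌈c - r⌉).toNat : ℝ) := by simp
    _ ≤ _ := ENNReal.ofReal_le_ofReal h1

lemma isFreqMeasure_torus {lam : ℝ} (h : 1 ≤ lam) : IsFreqMeasure (freqMeasure .torus lam) := by
  have h0 : lam ≠ 0 := by positivity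
  have hpos : 0 < lam := by positivity
  have hemb := measurableEmbedding_lattice h0
  have hm : Measurable fun n : ℤ => (n : ℝ) / lam := by fun_prop
  have hpres : ∀ (φ : ℤ → ℤ) (ψ : ℝ → ℝ), Measurable ψ → Function.Bijective φ →
      (∀ n : ℤ, ψ ((n : ℝ) / lam) = (φ n : ℝ) / lam) →
      MeasurePreserving ψ (freqMeasure .torus lam) (freqMeasure .torus lam) := by
    intro φ ψ hψ hφ hcomm
    refine ⟨hψ, ?_⟩
    rw [freqMeasure_torus_eq_map, Measure.map_map hψ hm]
    have : (ψ ∘ fun n : ℤ => (n : ℝ) / lam) = (fun n : ℤ => (n : ℝ) / lam) ∘ φ := by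
      funext n; simp [hcomm]
    rw [this, ← Measure.map_map hm (by fun_prop)]
    congr 1
    rw [Measure.map_smul]
    congr 1
    ext s hs
    rw [Measure.map_apply (by fun_prop) hs, Measure.count_apply (by measurability),
      Measure.count_apply hs]
    congr 1
    exact Set.encard_preimage_of_bijective hφ s
  refine ⟨?_, ?_, ?_, ?_⟩
  · rw [freqMeasure_torus_eq_map, hemb.ae_map_iff, ← freqMeasure_torus_eq_map]
    refine .of_forall fun k => hpres (fun n => k - n) _ (by fun_prop)
      (Equiv.subLeft k).bijective fun n => ?_
    push_cast; ring
  · refine hpres (fun n => -n) _ (by fun_prop) (Equiv.neg ℤ).bijective fun n => ?_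
    push_cast; ring
  · intro c r hr
    rw [freqMeasure_torus_eq_map, hemb.map_apply, Measure.smul_apply, smul_eq_mul]
    refine (mul_le_mul_right (card_le_of_abs_sub_le (c := c * lam) (r := r * lam) (by positivity)
      fun n hn => ?_) _).trans ?_
    · simp only [Set.mem_preimage, Metric.mem_closedBall, Real.dist_eq] at hn
      have : (n : ℝ) - c * lam = ((n : ℝ) / lam - c) * lam := by field_simp
      rw [this, abs_mul, abs_of_pos hpos]; gcongr
    · rw [← ENNReal.ofReal_mul (by positivity)]
      apply ENNReal.ofReal_le_ofReal
      have : 1 / lam ≤ 1 := by rw [div_le_one hpos]; exact h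
      have : 1 / lam * (2 * (r * lam) + 1) = 2 * r + 1 / lam := by field_simp
      linarith
  · intro r hr
    rw [freqMeasure_torus_eq_map, hemb.map_apply, Measure.smul_apply, smul_eq_mul]
    have hsub : (fun n : ℤ => (n : ℝ) / lam) ⁻¹' {x | 0 < |x| ∧ |x| ≤ r} ⊆
        ((Finset.Icc (-⌊r * lam⌋) ⌊r * lam⌋).erase 0 : Finset ℤ) := by
      intro n hn
      simp only [Set.mem_preimage, Set.mem_ofPred_eq, abs_div, abs_of_pos hpos] at hn
      have h2 : |(n : ℝ)| ≤ r * lam := by rw [← div_le_iff₀ hpos]; exact hn.2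
      have h3 : n ≠ 0 := by rintro rfl; simp at hn
      simp only [Finset.coe_erase, Finset.coe_Icc, Set.mem_sdiff, Set.mem_Icc,
        Set.mem_singleton_iff]
      refine ⟨?_, h3⟩
      have h4 : |n| ≤ ⌊r * lam⌋ := Int.le_floor.mpr (by exact_mod_cast h2)
      exact abs_le.mp h4
    refine (mul_le_mul_right (measure_mono hsub) _).trans ?_
    have hfl : 0 ≤ ⌊r * lam⌋ := Int.floor_nonneg.mpr (by positivity)
    rw [Measure.count_apply_finset, Finset.card_erase_of_mem (by simp [hfl]), Int.card_Icc]
    have hc : (((⌊r * lam⌋ + 1 - -⌊r * lam⌋).toNat - 1 : ℕ) : ℝ) ≤ 2 * (r * lam) := by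
      have : (((⌊r * lam⌋ + 1 - -⌊r * lam⌋).toNat - 1 : ℕ) : ℤ) = 2 * ⌊r * lam⌋ := by omega
      have h5 : (((⌊r * lam⌋ + 1 - -⌊r * lam⌋).toNat - 1 : ℕ) : ℝ) = 2 * (⌊r * lam⌋ : ℝ) := by
        exact_mod_cast this
      rw [h5]; linarith [Int.floor_le (r * lam)]
    rw [← ENNReal.ofReal_natCast, ← ENNReal.ofReal_mul (by positivity)]
    apply ENNReal.ofReal_le_ofReal
    calc 1 / lam * _ ≤ 1 / lam * (2 * (r * lam)) := by gcongr
      _ = 2 * r := by field_simp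

lemma isFreqMeasure (Z : Geometry) {lam : ℝ} (h : 1 ≤ lam) : IsFreqMeasure (freqMeasure Z lam) := by
  cases Z
  · exact isFreqMeasure_line lam
  · exact isFreqMeasure_torus h

/-! ### Dyadic integration -/

lemma lintegral_le_tsum_of_cover {α : Type*} [MeasurableSpace α] {μ : Measure α} {φ : α → ℝ≥0∞}
    {S : ℕ → Set α} {w : ℕ → ℝ≥0∞} (hS : ∀ k, MeasurableSet (S k))
    (h : ∀ x, φ x ≠ 0 → ∃ k, x ∈ S k ∧ φ x ≤ w k) :
    ∫⁻ x, φ x ∂μ ≤ ∑' k, w k * μ (S k) := by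
  calc ∫⁻ x, φ x ∂μ ≤ ∫⁻ x, ∑' k, (S k).indicator (fun _ => w k) x ∂μ := by
        refine lintegral_mono fun x => ?_
        by_cases hx : φ x = 0
        · simp [hx]
        obtain ⟨k, hk, hle⟩ := h x hx
        refine le_trans ?_ (ENNReal.le_tsum k)
        simpa [hk] using hle
    _ = ∑' k, ∫⁻ x, (S k).indicator (fun _ => w k) x ∂μ :=
        lintegral_tsum fun k => (measurable_const.indicator (hS k)).aemeasurable
    _ = _ := by
        congr 1; funext k
        rw [lintegral_indicator_const (hS k)]

lemma exists_lintegral_bracket_rpow_le {β : ℝ} (hβ : 1 < β) :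
    ∃ C : ℝ≥0, ∀ μ : Measure ℝ, IsFreqMeasure μ → ∀ c : ℝ,
      ∫⁻ x, ENNReal.ofReal (bracket (x - c) ^ (-β)) ∂μ ≤ C := by
  set r : ℝ := 2 ^ (1 - β) with hr
  have hr0 : 0 < r := by positivity
  have hr1 : r < 1 := Real.rpow_lt_one_of_one_lt_of_neg (by norm_num) (by linarith)
  refine ⟨Real.toNNReal (5 * (1 - r)⁻¹), fun μ hμ c => ?_⟩
  have hcover := lintegral_le_tsum_of_cover (μ := μ)
    (φ := fun x => ENNReal.ofReal (bracket (x - c) ^ (-β)))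
    (S := fun k => {x | bracket (x - c) < 2 ^ (k + 1)})
    (w := fun k => ENNReal.ofReal (((2 : ℝ) ^ k) ^ (-β)))
    (fun k => measurableSet_lt (by fun_prop) (by fun_prop))
    (fun x _ => by
      obtain ⟨k, hk, hk'⟩ := exists_nat_pow_near (one_le_bracket (x - c)) (one_lt_two (α := ℝ))
      refine ⟨k, hk', ENNReal.ofReal_le_ofReal ?_⟩
      exact Real.rpow_le_rpow_of_nonpos (by positivity) hk (by linarith))
  refine hcover.trans ?_
  calc ∑' k : ℕ, ENNReal.ofReal (((2 : ℝ) ^ k) ^ (-β)) * μ {x | bracket (x - c) < 2 ^ (k + 1)}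
      ≤ ∑' k : ℕ, ENNReal.ofReal (5 * r ^ k) := by
        refine ENNReal.tsum_le_tsum fun k => ?_
        have hsub : {x | bracket (x - c) < 2 ^ (k + 1)} ⊆ Metric.closedBall c (2 ^ (k + 1)) := by
          intro x hx
          rw [Metric.mem_closedBall, Real.dist_eq]
          exact (abs_le_bracket _).trans (le_of_lt hx)
        refine (mul_le_mul_right ((measure_mono hsub).trans (hμ.ball c _ (by positivity))) _).trans ?_
        rw [← ENNReal.ofReal_mul (by positivity)]
        apply ENNReal.ofReal_le_ofReal
        have h2 : (1 : ℝ) ≤ 2 ^ k := one_le_pow₀ (by norm_num)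
        have h3 : r ^ k = ((2 : ℝ) ^ k) ^ (-β) * 2 ^ k := by
          rw [hr, ← Real.rpow_natCast, ← Real.rpow_natCast, ← Real.rpow_mul (by norm_num),
            ← Real.rpow_mul (by norm_num), ← Real.rpow_add (by norm_num)]
          congr 1; ring
        rw [h3]
        have h4 : 0 ≤ ((2 : ℝ) ^ k) ^ (-β) := by positivity
        have h5 : (2 : ℝ) * 2 ^ (k + 1) + 1 ≤ 5 * 2 ^ k := by rw [pow_succ]; linarith
        nlinarith [mul_le_mul_of_nonneg_left h5 h4]
    _ = ENNReal.ofReal (5 * (1 - r)⁻¹) := by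
        rw [← ENNReal.ofReal_tsum_of_nonneg (fun k => by positivity)
          ((summable_geometric_of_lt_one hr0.le hr1).mul_left 5), tsum_mul_left,
          tsum_geometric_of_lt_one hr0.le hr1]


/-! ### Bilinear inequalities for convolutions -/

lemma sq_lintegral_le_of_sq_le {α : Type*} [MeasurableSpace α] {μ : Measure α}
    {u v w : α → ℝ≥0∞} (hv : AEMeasurable v μ) (hw : AEMeasurable w μ)
    (h : ∀ x, u x ^ 2 ≤ v x * w x) :
    (∫⁻ x, u x ∂μ) ^ 2 ≤ (∫⁻ x, v x ∂μ) * ∫⁻ x, w x ∂μ := by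
  have h1 : ∀ x, u x ≤ v x ^ (1 / 2 : ℝ) * w x ^ (1 / 2 : ℝ) := by
    intro x
    rw [← ENNReal.mul_rpow_of_nonneg _ _ (by norm_num)]
    calc u x = (u x ^ 2) ^ (1 / 2 : ℝ) := by
          rw [← ENNReal.rpow_natCast, ← ENNReal.rpow_mul]; norm_num
      _ ≤ _ := by gcongr; exact h x
  have h2 := ENNReal.lintegral_mul_le_Lp_mul_Lq μ (p := 2) (q := 2)
    (by constructor <;> norm_num) (hv.pow_const (1 / 2 : ℝ)) (hw.pow_const (1 / 2 : ℝ))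
  have h3 : ∀ a : ℝ≥0∞, (a ^ (1 / 2 : ℝ)) ^ (2 : ℝ) = a := fun a => by
    rw [← ENNReal.rpow_mul]; norm_num
  simp only [h3, Pi.mul_apply] at h2
  calc (∫⁻ x, u x ∂μ) ^ 2
      ≤ ((∫⁻ x, v x ∂μ) ^ (1 / 2 : ℝ) * (∫⁻ x, w x ∂μ) ^ (1 / 2 : ℝ)) ^ 2 := by
        gcongr; exact (lintegral_mono h1).trans h2
    _ = _ := by
        rw [mul_pow]
        simp only [← ENNReal.rpow_natCast, Nat.cast_ofNat, h3]

/-- Minkowski's integral inequality in `L²`, for nonnegative functions. -/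
lemma lintegral_sq_lintegral_le {α β : Type*} [MeasurableSpace α] [MeasurableSpace β]
    {μ : Measure α} {ν : Measure β} [SFinite μ] [SFinite ν] {g : α → β → ℝ≥0∞}
    (hg : Measurable (Function.uncurry g)) :
    ∫⁻ x, (∫⁻ y, g x y ∂ν) ^ 2 ∂μ ≤ (∫⁻ y, (∫⁻ x, g x y ^ 2 ∂μ) ^ (1 / 2 : ℝ) ∂ν) ^ 2 := by
  have hg' : Measurable fun z : α × β => g z.1 z.2 := hg
  have e1 : ∀ x, (∫⁻ y, g x y ∂ν) ^ 2 = ∫⁻ y, ∫⁻ y', g x y * g x y' ∂ν ∂ν := by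
    intro x
    have hx : Measurable (g x) := hg'.comp (by fun_prop : Measurable fun y : β => (x, y))
    rw [pow_two, ← lintegral_mul_const _ hx]
    refine lintegral_congr fun y => ?_
    rw [lintegral_const_mul _ hx]
  have hB : ∀ y y', ∫⁻ x, g x y * g x y' ∂μ ≤
      (∫⁻ x, g x y ^ 2 ∂μ) ^ (1 / 2 : ℝ) * (∫⁻ x, g x y' ^ 2 ∂μ) ^ (1 / 2 : ℝ) := by
    intro y y'
    have hy : ∀ y, Measurable fun x => g x y :=
      fun y => hg'.comp (by fun_prop : Measurable fun x : α => (x, y))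
    have := ENNReal.lintegral_mul_le_Lp_mul_Lq μ (p := 2) (q := 2)
      (by constructor <;> norm_num) (hy y).aemeasurable (hy y').aemeasurable
    simpa only [Pi.mul_apply, ENNReal.rpow_two] using this
  have hm : Measurable fun y => (∫⁻ x, g x y ^ 2 ∂μ) ^ (1 / 2 : ℝ) := by
    have : Measurable fun z : β × α => g z.2 z.1 ^ 2 := by fun_prop
    exact (this.lintegral_prod_right').pow_const _
  calc ∫⁻ x, (∫⁻ y, g x y ∂ν) ^ 2 ∂μ
      = ∫⁻ x, ∫⁻ y, ∫⁻ y', g x y * g x y' ∂ν ∂ν ∂μ := lintegral_congr e1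
    _ = ∫⁻ y, ∫⁻ x, ∫⁻ y', g x y * g x y' ∂ν ∂μ ∂ν := by
        rw [lintegral_lintegral_swap]
        have : Measurable fun z : (α × β) × β => g z.1.1 z.1.2 * g z.1.1 z.2 := by fun_prop
        exact this.lintegral_prod_right'.aemeasurable
    _ = ∫⁻ y, ∫⁻ y', ∫⁻ x, g x y * g x y' ∂μ ∂ν ∂ν := by
        refine lintegral_congr fun y => ?_
        rw [lintegral_lintegral_swap]
        exact (by fun_prop : Measurable fun z : α × β => g z.1 y * g z.1 z.2).aemeasurable
    _ ≤ ∫⁻ y, ∫⁻ y', (∫⁻ x, g x y ^ 2 ∂μ) ^ (1 / 2 : ℝ) *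
          (∫⁻ x, g x y' ^ 2 ∂μ) ^ (1 / 2 : ℝ) ∂ν ∂ν :=
        lintegral_mono fun y => lintegral_mono fun y' => hB y y'
    _ = _ := by
        rw [pow_two, ← lintegral_mul_const _ hm]
        refine lintegral_congr fun y => ?_
        rw [lintegral_const_mul _ hm]

lemma lintegral_sq_tsum_le {α : Type*} [MeasurableSpace α] {μ : Measure α} [SFinite μ]
    {g : ℕ → α → ℝ≥0∞} (hg : ∀ j, Measurable (g j)) :
    ∫⁻ x, (∑' j, g j x) ^ 2 ∂μ ≤ (∑' j, (∫⁻ x, g j x ^ 2 ∂μ) ^ (1 / 2 : ℝ)) ^ 2 := by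
  have := lintegral_sq_lintegral_le (μ := μ) (ν := (Measure.count : Measure ℕ))
    (g := fun x j => g j x) (measurable_from_prod_countable_left fun j => hg j)
  simpa [lintegral_count] using this

/-- Young's inequality `L¹ * L² ⊆ L²` on the real line. -/
lemma lintegral_sq_conv_le {a b : ℝ → ℝ≥0∞} (ha : Measurable a) (hb : Measurable b) :
    ∫⁻ t, (∫⁻ s, a s * b (t - s)) ^ 2 ≤ (∫⁻ s, a s) ^ 2 * ∫⁻ s, b s ^ 2 := by
  calc ∫⁻ t, (∫⁻ s, a s * b (t - s)) ^ 2
      ≤ ∫⁻ t, (∫⁻ s, a s) * ∫⁻ s, a s * b (t - s) ^ 2 := by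
        refine lintegral_mono fun t => ?_
        refine sq_lintegral_le_of_sq_le ha.aemeasurable (by fun_prop) fun s => ?_
        exact le_of_eq (by ring)
    _ = (∫⁻ s, a s) * ∫⁻ t, ∫⁻ s, a s * b (t - s) ^ 2 := by
        rw [lintegral_const_mul]
        have : Measurable fun z : ℝ × ℝ => a z.2 * b (z.1 - z.2) ^ 2 := by fun_prop
        exact this.lintegral_prod_right'
    _ = (∫⁻ s, a s) * ∫⁻ s, ∫⁻ t, a s * b (t - s) ^ 2 := by
        rw [lintegral_lintegral_swap]
        exact (by fun_prop : Measurable fun z : ℝ × ℝ => a z.2 * b (z.1 - z.2) ^ 2).aemeasurable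
    _ = (∫⁻ s, a s) * ∫⁻ s, a s * ∫⁻ t, b t ^ 2 := by
        congr 1
        refine lintegral_congr fun s => ?_
        rw [lintegral_const_mul _ (by fun_prop), lintegral_sub_right_eq_self (fun t => b t ^ 2) s]
    _ = _ := by rw [lintegral_mul_const _ ha]; ring

/-- The measure `dτ dξ`, for a given measure on the frequencies `ξ`. -/
noncomputable abbrev stMeasure (μ : Measure ℝ) : Measure (ℝ × ℝ) := (volume : Measure ℝ).prod μ

/-- The squared norm of a nonnegative function in `L²_ξ L¹_τ`. -/
noncomputable def sqNormLOne (μ : Measure ℝ) (φ : ℝ × ℝ → ℝ≥0∞) : ℝ≥0∞ :=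
  ∫⁻ x, (∫⁻ t, φ (t, x)) ^ 2 ∂μ

variable {μ : Measure ℝ}

namespace IsFreqMeasure

lemma ae_reflect (h : IsFreqMeasure μ) [SFinite μ] : ∀ᵐ q ∂(stMeasure μ),
    MeasurePreserving (fun p => q - p) (stMeasure μ) (stMeasure μ) := by
  have := Measure.quasiMeasurePreserving_snd (μ := (volume : Measure ℝ)) (ν := μ) |>.ae h.reflect
  filter_upwards [this] with q hq
  exact (Measure.measurePreserving_sub_left volume q.1).prod hq

lemma ae_translate (h : IsFreqMeasure μ) : ∀ᵐ x ∂μ, MeasurePreserving (fun y => y - x) μ μ := by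
  filter_upwards [h.reflect] with x hx
  have := h.neg.comp hx
  simpa [Function.comp_def] using this

lemma ae_translate_prod (h : IsFreqMeasure μ) [SFinite μ] : ∀ᵐ p ∂(stMeasure μ),
    MeasurePreserving (fun q => q - p) (stMeasure μ) (stMeasure μ) := by
  have := Measure.quasiMeasurePreserving_snd (μ := (volume : Measure ℝ)) (ν := μ) |>.ae
    h.ae_translate
  filter_upwards [this] with q hq
  exact (measurePreserving_sub_right volume q.1).prod hq

variable [SFinite μ]

lemma lintegral_conv (h : IsFreqMeasure μ) {G₁ G₂ : ℝ × ℝ → ℝ≥0∞} (h₁ : Measurable G₁)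
    (h₂ : Measurable G₂) :
    ∫⁻ q, ∫⁻ p, G₁ p * G₂ (q - p) ∂(stMeasure μ) ∂(stMeasure μ)
      = (∫⁻ p, G₁ p ∂(stMeasure μ)) * ∫⁻ p, G₂ p ∂(stMeasure μ) := by
  rw [lintegral_lintegral_swap (by fun_prop), ← lintegral_mul_const _ h₁]
  refine lintegral_congr_ae ?_
  filter_upwards [h.ae_translate_prod] with p hp
  rw [lintegral_const_mul _ (by fun_prop), hp.lintegral_comp h₂]

lemma lintegral_conv_freq (h : IsFreqMeasure μ) {G₁ G₂ : ℝ → ℝ≥0∞} (h₁ : Measurable G₁)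
    (h₂ : Measurable G₂) :
    ∫⁻ x, ∫⁻ y, G₁ y * G₂ (x - y) ∂μ ∂μ = (∫⁻ y, G₁ y ∂μ) * ∫⁻ y, G₂ y ∂μ := by
  rw [lintegral_lintegral_swap (by fun_prop), ← lintegral_mul_const _ h₁]
  refine lintegral_congr_ae ?_
  filter_upwards [h.ae_translate] with p hp
  rw [lintegral_const_mul _ (by fun_prop), hp.lintegral_comp h₂]

/-- An `L² × L² → L²` estimate, for a kernel that is bounded in `L²` uniformly in the output
frequency. -/
lemma bilinear_of_output (h : IsFreqMeasure μ) {u κ : ℝ × ℝ → ℝ × ℝ → ℝ≥0∞}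
    {G₁ G₂ : ℝ × ℝ → ℝ≥0∞} (h₁ : Measurable G₁) (h₂ : Measurable G₂)
    (hκ : Measurable (Function.uncurry κ)) {C : ℝ≥0∞}
    (hu : ∀ q p, u q p ^ 2 ≤ κ q p * (G₁ p * G₂ (q - p)))
    (hC : ∀ q, ∫⁻ p, κ q p ∂(stMeasure μ) ≤ C) :
    ∫⁻ q, (∫⁻ p, u q p ∂(stMeasure μ)) ^ 2 ∂(stMeasure μ)
      ≤ C * ((∫⁻ p, G₁ p ∂(stMeasure μ)) * ∫⁻ p, G₂ p ∂(stMeasure μ)) := by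
  have hκ' : ∀ q, Measurable (κ q) := fun q =>
    hκ.comp (by fun_prop : Measurable fun p : ℝ × ℝ => (q, p))
  calc ∫⁻ q, (∫⁻ p, u q p ∂(stMeasure μ)) ^ 2 ∂(stMeasure μ)
      ≤ ∫⁻ q, C * ∫⁻ p, G₁ p * G₂ (q - p) ∂(stMeasure μ) ∂(stMeasure μ) := by
        refine lintegral_mono fun q => ?_
        refine (sq_lintegral_le_of_sq_le (hκ' q).aemeasurable (by fun_prop) (hu q)).trans ?_
        gcongr
        exact hC q
    _ = _ := by
        rw [lintegral_const_mul, h.lintegral_conv h₁ h₂]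
        have : Measurable fun z : (ℝ × ℝ) × (ℝ × ℝ) => G₁ z.2 * G₂ (z.1 - z.2) := by fun_prop
        exact this.lintegral_prod_right'

/-- An `L² × L² → L²` estimate, for a kernel that is bounded in `L²` uniformly in the frequency of
the first factor. -/
lemma bilinear_of_input (h : IsFreqMeasure μ) {u κ : ℝ × ℝ → ℝ × ℝ → ℝ≥0∞}
    {G₁ G₂ : ℝ × ℝ → ℝ≥0∞} (h₁ : Measurable G₁) (h₂ : Measurable G₂)
    (hκ : Measurable (Function.uncurry κ)) {C : ℝ≥0∞}
    (hu : ∀ q p, u q p ^ 2 ≤ κ q p * (G₁ p * G₂ (q - p)))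
    (hC : ∀ p, ∫⁻ q, κ q p ∂(stMeasure μ) ≤ C) :
    ∫⁻ q, (∫⁻ p, u q p ∂(stMeasure μ)) ^ 2 ∂(stMeasure μ)
      ≤ C * ((∫⁻ p, G₁ p ∂(stMeasure μ)) * ∫⁻ p, G₂ p ∂(stMeasure μ)) := by
  have hκ0 : Measurable fun z : (ℝ × ℝ) × (ℝ × ℝ) => κ z.1 z.2 := hκ
  have hκ' : ∀ q, Measurable (κ q) := fun q =>
    hκ.comp (by fun_prop : Measurable fun p : ℝ × ℝ => (q, p))
  have hκ'' : ∀ p, Measurable fun q => κ q p := fun p =>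
    hκ.comp (by fun_prop : Measurable fun q : ℝ × ℝ => (q, p))
  calc ∫⁻ q, (∫⁻ p, u q p ∂(stMeasure μ)) ^ 2 ∂(stMeasure μ)
      ≤ ∫⁻ q, (∫⁻ p, κ q p * G₁ p ∂(stMeasure μ)) * ∫⁻ p, G₂ p ∂(stMeasure μ)
          ∂(stMeasure μ) := by
        refine lintegral_mono_ae ?_
        filter_upwards [h.ae_reflect] with q hq
        rw [← hq.lintegral_comp h₂]
        refine sq_lintegral_le_of_sq_le ((hκ' q).mul h₁).aemeasurable (by fun_prop) fun p => ?_
        rw [mul_assoc]; exact hu q p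
    _ = (∫⁻ q, ∫⁻ p, κ q p * G₁ p ∂(stMeasure μ) ∂(stMeasure μ))
          * ∫⁻ p, G₂ p ∂(stMeasure μ) := by
        rw [lintegral_mul_const]
        have : Measurable fun z : (ℝ × ℝ) × (ℝ × ℝ) => κ z.1 z.2 * G₁ z.2 := by fun_prop
        exact this.lintegral_prod_right'
    _ = (∫⁻ p, (∫⁻ q, κ q p ∂(stMeasure μ)) * G₁ p ∂(stMeasure μ))
          * ∫⁻ p, G₂ p ∂(stMeasure μ) := by
        rw [lintegral_lintegral_swap]
        · congr 1
          refine lintegral_congr fun p => ?_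
          rw [lintegral_mul_const _ (hκ'' p)]
        · exact (by fun_prop :
            Measurable fun z : (ℝ × ℝ) × (ℝ × ℝ) => κ z.1 z.2 * G₁ z.2).aemeasurable
    _ ≤ (∫⁻ p, C * G₁ p ∂(stMeasure μ)) * ∫⁻ p, G₂ p ∂(stMeasure μ) := by
        gcongr with p; exact hC p
    _ = _ := by rw [lintegral_const_mul _ h₁, mul_assoc]

lemma lintegral_comp_reflect (h : IsFreqMeasure μ) {u : ℝ × ℝ → ℝ × ℝ → ℝ≥0∞}
    (hu : Measurable (Function.uncurry u)) :
    ∀ᵐ q ∂(stMeasure μ), ∫⁻ p, u q (q - p) ∂(stMeasure μ) = ∫⁻ p, u q p ∂(stMeasure μ) := by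
  filter_upwards [h.ae_reflect] with q hq
  exact hq.lintegral_comp (f := u q) (hu.comp (by fun_prop : Measurable fun p : ℝ × ℝ => (q, p)))

/-- The convolution in `τ` only, at the frequencies `ξ = y + (x - y)`. -/
noncomputable def timeConv (φ₁ φ₂ : ℝ × ℝ → ℝ≥0∞) (t x y : ℝ) : ℝ≥0∞ :=
  ∫⁻ s, φ₁ (s, y) * φ₂ (t - s, x - y)

lemma measurable_timeConv {φ₁ φ₂ : ℝ × ℝ → ℝ≥0∞} (h₁ : Measurable φ₁) (h₂ : Measurable φ₂) :
    Measurable fun z : ℝ × ℝ × ℝ => timeConv φ₁ φ₂ z.1 z.2.1 z.2.2 := by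
  have : Measurable fun z : (ℝ × ℝ × ℝ) × ℝ =>
    φ₁ (z.2, z.1.2.2) * φ₂ (z.1.1 - z.2, z.1.2.1 - z.1.2.2) := by fun_prop
  exact this.lintegral_prod_right'

lemma lintegral_conv_eq_timeConv {φ₁ φ₂ : ℝ × ℝ → ℝ≥0∞} (h₁ : Measurable φ₁)
    (h₂ : Measurable φ₂) (q : ℝ × ℝ) (k : ℝ → ℝ≥0∞) (hk : Measurable k) :
    ∫⁻ p, k p.2 * (φ₁ p * φ₂ (q - p)) ∂(stMeasure μ)
      = ∫⁻ y, k y * timeConv φ₁ φ₂ q.1 q.2 y ∂μ := by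
  rw [lintegral_prod_symm' _ (by fun_prop)]
  refine lintegral_congr fun y => ?_
  rw [timeConv, ← lintegral_const_mul _ (by fun_prop)]
  rfl

lemma lintegral_sq_timeConv_le {φ₁ φ₂ : ℝ × ℝ → ℝ≥0∞} (h₁ : Measurable φ₁)
    (h₂ : Measurable φ₂) (x y : ℝ) :
    ∫⁻ t, timeConv φ₁ φ₂ t x y ^ 2
      ≤ (∫⁻ t, φ₁ (t, y)) ^ 2 * ∫⁻ t, φ₂ (t, x - y) ^ 2 :=
  lintegral_sq_conv_le (a := fun s => φ₁ (s, y)) (b := fun s => φ₂ (s, x - y)) (by fun_prop)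
    (by fun_prop)

lemma lintegral_sq_eq {φ : ℝ × ℝ → ℝ≥0∞} (hφ : Measurable φ) :
    ∫⁻ p, φ p ^ 2 ∂(stMeasure μ) = ∫⁻ x, ∫⁻ t, φ (t, x) ^ 2 ∂volume ∂μ :=
  lintegral_prod_symm' _ (hφ.pow_const 2)

/-- An estimate `L²_ξ L¹_τ × L² → L²`, for a kernel that depends on the spatial frequencies only and
is bounded in `L²` uniformly in the output frequency. -/
lemma bilinear_lOne_lTwo (h : IsFreqMeasure μ) {u : ℝ × ℝ → ℝ × ℝ → ℝ≥0∞} {κ : ℝ → ℝ → ℝ≥0∞}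
    {φ₁ φ₂ : ℝ × ℝ → ℝ≥0∞} (h₁ : Measurable φ₁) (h₂ : Measurable φ₂)
    (hκ : Measurable (Function.uncurry κ)) {C : ℝ≥0∞}
    (hu : ∀ q p, u q p ^ 2 ≤ κ q.2 p.2 * (φ₁ p * φ₂ (q - p)) ^ 2)
    (hC : ∀ᵐ x ∂μ, ∫⁻ y, κ x y ∂μ ≤ C) :
    ∫⁻ q, (∫⁻ p, u q p ∂(stMeasure μ)) ^ 2 ∂(stMeasure μ)
      ≤ C * (sqNormLOne μ φ₁ * ∫⁻ p, φ₂ p ^ 2 ∂(stMeasure μ)) := by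
  have hκ' : ∀ x, Measurable (κ x) := fun q => hκ.comp (by fun_prop : Measurable fun p : ℝ => (q, p))
  have hu' : ∀ q p, u q p ≤ κ q.2 p.2 ^ (1 / 2 : ℝ) * (φ₁ p * φ₂ (q - p)) := by
    intro q p
    have e : ∀ a : ℝ≥0∞, (a ^ 2) ^ (1 / 2 : ℝ) = a := fun a => by
      rw [← ENNReal.rpow_natCast, ← ENNReal.rpow_mul]; norm_num
    have := ENNReal.rpow_le_rpow (hu q p) (by norm_num : (0 : ℝ) ≤ 1 / 2)
    rwa [e, ENNReal.mul_rpow_of_nonneg _ _ (by norm_num), e] at this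
  have hT := measurable_timeConv h₁ h₂
  have hTm : ∀ t x, Measurable fun y => timeConv φ₁ φ₂ t x y := fun t x =>
    hT.comp (by fun_prop : Measurable fun y : ℝ => (t, x, y))
  have hΦ : Measurable fun y => ∫⁻ t, φ₁ (t, y) :=
    (h₁.comp measurable_swap).lintegral_prod_right'
  have hΨ : Measurable fun y => ∫⁻ t, φ₂ (t, y) ^ 2 :=
    ((h₂.pow_const 2).comp measurable_swap).lintegral_prod_right'
  calc ∫⁻ q, (∫⁻ p, u q p ∂(stMeasure μ)) ^ 2 ∂(stMeasure μ)
      ≤ ∫⁻ q : ℝ × ℝ, C * ∫⁻ y, timeConv φ₁ φ₂ q.1 q.2 y ^ 2 ∂μ ∂(stMeasure μ) := by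
        refine lintegral_mono_ae ?_
        filter_upwards [Measure.quasiMeasurePreserving_snd (μ := (volume : Measure ℝ)) |>.ae hC]
          with q hq
        calc (∫⁻ p, u q p ∂(stMeasure μ)) ^ 2
            ≤ (∫⁻ y, κ q.2 y ^ (1 / 2 : ℝ) * timeConv φ₁ φ₂ q.1 q.2 y ∂μ) ^ 2 := by
              rw [← lintegral_conv_eq_timeConv h₁ h₂ q _ ((hκ' _).pow_const _)]
              gcongr
              exact hu' q _
          _ ≤ (∫⁻ y, κ q.2 y ∂μ) * ∫⁻ y, timeConv φ₁ φ₂ q.1 q.2 y ^ 2 ∂μ := by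
              refine sq_lintegral_le_of_sq_le (hκ' _).aemeasurable
                ((hTm _ _).pow_const _).aemeasurable fun y => ?_
              rw [mul_pow, ← ENNReal.rpow_natCast (κ q.2 y ^ (1 / 2 : ℝ)), ← ENNReal.rpow_mul]
              norm_num
          _ ≤ _ := by gcongr
    _ = C * ∫⁻ x, ∫⁻ t, ∫⁻ y, timeConv φ₁ φ₂ t x y ^ 2 ∂μ ∂volume ∂μ := by
        have : Measurable fun z : (ℝ × ℝ) × ℝ => timeConv φ₁ φ₂ z.1.1 z.1.2 z.2 ^ 2 :=
          (hT.pow_const 2).comp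
            (by fun_prop : Measurable fun z : (ℝ × ℝ) × ℝ => (z.1.1, z.1.2, z.2))
        have hm := this.lintegral_prod_right' (ν := μ)
        rw [lintegral_const_mul _ hm, lintegral_prod_symm' _ hm]
    _ = C * ∫⁻ x, ∫⁻ y, ∫⁻ t, timeConv φ₁ φ₂ t x y ^ 2 ∂volume ∂μ ∂μ := by
        congr 1
        refine lintegral_congr fun x => ?_
        rw [lintegral_lintegral_swap]
        exact ((hT.pow_const 2).comp
            (by fun_prop : Measurable fun z : ℝ × ℝ => (z.1, x, z.2))).aemeasurable
    _ ≤ C * ∫⁻ x, ∫⁻ y, (∫⁻ t, φ₁ (t, y)) ^ 2 * ∫⁻ t, φ₂ (t, x - y) ^ 2 ∂volume ∂μ ∂μ := by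
        gcongr with x y
        exact lintegral_sq_timeConv_le h₁ h₂ x y
    _ = _ := by
        rw [h.lintegral_conv_freq (hΦ.pow_const 2) hΨ, lintegral_sq_eq h₂]
        rfl

/-- The variant of `bilinear_lOne_lTwo` with the roles of the two factors exchanged. -/
lemma bilinear_lTwo_lOne (h : IsFreqMeasure μ) {u : ℝ × ℝ → ℝ × ℝ → ℝ≥0∞} {κ : ℝ → ℝ → ℝ≥0∞}
    {φ₁ φ₂ : ℝ × ℝ → ℝ≥0∞} (h₁ : Measurable φ₁) (h₂ : Measurable φ₂)
    (hκ : Measurable (Function.uncurry κ)) {C : ℝ≥0∞}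
    (hu : ∀ q p, u q p ^ 2 ≤ κ q.2 p.2 * (φ₁ p * φ₂ (q - p)) ^ 2)
    (hC : ∀ x, ∫⁻ y, κ x y ∂μ ≤ C) :
    ∫⁻ q, (∫⁻ p, u q p ∂(stMeasure μ)) ^ 2 ∂(stMeasure μ)
      ≤ C * ((∫⁻ p, φ₁ p ^ 2 ∂(stMeasure μ)) * sqNormLOne μ φ₂) := by
  have hκ0 : Measurable fun z : ℝ × ℝ => κ z.1 z.2 := hκ
  have hκ' : ∀ x, Measurable (κ x) := fun q => hκ.comp (by fun_prop : Measurable fun p : ℝ => (q, p))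
  have e : ∀ a : ℝ≥0∞, (a ^ 2) ^ (1 / 2 : ℝ) = a := fun a => by
    rw [← ENNReal.rpow_natCast, ← ENNReal.rpow_mul]; norm_num
  set v : ℝ × ℝ → ℝ × ℝ → ℝ≥0∞ := fun q p =>
    κ q.2 p.2 ^ (1 / 2 : ℝ) * (φ₁ p * φ₂ (q - p)) with hv
  have hu' : ∀ q p, u q p ≤ v q p := by
    intro q p
    have := ENNReal.rpow_le_rpow (hu q p) (by norm_num : (0 : ℝ) ≤ 1 / 2)
    rwa [e, ENNReal.mul_rpow_of_nonneg _ _ (by norm_num), e] at this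
  have hvm : Measurable (Function.uncurry v) := by
    simp only [hv, Function.uncurry_def]; fun_prop
  calc ∫⁻ q, (∫⁻ p, u q p ∂(stMeasure μ)) ^ 2 ∂(stMeasure μ)
      ≤ ∫⁻ q, (∫⁻ p, v q p ∂(stMeasure μ)) ^ 2 ∂(stMeasure μ) := by
        gcongr with q p; exact hu' q p
    _ = ∫⁻ q, (∫⁻ p, v q (q - p) ∂(stMeasure μ)) ^ 2 ∂(stMeasure μ) := by
        refine lintegral_congr_ae ?_
        filter_upwards [h.lintegral_comp_reflect hvm] with q hq
        rw [hq]
    _ ≤ C * (sqNormLOne μ φ₂ * ∫⁻ p, φ₁ p ^ 2 ∂(stMeasure μ)) := by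
        refine h.bilinear_lOne_lTwo (κ := fun x y => κ x (x - y)) h₂ h₁ ?_ (fun q p => ?_) ?_
        · exact hκ.comp (by fun_prop : Measurable fun z : ℝ × ℝ => (z.1, z.1 - z.2))
        · simp only [hv, sub_sub_cancel, Prod.snd_sub]
          rw [mul_pow, ← ENNReal.rpow_natCast (_ ^ (1 / 2 : ℝ)), ← ENNReal.rpow_mul]
          norm_num
          rw [mul_comm (φ₁ _)]
        · filter_upwards [h.reflect] with x hx
          rw [hx.lintegral_comp (hκ' x)]; exact hC x
    _ = _ := by rw [mul_comm (sqNormLOne μ φ₂)]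

/-- An estimate `L²_ξ L¹_τ × L² → L^∞_ξ L²_τ`. -/
lemma bilinear_sup_lTwo (h : IsFreqMeasure μ) {φ₁ φ₂ : ℝ × ℝ → ℝ≥0∞} (h₁ : Measurable φ₁)
    (h₂ : Measurable φ₂) :
    ∀ᵐ x ∂μ, ∫⁻ t, (∫⁻ p, φ₁ p * φ₂ ((t, x) - p) ∂(stMeasure μ)) ^ 2
      ≤ sqNormLOne μ φ₁ * ∫⁻ p, φ₂ p ^ 2 ∂(stMeasure μ) := by
  have hT := measurable_timeConv h₁ h₂
  have hΦ : Measurable fun y => ∫⁻ t, φ₁ (t, y) :=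
    (h₁.comp measurable_swap).lintegral_prod_right'
  have hΨ : Measurable fun y => ∫⁻ t, φ₂ (t, y) ^ 2 :=
    ((h₂.pow_const 2).comp measurable_swap).lintegral_prod_right'
  filter_upwards [h.reflect] with x hx
  calc ∫⁻ t, (∫⁻ p, φ₁ p * φ₂ ((t, x) - p) ∂(stMeasure μ)) ^ 2
      = ∫⁻ t, (∫⁻ y, timeConv φ₁ φ₂ t x y ∂μ) ^ 2 := by
        refine lintegral_congr fun t => ?_
        have := lintegral_conv_eq_timeConv (μ := μ) h₁ h₂ (t, x) (fun _ => 1) measurable_const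
        simp only [one_mul] at this
        rw [this]
    _ ≤ (∫⁻ y, (∫⁻ t, timeConv φ₁ φ₂ t x y ^ 2) ^ (1 / 2 : ℝ) ∂μ) ^ 2 :=
        lintegral_sq_lintegral_le (μ := volume) (g := fun t y => timeConv φ₁ φ₂ t x y)
          (hT.comp (by fun_prop : Measurable fun z : ℝ × ℝ => (z.1, x, z.2)))
    _ ≤ (∫⁻ y, (∫⁻ t, φ₁ (t, y)) ^ 2 ∂μ) * ∫⁻ y, ∫⁻ t, φ₂ (t, x - y) ^ 2 ∂volume ∂μ := by
        refine sq_lintegral_le_of_sq_le (hΦ.pow_const 2).aemeasurable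
          (hΨ.comp (by fun_prop : Measurable fun y => x - y)).aemeasurable fun y => ?_
        rw [← ENNReal.rpow_natCast, ← ENNReal.rpow_mul]
        norm_num
        exact lintegral_sq_timeConv_le h₁ h₂ x y
    _ = _ := by
        rw [hx.lintegral_comp hΨ, lintegral_sq_eq h₂]; rfl

/-- An estimate `L²_ξ L¹_τ × L²_ξ L¹_τ → L^∞_ξ L¹_τ`. -/
lemma bilinear_sup_lOne (h : IsFreqMeasure μ) {φ₁ φ₂ : ℝ × ℝ → ℝ≥0∞} (h₁ : Measurable φ₁)
    (h₂ : Measurable φ₂) :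
    ∀ᵐ x ∂μ, (∫⁻ t, ∫⁻ p, φ₁ p * φ₂ ((t, x) - p) ∂(stMeasure μ)) ^ 2
      ≤ sqNormLOne μ φ₁ * sqNormLOne μ φ₂ := by
  have hT := measurable_timeConv h₁ h₂
  have hΦ : Measurable fun y => ∫⁻ t, φ₁ (t, y) :=
    (h₁.comp measurable_swap).lintegral_prod_right'
  have hΨ : Measurable fun y => ∫⁻ t, φ₂ (t, y) :=
    (h₂.comp measurable_swap).lintegral_prod_right'
  filter_upwards [h.reflect] with x hx
  have e : ∫⁻ t, ∫⁻ p, φ₁ p * φ₂ ((t, x) - p) ∂(stMeasure μ)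
      = ∫⁻ y, (∫⁻ t, φ₁ (t, y)) * ∫⁻ t, φ₂ (t, x - y) ∂volume ∂μ := by
    calc ∫⁻ t, ∫⁻ p, φ₁ p * φ₂ ((t, x) - p) ∂(stMeasure μ)
        = ∫⁻ t, ∫⁻ y, timeConv φ₁ φ₂ t x y ∂μ := by
          refine lintegral_congr fun t => ?_
          have := lintegral_conv_eq_timeConv (μ := μ) h₁ h₂ (t, x) (fun _ => 1) measurable_const
          simpa only [one_mul] using this
      _ = ∫⁻ y, ∫⁻ t, timeConv φ₁ φ₂ t x y ∂volume ∂μ := by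
          rw [lintegral_lintegral_swap]
          exact (hT.comp (by fun_prop : Measurable fun z : ℝ × ℝ => (z.1, x, z.2))).aemeasurable
      _ = _ := by
          refine lintegral_congr fun y => ?_
          unfold timeConv
          rw [lintegral_lintegral_swap (by fun_prop), ← lintegral_mul_const _ (by fun_prop)]
          refine lintegral_congr fun s => ?_
          rw [lintegral_const_mul _ (by fun_prop),
            lintegral_sub_right_eq_self (fun t => φ₂ (t, x - y)) s]
  rw [e]
  refine (sq_lintegral_le_of_sq_le (v := fun y => (∫⁻ t, φ₁ (t, y)) ^ 2)
    (w := fun y => (∫⁻ t, φ₂ (t, x - y)) ^ 2) (hΦ.pow_const 2).aemeasurable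
    ((hΨ.comp (by fun_prop : Measurable fun y => x - y)).pow_const 2).aemeasurable
    fun y => (mul_pow _ _ 2).le).trans ?_
  rw [hx.lintegral_comp (hΨ.pow_const 2)]; rfl

end IsFreqMeasure


/-! ### Integrals over the spatial frequency -/

lemma exists_lintegral_inv_bracket_sq_le : ∃ C : ℝ≥0, ∀ μ : Measure ℝ, IsFreqMeasure μ → ∀ c : ℝ,
    ∫⁻ x, ENNReal.ofReal ((bracket (x - c) ^ 2)⁻¹) ∂μ ≤ C := by
  obtain ⟨C, hC⟩ := exists_lintegral_bracket_rpow_le (β := 2) (by norm_num)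
  refine ⟨C, fun μ hμ c => ?_⟩
  simpa [Real.rpow_neg (bracket_pos _).le] using hC μ hμ c

lemma isFreqMeasure_volume : IsFreqMeasure (volume : Measure ℝ) := isFreqMeasure_line 1

/-- Factorization of `2 z² + c` through the distance from `|z|` to its nonnegative root (to `0`, if
there is no real root). -/
lemma exists_root_quadratic (c : ℝ) : ∃ a : ℝ, 0 ≤ a ∧ ∀ z : ℝ,
    2 * (|z| + a) * |(|z| - a)| ≤ |2 * z ^ 2 + c| := by
  rcases le_total 0 c with hc | hc
  · refine ⟨0, le_rfl, fun z => ?_⟩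
    rw [abs_of_nonneg (by positivity : 0 ≤ 2 * z ^ 2 + c), sub_zero, abs_abs]
    nlinarith [sq_abs z]
  · refine ⟨Real.sqrt (-c / 2), Real.sqrt_nonneg _, fun z => ?_⟩
    set a := Real.sqrt (-c / 2)
    have ha : a ^ 2 = -c / 2 := Real.sq_sqrt (by linarith)
    have h0 : 0 ≤ a := Real.sqrt_nonneg _
    have : 2 * z ^ 2 + c = 2 * (|z| + a) * (|z| - a) := by
      rw [show c = -2 * a ^ 2 by linarith, ← sq_abs z]; ring
    rw [this, abs_mul, abs_of_nonneg (by positivity : 0 ≤ 2 * (|z| + a))]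

lemma rpow_bracket_abs_sub_le {β : ℝ} (z a : ℝ) :
    bracket (|z| - a) ^ (-β) ≤ bracket (z - a) ^ (-β) + bracket (z + a) ^ (-β) := by
  have h1 : 0 ≤ bracket (z - a) ^ (-β) := Real.rpow_nonneg (bracket_pos _).le _
  have h2 : 0 ≤ bracket (z + a) ^ (-β) := Real.rpow_nonneg (bracket_pos _).le _
  rcases abs_cases z with ⟨h, _⟩ | ⟨h, _⟩
  · rw [h]; linarith
  · rw [h, show -z - a = -(z + a) by ring, bracket_neg]; linarith

lemma exists_lintegral_bracket_abs_sub_le {β : ℝ} (hβ : 1 < β) : ∃ C : ℝ≥0, ∀ μ : Measure ℝ,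
    IsFreqMeasure μ → ∀ a b : ℝ,
      ∫⁻ x, ENNReal.ofReal (bracket (|x - b| - a) ^ (-β)) ∂μ ≤ C := by
  obtain ⟨C, hC⟩ := exists_lintegral_bracket_rpow_le hβ
  refine ⟨C + C, fun μ hμ a b => ?_⟩
  calc ∫⁻ x, ENNReal.ofReal (bracket (|x - b| - a) ^ (-β)) ∂μ
      ≤ ∫⁻ x, ENNReal.ofReal (bracket (x - (b + a)) ^ (-β))
          + ENNReal.ofReal (bracket (x - (b - a)) ^ (-β)) ∂μ := by
        refine lintegral_mono fun x => ?_
        rw [← ENNReal.ofReal_add (Real.rpow_nonneg (bracket_pos _).le _)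
          (Real.rpow_nonneg (bracket_pos _).le _)]
        refine ENNReal.ofReal_le_ofReal ((rpow_bracket_abs_sub_le _ _).trans (le_of_eq ?_))
        congr 3 <;> ring
    _ ≤ _ := by
        rw [lintegral_add_left (by fun_prop)]
        push_cast
        exact add_le_add (hC μ hμ _) (hC μ hμ _)

/-- A quadratic phase with leading coefficient `2` takes values near a given number only on a set of
bounded measure. -/
lemma exists_lintegral_inv_bracket_quadratic_le : ∃ C : ℝ≥0, ∀ μ : Measure ℝ, IsFreqMeasure μ →
    ∀ b c : ℝ, ∫⁻ x, ENNReal.ofReal ((bracket (2 * (x - b) ^ 2 + c))⁻¹) ∂μ ≤ C := by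
  obtain ⟨C, hC⟩ := exists_lintegral_bracket_abs_sub_le (β := 2) (by norm_num)
  refine ⟨2 * C, fun μ hμ b c => ?_⟩
  obtain ⟨a, ha, hq⟩ := exists_root_quadratic c
  calc ∫⁻ x, ENNReal.ofReal ((bracket (2 * (x - b) ^ 2 + c))⁻¹) ∂μ
      ≤ ∫⁻ x, 2 * ENNReal.ofReal (bracket (|x - b| - a) ^ (-2 : ℝ)) ∂μ := by
        refine lintegral_mono fun x => ?_
        rw [show (2 : ℝ≥0∞) = ENNReal.ofReal 2 by simp, ← ENNReal.ofReal_mul (by norm_num)]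
        apply ENNReal.ofReal_le_ofReal
        have h1 := hq (x - b)
        have h2 : |(|x - b| - a)| ≤ |x - b| + a := by
          rw [abs_le]; constructor <;> linarith [abs_nonneg (x - b)]
        set r := |x - b| - a
        have h3 : 2 * r ^ 2 ≤ |2 * (x - b) ^ 2 + c| := by
          refine le_trans ?_ h1
          rw [← sq_abs r]
          nlinarith [abs_nonneg r]
        rw [Real.rpow_neg (bracket_pos _).le, Real.rpow_two, bracket_sq, ← div_eq_mul_inv,
          inv_eq_one_div, div_le_div_iff₀ (bracket_pos _) (by positivity)]
        linarith [abs_le_bracket (2 * (x - b) ^ 2 + c), one_le_bracket (2 * (x - b) ^ 2 + c)]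
    _ ≤ _ := by
        rw [lintegral_const_mul _ (by fun_prop)]
        push_cast
        gcongr
        exact hC μ hμ a b

/-- The phase of a product with output frequency `x`, as a function of the first input frequency:
its values near a given number have bounded measure, uniformly in `|x| ≥ 1`. -/
lemma exists_lintegral_output_phase_le : ∃ C : ℝ≥0, ∀ μ : Measure ℝ, IsFreqMeasure μ →
    ∀ ε₁ ε₂ : ℝ, (ε₁ = 1 ∨ ε₁ = -1) → (ε₂ = 1 ∨ ε₂ = -1) → ∀ x c : ℝ, 1 ≤ |x| →
      ∫⁻ y, ENNReal.ofReal ((bracket (c + ε₁ * y ^ 2 + ε₂ * (x - y) ^ 2) ^ 2)⁻¹) ∂μ ≤ C := by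
  obtain ⟨C₁, hC₁⟩ := exists_lintegral_inv_bracket_sq_le
  obtain ⟨C₂, hC₂⟩ := exists_lintegral_inv_bracket_quadratic_le
  have hquad : ∀ μ : Measure ℝ, IsFreqMeasure μ → ∀ (φ : ℝ → ℝ) (b c : ℝ),
      (∀ y, |φ y| = |2 * (y - b) ^ 2 + c|) →
      ∫⁻ y, ENNReal.ofReal ((bracket (φ y) ^ 2)⁻¹) ∂μ ≤ C₁ + C₂ := by
    intro μ hμ φ b c hφ
    refine le_trans (lintegral_mono fun y => ENNReal.ofReal_le_ofReal ?_)
      ((hC₂ μ hμ b c).trans le_add_self)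
    rw [← bracket_abs (φ y), hφ, bracket_abs]
    have := one_le_bracket (2 * (y - b) ^ 2 + c)
    exact inv_anti₀ (bracket_pos _) (by nlinarith)
  have hlin : ∀ μ : Measure ℝ, IsFreqMeasure μ → ∀ (φ : ℝ → ℝ) (m b : ℝ), 1 ≤ |m| →
      (∀ y, φ y = m * (y - b)) →
      ∫⁻ y, ENNReal.ofReal ((bracket (φ y) ^ 2)⁻¹) ∂μ ≤ C₁ + C₂ := by
    intro μ hμ φ m b hm hφ
    refine le_trans (lintegral_mono fun y => ENNReal.ofReal_le_ofReal ?_)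
      ((hC₁ μ hμ b).trans le_self_add)
    have h1 : bracket (y - b) ≤ bracket (φ y) := by
      refine bracket_le_bracket ?_
      rw [hφ, abs_mul]; nlinarith [abs_nonneg (y - b)]
    have := bracket_pos (y - b)
    gcongr
  refine ⟨C₁ + C₂, fun μ hμ ε₁ ε₂ h₁ h₂ x c hx => ?_⟩
  have hx0 : x ≠ 0 := by rintro rfl; norm_num at hx
  push_cast
  -- Equal signs give a quadratic phase centred at `x / 2`, opposite signs a linear one of slope `±2 x`.
  rcases h₁ with rfl | rfl <;> rcases h₂ with rfl | rfl
  · refine hquad μ hμ _ (x / 2) (c + x ^ 2 / 2) fun y => ?_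
    congr 1; ring
  · refine hlin μ hμ _ (2 * x) ((x ^ 2 - c) / (2 * x)) ?_ fun y => ?_
    · rw [abs_mul]; norm_num; linarith
    · field_simp; ring
  · refine hlin μ hμ _ (-2 * x) ((c + x ^ 2) / (2 * x)) ?_ fun y => ?_
    · rw [abs_mul]; norm_num; linarith
    · field_simp; ring
  · refine hquad μ hμ _ (x / 2) (x ^ 2 / 2 - c) fun y => ?_
    rw [← abs_neg]; congr 1; ring

/-- The gain `min (1, ⟨ξ⟩ / ⟨σ⟩)` of the output norm, for the output modulation `σ`. -/
noncomputable def gain (x σ : ℝ) : ℝ := min 1 (bracket x / bracket σ)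

@[fun_prop] lemma Measurable.gain {α : Type*} [MeasurableSpace α] {f g : α → ℝ}
    (hf : Measurable f) (hg : Measurable g) : Measurable fun a => gain (f a) (g a) := by
  unfold GoodBoussinesq.gain; fun_prop

lemma gain_pos (x σ : ℝ) : 0 < gain x σ :=
  lt_min one_pos (div_pos (bracket_pos _) (bracket_pos _))

lemma gain_le_one (x σ : ℝ) : gain x σ ≤ 1 := min_le_left _ _

lemma gain_le_div (x σ : ℝ) : gain x σ ≤ bracket x / bracket σ := min_le_right _ _

lemma gain_rpow_le (x σ : ℝ) : gain x σ ^ (3 / 2 : ℝ) ≤ gain x σ := by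
  conv_rhs => rw [← Real.rpow_one (gain x σ)]
  exact Real.rpow_le_rpow_of_exponent_ge (gain_pos _ _) (gain_le_one _ _) (by norm_num)

/-- If the output modulation `|σ|` is at least `⟨x⟩ |r|` up to a constant, then the power `3 / 2` of the
gain is integrable in `r`; the first power would not be. -/
lemma gain_rpow_le_of_le {x σ r K : ℝ} (hK : 1 ≤ K) (h : bracket x * |r| ≤ K * |σ|) :
    gain x σ ^ (3 / 2 : ℝ) ≤ (2 * K) ^ (3 / 2 : ℝ) * bracket r ^ (-(3 / 2) : ℝ) := by
  have hr := bracket_pos r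
  have h1 : gain x σ ≤ 2 * K / bracket r := by
    rw [le_div_iff₀ hr]
    have h2 := bracket_le_one_add_abs r
    rcases le_total |r| 1 with h3 | h3
    · nlinarith [gain_pos x σ, gain_le_one x σ]
    · have h4 : gain x σ * bracket σ ≤ bracket x := by
        rw [← le_div_iff₀ (bracket_pos _)]; exact gain_le_div _ _
      have h5 := abs_le_bracket σ
      have h6 := bracket_pos σ
      have h7 : gain x σ * |r| ≤ K := by
        by_contra! hcon
        have : K * bracket σ < bracket x * |r| := by nlinarith [abs_nonneg r]
        nlinarith
      nlinarith [gain_pos x σ]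
  calc gain x σ ^ (3 / 2 : ℝ) ≤ (2 * K / bracket r) ^ (3 / 2 : ℝ) :=
        Real.rpow_le_rpow (gain_pos _ _).le h1 (by norm_num)
    _ = _ := by rw [Real.div_rpow (by positivity) hr.le, Real.rpow_neg hr.le, div_eq_mul_inv]

/-- The input phase for a conjugated second factor, if the first frequency is much lower than the
output frequency `x`. -/
lemma exists_lintegral_gain_low_le : ∃ C : ℝ≥0, ∀ μ : Measure ℝ, IsFreqMeasure μ → ∀ y c : ℝ,
    ∫⁻ x, {x | 1 ≤ |x| ∧ 8 * bracket y ≤ bracket x}.indicator (fun x =>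
      ENNReal.ofReal (gain x (c + x ^ 2 + (x - y) ^ 2) ^ (3 / 2 : ℝ))) x ∂μ ≤ C := by
  obtain ⟨C, hC⟩ := exists_lintegral_bracket_abs_sub_le (β := 3 / 2) (by norm_num)
  refine ⟨Real.toNNReal (2 ^ (3 / 2 : ℝ)) * C, fun μ hμ y c => ?_⟩
  obtain ⟨a, ha, hq⟩ := exists_root_quadratic (c + y ^ 2 / 2)
  calc _ ≤ ∫⁻ x, ENNReal.ofReal (2 ^ (3 / 2 : ℝ)) *
        ENNReal.ofReal (bracket (|x - y / 2| - a) ^ (-(3 / 2) : ℝ)) ∂μ := by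
        refine lintegral_mono (Set.indicator_le fun x hx => ?_)
        obtain ⟨hx1, hx2⟩ := hx
        rw [← ENNReal.ofReal_mul (by positivity)]
        apply ENNReal.ofReal_le_ofReal
        have h1 := hq (x - y / 2)
        have h2 : 2 * (x - y / 2) ^ 2 + (c + y ^ 2 / 2) = c + x ^ 2 + (x - y) ^ 2 := by ring
        rw [h2] at h1
        have := gain_rpow_le_of_le (x := x) (σ := c + x ^ 2 + (x - y) ^ 2)
          (r := |x - y / 2| - a) (K := 1) le_rfl (by
            have h3 := bracket_le_two_mul_abs hx1
            have h4 := abs_le_bracket y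
            have h5 : |x| - |y / 2| ≤ |x - y / 2| := abs_sub_abs_le_abs_sub _ _
            rw [abs_div, abs_two] at h5
            have h6 : bracket x ≤ 2 * (|x - y / 2| + a) := by linarith
            nlinarith [abs_nonneg (|x - y / 2| - a)])
        simpa using this
    _ ≤ _ := by
        rw [lintegral_const_mul _ (by fun_prop)]
        push_cast
        refine mul_le_mul' (le_of_eq ?_) (hC μ hμ a (y / 2))
        rfl

/-- The input phase, if the first frequency is not much lower than the output frequency. -/
lemma exists_lintegral_gain_high_le : ∃ C : ℝ≥0, ∀ μ : Measure ℝ, IsFreqMeasure μ →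
    ∀ ε : ℝ, (ε = 1 ∨ ε = -1) → ∀ y c : ℝ,
    ∫⁻ x, {x | bracket x ≤ 8 * bracket y}.indicator (fun x =>
      ENNReal.ofReal ((bracket x)⁻¹ * gain x (c + x ^ 2 - ε * (x - y) ^ 2) ^ (3 / 2 : ℝ))) x ∂μ
        ≤ C := by
  obtain ⟨C₁, hC₁⟩ := exists_lintegral_inv_bracket_sq_le
  obtain ⟨C₂, hC₂⟩ := exists_lintegral_inv_bracket_quadratic_le
  obtain ⟨C₃, hC₃⟩ := exists_lintegral_bracket_rpow_le (β := 3 / 2) (by norm_num)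
  refine ⟨144 * C₁ + C₂ + Real.toNNReal ((2 * 6) ^ (3 / 2 : ℝ)) * C₃, fun μ hμ ε hε y c => ?_⟩
  have hb := fun x => one_le_bracket x
  rcases hε with rfl | rfl
  · rcases le_total |y| 1 with hy | hy
    · have : ∫⁻ x, 144 * ENNReal.ofReal ((bracket (x - 0) ^ 2)⁻¹) ∂μ ≤ 144 * C₁ := by
        rw [lintegral_const_mul _ (by fun_prop)]; gcongr; exact hC₁ μ hμ 0
      refine le_trans (lintegral_mono (Set.indicator_le fun x hx => ?_))
        (this.trans ?_)
      · rw [show (144 : ℝ≥0∞) = ENNReal.ofReal 144 by simp, ← ENNReal.ofReal_mul (by norm_num)]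
        apply ENNReal.ofReal_le_ofReal
        have h1 : bracket x ≤ 12 := hx.trans (by linarith [bracket_le_of_abs_le_one hy])
        have h2 : (bracket x)⁻¹ ≤ 1 := inv_le_one_of_one_le₀ (hb x)
        have h3 := (gain_rpow_le x (c + x ^ 2 - 1 * (x - y) ^ 2)).trans (gain_le_one _ _)
        have h4 : 1 ≤ 144 * (bracket (x - 0) ^ 2)⁻¹ := by
          rw [sub_zero, ← div_eq_mul_inv, one_le_div (by have := hb x; positivity)]
          nlinarith [hb x]
        refine le_trans (mul_le_one₀ h2 (Real.rpow_nonneg (gain_pos _ _).le _) h3) h4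
      · push_cast; rw [add_assoc]; exact le_self_add
    · have hy0 : y ≠ 0 := by rintro rfl; norm_num at hy
      set b := (y ^ 2 - c) / (2 * y) with hbdef
      have : ∫⁻ x, ENNReal.ofReal ((2 * 6) ^ (3 / 2 : ℝ)) *
          ENNReal.ofReal (bracket (x - b) ^ (-(3 / 2) : ℝ)) ∂μ
          ≤ ENNReal.ofReal ((2 * 6) ^ (3 / 2 : ℝ)) * C₃ := by
        rw [lintegral_const_mul _ (by fun_prop)]; gcongr; exact hC₃ μ hμ b
      refine le_trans (lintegral_mono (Set.indicator_le fun x hx => ?_))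
        (this.trans ?_)
      · rw [← ENNReal.ofReal_mul (by positivity)]
        apply ENNReal.ofReal_le_ofReal
        have h2 : (bracket x)⁻¹ ≤ 1 := inv_le_one_of_one_le₀ (hb x)
        have h3 : c + x ^ 2 - 1 * (x - y) ^ 2 = 2 * y * (x - b) := by
          rw [hbdef]; field_simp; ring
        refine le_trans (mul_le_of_le_one_left (Real.rpow_nonneg (gain_pos _ _).le _) h2) ?_
        refine gain_rpow_le_of_le (by norm_num) ?_
        rw [h3, abs_mul, abs_mul, abs_two]
        have h4 : bracket x ≤ 12 * |y| := hx.trans (by linarith [bracket_le_two_mul_abs hy])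
        nlinarith [abs_nonneg (x - b)]
      · push_cast
        exact le_add_self
  · refine le_trans (lintegral_mono (Set.indicator_le fun x hx => ?_))
      ((hC₂ μ hμ (y / 2) (c + y ^ 2 / 2)).trans ?_)
    · apply ENNReal.ofReal_le_ofReal
      have h2 : 2 * (x - y / 2) ^ 2 + (c + y ^ 2 / 2) = c + x ^ 2 - -1 * (x - y) ^ 2 := by ring
      rw [h2]
      have h3 := (gain_rpow_le x (c + x ^ 2 - -1 * (x - y) ^ 2)).trans (gain_le_div _ _)
      have h4 := bracket_pos x
      calc _ ≤ (bracket x)⁻¹ * (bracket x / bracket (c + x ^ 2 - -1 * (x - y) ^ 2)) := by gcongr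
        _ = _ := by field_simp
    · push_cast; rw [add_right_comm]; exact le_add_self


/-! ### Kernel integrals in spacetime -/

/-- The modulation bracket `⟨τ + ε ξ ^ 2⟩`; for `ε = -1` it is the one of a complex conjugate. -/
noncomputable def signedModulation (ε : ℝ) (q : ℝ × ℝ) : ℝ := bracket (q.1 + ε * q.2 ^ 2)

@[fun_prop] lemma Measurable.signedModulation {α : Type*} [MeasurableSpace α] {ε : ℝ}
    {f : α → ℝ × ℝ} (hf : Measurable f) : Measurable fun a => signedModulation ε (f a) := by
  unfold GoodBoussinesq.signedModulation; fun_prop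

@[fun_prop] lemma measurable_modulation : Measurable modulation := by
  unfold modulation; fun_prop

lemma one_le_signedModulation (ε : ℝ) (q : ℝ × ℝ) : 1 ≤ signedModulation ε q := one_le_bracket _

/-- The kernel of two factors that are both measured with their modulations, for a fixed output
frequency: the integral in `τ` turns it into the one of `exists_lintegral_output_phase_le`. -/
lemma exists_lintegral_output_kernel_le : ∃ C : ℝ≥0, ∀ (μ : Measure ℝ) [SFinite μ],
    IsFreqMeasure μ → ∀ ε₁ ε₂ : ℝ, (ε₁ = 1 ∨ ε₁ = -1) → (ε₂ = 1 ∨ ε₂ = -1) → ∀ q : ℝ × ℝ,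
      1 ≤ |q.2| → ∫⁻ p, ENNReal.ofReal ((signedModulation ε₁ p ^ 2)⁻¹ *
        (signedModulation ε₂ (q - p) ^ 2)⁻¹) ∂(stMeasure μ) ≤ C := by
  obtain ⟨C₁, hC₁⟩ := exists_lintegral_output_phase_le
  obtain ⟨C₂, hC₂⟩ := exists_lintegral_inv_bracket_sq_le
  refine ⟨C₂ * C₁, fun μ _ hμ ε₁ ε₂ h₁ h₂ q hq => ?_⟩
  rw [lintegral_prod_symm' _ (by fun_prop)]
  calc _ = ∫⁻ y, ∫⁻ a, ENNReal.ofReal ((bracket (a - 0) ^ 2)⁻¹) * ENNReal.ofReal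
          ((bracket ((q.1 - a) + ε₁ * y ^ 2 + ε₂ * (q.2 - y) ^ 2) ^ 2)⁻¹) ∂volume ∂μ := by
        refine lintegral_congr fun y => ?_
        -- The new variable is `τ₁ + ε₁ ξ₁ ^ 2`.
        rw [← lintegral_sub_right_eq_self _ (ε₁ * y ^ 2)]
        refine lintegral_congr fun a => ?_
        rw [← ENNReal.ofReal_mul (by positivity)]
        simp only [signedModulation, Prod.fst_sub, Prod.snd_sub]
        congr 5 <;> ring_nf
    _ = ∫⁻ a, ENNReal.ofReal ((bracket (a - 0) ^ 2)⁻¹) * ∫⁻ y, ENNReal.ofReal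
          ((bracket ((q.1 - a) + ε₁ * y ^ 2 + ε₂ * (q.2 - y) ^ 2) ^ 2)⁻¹) ∂μ := by
        rw [lintegral_lintegral_swap (by fun_prop)]
        refine lintegral_congr fun a => ?_
        rw [lintegral_const_mul _ (by fun_prop)]
    _ ≤ ∫⁻ a, ENNReal.ofReal ((bracket (a - 0) ^ 2)⁻¹) * C₁ := by
        gcongr with a
        exact hC₁ μ hμ ε₁ ε₂ h₁ h₂ q.2 _ hq
    _ ≤ _ := by
        rw [lintegral_mul_const _ (by fun_prop)]
        push_cast
        gcongr
        exact hC₂ volume isFreqMeasure_volume 0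

/-- A second factor that is measured with its modulation, for a fixed frequency `p` of the first factor:
the integral of a function `H` of `ξ` and `τ + ξ ^ 2` is bounded by integrals over the spatial
frequency only, along translates of the parabola of the second factor. -/
lemma exists_lintegral_input_kernel_le : ∃ C : ℝ≥0, ∀ (μ : Measure ℝ) [SFinite μ],
    ∀ (ε : ℝ) (p : ℝ × ℝ) (H : ℝ → ℝ → ℝ≥0∞), Measurable (Function.uncurry H) → ∀ B : ℝ≥0∞,
      (∀ c, ∫⁻ x, H x (c + x ^ 2 - ε * (x - p.2) ^ 2) ∂μ ≤ B) →
      ∫⁻ q, ENNReal.ofReal ((signedModulation ε (q - p) ^ 2)⁻¹) * H q.2 (q.1 + q.2 ^ 2)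
        ∂(stMeasure μ) ≤ C * B := by
  obtain ⟨C₂, hC₂⟩ := exists_lintegral_inv_bracket_sq_le
  refine ⟨C₂, fun μ _ ε p H hH B hB => ?_⟩
  have hH' : Measurable fun z : ℝ × ℝ => H z.1 z.2 := hH
  rw [lintegral_prod_symm' _ (by fun_prop)]
  calc _ = ∫⁻ x, ∫⁻ b, ENNReal.ofReal ((bracket (b - 0) ^ 2)⁻¹) *
          H x ((b + p.1) + x ^ 2 - ε * (x - p.2) ^ 2) ∂volume ∂μ := by
        refine lintegral_congr fun x => ?_
        -- The new variable is `τ₂ + ε ξ₂ ^ 2`.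
        rw [← lintegral_sub_right_eq_self _ (ε * (x - p.2) ^ 2 - p.1)]
        refine lintegral_congr fun a => ?_
        simp only [signedModulation, Prod.fst_sub, Prod.snd_sub]
        have e₁ : a - (ε * (x - p.2) ^ 2 - p.1) - p.1 + ε * (x - p.2) ^ 2 = a - 0 := by ring
        have e₂ : a - (ε * (x - p.2) ^ 2 - p.1) + x ^ 2
          = a + p.1 + x ^ 2 - ε * (x - p.2) ^ 2 := by ring
        rw [e₁, e₂]
    _ = ∫⁻ b, ENNReal.ofReal ((bracket (b - 0) ^ 2)⁻¹) *
          ∫⁻ x, H x ((b + p.1) + x ^ 2 - ε * (x - p.2) ^ 2) ∂μ := by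
        rw [lintegral_lintegral_swap (by fun_prop)]
        refine lintegral_congr fun a => ?_
        rw [lintegral_const_mul _ (by fun_prop)]
    _ ≤ ∫⁻ a, ENNReal.ofReal ((bracket (a - 0) ^ 2)⁻¹) * B := by
        gcongr with a
        exact hB _
    _ ≤ _ := by
        rw [lintegral_mul_const _ (by fun_prop)]
        gcongr
        exact hC₂ volume isFreqMeasure_volume 0

/-- The gain `min (1, ⟨ξ⟩ / ⟨τ + ξ ^ 2⟩)` at a spacetime frequency. -/
noncomputable def outGain (q : ℝ × ℝ) : ℝ := gain q.2 (q.1 + q.2 ^ 2)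

@[fun_prop] lemma measurable_outGain : Measurable outGain := by
  unfold outGain; fun_prop

lemma exists_lintegral_gain_le : ∃ C : ℝ≥0, ∀ (μ : Measure ℝ) [SFinite μ], IsFreqMeasure μ →
    ∫⁻ q, ENNReal.ofReal ((bracket q.2 ^ 3)⁻¹ * outGain q ^ (3 / 2 : ℝ)) ∂(stMeasure μ) ≤ C := by
  obtain ⟨C, hC⟩ := exists_lintegral_bracket_rpow_le (β := 3 / 2) (by norm_num)
  refine ⟨C * C, fun μ _ hμ => ?_⟩
  rw [lintegral_prod_symm' _ (by fun_prop)]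
  calc _ ≤ ∫⁻ x, ∫⁻ t, ENNReal.ofReal (bracket (x - 0) ^ (-(3 / 2) : ℝ)) *
          ENNReal.ofReal (bracket (t - -x ^ 2) ^ (-(3 / 2) : ℝ)) ∂volume ∂μ := by
        gcongr with x t
        rw [← ENNReal.ofReal_mul (Real.rpow_nonneg (bracket_pos _).le _)]
        apply ENNReal.ofReal_le_ofReal
        have hx := bracket_pos x
        have ht := bracket_pos (t + x ^ 2)
        rw [sub_zero, sub_neg_eq_add]
        calc (bracket x ^ 3)⁻¹ * outGain (t, x) ^ (3 / 2 : ℝ)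
            ≤ (bracket x ^ 3)⁻¹ * (bracket x / bracket (t + x ^ 2)) ^ (3 / 2 : ℝ) := by
              gcongr
              · exact (gain_pos _ _).le
              · exact gain_le_div _ _
          _ = _ := by
              rw [Real.div_rpow hx.le ht.le, div_eq_mul_inv, ← Real.rpow_neg ht.le, ← mul_assoc,
                ← Real.rpow_natCast, ← Real.rpow_neg hx.le, ← Real.rpow_add hx]
              norm_num
    _ ≤ ∫⁻ x, ENNReal.ofReal (bracket (x - 0) ^ (-(3 / 2) : ℝ)) * C ∂μ := by
        gcongr with x
        rw [lintegral_const_mul _ (by fun_prop)]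
        gcongr
        exact hC volume isFreqMeasure_volume _
    _ ≤ _ := by
        rw [lintegral_mul_const _ (by fun_prop)]
        push_cast
        gcongr
        exact hC μ hμ 0

/-! ### Pieces of the convolution -/

/-- The function `w f` with a real weight `w`. -/
noncomputable def weighted (w : ℝ × ℝ → ℝ) (f : ℝ × ℝ → ℝ≥0∞) (p : ℝ × ℝ) : ℝ≥0∞ :=
  ENNReal.ofReal (w p) * f p

@[fun_prop] lemma measurable_weighted {w : ℝ × ℝ → ℝ} {f : ℝ × ℝ → ℝ≥0∞} (hw : Measurable w)
    (hf : Measurable f) : Measurable (weighted w f) := by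
  unfold weighted; fun_prop

/-- The part of the convolution of `f₁` and `f₂`, with weight `o` at the output frequency `q`, that
comes from the pairs `(q, p)` in `S`; here `p` is the frequency of the first factor. -/
noncomputable def piece (μ : Measure ℝ) (o : ℝ × ℝ → ℝ) (f₁ f₂ : ℝ × ℝ → ℝ≥0∞)
    (S : Set ((ℝ × ℝ) × (ℝ × ℝ))) (q : ℝ × ℝ) : ℝ≥0∞ :=
  ∫⁻ p, S.indicator (fun z => ENNReal.ofReal (o z.1) * (f₁ z.2 * f₂ (z.1 - z.2))) (q, p)
    ∂(stMeasure μ)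

variable {μ : Measure ℝ} {o : ℝ × ℝ → ℝ} {f₁ f₂ : ℝ × ℝ → ℝ≥0∞}
  {S A B : Set ((ℝ × ℝ) × (ℝ × ℝ))}

lemma piece_le_add (ho : Measurable o) (h₁ : Measurable f₁) (h₂ : Measurable f₂)
    (hA : MeasurableSet A) (h : S ⊆ A ∪ B) (q : ℝ × ℝ) :
    piece μ o f₁ f₂ S q ≤ piece μ o f₁ f₂ A q + piece μ o f₁ f₂ B q := by
  unfold piece
  have hm : Measurable (A.indicator
      fun z => ENNReal.ofReal (o z.1) * (f₁ z.2 * f₂ (z.1 - z.2))) :=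
    Measurable.indicator (by fun_prop) hA
  have hm' : Measurable fun p => A.indicator
      (fun z => ENNReal.ofReal (o z.1) * (f₁ z.2 * f₂ (z.1 - z.2))) (q, p) :=
    hm.comp (by fun_prop : Measurable fun p : ℝ × ℝ => (q, p))
  rw [← lintegral_add_left hm']
  refine lintegral_mono fun p => ?_
  by_cases hz : (q, p) ∈ S
  · rw [Set.indicator_of_mem hz]
    rcases h hz with hz' | hz'
    · rw [Set.indicator_of_mem hz']; exact le_self_add
    · rw [Set.indicator_of_mem hz']; exact le_add_self
  · rw [Set.indicator_of_notMem hz]; exact zero_le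

variable [SFinite μ]

lemma measurable_piece (ho : Measurable o) (h₁ : Measurable f₁) (h₂ : Measurable f₂)
    (hS : MeasurableSet S) : Measurable (piece μ o f₁ f₂ S) := by
  have : Measurable (S.indicator
      fun z => ENNReal.ofReal (o z.1) * (f₁ z.2 * f₂ (z.1 - z.2))) := by
    refine Measurable.indicator ?_ hS
    fun_prop
  exact this.lintegral_prod_right'

lemma ennreal_add_sq_le (a b : ℝ≥0∞) : (a + b) ^ 2 ≤ 2 * (a ^ 2 + b ^ 2) := by
  have := ENNReal.rpow_add_le_mul_rpow_add_rpow a b (p := 2) (by norm_num)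
  norm_num at this
  simpa using this

lemma lintegral_sq_piece_le_add (ho : Measurable o) (h₁ : Measurable f₁) (h₂ : Measurable f₂)
    (hA : MeasurableSet A) (h : S ⊆ A ∪ B) {X : ℝ≥0∞} {a b : ℝ≥0}
    (ha : ∫⁻ q, piece μ o f₁ f₂ A q ^ 2 ∂(stMeasure μ) ≤ a * X)
    (hb : ∫⁻ q, piece μ o f₁ f₂ B q ^ 2 ∂(stMeasure μ) ≤ b * X) :
    ∫⁻ q, piece μ o f₁ f₂ S q ^ 2 ∂(stMeasure μ) ≤ (2 * (a + b) : ℝ≥0) * X := by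
  calc ∫⁻ q, piece μ o f₁ f₂ S q ^ 2 ∂(stMeasure μ)
      ≤ ∫⁻ q, 2 * (piece μ o f₁ f₂ A q ^ 2 + piece μ o f₁ f₂ B q ^ 2) ∂(stMeasure μ) := by
        refine lintegral_mono fun q => le_trans ?_ (ennreal_add_sq_le _ _)
        gcongr
        exact piece_le_add ho h₁ h₂ hA h q
    _ ≤ 2 * (a * X + b * X) := by
        rw [lintegral_const_mul' _ _ (by norm_num),
          lintegral_add_left ((measurable_piece ho h₁ h₂ hA).pow_const 2)]
        gcongr
    _ = _ := by push_cast; ring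

lemma indicator_sq_le {k w₁ w₂ : ℝ} {a b : ℝ≥0∞} {c : ℝ} (hk : 0 ≤ k) (hw₁ : 0 ≤ w₁)
    (hw₂ : 0 ≤ w₂) (h : c ^ 2 ≤ k * (w₁ * w₂) ^ 2) :
    (ENNReal.ofReal c * (a * b)) ^ 2
      ≤ ENNReal.ofReal k * ((ENNReal.ofReal w₁ * a) * (ENNReal.ofReal w₂ * b)) ^ 2 := by
  have h1 : ENNReal.ofReal c ^ 2
      ≤ ENNReal.ofReal k * (ENNReal.ofReal w₁ * ENNReal.ofReal w₂) ^ 2 := by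
    rcases le_total c 0 with hc | hc
    · rw [ENNReal.ofReal_of_nonpos hc]; simp
    rw [← ENNReal.ofReal_mul hw₁, ← ENNReal.ofReal_pow hc, ← ENNReal.ofReal_pow (by positivity),
      ← ENNReal.ofReal_mul hk]
    exact ENNReal.ofReal_le_ofReal h
  calc (ENNReal.ofReal c * (a * b)) ^ 2 = ENNReal.ofReal c ^ 2 * (a * b) ^ 2 := mul_pow _ _ _
    _ ≤ ENNReal.ofReal k * (ENNReal.ofReal w₁ * ENNReal.ofReal w₂) ^ 2 * (a * b) ^ 2 := by gcongr
    _ = _ := by ring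

/-- `bilinear_of_output` for a piece of the convolution. -/
lemma lintegral_sq_piece_le_of_output (hμ : IsFreqMeasure μ) (h₁ : Measurable f₁)
    (h₂ : Measurable f₂) (hS : MeasurableSet S) {w₁ w₂ : ℝ × ℝ → ℝ} (hw₁ : Measurable w₁)
    (hw₂ : Measurable w₂) (hp₁ : ∀ p, 0 ≤ w₁ p) (hp₂ : ∀ p, 0 ≤ w₂ p)
    {k : ℝ × ℝ → ℝ × ℝ → ℝ} (hk : Measurable fun z : (ℝ × ℝ) × (ℝ × ℝ) => k z.1 z.2)
    (hk0 : ∀ q p, 0 ≤ k q p)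
    (h : ∀ q p, (q, p) ∈ S → o q ^ 2 ≤ k q p * (w₁ p * w₂ (q - p)) ^ 2) {C : ℝ≥0}
    (hC : ∀ q, ∫⁻ p, S.indicator (fun z => ENNReal.ofReal (k z.1 z.2)) (q, p) ∂(stMeasure μ) ≤ C) :
    ∫⁻ q, piece μ o f₁ f₂ S q ^ 2 ∂(stMeasure μ)
      ≤ C * ((∫⁻ p, weighted w₁ f₁ p ^ 2 ∂(stMeasure μ))
        * ∫⁻ p, weighted w₂ f₂ p ^ 2 ∂(stMeasure μ)) := by
  refine hμ.bilinear_of_output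
    (κ := fun q p => S.indicator (fun z => ENNReal.ofReal (k z.1 z.2)) (q, p))
    (by fun_prop) (by fun_prop) ?_ (fun q p => ?_) hC
  · exact (by fun_prop : Measurable fun z : (ℝ × ℝ) × (ℝ × ℝ) => ENNReal.ofReal (k z.1 z.2)).indicator
      hS
  · by_cases hz : (q, p) ∈ S
    · simp only [Set.indicator_of_mem hz, weighted, ← mul_pow]
      exact indicator_sq_le (hk0 _ _) (hp₁ _) (hp₂ _) (h _ _ hz)
    · simp [Set.indicator_of_notMem hz]

/-- `bilinear_of_input` for a piece of the convolution. -/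
lemma lintegral_sq_piece_le_of_input (hμ : IsFreqMeasure μ) (h₁ : Measurable f₁)
    (h₂ : Measurable f₂) (hS : MeasurableSet S) {w₁ w₂ : ℝ × ℝ → ℝ} (hw₁ : Measurable w₁)
    (hw₂ : Measurable w₂) (hp₁ : ∀ p, 0 ≤ w₁ p) (hp₂ : ∀ p, 0 ≤ w₂ p)
    {k : ℝ × ℝ → ℝ × ℝ → ℝ} (hk : Measurable fun z : (ℝ × ℝ) × (ℝ × ℝ) => k z.1 z.2)
    (hk0 : ∀ q p, 0 ≤ k q p)
    (h : ∀ q p, (q, p) ∈ S → o q ^ 2 ≤ k q p * (w₁ p * w₂ (q - p)) ^ 2) {C : ℝ≥0}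
    (hC : ∀ p, ∫⁻ q, S.indicator (fun z => ENNReal.ofReal (k z.1 z.2)) (q, p) ∂(stMeasure μ) ≤ C) :
    ∫⁻ q, piece μ o f₁ f₂ S q ^ 2 ∂(stMeasure μ)
      ≤ C * ((∫⁻ p, weighted w₁ f₁ p ^ 2 ∂(stMeasure μ))
        * ∫⁻ p, weighted w₂ f₂ p ^ 2 ∂(stMeasure μ)) := by
  refine hμ.bilinear_of_input
    (κ := fun q p => S.indicator (fun z => ENNReal.ofReal (k z.1 z.2)) (q, p))
    (by fun_prop) (by fun_prop) ?_ (fun q p => ?_) hC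
  · exact (by fun_prop : Measurable fun z : (ℝ × ℝ) × (ℝ × ℝ) => ENNReal.ofReal (k z.1 z.2)).indicator
      hS
  · by_cases hz : (q, p) ∈ S
    · simp only [Set.indicator_of_mem hz, weighted, ← mul_pow]
      exact indicator_sq_le (hk0 _ _) (hp₁ _) (hp₂ _) (h _ _ hz)
    · simp [Set.indicator_of_notMem hz]

/-- `bilinear_lOne_lTwo` for a piece of the convolution; `D` is the set of the pairs of spatial
frequencies that occur in the piece. -/
lemma lintegral_sq_piece_le_lOne_lTwo (hμ : IsFreqMeasure μ) (h₁ : Measurable f₁)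
    (h₂ : Measurable f₂) {w₁ w₂ : ℝ × ℝ → ℝ} (hw₁ : Measurable w₁)
    (hw₂ : Measurable w₂) (hp₁ : ∀ p, 0 ≤ w₁ p) (hp₂ : ∀ p, 0 ≤ w₂ p)
    {k : ℝ → ℝ → ℝ} (hk : Measurable fun z : ℝ × ℝ => k z.1 z.2) (hk0 : ∀ x y, 0 ≤ k x y)
    {D : Set (ℝ × ℝ)} (hD : MeasurableSet D) (hSD : ∀ q p, (q, p) ∈ S → (q.2, p.2) ∈ D)
    (h : ∀ q p, (q, p) ∈ S → o q ^ 2 ≤ k q.2 p.2 * (w₁ p * w₂ (q - p)) ^ 2) {C : ℝ≥0}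
    (hC : ∀ x, ∫⁻ y, D.indicator (fun z => ENNReal.ofReal (k z.1 z.2)) (x, y) ∂μ ≤ C) :
    ∫⁻ q, piece μ o f₁ f₂ S q ^ 2 ∂(stMeasure μ)
      ≤ C * (sqNormLOne μ (weighted w₁ f₁)
        * ∫⁻ p, weighted w₂ f₂ p ^ 2 ∂(stMeasure μ)) := by
  refine hμ.bilinear_lOne_lTwo
    (κ := fun x y => D.indicator (fun z => ENNReal.ofReal (k z.1 z.2)) (x, y))
    (by fun_prop) (by fun_prop) ?_ (fun q p => ?_) (.of_forall hC)
  · exact (by fun_prop : Measurable fun z : ℝ × ℝ => ENNReal.ofReal (k z.1 z.2)).indicator hD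
  · by_cases hz : (q, p) ∈ S
    · simp only [Set.indicator_of_mem hz, Set.indicator_of_mem (hSD _ _ hz), weighted]
      exact indicator_sq_le (hk0 _ _) (hp₁ _) (hp₂ _) (h _ _ hz)
    · simp [Set.indicator_of_notMem hz]

/-- `bilinear_lTwo_lOne` for a piece of the convolution; `D` is the set of the pairs of spatial
frequencies that occur in the piece. -/
lemma lintegral_sq_piece_le_lTwo_lOne (hμ : IsFreqMeasure μ) (h₁ : Measurable f₁)
    (h₂ : Measurable f₂) {w₁ w₂ : ℝ × ℝ → ℝ} (hw₁ : Measurable w₁)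
    (hw₂ : Measurable w₂) (hp₁ : ∀ p, 0 ≤ w₁ p) (hp₂ : ∀ p, 0 ≤ w₂ p)
    {k : ℝ → ℝ → ℝ} (hk : Measurable fun z : ℝ × ℝ => k z.1 z.2) (hk0 : ∀ x y, 0 ≤ k x y)
    {D : Set (ℝ × ℝ)} (hD : MeasurableSet D) (hSD : ∀ q p, (q, p) ∈ S → (q.2, p.2) ∈ D)
    (h : ∀ q p, (q, p) ∈ S → o q ^ 2 ≤ k q.2 p.2 * (w₁ p * w₂ (q - p)) ^ 2) {C : ℝ≥0}
    (hC : ∀ x, ∫⁻ y, D.indicator (fun z => ENNReal.ofReal (k z.1 z.2)) (x, y) ∂μ ≤ C) :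
    ∫⁻ q, piece μ o f₁ f₂ S q ^ 2 ∂(stMeasure μ)
      ≤ C * ((∫⁻ p, weighted w₁ f₁ p ^ 2 ∂(stMeasure μ))
        * sqNormLOne μ (weighted w₂ f₂)) := by
  refine hμ.bilinear_lTwo_lOne
    (κ := fun x y => D.indicator (fun z => ENNReal.ofReal (k z.1 z.2)) (x, y))
    (by fun_prop) (by fun_prop) ?_ (fun q p => ?_) hC
  · exact (by fun_prop : Measurable fun z : ℝ × ℝ => ENNReal.ofReal (k z.1 z.2)).indicator hD
  · by_cases hz : (q, p) ∈ S
    · simp only [Set.indicator_of_mem hz, Set.indicator_of_mem (hSD _ _ hz), weighted]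
      exact indicator_sq_le (hk0 _ _) (hp₁ _) (hp₂ _) (h _ _ hz)
    · simp [Set.indicator_of_notMem hz]


/-! ### Weights and the norm of the factors -/

/-- The weight of the `L²` part of the norm of `W^s`, up to constants. -/
noncomputable def xWeight (s ε : ℝ) (p : ℝ × ℝ) : ℝ :=
  bracket p.2 ^ s * min (signedModulation ε p) (bracket p.2)

/-- The weight of the `L²_ξ L¹_τ` part of the norm of `W^s`. -/
noncomputable def yWeight (s : ℝ) (p : ℝ × ℝ) : ℝ := bracket p.2 ^ s

/-- The weight with which the `L²` norm of a product is estimated: it exceeds the weight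
`⟨ξ⟩ ^ s * min (1, ⟨ξ⟩ / ⟨τ + ξ ^ 2⟩)` of the norm of `Λ⁻¹ (u v)` by a power of the gain, which pays
for the summation over dyadic modulations. -/
noncomputable def outWeight (s : ℝ) (q : ℝ × ℝ) : ℝ :=
  bracket q.2 ^ s * outGain q ^ (3 / 4 : ℝ)

@[fun_prop] lemma measurable_xWeight (s ε : ℝ) : Measurable (xWeight s ε) := by
  unfold xWeight; fun_prop

@[fun_prop] lemma measurable_yWeight (s : ℝ) : Measurable (yWeight s) := by
  unfold yWeight; fun_prop

@[fun_prop] lemma measurable_outWeight (s : ℝ) : Measurable (outWeight s) := by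
  unfold outWeight; fun_prop

lemma one_le_min_modulation (ε : ℝ) (p : ℝ × ℝ) :
    1 ≤ min (signedModulation ε p) (bracket p.2) :=
  le_min (one_le_signedModulation _ _) (one_le_bracket _)

lemma xWeight_nonneg (s ε : ℝ) (p : ℝ × ℝ) : 0 ≤ xWeight s ε p :=
  mul_nonneg (Real.rpow_nonneg (bracket_pos _).le _)
    (zero_le_one.trans (one_le_min_modulation ε p))

lemma yWeight_nonneg (s : ℝ) (p : ℝ × ℝ) : 0 ≤ yWeight s p :=
  Real.rpow_nonneg (bracket_pos _).le _

/-- The frequencies with modulation `⟨τ + ε ξ ^ 2⟩ ∼ 2 ^ j` that is at least `⟨ξ⟩ ^ 2`. -/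
def farDyadic (ε : ℝ) (j : ℕ) : Set (ℝ × ℝ) :=
  ({p | (2 : ℝ) ^ j ≤ signedModulation ε p} ∩ {p | signedModulation ε p < (2 : ℝ) ^ (j + 1)}) ∩
    {p | bracket p.2 ^ 2 ≤ signedModulation ε p}

lemma measurableSet_farDyadic (ε : ℝ) (j : ℕ) : MeasurableSet (farDyadic ε j) :=
  ((measurableSet_le (by fun_prop) (by fun_prop)).inter
    (measurableSet_lt (by fun_prop) (by fun_prop))).inter
    (measurableSet_le (by fun_prop) (by fun_prop))

/-- The `ℓ¹` sum over dyadic modulations in the norm of `W^{-1/2}`. -/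
noncomputable def besovNorm (μ : Measure ℝ) (s ε : ℝ) (f : ℝ × ℝ → ℝ≥0∞) : ℝ≥0∞ :=
  ∑' j, (∫⁻ p, weighted (fun p => bracket p.2 ^ (s + 1)) ((farDyadic ε j).indicator f) p ^ 2
    ∂(stMeasure μ)) ^ (1 / 2 : ℝ)

open Classical in
/-- The part of the norm of `W^s` that the estimates use, squared. -/
noncomputable def sqNorm (μ : Measure ℝ) (s ε : ℝ) (f : ℝ × ℝ → ℝ≥0∞) : ℝ≥0∞ :=
  ∫⁻ p, weighted (xWeight s ε) f p ^ 2 ∂(stMeasure μ) + sqNormLOne μ (weighted (yWeight s) f)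
    + if s = -1 / 2 then besovNorm μ s ε f ^ 2 else 0

variable {μ : Measure ℝ} {s ε : ℝ} {f : ℝ × ℝ → ℝ≥0∞}

lemma lintegral_sq_weighted_le_sqNorm :
    ∫⁻ p, weighted (xWeight s ε) f p ^ 2 ∂(stMeasure μ) ≤ sqNorm μ s ε f :=
  le_self_add.trans le_self_add

lemma sqNormLOne_le_sqNorm : sqNormLOne μ (weighted (yWeight s) f) ≤ sqNorm μ s ε f :=
  le_add_self.trans le_self_add

lemma besovNorm_sq_le_sqNorm (hs : s = -1 / 2) : besovNorm μ s ε f ^ 2 ≤ sqNorm μ s ε f := by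
  unfold sqNorm; rw [if_pos hs]; exact le_add_self

/-- In the high frequency region, the weights are the worst for `s = -1/2`. -/
lemma sq_rpow_le {s n n₁ n₂ : ℝ} (hs : -1 / 2 ≤ s) (hs' : s ≤ 0) (hn : 1 ≤ n) (hn₁ : 1 ≤ n₁)
    (hn₂ : 1 ≤ n₂) (h : n ≤ n₁ + n₂) :
    (n ^ s) ^ 2 ≤ 2 * (n₁ * n₂ / n) * (n₁ ^ s * n₂ ^ s) ^ 2 := by
  have h0 : 0 < n := by linarith
  set X := n₁ * n₂ / n with hX
  have hX0 : 0 < X := by positivity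
  have hX2 : 1 ≤ 2 * X := by
    rw [hX, ← mul_div_assoc, one_le_div h0]; nlinarith
  have e1 : n ^ s = X ^ (-s) * (n₁ ^ s * n₂ ^ s) := by
    rw [Real.rpow_neg hX0.le, hX, Real.div_rpow (by positivity) h0.le,
      Real.mul_rpow (by positivity) (by positivity)]
    have : 0 < n₁ ^ s := by positivity
    have : 0 < n₂ ^ s := by positivity
    have : 0 < n ^ s := by positivity
    field_simp
  have e2 : (X ^ (-s)) ^ 2 ≤ 2 * X := by
    rw [← Real.rpow_natCast, ← Real.rpow_mul hX0.le]
    push_cast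
    rcases le_total 1 X with h1 | h1
    · calc X ^ (-s * 2) ≤ X ^ (1 : ℝ) := Real.rpow_le_rpow_of_exponent_le h1 (by linarith)
        _ = X := Real.rpow_one X
        _ ≤ _ := by linarith
    · exact (Real.rpow_le_one hX0.le h1 (by linarith)).trans hX2
  rw [e1, mul_pow]
  gcongr

lemma outGain_pos (q : ℝ × ℝ) : 0 < outGain q := gain_pos _ _

lemma outWeight_sq (s : ℝ) (q : ℝ × ℝ) :
    outWeight s q ^ 2 = (bracket q.2 ^ s) ^ 2 * outGain q ^ (3 / 2 : ℝ) := by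
  rw [outWeight, mul_pow, ← Real.rpow_natCast (outGain q ^ (3 / 4 : ℝ)),
    ← Real.rpow_mul (outGain_pos q).le]
  norm_num

lemma bracket_le_add_sub (x y : ℝ) : bracket x ≤ bracket y + bracket (x - y) := by
  have := bracket_add_le' y (x - y)
  rwa [add_sub_cancel] at this

lemma outWeight_sq_le (hs : -1 / 2 ≤ s) (hs' : s ≤ 0) {q p : ℝ × ℝ} {k m₁ m₂ : ℝ}
    (h : 2 * (bracket p.2 * bracket (q - p).2 / bracket q.2) * outGain q ^ (3 / 2 : ℝ)
      ≤ k * (m₁ * m₂) ^ 2) :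
    outWeight s q ^ 2 ≤ k * ((bracket p.2 ^ s * m₁) * (bracket (q - p).2 ^ s * m₂)) ^ 2 := by
  have h1 := sq_rpow_le hs hs' (one_le_bracket q.2) (one_le_bracket p.2)
    (one_le_bracket (q - p).2) (bracket_le_add_sub _ _)
  rw [outWeight_sq]
  set P := bracket p.2 ^ s
  set Q := bracket (q - p).2 ^ s
  calc _ ≤ 2 * (bracket p.2 * bracket (q - p).2 / bracket q.2) * (P * Q) ^ 2 *
        outGain q ^ (3 / 2 : ℝ) := by
        gcongr; exact Real.rpow_nonneg (outGain_pos q).le _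
    _ = (2 * (bracket p.2 * bracket (q - p).2 / bracket q.2) * outGain q ^ (3 / 2 : ℝ))
        * (P * Q) ^ 2 := by ring
    _ ≤ k * (m₁ * m₂) ^ 2 * (P * Q) ^ 2 := by gcongr
    _ = _ := by ring

lemma outGain_rpow_le_one (q : ℝ × ℝ) : outGain q ^ (3 / 2 : ℝ) ≤ 1 :=
  (gain_rpow_le _ _).trans (gain_le_one _ _)

lemma outGain_rpow_nonneg (q : ℝ × ℝ) : 0 ≤ outGain q ^ (3 / 2 : ℝ) :=
  Real.rpow_nonneg (outGain_pos q).le _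

lemma outGain_rpow_le_div (q : ℝ × ℝ) : outGain q ^ (3 / 2 : ℝ) ≤ bracket q.2 / modulation q :=
  (gain_rpow_le _ _).trans (gain_le_div _ _)

/-! ### Products with a first factor of low frequency -/

section
variable [SFinite μ] {f₁ f₂ : ℝ × ℝ → ℝ≥0∞} {ε₁ ε₂ : ℝ}

lemma bracket_snd_sub_le {q p : ℝ × ℝ} (h : 8 * bracket p.2 ≤ bracket q.2) :
    bracket (q - p).2 ≤ 9 / 8 * bracket q.2 ∧ 7 / 8 * bracket q.2 ≤ bracket (q - p).2 := by
  have h1 := bracket_le_add_sub q.2 p.2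
  have h2 := bracket_add_le' q.2 (-p.2)
  rw [bracket_neg] at h2
  simp only [Prod.snd_sub]
  rw [sub_eq_add_neg] at *
  constructor <;> linarith

/-- A low first frequency, and a bounded frequency or a high modulation of the second factor. -/
def lowHighSet (ε₂ : ℝ) : Set ((ℝ × ℝ) × (ℝ × ℝ)) :=
  {z | 8 * bracket z.2.2 ≤ bracket z.1.2} ∩
    ({z | |z.2.2| ≤ 1} ∪ {z | bracket z.1.2 ≤ 8 * signedModulation ε₂ (z.1 - z.2)})

lemma measurableSet_lowHighSet (ε₂ : ℝ) : MeasurableSet (lowHighSet ε₂) :=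
  (measurableSet_le (by fun_prop) (by fun_prop)).inter
    ((measurableSet_le (by fun_prop) (by fun_prop)).union
      (measurableSet_le (by fun_prop) (by fun_prop)))

/-- The first factor is measured in `L²_ξ L¹_τ`, the second one in `L²`: for `|ξ₁| ≤ 1` the kernel
`⟨ξ₁⟩⁻²` does, and otherwise the modulation of the second factor is at least `⟨ξ⟩ / 8`, which leaves
the kernel `⟨ξ⟩⁻¹` on `⟨ξ₁⟩ ≤ ⟨ξ⟩ / 8`. -/
lemma exists_lowHigh_le (hs : -1 / 2 ≤ s) (hs' : s ≤ 0) : ∃ C : ℝ≥0, ∀ (μ : Measure ℝ) [SFinite μ],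
    IsFreqMeasure μ → ∀ (ε₁ ε₂ : ℝ) (f₁ f₂ : ℝ × ℝ → ℝ≥0∞), Measurable f₁ → Measurable f₂ →
      ∫⁻ q, piece μ (outWeight s) f₁ f₂ (lowHighSet ε₂) q ^ 2 ∂(stMeasure μ)
        ≤ C * (sqNorm μ s ε₁ f₁ * sqNorm μ s ε₂ f₂) := by
  obtain ⟨C, hC⟩ := exists_lintegral_inv_bracket_sq_le
  refine ⟨9 * C + 54, fun μ _ hμ ε₁ ε₂ f₁ f₂ h₁ h₂ => ?_⟩
  refine (lintegral_sq_piece_le_lOne_lTwo hμ h₁ h₂ (w₁ := yWeight s) (w₂ := xWeight s ε₂)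
    (k := fun x y => 9 * (bracket y ^ 2)⁻¹ + 18 * (bracket x)⁻¹) (by fun_prop) (by fun_prop)
    (yWeight_nonneg s) (xWeight_nonneg s ε₂) (by fun_prop) (fun x y => ?_)
    (D := {z | 8 * bracket z.2 ≤ bracket z.1}) (measurableSet_le (by fun_prop) (by fun_prop))
    (fun q p hz => hz.1) (fun q p hz => ?_) (C := 9 * C + 54) (fun x => ?_)).trans ?_
  · have := bracket_pos x; have := bracket_pos y; positivity
  · have := outWeight_sq_le hs hs' (q := q) (p := p)
      (k := 9 * (bracket p.2 ^ 2)⁻¹ + 18 * (bracket q.2)⁻¹) (m₁ := 1)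
      (m₂ := min (signedModulation ε₂ (q - p)) (bracket (q - p).2)) ?_
    · simpa only [mul_one, xWeight, yWeight] using this
    obtain ⟨hz1, hz2⟩ := hz
    simp only [Set.mem_ofPred_eq, Set.mem_union] at hz1 hz2
    obtain ⟨g1, g2⟩ := bracket_snd_sub_le hz1
    have hT := outGain_rpow_le_one q
    have hT0 := outGain_rpow_nonneg q
    have hm := one_le_min_modulation ε₂ (q - p)
    have hn := one_le_bracket q.2
    have hn1 := one_le_bracket p.2
    have hn2 := one_le_bracket (q - p).2
    set n := bracket q.2
    set n1 := bracket p.2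
    set n2 := bracket (q - p).2
    set m := min (signedModulation ε₂ (q - p)) n2 with hmdef
    have hL : 2 * (n1 * n2 / n) * outGain q ^ (3 / 2 : ℝ) ≤ 9 / 4 * n1 := by
      have h3 : n1 * n2 / n ≤ 9 / 8 * n1 := by rw [div_le_iff₀ (by linarith)]; nlinarith
      have h4 : 0 ≤ n1 * n2 / n := by positivity
      nlinarith
    refine hL.trans ?_
    rw [one_mul, add_mul]
    rcases hz2 with h5 | h5
    · have h6 : n1 ≤ 3 / 2 := bracket_le_of_abs_le_one h5
      have h7 : 4 ≤ 9 * (n1 ^ 2)⁻¹ := by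
        rw [← div_eq_mul_inv, le_div_iff₀ (by positivity)]; nlinarith
      have h8 : 0 ≤ 18 * n⁻¹ * m ^ 2 := by positivity
      nlinarith
    · have h6 : n / 8 ≤ m := le_min (by linarith) (by linarith)
      have h7 : 18 * n⁻¹ * (n / 8) ^ 2 ≤ 18 * n⁻¹ * m ^ 2 := by gcongr
      have h8 : 18 * n⁻¹ * (n / 8) ^ 2 = 9 / 32 * n := by field_simp; norm_num
      have h9 : 0 ≤ 9 * (n1 ^ 2)⁻¹ * m ^ 2 := by positivity
      linarith
  · have hx := one_le_bracket x
    calc _ ≤ ∫⁻ y, 9 * ENNReal.ofReal ((bracket (y - 0) ^ 2)⁻¹) +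
          (Metric.closedBall 0 (bracket x)).indicator
            (fun _ => ENNReal.ofReal (18 * (bracket x)⁻¹)) y ∂μ := by
          refine lintegral_mono fun y => Set.indicator_apply_le' (fun hy => ?_) fun _ => zero_le
          have hy' : y ∈ Metric.closedBall 0 (bracket x) := by
            have h1 := abs_le_bracket y
            have h2 : 8 * bracket y ≤ bracket x := hy
            have h3 := bracket_pos y
            simp only [Metric.mem_closedBall, dist_zero_right, Real.norm_eq_abs]
            linarith
          have h3 := bracket_pos y
          rw [Set.indicator_of_mem hy', show (9 : ℝ≥0∞) = ENNReal.ofReal 9 by simp,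
            ← ENNReal.ofReal_mul (by norm_num), sub_zero, ← ENNReal.ofReal_add (by positivity)
            (by positivity)]
      _ ≤ 9 * C + 54 := by
          rw [lintegral_add_left (by fun_prop), lintegral_const_mul _ (by fun_prop),
            lintegral_indicator_const Metric.isClosed_closedBall.measurableSet]
          gcongr
          · exact hC μ hμ 0
          · calc _ ≤ ENNReal.ofReal (18 * (bracket x)⁻¹) * ENNReal.ofReal (2 * bracket x + 1) := by
                  gcongr; exact hμ.ball _ _ (by linarith)
              _ ≤ ENNReal.ofReal 54 := by
                  rw [← ENNReal.ofReal_mul (by positivity)]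
                  apply ENNReal.ofReal_le_ofReal
                  rw [mul_assoc, ← div_eq_inv_mul, mul_div_assoc', div_le_iff₀ (by linarith)]
                  linarith
              _ = 54 := by simp
      _ = _ := by push_cast; rfl
  · gcongr
    · exact sqNormLOne_le_sqNorm
    · exact lintegral_sq_weighted_le_sqNorm

/-- A low first frequency, and a high output modulation. -/
def lowOutSet : Set ((ℝ × ℝ) × (ℝ × ℝ)) :=
  {z | 8 * bracket z.2.2 ≤ bracket z.1.2} ∩
    {z | bracket z.1.2 * bracket z.2.2 ≤ 8 * modulation z.1}

lemma measurableSet_lowOutSet : MeasurableSet lowOutSet :=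
  (measurableSet_le (by fun_prop) (by fun_prop)).inter
    (measurableSet_le (by fun_prop) (by fun_prop))

/-- The product of the weights loses a factor `⟨ξ₁⟩`; the gain of the output, at most `8 / ⟨ξ₁⟩`, pays for
it. -/
lemma lowOut_aux {q p : ℝ × ℝ} (h : (q, p) ∈ lowOutSet) :
    2 * (bracket p.2 * bracket (q - p).2 / bracket q.2) * outGain q ^ (3 / 2 : ℝ) ≤ 18 := by
  obtain ⟨h1, h2⟩ := h
  simp only [Set.mem_ofPred_eq] at h1 h2
  obtain ⟨g1, g2⟩ := bracket_snd_sub_le h1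
  have hT := outGain_rpow_le_div q
  have hT0 := outGain_rpow_nonneg q
  have hn := one_le_bracket q.2
  have hn1 := one_le_bracket p.2
  have hl : 1 ≤ modulation q := one_le_bracket _
  set n := bracket q.2
  set n1 := bracket p.2
  set n2 := bracket (q - p).2
  have h3 : n1 * n2 / n ≤ 9 / 8 * n1 := by rw [div_le_iff₀ (by linarith)]; nlinarith
  have h5 : n / modulation q ≤ 8 / n1 := by
    rw [div_le_div_iff₀ (by linarith) (by linarith)]; exact h2
  calc 2 * (n1 * n2 / n) * outGain q ^ (3 / 2 : ℝ) ≤ 2 * (9 / 8 * n1) * (8 / n1) := by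
        gcongr; exact hT.trans h5
    _ = 18 := by field_simp; norm_num

/-- If the first factor has a modulation above `⟨ξ₁⟩`, then its weight leaves the integrable kernel
`⟨ξ₁⟩⁻²`. -/
lemma exists_lowOut_le (hs : -1 / 2 ≤ s) (hs' : s ≤ 0) : ∃ C : ℝ≥0, ∀ (μ : Measure ℝ) [SFinite μ],
    IsFreqMeasure μ → ∀ (ε₁ ε₂ : ℝ) (f₁ f₂ : ℝ × ℝ → ℝ≥0∞), Measurable f₁ → Measurable f₂ →
      ∫⁻ q, piece μ (outWeight s) f₁ f₂ (lowOutSet ∩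
          {z | bracket z.2.2 ≤ signedModulation ε₁ z.2}) q ^ 2 ∂(stMeasure μ)
        ≤ C * (sqNorm μ s ε₁ f₁ * sqNorm μ s ε₂ f₂) := by
  obtain ⟨C, hC⟩ := exists_lintegral_inv_bracket_sq_le
  refine ⟨18 * C, fun μ _ hμ ε₁ ε₂ f₁ f₂ h₁ h₂ => ?_⟩
  refine (lintegral_sq_piece_le_lTwo_lOne hμ h₁ h₂ (w₁ := xWeight s ε₁) (w₂ := yWeight s)
    (k := fun _ y => 18 * (bracket y ^ 2)⁻¹) (by fun_prop) (by fun_prop)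
    (xWeight_nonneg s ε₁) (yWeight_nonneg s) (by fun_prop) (fun x y => by positivity)
    (D := Set.univ) .univ (fun q p _ => trivial) (fun q p hz => ?_) (C := 18 * C)
    (fun x => ?_)).trans ?_
  · have := outWeight_sq_le hs hs' (q := q) (p := p) (k := 18 * (bracket p.2 ^ 2)⁻¹)
      (m₁ := min (signedModulation ε₁ p) (bracket p.2)) (m₂ := 1) ?_
    · simpa only [mul_one, xWeight, yWeight] using this
    refine (lowOut_aux hz.1).trans ?_
    have h3 : bracket p.2 ≤ signedModulation ε₁ p := hz.2
    have := bracket_pos p.2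
    rw [min_eq_right h3, mul_one, mul_assoc, inv_mul_cancel₀ (by positivity), mul_one]
  · simp only [Set.indicator_univ]
    calc _ = ∫⁻ y, 18 * ENNReal.ofReal ((bracket (y - 0) ^ 2)⁻¹) ∂μ := by
          refine lintegral_congr fun y => ?_
          rw [ENNReal.ofReal_mul (by norm_num), sub_zero]; simp
      _ ≤ _ := by
          rw [lintegral_const_mul _ (by fun_prop)]; push_cast; gcongr; exact hC μ hμ 0
  · gcongr
    · exact lintegral_sq_weighted_le_sqNorm
    · exact sqNormLOne_le_sqNorm

/-- A low first frequency, a high output modulation, and low modulations of the factors. -/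
def lowOutSet' (ε₁ ε₂ : ℝ) : Set ((ℝ × ℝ) × (ℝ × ℝ)) :=
  (lowOutSet ∩ {z | signedModulation ε₁ z.2 ≤ bracket z.2.2}) ∩
    ({z | 8 * signedModulation ε₂ (z.1 - z.2) ≤ bracket z.1.2} ∩ {z | 1 ≤ |z.1.2|})

lemma measurableSet_lowOutSet' (ε₁ ε₂ : ℝ) : MeasurableSet (lowOutSet' ε₁ ε₂) :=
  (measurableSet_lowOutSet.inter (measurableSet_le (by fun_prop) (by fun_prop))).inter
    ((measurableSet_le (by fun_prop) (by fun_prop)).inter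
      (measurableSet_le (by fun_prop) (by fun_prop)))

/-- If both factors have low modulations, then their weights leave the kernel of
`exists_lintegral_output_kernel_le`. -/
lemma exists_lowOut_le' (hs : -1 / 2 ≤ s) (hs' : s ≤ 0) :
    ∃ C : ℝ≥0, ∀ (μ : Measure ℝ) [SFinite μ], IsFreqMeasure μ → ∀ (ε₁ ε₂ : ℝ),
      (ε₁ = 1 ∨ ε₁ = -1) → (ε₂ = 1 ∨ ε₂ = -1) → ∀ (f₁ f₂ : ℝ × ℝ → ℝ≥0∞),
      Measurable f₁ → Measurable f₂ →
      ∫⁻ q, piece μ (outWeight s) f₁ f₂ (lowOutSet' ε₁ ε₂) q ^ 2 ∂(stMeasure μ)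
        ≤ C * (sqNorm μ s ε₁ f₁ * sqNorm μ s ε₂ f₂) := by
  obtain ⟨C, hC⟩ := exists_lintegral_output_kernel_le
  refine ⟨18 * C, fun μ _ hμ ε₁ ε₂ hε₁ hε₂ f₁ f₂ h₁ h₂ => ?_⟩
  refine (lintegral_sq_piece_le_of_output hμ h₁ h₂ (measurableSet_lowOutSet' ε₁ ε₂)
    (w₁ := xWeight s ε₁) (w₂ := xWeight s ε₂)
    (k := fun q p => 18 * ((signedModulation ε₁ p ^ 2)⁻¹ * (signedModulation ε₂ (q - p) ^ 2)⁻¹))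
    (by fun_prop) (by fun_prop) (xWeight_nonneg s ε₁) (xWeight_nonneg s ε₂)
    (by fun_prop) (fun x y => by positivity) (fun q p hz => ?_) (C := 18 * C)
    (fun q => ?_)).trans ?_
  · refine outWeight_sq_le hs hs' ?_
    obtain ⟨⟨hz1, hz2⟩, hz3, -⟩ := hz
    simp only [Set.mem_ofPred_eq] at hz2 hz3
    refine (lowOut_aux hz1).trans ?_
    have g := (bracket_snd_sub_le hz1.1).2
    simp only at g
    have := one_le_signedModulation ε₁ p
    have := one_le_signedModulation ε₂ (q - p)
    rw [min_eq_left hz2, min_eq_left (by linarith)]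
    apply le_of_eq
    field_simp
  · by_cases hq : 1 ≤ |q.2|
    · calc _ ≤ ∫⁻ p, 18 * ENNReal.ofReal ((signedModulation ε₁ p ^ 2)⁻¹ *
            (signedModulation ε₂ (q - p) ^ 2)⁻¹) ∂(stMeasure μ) := by
            refine lintegral_mono fun p => Set.indicator_apply_le' (fun hy => ?_) fun _ => zero_le
            rw [ENNReal.ofReal_mul (by norm_num)]; simp
        _ ≤ _ := by
            rw [lintegral_const_mul _ (by fun_prop)]; push_cast; gcongr
            exact hC μ hμ ε₁ ε₂ hε₁ hε₂ q hq
    · refine le_trans (le_of_eq ?_) zero_le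
      rw [← lintegral_zero (μ := stMeasure μ)]
      exact lintegral_congr fun p => Set.indicator_of_notMem (fun hz => hq hz.2.2) _
  · gcongr
    · exact lintegral_sq_weighted_le_sqNorm
    · exact lintegral_sq_weighted_le_sqNorm

end


/-! ### The resonance, and a first factor of low frequency that carries it -/

variable {s : ℝ}

/-- The modulation of the output is the sum of those of the factors and of the resonance. -/
lemma resonance_identity (ε₁ ε₂ : ℝ) (q p : ℝ × ℝ) :
    q.1 + q.2 ^ 2 = (p.1 + ε₁ * p.2 ^ 2) + ((q - p).1 + ε₂ * (q - p).2 ^ 2)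
      + (q.2 ^ 2 - ε₁ * p.2 ^ 2 - ε₂ * (q.2 - p.2) ^ 2) := by
  simp only [Prod.fst_sub, Prod.snd_sub]; ring

/-- One of the three modulations is at least a third of the resonance. -/
lemma abs_resonance_le_add (ε₁ ε₂ : ℝ) (q p : ℝ × ℝ) :
    |q.2 ^ 2 - ε₁ * p.2 ^ 2 - ε₂ * (q.2 - p.2) ^ 2|
      ≤ modulation q + signedModulation ε₁ p + signedModulation ε₂ (q - p) := by
  have h1 := abs_le_bracket (q.1 + q.2 ^ 2)
  have h2 := abs_le_bracket (p.1 + ε₁ * p.2 ^ 2)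
  have h3 := abs_le_bracket ((q - p).1 + ε₂ * (q - p).2 ^ 2)
  have e : q.2 ^ 2 - ε₁ * p.2 ^ 2 - ε₂ * (q.2 - p.2) ^ 2
    = (q.1 + q.2 ^ 2) - (p.1 + ε₁ * p.2 ^ 2) - ((q - p).1 + ε₂ * (q - p).2 ^ 2) := by
    rw [resonance_identity ε₁ ε₂ q p]; ring
  rw [e]
  unfold modulation signedModulation
  exact (abs_sub _ _).trans (add_le_add ((abs_sub _ _).trans (add_le_add h1 h2)) h3)

/-- For `|ξ₁| ≪ |ξ|` the resonance is at least of the order `⟨ξ⟩⟨ξ₁⟩`, for all signs. -/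
lemma low_resonance_ge {ε₁ ε₂ x y : ℝ} (h₁ : ε₁ = 1 ∨ ε₁ = -1) (h₂ : ε₂ = 1 ∨ ε₂ = -1)
    (hx : 1 ≤ |x|) (hy : 1 ≤ |y|) (h : 8 * bracket y ≤ bracket x) :
    2 / 3 * (bracket x * bracket y) ≤ |x ^ 2 - ε₁ * y ^ 2 - ε₂ * (x - y) ^ 2| := by
  have a1 := bracket_le_two_mul_abs hx
  have a2 := bracket_le_two_mul_abs hy
  have a3 := abs_le_bracket y
  have a4 := one_le_bracket y
  have a5 : |x| - |y| ≤ |x - y| := abs_sub_abs_le_abs_sub x y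
  have a6 : bracket x * bracket y ≤ 9 / 4 * (|x| * |y|) := by nlinarith
  have a7 : bracket x / 2 ≤ |x - y| := by linarith
  have a8 : bracket x * bracket y ≤ bracket x ^ 2 / 8 := by nlinarith
  have a9 : bracket x ^ 2 ≤ 9 / 4 * x ^ 2 := by nlinarith [sq_abs x]
  have a10 : y ^ 2 ≤ bracket x ^ 2 / 64 := by nlinarith [sq_abs y]
  rcases h₁ with rfl | rfl <;> rcases h₂ with rfl | rfl
  · have : x ^ 2 - 1 * y ^ 2 - 1 * (x - y) ^ 2 = 2 * y * (x - y) := by ring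
    rw [this, abs_mul, abs_mul, abs_two]
    nlinarith [abs_nonneg y]
  · refine le_trans ?_ (le_abs_self _)
    nlinarith [sq_nonneg (x - y)]
  · have : x ^ 2 - -1 * y ^ 2 - 1 * (x - y) ^ 2 = 2 * x * y := by ring
    rw [this, abs_mul, abs_mul, abs_two]
    nlinarith
  · refine le_trans ?_ (le_abs_self _)
    nlinarith [sq_nonneg (x - y), sq_nonneg y]

/-- If the second factor is not conjugated, then the resonance is also at most of the order `⟨ξ⟩⟨ξ₁⟩`. -/
lemma low_resonance_le {ε₁ x y : ℝ} (h₁ : ε₁ = 1 ∨ ε₁ = -1) (h : 8 * bracket y ≤ bracket x) :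
    |x ^ 2 - ε₁ * y ^ 2 - 1 * (x - y) ^ 2| ≤ 9 / 4 * (bracket x * bracket y) := by
  have a1 := abs_le_bracket x
  have a3 := abs_le_bracket y
  have a4 := one_le_bracket y
  have a5 : |x - y| ≤ |x| + |y| := abs_sub x y
  have a6 := bracket_pos x
  rcases h₁ with rfl | rfl
  · have : x ^ 2 - 1 * y ^ 2 - 1 * (x - y) ^ 2 = 2 * y * (x - y) := by ring
    rw [this, abs_mul, abs_mul, abs_two]
    have : |x - y| ≤ 9 / 8 * bracket x := by linarith
    calc 2 * |y| * |x - y| ≤ 2 * bracket y * (9 / 8 * bracket x) := by gcongr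
      _ = _ := by ring
  · have : x ^ 2 - -1 * y ^ 2 - 1 * (x - y) ^ 2 = 2 * x * y := by ring
    rw [this, abs_mul, abs_mul, abs_two]
    calc 2 * |x| * |y| ≤ 2 * bracket x * bracket y := by gcongr
      _ ≤ _ := by nlinarith [one_le_bracket x]

/-- A low first frequency, with low modulations of the output and of the second factor; then the
first factor has the modulation of the resonance. -/
def lowInSet (ε₂ : ℝ) : Set ((ℝ × ℝ) × (ℝ × ℝ)) :=
  ({z | 1 ≤ |z.1.2|} ∩ {z | 1 ≤ |z.2.2|}) ∩ ({z | 8 * bracket z.2.2 ≤ bracket z.1.2} ∩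
    ({z | 8 * signedModulation ε₂ (z.1 - z.2) ≤ bracket z.1.2} ∩
      {z | 8 * modulation z.1 ≤ bracket z.1.2 * bracket z.2.2}))

lemma measurableSet_lowInSet (ε₂ : ℝ) : MeasurableSet (lowInSet ε₂) :=
  ((measurableSet_le (by fun_prop) (by fun_prop)).inter
    (measurableSet_le (by fun_prop) (by fun_prop))).inter
  ((measurableSet_le (by fun_prop) (by fun_prop)).inter
    ((measurableSet_le (by fun_prop) (by fun_prop)).inter
      (measurableSet_le (by fun_prop) (by fun_prop))))

lemma le_signedModulation_of_mem_lowInSet {ε₁ ε₂ : ℝ} (h₁ : ε₁ = 1 ∨ ε₁ = -1)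
    (h₂ : ε₂ = 1 ∨ ε₂ = -1) {q p : ℝ × ℝ} (hz : (q, p) ∈ lowInSet ε₂) :
    bracket q.2 * bracket p.2 ≤ 4 * signedModulation ε₁ p := by
  obtain ⟨⟨z1, z2⟩, z3, z4, z5⟩ := hz
  simp only [Set.mem_ofPred_eq] at z1 z2 z3 z4 z5
  have r1 := low_resonance_ge h₁ h₂ z1 z2 z3
  have r2 := abs_resonance_le_add ε₁ ε₂ q p
  nlinarith [one_le_bracket p.2, one_le_bracket q.2]

lemma bracket_le_signedModulation_of_mem_lowInSet {ε₁ ε₂ : ℝ} (h₁ : ε₁ = 1 ∨ ε₁ = -1)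
    (h₂ : ε₂ = 1 ∨ ε₂ = -1) {q p : ℝ × ℝ} (hz : (q, p) ∈ lowInSet ε₂) :
    bracket p.2 ^ 2 ≤ signedModulation ε₁ p := by
  have h := le_signedModulation_of_mem_lowInSet h₁ h₂ hz
  have z3 : 8 * bracket p.2 ≤ bracket q.2 := hz.2.1
  nlinarith [one_le_bracket p.2]

lemma signedModulation_le_of_mem_lowInSet {ε₁ : ℝ} (h₁ : ε₁ = 1 ∨ ε₁ = -1)
    {q p : ℝ × ℝ} (hz : (q, p) ∈ lowInSet 1) :
    signedModulation ε₁ p ≤ 4 * (bracket q.2 * bracket p.2) := by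
  obtain ⟨⟨z1, z2⟩, z3, z4, z5⟩ := hz
  simp only [Set.mem_ofPred_eq] at z1 z2 z3 z4 z5
  have r1 := low_resonance_le h₁ z3
  have e := resonance_identity ε₁ 1 q p
  set R := q.2 ^ 2 - ε₁ * p.2 ^ 2 - 1 * (q.2 - p.2) ^ 2
  have e' : p.1 + ε₁ * p.2 ^ 2 = (q.1 + q.2 ^ 2) - ((q - p).1 + 1 * (q - p).2 ^ 2) - R := by
    linarith
  have b1 := bracket_le_one_add_abs (p.1 + ε₁ * p.2 ^ 2)
  have b2 := abs_le_bracket (q.1 + q.2 ^ 2)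
  have b3 := abs_le_bracket ((q - p).1 + 1 * (q - p).2 ^ 2)
  have b4 : |p.1 + ε₁ * p.2 ^ 2| ≤ modulation q + signedModulation 1 (q - p) + |R| := by
    rw [e']
    exact (abs_sub _ _).trans (add_le_add ((abs_sub _ _).trans (add_le_add b2 b3)) le_rfl)
  have : signedModulation ε₁ p = bracket (p.1 + ε₁ * p.2 ^ 2) := rfl
  have := one_le_bracket p.2
  have := one_le_bracket q.2
  nlinarith

lemma lowIn_aux {ε₂ : ℝ} {q p : ℝ × ℝ} (hz : (q, p) ∈ lowInSet ε₂) :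
    2 * (bracket p.2 * bracket (q - p).2 / bracket q.2) * outGain q ^ (3 / 2 : ℝ)
      ≤ 9 / 4 * bracket p.2 * outGain q ^ (3 / 2 : ℝ) := by
  have z3 : 8 * bracket p.2 ≤ bracket q.2 := hz.2.1
  obtain ⟨g1, g2⟩ := bracket_snd_sub_le z3
  have hn := one_le_bracket q.2
  have hn1 := one_le_bracket p.2
  have h3 : bracket p.2 * bracket (q - p).2 / bracket q.2 ≤ 9 / 8 * bracket p.2 := by
    rw [div_le_iff₀ (by linarith)]; nlinarith
  have h4 : 2 * (bracket p.2 * bracket (q - p).2 / bracket q.2) ≤ 9 / 4 * bracket p.2 := by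
    linarith
  exact mul_le_mul_of_nonneg_right h4 (outGain_rpow_nonneg q)

/-- For `s > -1 / 2`: the modulation of the first factor is at least `⟨ξ₁⟩ ^ 2`, so its weight is
`⟨ξ₁⟩ ^ (s + 1)`, which leaves the integrable kernel `⟨ξ₁⟩ ^ (-(2 s + 2))`. -/
lemma exists_lowIn_le_of_lt (hs : -1 / 2 < s) (hs' : s ≤ 0) :
    ∃ C : ℝ≥0, ∀ (μ : Measure ℝ) [SFinite μ], IsFreqMeasure μ → ∀ (ε₁ ε₂ : ℝ),
      (ε₁ = 1 ∨ ε₁ = -1) → (ε₂ = 1 ∨ ε₂ = -1) → ∀ (f₁ f₂ : ℝ × ℝ → ℝ≥0∞),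
      Measurable f₁ → Measurable f₂ →
      ∫⁻ q, piece μ (outWeight s) f₁ f₂ (lowInSet ε₂) q ^ 2 ∂(stMeasure μ)
        ≤ C * (sqNorm μ s ε₁ f₁ * sqNorm μ s ε₂ f₂) := by
  obtain ⟨C, hC⟩ := exists_lintegral_bracket_rpow_le (β := 2 * s + 2) (by linarith)
  refine ⟨4 * C, fun μ _ hμ ε₁ ε₂ hε₁ hε₂ f₁ f₂ h₁ h₂ => ?_⟩
  refine (lintegral_sq_piece_le_lTwo_lOne hμ h₁ h₂ (w₁ := xWeight s ε₁) (w₂ := yWeight s)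
    (k := fun _ y => 4 * bracket y ^ (-(2 * s + 2))) (by fun_prop) (by fun_prop)
    (xWeight_nonneg s ε₁) (yWeight_nonneg s) (by fun_prop)
    (fun x y => by have := bracket_pos y; positivity)
    (D := Set.univ) .univ (fun q p _ => trivial) (fun q p hz => ?_) (C := 4 * C)
    (fun x => ?_)).trans ?_
  · have z3 : 8 * bracket p.2 ≤ bracket q.2 := hz.2.1
    have g := bracket_snd_sub_le z3
    have hm := bracket_le_signedModulation_of_mem_lowInSet hε₁ hε₂ hz
    have hn := bracket_pos q.2
    have hn1 := one_le_bracket p.2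
    have hn2 := bracket_pos (q - p).2
    have e1 : xWeight s ε₁ p = bracket p.2 ^ (s + 1) := by
      rw [xWeight, min_eq_right (by nlinarith), Real.rpow_add_one (by positivity)]
    have e2 : bracket q.2 ^ s ≤ 2 * yWeight s (q - p) := by
      rw [yWeight]
      calc bracket q.2 ^ s = 2 * (2 ^ (-1 : ℝ) * bracket q.2 ^ s) := by
            rw [Real.rpow_neg_one]; ring
        _ ≤ 2 * (2 ^ s * bracket q.2 ^ s) := by
            gcongr
            · norm_num
            · linarith
        _ = 2 * (2 * bracket q.2) ^ s := by rw [Real.mul_rpow (by norm_num) hn.le]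
        _ ≤ _ := by
            gcongr 2 * ?_
            exact Real.rpow_le_rpow_of_nonpos hn2 (by linarith) hs'
    rw [outWeight_sq, e1, mul_pow, mul_assoc, ← mul_assoc (bracket p.2 ^ _),
      ← Real.rpow_natCast (bracket p.2 ^ (s + 1)), ← Real.rpow_mul (by positivity),
      ← Real.rpow_add (by positivity)]
    have e3 : -(2 * s + 2) + (s + 1) * (2 : ℕ) = 0 := by push_cast; ring
    rw [e3, Real.rpow_zero, one_mul]
    have h0 : 0 ≤ bracket q.2 ^ s := by positivity
    calc (bracket q.2 ^ s) ^ 2 * outGain q ^ (3 / 2 : ℝ) ≤ (bracket q.2 ^ s) ^ 2 * 1 := by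
          gcongr; exact outGain_rpow_le_one q
      _ ≤ (2 * yWeight s (q - p)) ^ 2 := by rw [mul_one]; gcongr
      _ = _ := by ring
  · simp only [Set.indicator_univ]
    calc _ = ∫⁻ y, 4 * ENNReal.ofReal (bracket (y - 0) ^ (-(2 * s + 2))) ∂μ := by
          refine lintegral_congr fun y => ?_
          rw [ENNReal.ofReal_mul (by norm_num), sub_zero]; simp
      _ ≤ _ := by
          rw [lintegral_const_mul _ (by fun_prop)]; push_cast; gcongr; exact hC μ hμ 0
  · gcongr
    · exact lintegral_sq_weighted_le_sqNorm
    · exact sqNormLOne_le_sqNorm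

/-- For a conjugated second factor, also at `s = -1 / 2`: the phase is quadratic in the output frequency,
so the gain is integrable for a fixed frequency of the first factor. -/
lemma exists_lowIn_le_of_conj (hs : -1 / 2 ≤ s) (hs' : s ≤ 0) :
    ∃ C : ℝ≥0, ∀ (μ : Measure ℝ) [SFinite μ], IsFreqMeasure μ → ∀ (ε₁ : ℝ),
      (ε₁ = 1 ∨ ε₁ = -1) → ∀ (f₁ f₂ : ℝ × ℝ → ℝ≥0∞),
      Measurable f₁ → Measurable f₂ →
      ∫⁻ q, piece μ (outWeight s) f₁ f₂ (lowInSet (-1)) q ^ 2 ∂(stMeasure μ)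
        ≤ C * (sqNorm μ s ε₁ f₁ * sqNorm μ s (-1) f₂) := by
  obtain ⟨C₁, hC₁⟩ := exists_lintegral_gain_low_le
  obtain ⟨C₂, hC₂⟩ := exists_lintegral_input_kernel_le
  refine ⟨3 * (C₂ * C₁), fun μ _ hμ ε₁ hε₁ f₁ f₂ h₁ h₂ => ?_⟩
  refine (lintegral_sq_piece_le_of_input hμ h₁ h₂ (measurableSet_lowInSet (-1))
    (w₁ := xWeight s ε₁) (w₂ := xWeight s (-1))
    (k := fun q p => 3 * ((signedModulation (-1) (q - p) ^ 2)⁻¹ * outGain q ^ (3 / 2 : ℝ)))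
    (by fun_prop) (by fun_prop) (xWeight_nonneg s ε₁) (xWeight_nonneg s (-1))
    (by fun_prop) (fun q p => by have := outGain_rpow_nonneg q; positivity)
    (fun q p hz => ?_) (C := 3 * (C₂ * C₁)) (fun p => ?_)).trans ?_
  · refine outWeight_sq_le hs hs' ((lowIn_aux hz).trans ?_)
    have hm := bracket_le_signedModulation_of_mem_lowInSet hε₁ (Or.inr rfl) hz
    obtain ⟨⟨z1, z2⟩, z3, z4, z5⟩ := hz
    simp only [Set.mem_ofPred_eq] at z1 z2 z3 z4 z5
    have g := bracket_snd_sub_le z3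
    have hn1 := one_le_bracket p.2
    have hl := one_le_signedModulation (-1) (q - p)
    have hT := outGain_rpow_nonneg q
    rw [min_eq_right (by nlinarith : bracket p.2 ≤ signedModulation ε₁ p),
      min_eq_left (by linarith)]
    have e : 3 * ((signedModulation (-1) (q - p) ^ 2)⁻¹ * outGain q ^ (3 / 2 : ℝ)) *
        (bracket p.2 * signedModulation (-1) (q - p)) ^ 2
        = 3 * bracket p.2 ^ 2 * outGain q ^ (3 / 2 : ℝ) := by field_simp
    rw [e]
    refine mul_le_mul_of_nonneg_right ?_ hT
    nlinarith
  · set A : Set (ℝ × ℝ) := {z | 1 ≤ |z.1|} ∩ {z | 8 * bracket p.2 ≤ bracket z.1} with hA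
    set H : ℝ → ℝ → ℝ≥0∞ := fun x σ =>
      A.indicator (fun z => ENNReal.ofReal (gain z.1 z.2 ^ (3 / 2 : ℝ))) (x, σ) with hH
    have hHm : Measurable (Function.uncurry H) := by
      have : Function.uncurry H =
          A.indicator fun z => ENNReal.ofReal (gain z.1 z.2 ^ (3 / 2 : ℝ)) := by
        ext z; rfl
      rw [this]
      exact Measurable.indicator (by fun_prop) ((measurableSet_le (by fun_prop) (by fun_prop)).inter
        (measurableSet_le (by fun_prop) (by fun_prop)))
    calc _ ≤ ∫⁻ q, 3 * (ENNReal.ofReal ((signedModulation (-1) (q - p) ^ 2)⁻¹) *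
          H q.2 (q.1 + q.2 ^ 2)) ∂(stMeasure μ) := by
          refine lintegral_mono fun q => Set.indicator_apply_le' (fun hz => ?_) fun _ => zero_le
          have hx : (q.2, q.1 + q.2 ^ 2) ∈ A := ⟨hz.1.1, hz.2.1⟩
          rw [ENNReal.ofReal_mul (by norm_num), ENNReal.ofReal_mul (by positivity)]
          simp only [hH, Set.indicator_of_mem hx]
          rw [outGain]; simp
      _ ≤ 3 * (C₂ * C₁) := by
          have hHm' : Measurable fun z : ℝ × ℝ => H z.1 z.2 := hHm
          rw [lintegral_const_mul _ (by fun_prop)]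
          gcongr
          refine hC₂ μ (-1) p H hHm C₁ fun c => ?_
          refine le_trans (lintegral_mono fun x => ?_) (hC₁ μ hμ p.2 c)
          simp only [hH, neg_one_mul, sub_neg_eq_add]
          refine Set.indicator_apply_le' (fun hz => ?_) fun _ => zero_le
          rw [Set.indicator_of_mem (show x ∈ {x | 1 ≤ |x| ∧ 8 * bracket p.2 ≤ bracket x} from hz)]
      _ = _ := by push_cast; rfl
  · gcongr
    · exact lintegral_sq_weighted_le_sqNorm
    · exact lintegral_sq_weighted_le_sqNorm

/-- The kernel `⟨y⟩⁻¹` has a bounded integral over a dyadic shell. -/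
lemma lintegral_low_dyadic_le {μ : Measure ℝ} (hμ : IsFreqMeasure μ) (j : ℕ) (x : ℝ) :
    ∫⁻ y, ({z : ℝ × ℝ | (2 : ℝ) ^ j ≤ 4 * (bracket z.1 * bracket z.2)} ∩
      {z | bracket z.1 * bracket z.2 ≤ 8 * 2 ^ j}).indicator
        (fun z => ENNReal.ofReal (9 / 4 * (bracket z.2)⁻¹)) (x, y) ∂μ ≤ (216 : ℝ≥0) := by
  have hn := bracket_pos x
  set Q : ℝ := 2 ^ j / (4 * bracket x) with hQ
  have hQ0 : 0 < Q := by positivity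
  calc _ ≤ ∫⁻ y, {y | bracket y ≤ 32 * Q}.indicator
        (fun _ => ENNReal.ofReal (9 / 4 * Q⁻¹)) y ∂μ := by
        refine lintegral_mono fun y => Set.indicator_apply_le' (fun hz => ?_) fun _ => zero_le
        obtain ⟨z1, z2⟩ := hz
        simp only [Set.mem_ofPred_eq] at z1 z2
        have h1 := bracket_pos y
        have h2 : bracket y ≤ 32 * Q := by
          rw [hQ, mul_div_assoc', le_div_iff₀ (by positivity)]; nlinarith
        have h3 : Q ≤ bracket y := by
          rw [hQ, div_le_iff₀ (by positivity)]; nlinarith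
        rw [Set.indicator_of_mem (show y ∈ {y | bracket y ≤ 32 * Q} from h2)]
        apply ENNReal.ofReal_le_ofReal
        gcongr
    _ = ENNReal.ofReal (9 / 4 * Q⁻¹) * μ {y | bracket y ≤ 32 * Q} :=
        lintegral_indicator_const (measurableSet_le (by fun_prop) (by fun_prop)) _
    _ ≤ ENNReal.ofReal 216 := by
        rcases le_or_gt 1 (32 * Q) with h | h
        · calc _ ≤ ENNReal.ofReal (9 / 4 * Q⁻¹) * μ (Metric.closedBall 0 (32 * Q)) := by
                gcongr
                intro y hy
                simpa using (abs_le_bracket y).trans hy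
            _ ≤ ENNReal.ofReal (9 / 4 * Q⁻¹) * ENNReal.ofReal (2 * (32 * Q) + 1) := by
                gcongr; exact hμ.ball _ _ (by linarith)
            _ ≤ _ := by
                rw [← ENNReal.ofReal_mul (by positivity)]
                apply ENNReal.ofReal_le_ofReal
                rw [mul_assoc, ← div_eq_inv_mul, mul_div_assoc', div_le_iff₀ hQ0]
                linarith
        · have : {y | bracket y ≤ 32 * Q} = ∅ := by
            ext y
            simp only [Set.mem_ofPred_eq, Set.mem_empty_iff_false, iff_false, not_le]
            linarith [one_le_bracket y]
          rw [this]; simp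
    _ = _ := by
        rw [ENNReal.ofReal]; congr 1
        rw [Real.toNNReal_ofNat]

/-- At `s = -1 / 2` the kernel of `exists_lowIn_le_of_lt` is `⟨ξ₁⟩⁻¹`, whose integral diverges
logarithmically. But for a second factor that is not conjugated the modulation of the first factor is
of the order `⟨ξ⟩⟨ξ₁⟩`, so that a dyadic modulation and the output frequency confine `⟨ξ₁⟩` to a
dyadic shell, and the modulations are summed by `besovNorm`. -/
lemma exists_lowIn_le_of_endpoint (hs : s = -1 / 2) :
    ∃ C : ℝ≥0, ∀ (μ : Measure ℝ) [SFinite μ], IsFreqMeasure μ → ∀ (ε₁ : ℝ),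
      (ε₁ = 1 ∨ ε₁ = -1) → ∀ (f₁ f₂ : ℝ × ℝ → ℝ≥0∞),
      Measurable f₁ → Measurable f₂ →
      ∫⁻ q, piece μ (outWeight s) f₁ f₂ (lowInSet 1) q ^ 2 ∂(stMeasure μ)
        ≤ C * (sqNorm μ s ε₁ f₁ * sqNorm μ s 1 f₂) := by
  refine ⟨216, fun μ _ hμ ε₁ hε₁ f₁ f₂ h₁ h₂ => ?_⟩
  set S : ℕ → Set ((ℝ × ℝ) × (ℝ × ℝ)) := fun j => lowInSet 1 ∩ {z | z.2 ∈ farDyadic ε₁ j} with hS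
  have hSm : ∀ j, MeasurableSet (S j) := fun j => (measurableSet_lowInSet 1).inter
    ((measurableSet_farDyadic ε₁ j).preimage measurable_snd)
  have hbound : ∀ j, ∫⁻ q, piece μ (outWeight s) f₁ f₂ (S j) q ^ 2 ∂(stMeasure μ) ≤
      (216 : ℝ≥0) * ((∫⁻ p, weighted (fun p => bracket p.2 ^ (s + 1))
        ((farDyadic ε₁ j).indicator f₁) p ^ 2 ∂(stMeasure μ)) * sqNorm μ s 1 f₂) := by
    intro j
    have e : ∀ q, piece μ (outWeight s) f₁ f₂ (S j) q
        = piece μ (outWeight s) ((farDyadic ε₁ j).indicator f₁) f₂ (S j) q := by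
      intro q
      refine lintegral_congr fun p => ?_
      by_cases hz : (q, p) ∈ S j
      · rw [Set.indicator_of_mem hz, Set.indicator_of_mem hz,
          Set.indicator_of_mem (show p ∈ farDyadic ε₁ j from hz.2)]
      · rw [Set.indicator_of_notMem hz, Set.indicator_of_notMem hz]
    simp only [e]
    refine (lintegral_sq_piece_le_lTwo_lOne hμ (h₁.indicator (measurableSet_farDyadic ε₁ j)) h₂
      (w₁ := fun p => bracket p.2 ^ (s + 1)) (w₂ := yWeight s)
      (k := fun _ y => 9 / 4 * (bracket y)⁻¹) (by fun_prop) (by fun_prop)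
      (fun p => Real.rpow_nonneg (bracket_pos _).le _) (yWeight_nonneg s) (by fun_prop)
      (fun x y => by have := bracket_pos y; positivity)
      (D := {z : ℝ × ℝ | (2 : ℝ) ^ j ≤ 4 * (bracket z.1 * bracket z.2)} ∩
        {z | bracket z.1 * bracket z.2 ≤ 8 * 2 ^ j})
      ((measurableSet_le (by fun_prop) (by fun_prop)).inter
        (measurableSet_le (by fun_prop) (by fun_prop)))
      (fun q p hz => ?_) (fun q p hz => ?_) (lintegral_low_dyadic_le hμ j)).trans ?_
    · obtain ⟨hz, ⟨d1, d2⟩, d3⟩ := hz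
      simp only [Set.mem_ofPred_eq] at d1 d2 d3
      have b1 := le_signedModulation_of_mem_lowInSet hε₁ (Or.inl rfl) hz
      have b2 := signedModulation_le_of_mem_lowInSet hε₁ hz
      rw [pow_succ] at d2
      exact ⟨d1.trans b2, show bracket q.2 * bracket p.2 ≤ 8 * 2 ^ j by linarith⟩
    · have hn1 := bracket_pos p.2
      have := outWeight_sq_le (s := s) (by linarith) (by linarith) (q := q) (p := p)
        (k := 9 / 4 * (bracket p.2)⁻¹) (m₁ := bracket p.2) (m₂ := 1) ?_
      · rw [Real.rpow_add_one hn1.ne']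
        simpa only [mul_one, yWeight] using this
      · refine (lowIn_aux hz.1).trans ?_
        calc 9 / 4 * bracket p.2 * outGain q ^ (3 / 2 : ℝ) ≤ 9 / 4 * bracket p.2 * 1 := by
              gcongr; exact outGain_rpow_le_one q
          _ = _ := by field_simp
    · gcongr
      exact sqNormLOne_le_sqNorm
  have hsum : ∀ q, piece μ (outWeight s) f₁ f₂ (lowInSet 1) q
      ≤ ∑' j, piece μ (outWeight s) f₁ f₂ (S j) q := by
    intro q
    unfold piece
    rw [← lintegral_tsum]
    · refine lintegral_mono fun p => ?_
      by_cases hz : (q, p) ∈ lowInSet 1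
      · obtain ⟨j, hj, hj'⟩ := exists_nat_pow_near (one_le_signedModulation ε₁ p)
          (one_lt_two (α := ℝ))
        have hmem : (q, p) ∈ S j := ⟨hz, ⟨hj, hj'⟩,
          bracket_le_signedModulation_of_mem_lowInSet hε₁ (Or.inl rfl) hz⟩
        refine le_trans (le_of_eq ?_) (ENNReal.le_tsum j)
        rw [Set.indicator_of_mem hz, Set.indicator_of_mem hmem]
      · rw [Set.indicator_of_notMem hz]; exact zero_le
    · intro j
      have : Measurable ((S j).indicator
        fun z => ENNReal.ofReal (outWeight s z.1) * (f₁ z.2 * f₂ (z.1 - z.2))) :=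
        Measurable.indicator (by fun_prop) (hSm j)
      exact (this.comp (by fun_prop : Measurable fun p : ℝ × ℝ => (q, p))).aemeasurable
  calc ∫⁻ q, piece μ (outWeight s) f₁ f₂ (lowInSet 1) q ^ 2 ∂(stMeasure μ)
      ≤ ∫⁻ q, (∑' j, piece μ (outWeight s) f₁ f₂ (S j) q) ^ 2 ∂(stMeasure μ) := by
        gcongr with q; exact hsum q
    _ ≤ (∑' j, (∫⁻ q, piece μ (outWeight s) f₁ f₂ (S j) q ^ 2 ∂(stMeasure μ)) ^ (1 / 2 : ℝ)) ^ 2 :=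
        lintegral_sq_tsum_le fun j => measurable_piece (by fun_prop) h₁ h₂ (hSm j)
    _ ≤ (∑' j, ((216 : ℝ≥0) * sqNorm μ s 1 f₂ : ℝ≥0∞) ^ (1 / 2 : ℝ) *
          (∫⁻ p, weighted (fun p => bracket p.2 ^ (s + 1))
            ((farDyadic ε₁ j).indicator f₁) p ^ 2 ∂(stMeasure μ)) ^ (1 / 2 : ℝ)) ^ 2 := by
        gcongr with j
        rw [← ENNReal.mul_rpow_of_nonneg _ _ (by norm_num)]
        gcongr
        refine (hbound j).trans (le_of_eq (by ring))
    _ = (216 : ℝ≥0) * (besovNorm μ s ε₁ f₁ ^ 2 * sqNorm μ s 1 f₂) := by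
        rw [ENNReal.tsum_mul_left, mul_pow, ← ENNReal.rpow_natCast (_ ^ (1 / 2 : ℝ)),
          ← ENNReal.rpow_mul]
        norm_num
        rw [besovNorm]; ring
    _ ≤ _ := by
        gcongr
        exact besovNorm_sq_le_sqNorm hs


variable {s : ℝ}

/-! ### Products of two factors of high frequency -/

/-- Both frequencies of the factors are high, and the first factor carries the resonance. -/
def highInSet (ε₁ : ℝ) : Set ((ℝ × ℝ) × (ℝ × ℝ)) :=
  ({z | bracket z.1.2 ≤ 8 * bracket z.2.2} ∩ {z | bracket z.1.2 ≤ 8 * bracket (z.1 - z.2).2}) ∩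
    {z | bracket z.1.2 * bracket z.2.2 ≤ 1500 * signedModulation ε₁ z.2}

lemma measurableSet_highInSet (ε₁ : ℝ) : MeasurableSet (highInSet ε₁) :=
  ((measurableSet_le (by fun_prop) (by fun_prop)).inter
    (measurableSet_le (by fun_prop) (by fun_prop))).inter
    (measurableSet_le (by fun_prop) (by fun_prop))

/-- The first factor has the full weight `⟨ξ₁⟩ ^ (s + 1)`, up to a constant. The weight of the second
factor contains its modulation or `⟨ξ₂⟩ ≥ ⟨ξ⟩ / 8`; both kernels are integrable over the output
frequency. -/
lemma exists_highIn_le (hs : -1 / 2 ≤ s) (hs' : s ≤ 0) :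
    ∃ C : ℝ≥0, ∀ (μ : Measure ℝ) [SFinite μ], IsFreqMeasure μ → ∀ (ε₁ ε₂ : ℝ),
      (ε₂ = 1 ∨ ε₂ = -1) → ∀ (f₁ f₂ : ℝ × ℝ → ℝ≥0∞), Measurable f₁ → Measurable f₂ →
      ∫⁻ q, piece μ (outWeight s) f₁ f₂ (highInSet ε₁) q ^ 2 ∂(stMeasure μ)
        ≤ C * (sqNorm μ s ε₁ f₁ * sqNorm μ s ε₂ f₂) := by
  obtain ⟨C₁, hC₁⟩ := exists_lintegral_gain_high_le
  obtain ⟨C₂, hC₂⟩ := exists_lintegral_input_kernel_le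
  obtain ⟨C₃, hC₃⟩ := exists_lintegral_gain_le
  set K : ℝ≥0 := 18 * 1500 ^ 2 with hK
  refine ⟨K * (C₂ * C₁ + 64 * C₃), fun μ _ hμ ε₁ ε₂ hε₂ f₁ f₂ h₁ h₂ => ?_⟩
  refine (lintegral_sq_piece_le_of_input hμ h₁ h₂ (measurableSet_highInSet ε₁)
    (w₁ := xWeight s ε₁) (w₂ := xWeight s ε₂)
    (k := fun q p => K * ((signedModulation ε₂ (q - p) ^ 2)⁻¹ *
        ((bracket q.2)⁻¹ * outGain q ^ (3 / 2 : ℝ)) +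
      64 * ((bracket q.2 ^ 3)⁻¹ * outGain q ^ (3 / 2 : ℝ))))
    (by fun_prop) (by fun_prop) (xWeight_nonneg s ε₁) (xWeight_nonneg s ε₂)
    (by fun_prop) (fun q p => by
      have := outGain_rpow_nonneg q; have := bracket_pos q.2; positivity)
    (fun q p hz => ?_) (C := K * (C₂ * C₁ + 64 * C₃)) (fun p => ?_)).trans ?_
  · refine outWeight_sq_le hs hs' ?_
    obtain ⟨⟨z1, z2⟩, z3⟩ := hz
    simp only [Set.mem_ofPred_eq] at z1 z2 z3
    have hn := one_le_bracket q.2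
    have hn1 := one_le_bracket p.2
    have hn2 := one_le_bracket (q - p).2
    have hl := one_le_signedModulation ε₂ (q - p)
    have hT := outGain_rpow_nonneg q
    have g1 := bracket_add_le' q.2 (-p.2)
    rw [bracket_neg, ← sub_eq_add_neg] at g1
    have g2 : bracket (q - p).2 ≤ 9 * bracket p.2 := by
      rw [Prod.snd_sub]; linarith
    set n := bracket q.2
    set n1 := bracket p.2
    set n2 := bracket (q - p).2
    set l2 := signedModulation ε₂ (q - p)
    set T := outGain q ^ (3 / 2 : ℝ)
    have hm1 : n1 / 1500 ≤ min (signedModulation ε₁ p) n1 := le_min (by nlinarith) (by linarith)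
    have hm2 : 1 ≤ ((l2 ^ 2)⁻¹ + 64 * (n ^ 2)⁻¹) * min l2 n2 ^ 2 := by
      rcases min_choice l2 n2 with h | h <;> rw [h, add_mul]
      · rw [inv_mul_cancel₀ (by positivity)]
        have : 0 ≤ 64 * (n ^ 2)⁻¹ * l2 ^ 2 := by positivity
        linarith
      · have h1 : 1 ≤ 64 * (n ^ 2)⁻¹ * n2 ^ 2 := by
          rw [mul_assoc, ← div_eq_inv_mul, mul_div_assoc', one_le_div (by positivity)]
          nlinarith
        have : 0 ≤ (l2 ^ 2)⁻¹ * n2 ^ 2 := by positivity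
        linarith
    calc 2 * (n1 * n2 / n) * T ≤ 2 * (n1 * (9 * n1) / n) * T := by gcongr
      _ = 18 * 1500 ^ 2 * (T / n) * ((n1 / 1500) ^ 2 * 1) := by field_simp; norm_num; ring
      _ ≤ 18 * 1500 ^ 2 * (T / n) * ((min (signedModulation ε₁ p) n1) ^ 2 *
          (((l2 ^ 2)⁻¹ + 64 * (n ^ 2)⁻¹) * min l2 n2 ^ 2)) := by gcongr
      _ = _ := by rw [hK]; push_cast; field_simp
  · set A : Set (ℝ × ℝ) := {z | bracket z.1 ≤ 8 * bracket p.2} with hA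
    set H : ℝ → ℝ → ℝ≥0∞ := fun x σ =>
      A.indicator (fun z => ENNReal.ofReal ((bracket z.1)⁻¹ * gain z.1 z.2 ^ (3 / 2 : ℝ))) (x, σ)
      with hH
    have hHm : Measurable (Function.uncurry H) := by
      have : Function.uncurry H =
          A.indicator fun z => ENNReal.ofReal ((bracket z.1)⁻¹ * gain z.1 z.2 ^ (3 / 2 : ℝ)) := by
        ext z; rfl
      rw [this]
      exact Measurable.indicator (by fun_prop) (measurableSet_le (by fun_prop) (by fun_prop))
    have hHm' : Measurable fun z : ℝ × ℝ => H z.1 z.2 := hHm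
    calc _ ≤ ∫⁻ q, K * (ENNReal.ofReal ((signedModulation ε₂ (q - p) ^ 2)⁻¹) *
          H q.2 (q.1 + q.2 ^ 2) + 64 * ENNReal.ofReal ((bracket q.2 ^ 3)⁻¹ *
            outGain q ^ (3 / 2 : ℝ))) ∂(stMeasure μ) := by
          refine lintegral_mono fun q => Set.indicator_apply_le' (fun hz => ?_) fun _ => zero_le
          have hx : (q.2, q.1 + q.2 ^ 2) ∈ A := hz.1.1
          have hT := outGain_rpow_nonneg q
          have hn := bracket_pos q.2
          simp only [hH, Set.indicator_of_mem hx]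
          rw [ENNReal.ofReal_mul (by positivity), ENNReal.ofReal_coe_nnreal,
            ENNReal.ofReal_add (by positivity) (by positivity),
            ENNReal.ofReal_mul (p := (signedModulation ε₂ (q - p) ^ 2)⁻¹) (by positivity),
            ENNReal.ofReal_mul (p := 64) (by positivity), ENNReal.ofReal_ofNat]
          rfl
      _ ≤ K * (C₂ * C₁ + 64 * C₃) := by
          rw [lintegral_const_mul _ (by fun_prop), lintegral_add_left (by fun_prop),
            lintegral_const_mul _ (by fun_prop)]
          gcongr
          · refine hC₂ μ ε₂ p H hHm C₁ fun c => ?_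
            refine le_trans (lintegral_mono fun x => ?_) (hC₁ μ hμ ε₂ hε₂ p.2 c)
            simp only [hH]
            refine Set.indicator_apply_le' (fun hz => ?_) fun _ => zero_le
            rw [Set.indicator_of_mem (show x ∈ {x | bracket x ≤ 8 * bracket p.2} from hz)]
          · exact hC₃ μ hμ
      _ = _ := by push_cast; rfl
  · gcongr
    · exact lintegral_sq_weighted_le_sqNorm
    · exact lintegral_sq_weighted_le_sqNorm

/-- The interactions with output frequency at least `1` in which the first factor has a low
frequency, or has a high frequency and carries the resonance. -/
def firstSet (ε₁ : ℝ) : Set ((ℝ × ℝ) × (ℝ × ℝ)) :=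
  {z | 1 ≤ |z.1.2|} ∩ ({z | 8 * bracket z.2.2 ≤ bracket z.1.2} ∪ highInSet ε₁)

lemma measurableSet_firstSet (ε₁ : ℝ) : MeasurableSet (firstSet ε₁) :=
  (measurableSet_le (by fun_prop) (by fun_prop)).inter
    ((measurableSet_le (by fun_prop) (by fun_prop)).union (measurableSet_highInSet ε₁))

lemma firstSet_subset (ε₁ ε₂ : ℝ) : firstSet ε₁ ⊆ lowHighSet ε₂ ∪
    ((lowOutSet ∩ {z | bracket z.2.2 ≤ signedModulation ε₁ z.2}) ∪ (lowOutSet' ε₁ ε₂ ∪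
      (lowInSet ε₂ ∪ highInSet ε₁))) := by
  rintro ⟨q, p⟩ ⟨z1, z2⟩
  by_cases hH : (q, p) ∈ highInSet ε₁
  · exact Or.inr (Or.inr (Or.inr (Or.inr hH)))
  have z3 : 8 * bracket p.2 ≤ bracket q.2 := z2.resolve_right hH
  rcases le_total |p.2| 1 with h1 | h1
  · exact Or.inl ⟨z3, Or.inl h1⟩
  rcases le_total (bracket q.2) (8 * signedModulation ε₂ (q - p)) with h2 | h2
  · exact Or.inl ⟨z3, Or.inr h2⟩
  rcases le_total (bracket q.2 * bracket p.2) (8 * modulation q) with h3 | h3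
  · rcases le_total (bracket p.2) (signedModulation ε₁ p) with h4 | h4
    · exact Or.inr (Or.inl ⟨⟨z3, h3⟩, h4⟩)
    · exact Or.inr (Or.inr (Or.inl ⟨⟨⟨z3, h3⟩, h4⟩, h2, z1⟩))
  · exact Or.inr (Or.inr (Or.inr (Or.inl ⟨⟨z1, h1⟩, z3, h2, h3⟩)))

lemma exists_lowIn_le (hs : -1 / 2 ≤ s) (hs' : s ≤ 0) :
    ∃ C : ℝ≥0, ∀ (μ : Measure ℝ) [SFinite μ], IsFreqMeasure μ → ∀ (ε₁ ε₂ : ℝ),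
      (ε₁ = 1 ∨ ε₁ = -1) → (ε₂ = 1 ∨ ε₂ = -1) → ∀ (f₁ f₂ : ℝ × ℝ → ℝ≥0∞),
      Measurable f₁ → Measurable f₂ →
      ∫⁻ q, piece μ (outWeight s) f₁ f₂ (lowInSet ε₂) q ^ 2 ∂(stMeasure μ)
        ≤ C * (sqNorm μ s ε₁ f₁ * sqNorm μ s ε₂ f₂) := by
  rcases hs.lt_or_eq with h | h
  · exact exists_lowIn_le_of_lt h hs'
  obtain ⟨A, hA⟩ := exists_lowIn_le_of_conj hs hs'
  obtain ⟨B, hB⟩ := exists_lowIn_le_of_endpoint h.symm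
  refine ⟨A + B, fun μ _ hμ ε₁ ε₂ hε₁ hε₂ f₁ f₂ h₁ h₂ => ?_⟩
  rcases hε₂ with rfl | rfl
  · refine (hB μ hμ ε₁ hε₁ f₁ f₂ h₁ h₂).trans ?_
    gcongr
    simp
  · refine (hA μ hμ ε₁ hε₁ f₁ f₂ h₁ h₂).trans ?_
    gcongr
    simp

lemma exists_first_le (hs : -1 / 2 ≤ s) (hs' : s ≤ 0) :
    ∃ C : ℝ≥0, ∀ (μ : Measure ℝ) [SFinite μ], IsFreqMeasure μ → ∀ (ε₁ ε₂ : ℝ),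
      (ε₁ = 1 ∨ ε₁ = -1) → (ε₂ = 1 ∨ ε₂ = -1) → ∀ (f₁ f₂ : ℝ × ℝ → ℝ≥0∞),
      Measurable f₁ → Measurable f₂ →
      ∫⁻ q, piece μ (outWeight s) f₁ f₂ (firstSet ε₁) q ^ 2 ∂(stMeasure μ)
        ≤ C * (sqNorm μ s ε₁ f₁ * sqNorm μ s ε₂ f₂) := by
  obtain ⟨A, hA⟩ := exists_lowHigh_le hs hs'
  obtain ⟨B, hB⟩ := exists_lowOut_le hs hs'
  obtain ⟨D, hD⟩ := exists_lowOut_le' hs hs'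
  obtain ⟨E, hE⟩ := exists_lowIn_le hs hs'
  obtain ⟨F, hF⟩ := exists_highIn_le hs hs'
  refine ⟨2 * (A + 2 * (B + 2 * (D + 2 * (E + F)))),
    fun μ _ hμ ε₁ ε₂ hε₁ hε₂ f₁ f₂ h₁ h₂ => ?_⟩
  refine lintegral_sq_piece_le_add (by fun_prop) h₁ h₂ (measurableSet_lowHighSet ε₂)
    (firstSet_subset ε₁ ε₂) (hA μ hμ ε₁ ε₂ f₁ f₂ h₁ h₂) ?_
  refine lintegral_sq_piece_le_add (by fun_prop) h₁ h₂ (measurableSet_lowOutSet.inter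
    (measurableSet_le (by fun_prop) (by fun_prop))) subset_rfl (hB μ hμ ε₁ ε₂ f₁ f₂ h₁ h₂) ?_
  refine lintegral_sq_piece_le_add (by fun_prop) h₁ h₂ (measurableSet_lowOutSet' ε₁ ε₂) subset_rfl
    (hD μ hμ ε₁ ε₂ hε₁ hε₂ f₁ f₂ h₁ h₂) ?_
  exact lintegral_sq_piece_le_add (by fun_prop) h₁ h₂ (measurableSet_lowInSet ε₂) subset_rfl
    (hE μ hμ ε₁ ε₂ hε₁ hε₂ f₁ f₂ h₁ h₂) (hF μ hμ ε₁ ε₂ hε₂ f₁ f₂ h₁ h₂)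

/-- The interactions with the roles of the two factors exchanged. -/
def swapSet (S : Set ((ℝ × ℝ) × (ℝ × ℝ))) : Set ((ℝ × ℝ) × (ℝ × ℝ)) := {z | (z.1, z.1 - z.2) ∈ S}

lemma measurableSet_swapSet {S : Set ((ℝ × ℝ) × (ℝ × ℝ))} (hS : MeasurableSet S) :
    MeasurableSet (swapSet S) :=
  hS.preimage (by fun_prop : Measurable fun z : (ℝ × ℝ) × (ℝ × ℝ) => (z.1, z.1 - z.2))

lemma piece_swapSet {μ : Measure ℝ} [SFinite μ] (hμ : IsFreqMeasure μ) {o : ℝ × ℝ → ℝ}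
    {f₁ f₂ : ℝ × ℝ → ℝ≥0∞} {S : Set ((ℝ × ℝ) × (ℝ × ℝ))} (ho : Measurable o)
    (h₁ : Measurable f₁) (h₂ : Measurable f₂) (hS : MeasurableSet S) :
    ∀ᵐ q ∂(stMeasure μ), piece μ o f₁ f₂ (swapSet S) q = piece μ o f₂ f₁ S q := by
  have hm : Measurable (S.indicator
      fun z => ENNReal.ofReal (o z.1) * (f₂ z.2 * f₁ (z.1 - z.2))) :=
    Measurable.indicator (by fun_prop) hS
  filter_upwards [hμ.lintegral_comp_reflect (u := fun q p => S.indicator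
    (fun z => ENNReal.ofReal (o z.1) * (f₂ z.2 * f₁ (z.1 - z.2))) (q, p)) hm] with q hq
  rw [piece, piece, ← hq]
  refine lintegral_congr fun p => ?_
  by_cases h : (q, q - p) ∈ S
  · rw [Set.indicator_of_mem h, Set.indicator_of_mem (show (q, p) ∈ swapSet S from h)]
    simp only [sub_sub_cancel]
    rw [mul_comm (f₁ p)]
  · rw [Set.indicator_of_notMem h, Set.indicator_of_notMem (show (q, p) ∉ swapSet S from h)]

lemma exists_first_swap_le (hs : -1 / 2 ≤ s) (hs' : s ≤ 0) :
    ∃ C : ℝ≥0, ∀ (μ : Measure ℝ) [SFinite μ], IsFreqMeasure μ → ∀ (ε₁ ε₂ : ℝ),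
      (ε₁ = 1 ∨ ε₁ = -1) → (ε₂ = 1 ∨ ε₂ = -1) → ∀ (f₁ f₂ : ℝ × ℝ → ℝ≥0∞),
      Measurable f₁ → Measurable f₂ →
      ∫⁻ q, piece μ (outWeight s) f₁ f₂ (firstSet ε₁ ∪ swapSet (firstSet ε₂)) q ^ 2
        ∂(stMeasure μ) ≤ C * (sqNorm μ s ε₁ f₁ * sqNorm μ s ε₂ f₂) := by
  obtain ⟨C, hC⟩ := exists_first_le hs hs'
  refine ⟨2 * (C + C), fun μ _ hμ ε₁ ε₂ hε₁ hε₂ f₁ f₂ h₁ h₂ => ?_⟩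
  refine lintegral_sq_piece_le_add (by fun_prop) h₁ h₂ (measurableSet_firstSet ε₁) subset_rfl
    (hC μ hμ ε₁ ε₂ hε₁ hε₂ f₁ f₂ h₁ h₂) (b := C) ?_
  rw [mul_comm (sqNorm μ s ε₁ f₁)]
  refine le_trans (le_of_eq ?_) (hC μ hμ ε₂ ε₁ hε₂ hε₁ f₂ f₁ h₂ h₁)
  refine lintegral_congr_ae ?_
  filter_upwards [piece_swapSet hμ (measurable_outWeight s) h₁ h₂ (measurableSet_firstSet ε₂)]
    with q hq
  rw [hq]

/-- If the frequency of the second factor is not much lower than the one of the output, then the resonance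
is at least of the order `⟨ξ⟩⟨ξ₁⟩`, for all signs. -/
lemma high_resonance_ge {ε₁ ε₂ x y : ℝ} (h₁ : ε₁ = 1 ∨ ε₁ = -1) (h₂ : ε₂ = 1 ∨ ε₂ = -1)
    (hx : 1 ≤ |x|) (hy : 1 ≤ |y|) (hy' : 1 ≤ |x - y|) (h' : bracket x ≤ 8 * bracket (x - y)) :
    bracket x * bracket y ≤ 12 * |x ^ 2 - ε₁ * y ^ 2 - ε₂ * (x - y) ^ 2| := by
  have a1 := bracket_le_two_mul_abs hx
  have a2 := bracket_le_two_mul_abs hy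
  have a3 := bracket_le_two_mul_abs hy'
  have b1 := bracket_pos x
  have b2 := bracket_pos y
  have b3 := bracket_pos (x - y)
  have a4 := bracket_le_add_sub y x
  rw [← neg_sub x y, bracket_neg] at a4
  have a5 : bracket y ≤ 9 * bracket (x - y) := by linarith
  have a6 : bracket x * bracket y ≤ 9 / 4 * (|x| * |y|) := by
    nlinarith [mul_le_mul a1 a2 b2.le (by positivity)]
  have a7 : bracket x * bracket y ≤ 81 / 4 * (|x| * |x - y|) := by
    have := mul_le_mul a1 a3 b3.le (by positivity)
    nlinarith
  have a0 : 0 ≤ |x| * |x - y| := by positivity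
  have a9 : 0 ≤ |y| * |x - y| := by positivity
  have a8 : bracket x * bracket y ≤ 18 * (|y| * |x - y|) := by
    have := mul_le_mul a2 a3 b3.le (by positivity)
    nlinarith
  rcases h₁ with rfl | rfl <;> rcases h₂ with rfl | rfl
  · have : x ^ 2 - 1 * y ^ 2 - 1 * (x - y) ^ 2 = 2 * y * (x - y) := by ring
    rw [this, abs_mul, abs_mul, abs_two]
    linarith [a0, a9]
  · have : x ^ 2 - 1 * y ^ 2 - -1 * (x - y) ^ 2 = 2 * x * (x - y) := by ring
    rw [this, abs_mul, abs_mul, abs_two]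
    linarith [a0, a9]
  · have : x ^ 2 - -1 * y ^ 2 - 1 * (x - y) ^ 2 = 2 * x * y := by ring
    rw [this, abs_mul, abs_mul, abs_two]
    have : 0 ≤ |x| * |y| := by positivity
    linarith
  · have := le_abs_self (x ^ 2 - -1 * y ^ 2 - -1 * (x - y) ^ 2)
    have : 0 ≤ |x| * |y| := by positivity
    nlinarith [sq_nonneg (x - y), sq_nonneg (|x| - |y|), sq_abs x, sq_abs y]

/-- Both frequencies of the factors are high, and the output carries the resonance. -/
def highOutSet : Set ((ℝ × ℝ) × (ℝ × ℝ)) :=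
  ({z | bracket z.1.2 * bracket z.2.2 ≤ 1500 * modulation z.1} ∩
    {z | bracket z.1.2 * bracket (z.1 - z.2).2 ≤ 1500 * modulation z.1}) ∩ {z | 1 ≤ |z.1.2|}

lemma measurableSet_highOutSet : MeasurableSet highOutSet :=
  ((measurableSet_le (by fun_prop) (by fun_prop)).inter
    (measurableSet_le (by fun_prop) (by fun_prop))).inter
    (measurableSet_le (by fun_prop) (by fun_prop))

/-- If both factors have a high frequency, then one of the modulations is high. -/
lemma mul_bracket_le_of_high {ε₁ ε₂ : ℝ} (h₁ : ε₁ = 1 ∨ ε₁ = -1) (h₂ : ε₂ = 1 ∨ ε₂ = -1)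
    {q p : ℝ × ℝ} (hq : 1 ≤ |q.2|) (c1 : bracket q.2 ≤ 8 * bracket p.2)
    (c2 : bracket q.2 ≤ 8 * bracket (q - p).2) : bracket q.2 * bracket p.2
      ≤ 54 * (modulation q + signedModulation ε₁ p + signedModulation ε₂ (q - p)) := by
  have e : (q - p).2 = q.2 - p.2 := rfl
  have g3 := bracket_le_add_sub p.2 q.2
  rw [← neg_sub q.2 p.2, bracket_neg] at g3
  rw [e] at c2
  have l0 : 1 ≤ modulation q := one_le_bracket _
  have l1 := one_le_signedModulation ε₁ p
  have l2 := one_le_signedModulation ε₂ (q - p)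
  have n0 := one_le_bracket q.2
  have n1 := one_le_bracket p.2
  rcases le_total |q.2 - p.2| 1 with c4 | c4
  · have := bracket_le_of_abs_le_one c4
    nlinarith
  rcases le_total |p.2| 1 with c3 | c3
  · have := bracket_le_of_abs_le_one c3
    nlinarith
  · have := high_resonance_ge h₁ h₂ hq c3 c4 c2
    have := abs_resonance_le_add ε₁ ε₂ q p
    linarith

/-- The interactions with output frequency at least `1` fall into three classes: those of `firstSet`, up
to exchanging the factors, and those in which the output carries the resonance. -/
lemma high_subset {ε₁ ε₂ : ℝ} (h₁ : ε₁ = 1 ∨ ε₁ = -1) (h₂ : ε₂ = 1 ∨ ε₂ = -1) :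
    {z : (ℝ × ℝ) × (ℝ × ℝ) | 1 ≤ |z.1.2|}
      ⊆ (firstSet ε₁ ∪ swapSet (firstSet ε₂)) ∪ highOutSet := by
  rintro ⟨q, p⟩ hq
  have hq : 1 ≤ |q.2| := hq
  rcases le_total (8 * bracket p.2) (bracket q.2) with c1 | c1
  · exact Or.inl (Or.inl ⟨hq, Or.inl c1⟩)
  rcases le_total (8 * bracket (q - p).2) (bracket q.2) with c2 | c2
  · exact Or.inl (Or.inr ⟨hq, Or.inl c2⟩)
  have e : (q - p).2 = q.2 - p.2 := rfl
  have g1 := bracket_add_le' q.2 (-p.2)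
  rw [bracket_neg, ← sub_eq_add_neg] at g1
  have g2 : bracket (q - p).2 ≤ 9 * bracket p.2 := by rw [e]; linarith
  have l0 : 1 ≤ modulation q := one_le_bracket _
  have l1 := one_le_signedModulation ε₁ p
  have l2 := one_le_signedModulation ε₂ (q - p)
  have n0 := one_le_bracket q.2
  have n1 := one_le_bracket p.2
  have n2 := one_le_bracket (q - p).2
  have key := mul_bracket_le_of_high h₁ h₂ hq c1 c2
  rcases le_total (bracket q.2 * bracket p.2) (162 * modulation q) with c5 | c5
  · exact Or.inr ⟨⟨show bracket q.2 * bracket p.2 ≤ 1500 * modulation q by linarith,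
      show bracket q.2 * bracket (q - p).2 ≤ 1500 * modulation q by nlinarith⟩, hq⟩
  rcases le_total (bracket q.2 * bracket p.2) (162 * signedModulation ε₁ p) with c6 | c6
  · exact Or.inl (Or.inl ⟨hq, Or.inr ⟨⟨c1, c2⟩,
      show bracket q.2 * bracket p.2 ≤ 1500 * signedModulation ε₁ p by linarith⟩⟩)
  · refine Or.inl (Or.inr ⟨hq, Or.inr ⟨⟨c2, ?_⟩,
      show bracket q.2 * bracket (q - p).2 ≤ 1500 * signedModulation ε₂ (q - p) by nlinarith⟩⟩)
    simpa only [Set.mem_ofPred_eq, sub_sub_cancel] using c1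


/-! ### Sums over dyadic modulations -/

section
variable {μ : Measure ℝ} {G G₁ G₂ : ℝ × ℝ → ℝ≥0∞}

/-- The `L²` norm of a nonnegative function. -/
noncomputable def lTwo (μ : Measure ℝ) (G : ℝ × ℝ → ℝ≥0∞) : ℝ≥0∞ :=
  (∫⁻ p, G p ^ 2 ∂(stMeasure μ)) ^ (1 / 2 : ℝ)

lemma ennreal_sqrt_sq (a : ℝ≥0∞) : (a ^ (1 / 2 : ℝ)) ^ 2 = a := by
  rw [← ENNReal.rpow_natCast, ← ENNReal.rpow_mul]; norm_num

lemma ennreal_sq_sqrt (a : ℝ≥0∞) : (a ^ 2) ^ (1 / 2 : ℝ) = a := by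
  rw [← ENNReal.rpow_natCast, ← ENNReal.rpow_mul]; norm_num

lemma lTwo_sq (G : ℝ × ℝ → ℝ≥0∞) : lTwo μ G ^ 2 = ∫⁻ p, G p ^ 2 ∂(stMeasure μ) :=
  ennreal_sqrt_sq _

lemma lTwo_le_iff {a : ℝ≥0∞} : lTwo μ G ≤ a ↔ ∫⁻ p, G p ^ 2 ∂(stMeasure μ) ≤ a ^ 2 := by
  rw [← lTwo_sq, ENNReal.pow_le_pow_left_iff two_ne_zero]

lemma lTwo_mono (h : ∀ p, G₁ p ≤ G₂ p) : lTwo μ G₁ ≤ lTwo μ G₂ := by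
  unfold lTwo; gcongr with p; exact h p

lemma lTwo_mono_ae (h : ∀ᵐ p ∂(stMeasure μ), G₁ p ≤ G₂ p) : lTwo μ G₁ ≤ lTwo μ G₂ := by
  unfold lTwo
  gcongr ?_ ^ _
  refine lintegral_mono_ae ?_
  filter_upwards [h] with p hp
  gcongr

lemma lTwo_congr_ae (h : ∀ᵐ p ∂(stMeasure μ), G₁ p = G₂ p) : lTwo μ G₁ = lTwo μ G₂ :=
  le_antisymm (lTwo_mono_ae (h.mono fun _ h => h.le)) (lTwo_mono_ae (h.mono fun _ h => h.ge))

lemma lTwo_add_le (h₁ : Measurable G₁) (h₂ : Measurable G₂) :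
    lTwo μ (fun p => G₁ p + G₂ p) ≤ lTwo μ G₁ + lTwo μ G₂ := by
  have := ENNReal.lintegral_Lp_add_le (μ := stMeasure μ) (p := 2) h₁.aemeasurable h₂.aemeasurable
    (by norm_num)
  simpa only [Pi.add_apply, ENNReal.rpow_two, lTwo] using this

lemma lTwo_tsum_le [SFinite μ] {g : ℕ → ℝ × ℝ → ℝ≥0∞} (hg : ∀ j, Measurable (g j)) :
    lTwo μ (fun p => ∑' j, g j p) ≤ ∑' j, lTwo μ (g j) :=
  lTwo_le_iff.2 (lintegral_sq_tsum_le hg)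

lemma lTwo_const_mul (c : ℝ≥0∞) (hG : Measurable G) :
    lTwo μ (fun p => c * G p) = c * lTwo μ G := by
  unfold lTwo
  simp only [mul_pow]
  rw [lintegral_const_mul _ (by fun_prop), ENNReal.mul_rpow_of_nonneg _ _ (by norm_num),
    ennreal_sq_sqrt]

end

/-- The ratio of the geometric series that bound the sums over dyadic modulations. -/
noncomputable def dyadicRatio : ℝ≥0 := (1 / 2) ^ (1 / 8 : ℝ)

lemma dyadicRatio_lt_one : dyadicRatio < 1 := NNReal.rpow_lt_one (by norm_num) (by norm_num)

lemma two_pow_rpow_le {a : ℝ} (ha : 1 / 8 ≤ a) (j : ℕ) :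
    ((2 : ℝ) ^ j) ^ (-a) ≤ ((dyadicRatio ^ j : ℝ≥0) : ℝ) := by
  have h : (1 : ℝ) ≤ 2 ^ j := one_le_pow₀ (by norm_num)
  calc ((2 : ℝ) ^ j) ^ (-a) ≤ ((2 : ℝ) ^ j) ^ (-(1 / 8) : ℝ) :=
        Real.rpow_le_rpow_of_exponent_le h (by linarith)
    _ = _ := by
        rw [dyadicRatio, NNReal.coe_pow, NNReal.coe_rpow, ← Real.rpow_natCast,
          ← Real.rpow_natCast, ← Real.rpow_mul (by norm_num), ← Real.rpow_mul (by norm_num)]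
        push_cast
        rw [show (1 / 2 : ℝ) = 2⁻¹ by norm_num, Real.inv_rpow (by norm_num),
          ← Real.rpow_neg (by norm_num)]
        ring_nf

/-- The sum of the geometric series of ratio `dyadicRatio`. -/
noncomputable def dyadicSum : ℝ≥0 := (1 - dyadicRatio)⁻¹

lemma tsum_dyadicRatio : ∑' j, ((dyadicRatio ^ j : ℝ≥0) : ℝ≥0∞) = dyadicSum := by
  have h : (1 : ℝ≥0) - dyadicRatio ≠ 0 := (tsub_pos_of_lt dyadicRatio_lt_one).ne'
  push_cast
  rw [ENNReal.tsum_geometric, dyadicSum, ENNReal.coe_inv h, ENNReal.coe_sub, ENNReal.coe_one]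

lemma tsum_le_of_le_dyadicRatio {a : ℕ → ℝ≥0∞} {X : ℝ≥0∞}
    (h : ∀ j, a j ≤ (dyadicRatio ^ j : ℝ≥0) * X) : ∑' j, a j ≤ dyadicSum * X := by
  rw [← tsum_dyadicRatio, ← ENNReal.tsum_mul_right]
  exact ENNReal.tsum_le_tsum h

/-- The Cauchy–Schwarz inequality for series. -/
lemma sq_tsum_sqrt_le (a b : ℕ → ℝ≥0∞) :
    (∑' j, (a j * b j) ^ (1 / 2 : ℝ)) ^ 2 ≤ (∑' j, a j) * ∑' j, b j := by
  have := sq_lintegral_le_of_sq_le (μ := (Measure.count : Measure ℕ))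
    (u := fun j => (a j * b j) ^ (1 / 2 : ℝ)) (v := a) (w := b)
    (measurable_of_countable _).aemeasurable (measurable_of_countable _).aemeasurable
    (fun j => (ennreal_sqrt_sq _).le)
  simpa only [lintegral_count] using this

/-- A weight that decays away from `1`; it localizes a frequency to a dyadic shell. -/
noncomputable def dyadicDecay (y : ℝ) : ℝ := min y y⁻¹ ^ (1 / 4 : ℝ)

@[fun_prop] lemma measurable_dyadicDecay : Measurable dyadicDecay := by
  unfold dyadicDecay; fun_prop

lemma dyadicDecay_nonneg {y : ℝ} (hy : 0 ≤ y) : 0 ≤ dyadicDecay y :=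
  Real.rpow_nonneg (le_min hy (inv_nonneg.2 hy)) _

lemma dyadicDecay_le_rpow {y : ℝ} (hy : 0 ≤ y) : dyadicDecay y ≤ y ^ (1 / 4 : ℝ) :=
  Real.rpow_le_rpow (le_min hy (inv_nonneg.2 hy)) (min_le_left _ _) (by norm_num)

lemma dyadicDecay_le_rpow_inv {y : ℝ} (hy : 0 ≤ y) : dyadicDecay y ≤ y⁻¹ ^ (1 / 4 : ℝ) :=
  Real.rpow_le_rpow (le_min hy (inv_nonneg.2 hy)) (min_le_right _ _) (by norm_num)

lemma dyadicDecay_of_le_one {y : ℝ} (hy : 0 < y) (h : y ≤ 1) : dyadicDecay y = y ^ (1 / 4 : ℝ) := by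
  rw [dyadicDecay, min_eq_left (h.trans ((one_le_inv₀ hy).2 h))]

lemma dyadicDecay_of_one_le {y : ℝ} (h : 1 ≤ y) : dyadicDecay y = y ^ (-(1 / 4) : ℝ) := by
  have hy : 0 < y := by linarith
  rw [dyadicDecay, min_eq_right (((inv_le_one₀ hy).2 h).trans h), Real.inv_rpow hy.le,
    Real.rpow_neg hy.le]

lemma sqrt_le_dyadicDecay {y K : ℝ} (hy : 0 < y) (hK : 1 ≤ K) (h : y ≤ K) :
    y ^ (1 / 2 : ℝ) ≤ K * dyadicDecay y := by
  rcases le_total y 1 with h1 | h1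
  · rw [dyadicDecay_of_le_one hy h1]
    calc y ^ (1 / 2 : ℝ) ≤ y ^ (1 / 4 : ℝ) :=
          Real.rpow_le_rpow_of_exponent_ge hy h1 (by norm_num)
      _ ≤ _ := le_mul_of_one_le_left (by positivity) hK
  · rw [dyadicDecay_of_one_le h1]
    calc y ^ (1 / 2 : ℝ) ≤ y ^ (1 + -(1 / 4) : ℝ) :=
          Real.rpow_le_rpow_of_exponent_le h1 (by norm_num)
      _ = y * y ^ (-(1 / 4) : ℝ) := by rw [Real.rpow_add hy, Real.rpow_one]
      _ ≤ _ := by gcongr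

lemma dyadicDecay_le_of_le {a b : ℝ} (ha : 0 < a) (h : a ≤ 2 * b) (h' : b ≤ 2 * a) :
    dyadicDecay a ≤ 2 * dyadicDecay b := by
  have hb : 0 < b := by linarith
  have h2 : (2 : ℝ) ^ (1 / 4 : ℝ) ≤ 2 := by
    calc (2 : ℝ) ^ (1 / 4 : ℝ) ≤ 2 ^ (1 : ℝ) :=
          Real.rpow_le_rpow_of_exponent_le (by norm_num) (by norm_num)
      _ = 2 := by norm_num
  have hm : min a a⁻¹ ≤ 2 * min b b⁻¹ := by
    rw [mul_min_of_nonneg _ _ (by norm_num)]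
    refine min_le_min h ?_
    rw [inv_le_comm₀ ha (by positivity), mul_inv, inv_inv]
    linarith
  calc dyadicDecay a ≤ (2 * min b b⁻¹) ^ (1 / 4 : ℝ) :=
        Real.rpow_le_rpow (le_min ha.le (by positivity)) hm (by norm_num)
    _ = 2 ^ (1 / 4 : ℝ) * dyadicDecay b := Real.mul_rpow (by norm_num) (le_min hb.le (by positivity))
    _ ≤ _ := mul_le_mul_of_nonneg_right h2 (dyadicDecay_nonneg hb.le)

/-- The geometric series over the dyadic scales below the scale `k`. -/
lemma tsum_dyadicRatio_sub_le (k : ℕ) :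
    ∑' j : ℕ, (if j ≤ k then ((dyadicRatio ^ (k - j) : ℝ≥0) : ℝ≥0∞) else 0)
    ≤ dyadicSum := by
  rw [tsum_eq_sum (s := Finset.range (k + 1)) (by
    intro j hj; rw [if_neg (by simpa [Nat.lt_succ_iff] using hj)]), ← tsum_dyadicRatio]
  calc _ = ∑ j ∈ Finset.range (k + 1), ((dyadicRatio ^ (k + 1 - 1 - j) : ℝ≥0) : ℝ≥0∞) := by
        refine Finset.sum_congr rfl fun j hj => ?_
        rw [if_pos (by simpa [Nat.lt_succ_iff] using hj), Nat.add_sub_cancel]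
    _ = ∑ j ∈ Finset.range (k + 1), ((dyadicRatio ^ j : ℝ≥0) : ℝ≥0∞) :=
        Finset.sum_range_reflect (fun j => ((dyadicRatio ^ j : ℝ≥0) : ℝ≥0∞)) (k + 1)
    _ ≤ _ := ENNReal.sum_le_tsum _

/-- The geometric series over the dyadic scales above the scale `k`. -/
lemma tsum_dyadicRatio_sub_le' (k : ℕ) :
    ∑' j : ℕ, (if j ≤ k then 0 else ((dyadicRatio ^ (j - k) : ℝ≥0) : ℝ≥0∞)) ≤ dyadicSum := by
  set a : ℕ → ℝ≥0∞ := fun j => if j ≤ k then 0 else ((dyadicRatio ^ (j - k) : ℝ≥0) : ℝ≥0∞) with ha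
  have h : ∑ i ∈ Finset.range k, a i + ∑' i, a (i + k) = ∑' i, a i :=
    (ENNReal.summable (f := fun i => a (i + k))).sum_add_tsum_nat_add'
  have h0 : ∑ i ∈ Finset.range k, a i = 0 := Finset.sum_eq_zero fun j hj => by
    simp only [ha]
    rw [if_pos (Finset.mem_range.1 hj).le]
  rw [← h, h0, zero_add, ← tsum_dyadicRatio]
  refine ENNReal.tsum_le_tsum fun j => ?_
  simp only [ha]
  split_ifs
  · exact zero_le
  · rw [Nat.add_sub_cancel]

/-- The weights that localize a frequency to the dyadic shells add up to a bounded function. -/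
lemma exists_tsum_dyadicDecay_le : ∃ C : ℝ≥0, ∀ y : ℝ, 0 < y →
    ∑' j : ℕ, ENNReal.ofReal (dyadicDecay (y / 2 ^ j)) ≤ C := by
  refine ⟨dyadicSum + 2 * (dyadicSum + dyadicSum), fun y hy => ?_⟩
  have hpow : ∀ i : ℕ, (((2 : ℝ) ^ i)⁻¹) ^ (1 / 4 : ℝ) ≤ ((dyadicRatio ^ i : ℝ≥0) : ℝ) := by
    intro i
    rw [Real.inv_rpow (by positivity), ← Real.rpow_neg (by positivity)]
    exact two_pow_rpow_le (by norm_num) i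
  rcases lt_or_ge y 1 with h | h
  · calc _ ≤ ∑' j : ℕ, ((dyadicRatio ^ j : ℝ≥0) : ℝ≥0∞) := by
          refine ENNReal.tsum_le_tsum fun j => ENNReal.ofReal_le_of_le_toReal ?_
          refine (dyadicDecay_le_rpow (by positivity)).trans (le_trans ?_ (hpow j))
          gcongr
          rw [div_eq_mul_inv]
          exact mul_le_of_le_one_left (by positivity) h.le
      _ = dyadicSum := tsum_dyadicRatio
      _ ≤ _ := by push_cast; exact le_self_add
  · obtain ⟨k, hk, hk'⟩ := exists_nat_pow_near h (one_lt_two (α := ℝ))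
    have hterm : ∀ j : ℕ, ENNReal.ofReal (dyadicDecay (y / 2 ^ j)) ≤
        2 * (if j ≤ k then ((dyadicRatio ^ (k - j) : ℝ≥0) : ℝ≥0∞) else
          ((dyadicRatio ^ (j - k) : ℝ≥0) : ℝ≥0∞)) := by
      intro j
      split_ifs with hj
      · calc _ ≤ ((dyadicRatio ^ (k - j) : ℝ≥0) : ℝ≥0∞) := by
              refine ENNReal.ofReal_le_of_le_toReal ?_
              refine (dyadicDecay_le_rpow_inv (by positivity)).trans (le_trans ?_ (hpow (k - j)))
              gcongr
              rw [le_div_iff₀ (by positivity), ← pow_add, Nat.sub_add_cancel hj]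
              exact hk
          _ ≤ _ := le_mul_of_one_le_left zero_le (by norm_num)
      · push Not at hj
        rw [show (2 : ℝ≥0∞) = ((2 : ℝ≥0) : ℝ≥0∞) by norm_num, ← ENNReal.coe_mul]
        refine ENNReal.ofReal_le_of_le_toReal ?_
        refine (dyadicDecay_le_rpow (by positivity)).trans ?_
        calc (y / 2 ^ j) ^ (1 / 4 : ℝ) ≤ (2 * (2 ^ (j - k))⁻¹ : ℝ) ^ (1 / 4 : ℝ) := by
              gcongr
              rw [div_le_iff₀ (by positivity), mul_assoc, inv_mul_eq_div]
              rw [show (2 : ℝ) ^ j = 2 ^ k * 2 ^ (j - k) by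
                rw [← pow_add, Nat.add_sub_cancel' hj.le]]
              rw [mul_div_cancel_right₀ _ (by positivity)]
              rw [pow_succ] at hk'; linarith
          _ = (2 : ℝ) ^ (1 / 4 : ℝ) * ((2 ^ (j - k))⁻¹ : ℝ) ^ (1 / 4 : ℝ) :=
              Real.mul_rpow (by norm_num) (by positivity)
          _ ≤ 2 * ((dyadicRatio ^ (j - k) : ℝ≥0) : ℝ) := by
              gcongr
              · calc (2 : ℝ) ^ (1 / 4 : ℝ) ≤ 2 ^ (1 : ℝ) :=
                    Real.rpow_le_rpow_of_exponent_le (by norm_num) (by norm_num)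
                  _ = 2 := by norm_num
              · exact hpow _
          _ = _ := by simp
    have hA := tsum_dyadicRatio_sub_le k
    have hB := tsum_dyadicRatio_sub_le' k
    calc _ ≤ ∑' j : ℕ, 2 * ((if j ≤ k then ((dyadicRatio ^ (k - j) : ℝ≥0) : ℝ≥0∞) else 0) +
          (if j ≤ k then 0 else ((dyadicRatio ^ (j - k) : ℝ≥0) : ℝ≥0∞))) := by
          refine ENNReal.tsum_le_tsum fun j => (hterm j).trans ?_
          split_ifs <;> simp
      _ ≤ 2 * (dyadicSum + dyadicSum) := by
          rw [ENNReal.tsum_mul_left, ENNReal.tsum_add]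
          exact mul_le_mul' le_rfl (add_le_add hA hB)
      _ ≤ _ := by push_cast; exact le_add_self


/-! ### The `L²` norms of the output -/

section
variable {μ : Measure ℝ} {G G₁ G₂ : ℝ × ℝ → ℝ≥0∞}

lemma measurableSet_dyadicRegion (j : ℕ) : MeasurableSet (dyadicRegion j) :=
  (measurableSet_le (f := fun _ => (2 : ℝ) ^ j) (by fun_prop) measurable_modulation).inter
    (measurableSet_lt (g := fun _ => (2 : ℝ) ^ (j + 1)) measurable_modulation (by fun_prop))

lemma measurableSet_farRegion : MeasurableSet farRegion :=
  measurableSet_le (by fun_prop) measurable_modulation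

/-- The `L²` norms, in the norm of `W^s` or of `W^{-1/2}`, of the function whose Fourier transform is
`⟨ξ⟩ ^ (-s) * ⟨τ + ξ ^ 2⟩⁻¹ * G`. -/
noncomputable def outNorm (μ : Measure ℝ) (G : ℝ × ℝ → ℝ≥0∞) : ℝ≥0∞ :=
  lTwo μ (fun q => ENNReal.ofReal (outGain q) * G q) +
    ∑' j, lTwo μ ((dyadicRegion j ∩ farRegion).indicator
      fun q => ENNReal.ofReal (bracket q.2 / modulation q) * G q)

lemma outNorm_mono (h : ∀ q, G₁ q ≤ G₂ q) : outNorm μ G₁ ≤ outNorm μ G₂ := by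
  unfold outNorm
  gcongr with j
  · exact lTwo_mono fun q => by gcongr; exact h q
  · exact lTwo_mono fun q => Set.indicator_le_indicator (by gcongr; exact h q)

lemma outNorm_add_le (h₁ : Measurable G₁) (h₂ : Measurable G₂) :
    outNorm μ (fun q => G₁ q + G₂ q) ≤ outNorm μ G₁ + outNorm μ G₂ := by
  unfold outNorm
  calc _ ≤ (lTwo μ (fun q => ENNReal.ofReal (outGain q) * G₁ q) +
          lTwo μ (fun q => ENNReal.ofReal (outGain q) * G₂ q)) +
        ∑' j, (lTwo μ ((dyadicRegion j ∩ farRegion).indicator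
            fun q => ENNReal.ofReal (bracket q.2 / modulation q) * G₁ q) +
          lTwo μ ((dyadicRegion j ∩ farRegion).indicator
            fun q => ENNReal.ofReal (bracket q.2 / modulation q) * G₂ q)) := by
        gcongr with j
        · simp only [mul_add]
          exact lTwo_add_le (by fun_prop) (by fun_prop)
        · have hm := (measurableSet_dyadicRegion j).inter measurableSet_farRegion
          refine le_trans (le_of_eq ?_) (lTwo_add_le (Measurable.indicator (by fun_prop) hm)
            (Measurable.indicator (by fun_prop) hm))
          simp only [mul_add]
          congr 1
          exact Set.indicator_add _ _ _
    _ = _ := by rw [ENNReal.tsum_add]; abel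

/-- The power of the gain that `outWeight` contains pays for the sum over dyadic modulations. -/
lemma outNorm_le_lTwo (hG : Measurable G) :
    outNorm μ G ≤ (1 + dyadicSum : ℝ≥0) *
      lTwo μ (fun q => ENNReal.ofReal (outGain q ^ (3 / 4 : ℝ)) * G q) := by
  have h1 : ∀ q, outGain q ≤ 1 := fun q => gain_le_one _ _
  unfold outNorm
  push_cast
  rw [add_mul, one_mul]
  gcongr
  · refine lTwo_mono fun q => ?_
    gcongr
    calc outGain q = outGain q ^ (1 : ℝ) := (Real.rpow_one _).symm
      _ ≤ _ := Real.rpow_le_rpow_of_exponent_ge (outGain_pos q) (h1 q) (by norm_num)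
  · refine tsum_le_of_le_dyadicRatio fun j => ?_
    rw [← lTwo_const_mul _ (by fun_prop)]
    refine lTwo_mono fun q => Set.indicator_apply_le' (fun hq => ?_) fun _ => zero_le
    obtain ⟨⟨d1, d2⟩, d3⟩ := hq
    have d3 : bracket q.2 ^ 2 ≤ modulation q := d3
    rw [← mul_assoc, ← ENNReal.ofReal_coe_nnreal, ← ENNReal.ofReal_mul (by positivity)]
    gcongr
    have hn := one_le_bracket q.2
    have hL : 0 < modulation q := bracket_pos _
    have e : outGain q = bracket q.2 / modulation q := by
      change min 1 (bracket q.2 / modulation q) = _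
      exact min_eq_right (by rw [div_le_one hL]; nlinarith)
    rw [← e]
    have e2 : outGain q ≤ (modulation q) ^ (-(1 / 2) : ℝ) := by
      have h3 : bracket q.2 ≤ modulation q ^ (1 / 2 : ℝ) := by
        rw [← Real.sqrt_eq_rpow]; exact Real.le_sqrt_of_sq_le d3
      rw [e, div_le_iff₀ hL, ← Real.rpow_add_one hL.ne']
      norm_num
      exact h3
    calc outGain q = outGain q ^ (1 / 4 : ℝ) * outGain q ^ (3 / 4 : ℝ) := by
          rw [← Real.rpow_add (outGain_pos q)]; norm_num
      _ ≤ ((dyadicRatio ^ j : ℝ≥0) : ℝ) * outGain q ^ (3 / 4 : ℝ) := by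
          refine mul_le_mul_of_nonneg_right ?_ (Real.rpow_nonneg (outGain_pos q).le _)
          calc outGain q ^ (1 / 4 : ℝ) ≤ (modulation q ^ (-(1 / 2) : ℝ)) ^ (1 / 4 : ℝ) :=
                Real.rpow_le_rpow (outGain_pos q).le e2 (by norm_num)
            _ = modulation q ^ (-(1 / 8) : ℝ) := by rw [← Real.rpow_mul hL.le]; norm_num
            _ ≤ ((2 : ℝ) ^ j) ^ (-(1 / 8) : ℝ) :=
                Real.rpow_le_rpow_of_nonpos (by positivity) d1 (by norm_num)
            _ ≤ _ := two_pow_rpow_le le_rfl j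

lemma le_tsum_indicator_dyadicRegion (F : ℝ × ℝ → ℝ≥0∞) (q : ℝ × ℝ) :
    F q ≤ ∑' j, (dyadicRegion j).indicator F q := by
  obtain ⟨j, hj, hj'⟩ := exists_nat_pow_near (one_le_bracket (q.1 + q.2 ^ 2))
    (one_lt_two (α := ℝ))
  refine le_trans (le_of_eq ?_) (ENNReal.le_tsum j)
  rw [Set.indicator_of_mem (show q ∈ dyadicRegion j from ⟨hj, hj'⟩)]

lemma outNorm_le_tsum [SFinite μ] (hG : Measurable G) :
    outNorm μ G ≤ 2 * ∑' j, lTwo μ ((dyadicRegion j).indicator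
      fun q => ENNReal.ofReal (bracket q.2 / modulation q) * G q) := by
  rw [two_mul]
  unfold outNorm
  gcongr ?_ + ?_
  · refine le_trans (lTwo_mono fun q => ?_) (lTwo_tsum_le fun j =>
      Measurable.indicator (by fun_prop) (measurableSet_dyadicRegion j))
    refine le_trans ?_ (le_tsum_indicator_dyadicRegion _ q)
    gcongr
    exact gain_le_div _ _
  · gcongr with j
    exact lTwo_mono fun q => Set.indicator_le_indicator_of_subset Set.inter_subset_left
      (fun _ => zero_le) q

end

/-! ### The output carries the resonance -/

section
variable {s : ℝ}

/-- The weight of `Λ⁻¹ (u v)` at high modulations. -/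
noncomputable def ratioWeight (s : ℝ) (q : ℝ × ℝ) : ℝ :=
  bracket q.2 ^ s * (bracket q.2 / modulation q)

@[fun_prop] lemma measurable_ratioWeight (s : ℝ) : Measurable (ratioWeight s) := by
  unfold ratioWeight; fun_prop

lemma ratioWeight_sq_le (hs : -1 / 2 ≤ s) (hs' : s ≤ 0) {q p : ℝ × ℝ} {k m₁ m₂ : ℝ}
    (h : 2 * (bracket q.2 * bracket p.2 * bracket (q - p).2) / modulation q ^ 2
      ≤ k * (m₁ * m₂) ^ 2) :
    ratioWeight s q ^ 2 ≤ k * ((bracket p.2 ^ s * m₁) * (bracket (q - p).2 ^ s * m₂)) ^ 2 := by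
  have h1 := sq_rpow_le hs hs' (one_le_bracket q.2) (one_le_bracket p.2)
    (one_le_bracket (q - p).2) (bracket_le_add_sub _ _)
  have hn := bracket_pos q.2
  rw [ratioWeight]
  set P := bracket p.2 ^ s
  set Q := bracket (q - p).2 ^ s
  calc _ ≤ 2 * (bracket p.2 * bracket (q - p).2 / bracket q.2) * (P * Q) ^ 2 *
        (bracket q.2 / modulation q) ^ 2 := by
        rw [mul_pow]; gcongr
    _ = (2 * (bracket q.2 * bracket p.2 * bracket (q - p).2) / modulation q ^ 2)
        * (P * Q) ^ 2 := by field_simp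
    _ ≤ k * (m₁ * m₂) ^ 2 * (P * Q) ^ 2 := by gcongr
    _ = _ := by ring

lemma ofReal_mul_piece {μ : Measure ℝ} {a o : ℝ × ℝ → ℝ} {f₁ f₂ : ℝ × ℝ → ℝ≥0∞}
    {S : Set ((ℝ × ℝ) × (ℝ × ℝ))} {q : ℝ × ℝ} (ha : 0 ≤ a q) :
    ENNReal.ofReal (a q) * piece μ o f₁ f₂ S q = piece μ (fun q => a q * o q) f₁ f₂ S q := by
  rw [piece, ← lintegral_const_mul' _ _ ENNReal.ofReal_ne_top]
  refine lintegral_congr fun p => ?_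
  by_cases h : (q, p) ∈ S
  · rw [Set.indicator_of_mem h, Set.indicator_of_mem h, ENNReal.ofReal_mul ha, mul_assoc]
  · rw [Set.indicator_of_notMem h, Set.indicator_of_notMem h, mul_zero]

lemma piece_inter_of_mem {μ : Measure ℝ} {o : ℝ × ℝ → ℝ} {f₁ f₂ : ℝ × ℝ → ℝ≥0∞}
    {S : Set ((ℝ × ℝ) × (ℝ × ℝ))} {D : Set (ℝ × ℝ)} {q : ℝ × ℝ} (hq : q ∈ D) :
    piece μ o f₁ f₂ (S ∩ {z | z.1 ∈ D}) q = piece μ o f₁ f₂ S q := by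
  refine lintegral_congr fun p => ?_
  by_cases h : (q, p) ∈ S
  · rw [Set.indicator_of_mem h,
      Set.indicator_of_mem (show (q, p) ∈ S ∩ {z | z.1 ∈ D} from ⟨h, hq⟩)]
  · rw [Set.indicator_of_notMem h, Set.indicator_of_notMem fun h' => h h'.1]

/-- The output carries the resonance, and the first factor has a high modulation. -/
def highOutSet₁ (ε₁ : ℝ) (j : ℕ) : Set ((ℝ × ℝ) × (ℝ × ℝ)) :=
  (highOutSet ∩ {z | bracket z.2.2 ≤ signedModulation ε₁ z.2}) ∩ {z | z.1 ∈ dyadicRegion j}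

lemma measurableSet_highOutSet₁ (ε₁ : ℝ) (j : ℕ) : MeasurableSet (highOutSet₁ ε₁ j) :=
  (measurableSet_highOutSet.inter (measurableSet_le (by fun_prop) (by fun_prop))).inter
    ((measurableSet_dyadicRegion j).preimage measurable_fst)

/-- Up to a constant, the output modulation is at least `⟨ξ⟩⟨ξ₁⟩`, and the weight `⟨ξ₁⟩` of
the first factor leaves room for an integrable kernel and for a geometric decay in the dyadic output modulation. -/
lemma exists_highOut₁_le (hs : -1 / 2 ≤ s) (hs' : s ≤ 0) :
    ∃ C : ℝ≥0, ∀ (μ : Measure ℝ) [SFinite μ], IsFreqMeasure μ → ∀ (ε₁ ε₂ : ℝ)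
      (f₁ f₂ : ℝ × ℝ → ℝ≥0∞), Measurable f₁ → Measurable f₂ → ∀ j : ℕ,
      ∫⁻ q, piece μ (ratioWeight s) f₁ f₂ (highOutSet₁ ε₁ j) q ^ 2 ∂(stMeasure μ)
        ≤ ((dyadicRatio ^ j) ^ 2 * C : ℝ≥0) * (sqNorm μ s ε₁ f₁ * sqNorm μ s ε₂ f₂) := by
  obtain ⟨C, hC⟩ := exists_lintegral_bracket_rpow_le (β := 3 / 2) (by norm_num)
  refine ⟨4500000 * C, fun μ _ hμ ε₁ ε₂ f₁ f₂ h₁ h₂ j => ?_⟩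
  set ρ : ℝ≥0 := dyadicRatio ^ j with hρ
  refine (lintegral_sq_piece_le_lTwo_lOne hμ h₁ h₂ (w₁ := xWeight s ε₁) (w₂ := yWeight s)
    (k := fun _ y => (ρ : ℝ) ^ 2 * 4500000 * bracket y ^ (-(3 / 2) : ℝ)) (by fun_prop)
    (by fun_prop) (xWeight_nonneg s ε₁) (yWeight_nonneg s) (by fun_prop)
    (fun x y => by have := bracket_pos y; positivity)
    (D := Set.univ) .univ (fun q p _ => trivial) (fun q p hz => ?_)
    (C := ρ ^ 2 * (4500000 * C)) (fun x => ?_)).trans ?_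
  · have := ratioWeight_sq_le hs hs' (q := q) (p := p)
      (k := (ρ : ℝ) ^ 2 * 4500000 * bracket p.2 ^ (-(3 / 2) : ℝ))
      (m₁ := min (signedModulation ε₁ p) (bracket p.2)) (m₂ := 1) ?_
    · simpa only [mul_one, xWeight, yWeight] using this
    obtain ⟨⟨⟨⟨z1, z2⟩, -⟩, z3⟩, z4, -⟩ := hz
    simp only [Set.mem_ofPred_eq] at z1 z2 z3 z4
    have hn := one_le_bracket q.2
    have hn1 := one_le_bracket p.2
    rw [min_eq_right z3, mul_one]
    have hL : 0 < modulation q := bracket_pos _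
    set n := bracket q.2
    set n1 := bracket p.2
    set n2 := bracket (q - p).2
    set L := modulation q
    have h1 : n1 ≤ 1500 * L := by nlinarith
    have h2 : L ^ (-(1 / 2) : ℝ) ≤ (ρ : ℝ) ^ 2 := by
      calc L ^ (-(1 / 2) : ℝ) ≤ ((2 : ℝ) ^ j) ^ (-(1 / 2) : ℝ) :=
            Real.rpow_le_rpow_of_nonpos (by positivity) z4 (by norm_num)
        _ = (((2 : ℝ) ^ j) ^ (-(1 / 4) : ℝ)) ^ 2 := by
            rw [← Real.rpow_natCast (_ ^ (-(1 / 4) : ℝ)), ← Real.rpow_mul (by positivity)]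
            norm_num
        _ ≤ _ := by gcongr; exact two_pow_rpow_le (by norm_num) j
    have h3 : L ^ (-(1 / 2) : ℝ) ≤ 1500 * n1 ^ (-(1 / 2) : ℝ) := by
      calc L ^ (-(1 / 2) : ℝ) ≤ (n1 / 1500) ^ (-(1 / 2) : ℝ) :=
            Real.rpow_le_rpow_of_nonpos (by positivity) (by linarith) (by norm_num)
        _ = n1 ^ (-(1 / 2) : ℝ) * 1500 ^ (1 / 2 : ℝ) := by
            rw [Real.div_rpow (by positivity) (by norm_num), Real.rpow_neg (x := 1500)
              (by norm_num), div_inv_eq_mul]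
        _ ≤ n1 ^ (-(1 / 2) : ℝ) * 1500 ^ (1 : ℝ) := by
            gcongr <;> norm_num
        _ = _ := by rw [Real.rpow_one, mul_comm]
    calc 2 * (n * n1 * n2) / L ^ 2 = 2 * n1 * (n * n2) / L ^ 2 := by ring
      _ ≤ 2 * n1 * (1500 * L) / L ^ 2 := by gcongr
      _ = 3000 * n1 * (L ^ (-(1 / 2) : ℝ) * L ^ (-(1 / 2) : ℝ)) := by
          rw [← Real.rpow_add hL]; norm_num; rw [Real.rpow_neg_one]; field_simp; norm_num
      _ ≤ 3000 * n1 * ((ρ : ℝ) ^ 2 * (1500 * n1 ^ (-(1 / 2) : ℝ))) := by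
          gcongr
      _ = (ρ : ℝ) ^ 2 * 4500000 * (n1 ^ (1 : ℝ) * n1 ^ (-(1 / 2) : ℝ)) := by
          rw [Real.rpow_one]; ring
      _ = (ρ : ℝ) ^ 2 * 4500000 * (n1 ^ (-(3 / 2) : ℝ) * n1 ^ (2 : ℝ)) := by
          rw [← Real.rpow_add (by positivity), ← Real.rpow_add (by positivity)]; norm_num
      _ = _ := by rw [Real.rpow_two]; ring
  · simp only [Set.indicator_univ]
    calc _ = ∫⁻ y, ENNReal.ofReal ((ρ : ℝ) ^ 2 * 4500000) *
          ENNReal.ofReal (bracket (y - 0) ^ (-(3 / 2) : ℝ)) ∂μ := by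
          refine lintegral_congr fun y => ?_
          rw [ENNReal.ofReal_mul (by positivity), sub_zero]
      _ ≤ ENNReal.ofReal ((ρ : ℝ) ^ 2 * 4500000) * C := by
          rw [lintegral_const_mul _ (by fun_prop)]; gcongr; exact hC μ hμ 0
      _ = _ := by
          rw [ENNReal.ofReal_mul (by positivity), ENNReal.ofReal_pow (by positivity)]
          simp only [ENNReal.ofReal_coe_nnreal, ENNReal.ofReal_ofNat]
          push_cast; ring
  · gcongr
    · exact lintegral_sq_weighted_le_sqNorm
    · exact sqNormLOne_le_sqNorm

/-- A weight localized to the dyadic shell where `Y ∼ 2 ^ j`. -/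
noncomputable def localized (w Y : ℝ × ℝ → ℝ) (j : ℕ) (p : ℝ × ℝ) : ℝ :=
  w p * dyadicDecay (Y p / 2 ^ j) ^ (1 / 2 : ℝ)

lemma measurable_localized {w Y : ℝ × ℝ → ℝ} (hw : Measurable w) (hY : Measurable Y) (j : ℕ) :
    Measurable (localized w Y j) := by
  unfold localized; fun_prop

lemma localized_nonneg {w Y : ℝ × ℝ → ℝ} (hw : ∀ p, 0 ≤ w p) (hY : ∀ p, 0 < Y p) (j : ℕ)
    (p : ℝ × ℝ) : 0 ≤ localized w Y j p :=
  mul_nonneg (hw p) (Real.rpow_nonneg (dyadicDecay_nonneg (div_pos (hY p) (by positivity)).le) _)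

/-- The localized `L²` norms are square summable over the dyadic shells. -/
lemma exists_tsum_localized_le : ∃ C : ℝ≥0, ∀ (μ : Measure ℝ) (w Y : ℝ × ℝ → ℝ)
    (f : ℝ × ℝ → ℝ≥0∞), Measurable w → Measurable Y → Measurable f → (∀ p, 0 ≤ w p) →
    (∀ p, 0 < Y p) → ∑' j, ∫⁻ p, weighted (localized w Y j) f p ^ 2 ∂(stMeasure μ)
      ≤ C * ∫⁻ p, weighted w f p ^ 2 ∂(stMeasure μ) := by
  obtain ⟨C, hC⟩ := exists_tsum_dyadicDecay_le
  refine ⟨C, fun μ w Y f hw hY hf hw0 hY0 => ?_⟩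
  rw [← lintegral_tsum fun j => by
      have := measurable_localized hw hY j
      exact ((measurable_weighted this hf).pow_const 2).aemeasurable,
    ← lintegral_const_mul _ (by fun_prop)]
  refine lintegral_mono fun p => ?_
  have e : ∀ j, weighted (localized w Y j) f p ^ 2
      = ENNReal.ofReal (dyadicDecay (Y p / 2 ^ j)) * weighted w f p ^ 2 := by
    intro j
    have h0 := dyadicDecay_nonneg (div_pos (hY0 p) (by positivity : (0 : ℝ) < 2 ^ j)).le
    have e' : (dyadicDecay (Y p / 2 ^ j) ^ (1 / 2 : ℝ)) ^ 2 = dyadicDecay (Y p / 2 ^ j) := by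
      rw [← Real.rpow_natCast, ← Real.rpow_mul h0]; norm_num
    have e'' : ENNReal.ofReal (dyadicDecay (Y p / 2 ^ j))
        = ENNReal.ofReal (dyadicDecay (Y p / 2 ^ j) ^ (1 / 2 : ℝ)) ^ 2 := by
      rw [← ENNReal.ofReal_pow (by positivity), e']
    rw [weighted, weighted, localized, ENNReal.ofReal_mul (hw0 p), e'']
    ring
  simp only [e]
  rw [ENNReal.tsum_mul_right]
  gcongr
  exact hC _ (hY0 p)

/-- The output carries the resonance, and both factors have low modulations. -/
def highOutSet₂ (ε₁ ε₂ : ℝ) (j : ℕ) : Set ((ℝ × ℝ) × (ℝ × ℝ)) :=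
  (highOutSet ∩ ({z | signedModulation ε₁ z.2 ≤ bracket z.2.2} ∩
    {z | signedModulation ε₂ (z.1 - z.2) ≤ bracket (z.1 - z.2).2})) ∩ {z | z.1 ∈ dyadicRegion j}

lemma measurableSet_highOutSet₂ (ε₁ ε₂ : ℝ) (j : ℕ) : MeasurableSet (highOutSet₂ ε₁ ε₂ j) :=
  (measurableSet_highOutSet.inter ((measurableSet_le (by fun_prop) (by fun_prop)).inter
    (measurableSet_le (by fun_prop) (by fun_prop)))).inter
    ((measurableSet_dyadicRegion j).preimage measurable_fst)

/-- Both factors are measured with their modulations. At the output modulation `2 ^ j` there is no decay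
in `j`, but the frequencies of the factors are localized. -/
lemma exists_highOut₂_le (hs : -1 / 2 ≤ s) (hs' : s ≤ 0) :
    ∃ C : ℝ≥0, ∀ (μ : Measure ℝ) [SFinite μ], IsFreqMeasure μ → ∀ (ε₁ ε₂ : ℝ),
      (ε₁ = 1 ∨ ε₁ = -1) → (ε₂ = 1 ∨ ε₂ = -1) → ∀ (f₁ f₂ : ℝ × ℝ → ℝ≥0∞),
      Measurable f₁ → Measurable f₂ → ∀ j : ℕ,
      ∫⁻ q, piece μ (ratioWeight s) f₁ f₂ (highOutSet₂ ε₁ ε₂ j) q ^ 2 ∂(stMeasure μ)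
        ≤ C * ((∫⁻ p, weighted (localized (xWeight s ε₁) (fun p => bracket p.2) j) f₁ p ^ 2
            ∂(stMeasure μ)) *
          ∫⁻ p, weighted (localized (xWeight s ε₂) (fun p => bracket p.2) j) f₂ p ^ 2
            ∂(stMeasure μ)) := by
  obtain ⟨C, hC⟩ := exists_lintegral_output_kernel_le
  refine ⟨54000000000 * C, fun μ _ hμ ε₁ ε₂ hε₁ hε₂ f₁ f₂ h₁ h₂ j => ?_⟩
  refine lintegral_sq_piece_le_of_output hμ h₁ h₂ (measurableSet_highOutSet₂ ε₁ ε₂ j)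
    (w₁ := localized (xWeight s ε₁) (fun p => bracket p.2) j)
    (w₂ := localized (xWeight s ε₂) (fun p => bracket p.2) j)
    (k := fun q p => 54000000000 *
      ((signedModulation ε₁ p ^ 2)⁻¹ * (signedModulation ε₂ (q - p) ^ 2)⁻¹))
    (measurable_localized (by fun_prop) (by fun_prop) j)
    (measurable_localized (by fun_prop) (by fun_prop) j)
    (localized_nonneg (xWeight_nonneg s ε₁) (fun p => bracket_pos _) j)
    (localized_nonneg (xWeight_nonneg s ε₂) (fun p => bracket_pos _) j)
    (by fun_prop) (fun x y => by positivity) (fun q p hz => ?_) (C := 54000000000 * C)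
    (fun q => ?_)
  · have e : ∀ ε p, localized (xWeight s ε) (fun p => bracket p.2) j p = bracket p.2 ^ s *
        (min (signedModulation ε p) (bracket p.2) *
          dyadicDecay (bracket p.2 / 2 ^ j) ^ (1 / 2 : ℝ)) := fun _ _ => mul_assoc _ _ _
    rw [e, e]
    refine ratioWeight_sq_le hs hs' ?_
    obtain ⟨⟨⟨⟨z1, z2⟩, -⟩, z3, z4⟩, z5, z6⟩ := hz
    simp only [Set.mem_ofPred_eq] at z1 z2 z3 z4 z5 z6
    have l1 := one_le_signedModulation ε₁ p
    have l2 := one_le_signedModulation ε₂ (q - p)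
    have hn := one_le_bracket q.2
    have hn1 := bracket_pos p.2
    have hn2 := bracket_pos (q - p).2
    rw [min_eq_left z3, min_eq_left z4]
    set n := bracket q.2
    set n1 := bracket p.2
    set n2 := bracket (q - p).2
    set L := modulation q
    set M : ℝ := 2 ^ j with hM
    have hM0 : 0 < M := by positivity
    have hL : L ≤ 2 * M := by rw [hM, mul_comm, ← pow_succ]; exact z6.le
    set a := n1 / M with ha
    set b := n2 / M with hb
    have ha0 : 0 < a := by positivity
    have hb0 : 0 < b := by positivity
    have na : n * a ≤ 3000 := by
      rw [ha, mul_div_assoc', div_le_iff₀ hM0]; linarith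
    have nb : n * b ≤ 3000 := by
      rw [hb, mul_div_assoc', div_le_iff₀ hM0]; linarith
    -- From `n a, n b ≤ 3000` and `1 ≤ n` follows `n a b ≤ 3000 √(a b)`: the square roots localize.
    have da := sqrt_le_dyadicDecay ha0 (K := 3000) (by norm_num) (by nlinarith)
    have db := sqrt_le_dyadicDecay hb0 (K := 3000) (by norm_num) (by nlinarith)
    have da0 := dyadicDecay_nonneg ha0.le
    have db0 := dyadicDecay_nonneg hb0.le
    have esq : ∀ y : ℝ, 0 ≤ y → (y ^ (1 / 2 : ℝ)) ^ 2 = y := fun y hy => by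
      rw [← Real.rpow_natCast, ← Real.rpow_mul hy]; norm_num
    have key : n * a * b ≤ 3000 * (a ^ (1 / 2 : ℝ) * b ^ (1 / 2 : ℝ)) := by
      have ea := esq a ha0.le
      have eb := esq b hb0.le
      have hA : 0 < a ^ (1 / 2 : ℝ) := by positivity
      have hB : 0 < b ^ (1 / 2 : ℝ) := by positivity
      set A := a ^ (1 / 2 : ℝ)
      set B := b ^ (1 / 2 : ℝ)
      rw [← ea] at na
      rw [← eb] at nb
      have h3 : n * A * B ≤ 3000 := by
        have : n * A * B ≤ n * (A ^ 2 + B ^ 2) / 2 := by nlinarith [sq_nonneg (A - B)]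
        linarith
      rw [← ea, ← eb]
      calc n * A ^ 2 * B ^ 2 = n * A * B * (A * B) := by ring
        _ ≤ _ := by gcongr
    have hL0 : M ^ 2 ≤ L ^ 2 := by gcongr
    calc 2 * (n * n1 * n2) / L ^ 2 ≤ 2 * (n * n1 * n2) / M ^ 2 := by gcongr
      _ = 2 * (n * a * b) := by rw [ha, hb]; field_simp
      _ ≤ 2 * (3000 * ((3000 * dyadicDecay a) * (3000 * dyadicDecay b))) := by
          rw [mul_assoc n]
          rw [mul_assoc n] at key
          refine mul_le_mul_of_nonneg_left (key.trans ?_) (by norm_num)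
          gcongr
      _ = 54000000000 * (dyadicDecay a * dyadicDecay b) := by ring
      _ = 54000000000 * ((dyadicDecay a ^ (1 / 2 : ℝ)) ^ 2 *
            (dyadicDecay b ^ (1 / 2 : ℝ)) ^ 2) := by rw [esq _ da0, esq _ db0]
      _ = _ := by field_simp
  · by_cases hq : 1 ≤ |q.2|
    · calc _ ≤ ∫⁻ p, 54000000000 * ENNReal.ofReal ((signedModulation ε₁ p ^ 2)⁻¹ *
            (signedModulation ε₂ (q - p) ^ 2)⁻¹) ∂(stMeasure μ) := by
            refine lintegral_mono fun p => Set.indicator_apply_le' (fun hy => ?_) fun _ => zero_le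
            rw [ENNReal.ofReal_mul (by norm_num)]; simp
        _ ≤ _ := by
            rw [lintegral_const_mul _ (by fun_prop)]; push_cast; gcongr
            exact hC μ hμ ε₁ ε₂ hε₁ hε₂ q hq
    · refine le_trans (le_of_eq ?_) zero_le
      rw [← lintegral_zero (μ := stMeasure μ)]
      exact lintegral_congr fun p => Set.indicator_of_notMem (fun hz => hq hz.1.1.2) _

lemma highOut_subset (ε₁ ε₂ : ℝ) (j : ℕ) : highOutSet ∩ {z | z.1 ∈ dyadicRegion j} ⊆
    highOutSet₁ ε₁ j ∪ (swapSet (highOutSet₁ ε₂ j) ∪ highOutSet₂ ε₁ ε₂ j) := by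
  rintro ⟨q, p⟩ ⟨hz, hj⟩
  rcases le_total (bracket p.2) (signedModulation ε₁ p) with h1 | h1
  · exact Or.inl ⟨⟨hz, h1⟩, hj⟩
  rcases le_total (bracket (q - p).2) (signedModulation ε₂ (q - p)) with h2 | h2
  · refine Or.inr (Or.inl ⟨⟨⟨⟨hz.1.2, ?_⟩, hz.2⟩, h2⟩, hj⟩)
    simpa only [Set.mem_ofPred_eq, sub_sub_cancel] using hz.1.1
  · exact Or.inr (Or.inr ⟨⟨hz, h1, h2⟩, hj⟩)

/-- The first two pieces are summed by their geometric decay, the last one by the Cauchy–Schwarz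
inequality in `j`. -/
lemma exists_highOut_le (hs : -1 / 2 ≤ s) (hs' : s ≤ 0) :
    ∃ C : ℝ≥0, ∀ (μ : Measure ℝ) [SFinite μ], IsFreqMeasure μ → ∀ (ε₁ ε₂ : ℝ),
      (ε₁ = 1 ∨ ε₁ = -1) → (ε₂ = 1 ∨ ε₂ = -1) → ∀ (f₁ f₂ : ℝ × ℝ → ℝ≥0∞),
      Measurable f₁ → Measurable f₂ →
      ∑' j, lTwo μ (piece μ (ratioWeight s) f₁ f₂ (highOutSet ∩ {z | z.1 ∈ dyadicRegion j}))
        ≤ C * (sqNorm μ s ε₁ f₁ * sqNorm μ s ε₂ f₂) ^ (1 / 2 : ℝ) := by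
  obtain ⟨A, hA⟩ := exists_highOut₁_le hs hs'
  obtain ⟨B, hB⟩ := exists_highOut₂_le hs hs'
  obtain ⟨D, hD⟩ := exists_tsum_localized_le
  refine ⟨dyadicSum * A ^ (1 / 2 : ℝ) + (dyadicSum * A ^ (1 / 2 : ℝ) + B ^ (1 / 2 : ℝ) * D),
    fun μ _ hμ ε₁ ε₂ hε₁ hε₂ f₁ f₂ h₁ h₂ => ?_⟩
  set X := sqNorm μ s ε₁ f₁ * sqNorm μ s ε₂ f₂ with hX
  have hp : ∀ j, lTwo μ (piece μ (ratioWeight s) f₁ f₂ (highOutSet ∩ {z | z.1 ∈ dyadicRegion j}))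
      ≤ lTwo μ (piece μ (ratioWeight s) f₁ f₂ (highOutSet₁ ε₁ j)) +
        (lTwo μ (piece μ (ratioWeight s) f₂ f₁ (highOutSet₁ ε₂ j)) +
          lTwo μ (piece μ (ratioWeight s) f₁ f₂ (highOutSet₂ ε₁ ε₂ j))) := by
    intro j
    have m1 := measurableSet_highOutSet₁ ε₁ j
    have m2 := measurableSet_swapSet (measurableSet_highOutSet₁ ε₂ j)
    have m3 := measurableSet_highOutSet₂ ε₁ ε₂ j
    have hw := measurable_ratioWeight s
    rw [← lTwo_congr_ae (piece_swapSet hμ hw h₁ h₂ (measurableSet_highOutSet₁ ε₂ j))]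
    refine (lTwo_mono fun q => (piece_le_add hw h₁ h₂ m1 (highOut_subset ε₁ ε₂ j) q).trans
      (add_le_add le_rfl (piece_le_add hw h₁ h₂ m2 subset_rfl q))).trans ?_
    refine (lTwo_add_le (measurable_piece hw h₁ h₂ m1)
      ((measurable_piece hw h₁ h₂ m2).add (measurable_piece hw h₁ h₂ m3))).trans ?_
    gcongr
    exact lTwo_add_le (measurable_piece hw h₁ h₂ m2) (measurable_piece hw h₁ h₂ m3)
  have hsq : ∀ (Y : ℝ≥0∞) (j : ℕ), (((dyadicRatio ^ j) ^ 2 * A : ℝ≥0) * Y) ^ (1 / 2 : ℝ)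
      = (dyadicRatio ^ j : ℝ≥0) * ((A : ℝ≥0∞) ^ (1 / 2 : ℝ) * Y ^ (1 / 2 : ℝ)) := by
    intro Y j
    push_cast
    rw [ENNReal.mul_rpow_of_nonneg _ _ (by norm_num), ENNReal.mul_rpow_of_nonneg _ _ (by norm_num),
      ennreal_sq_sqrt, mul_assoc]
  have t1 : ∑' j, lTwo μ (piece μ (ratioWeight s) f₁ f₂ (highOutSet₁ ε₁ j))
      ≤ dyadicSum * ((A : ℝ≥0∞) ^ (1 / 2 : ℝ) * X ^ (1 / 2 : ℝ)) := by
    refine tsum_le_of_le_dyadicRatio fun j => ?_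
    rw [← hsq, lTwo]
    gcongr
    exact hA μ hμ ε₁ ε₂ f₁ f₂ h₁ h₂ j
  have t2 : ∑' j, lTwo μ (piece μ (ratioWeight s) f₂ f₁ (highOutSet₁ ε₂ j))
      ≤ dyadicSum * ((A : ℝ≥0∞) ^ (1 / 2 : ℝ) * X ^ (1 / 2 : ℝ)) := by
    refine tsum_le_of_le_dyadicRatio fun j => ?_
    rw [← hsq, lTwo, hX, mul_comm (sqNorm μ s ε₁ f₁)]
    gcongr
    exact hA μ hμ ε₂ ε₁ f₂ f₁ h₂ h₁ j
  have t3 : ∑' j, lTwo μ (piece μ (ratioWeight s) f₁ f₂ (highOutSet₂ ε₁ ε₂ j))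
      ≤ (B : ℝ≥0∞) ^ (1 / 2 : ℝ) * (D * X ^ (1 / 2 : ℝ)) := by
    set a := fun j : ℕ => ∫⁻ p, weighted (localized (xWeight s ε₁) (fun p => bracket p.2) j) f₁ p ^ 2
            ∂(stMeasure μ)
    set b := fun j : ℕ => ∫⁻ p, weighted (localized (xWeight s ε₂) (fun p => bracket p.2) j) f₂ p ^ 2
            ∂(stMeasure μ)
    calc _ ≤ ∑' j, (B : ℝ≥0∞) ^ (1 / 2 : ℝ) * (a j * b j) ^ (1 / 2 : ℝ) := by
          refine ENNReal.tsum_le_tsum fun j => ?_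
          rw [← ENNReal.mul_rpow_of_nonneg _ _ (by norm_num), lTwo]
          gcongr
          exact hB μ hμ ε₁ ε₂ hε₁ hε₂ f₁ f₂ h₁ h₂ j
      _ = (B : ℝ≥0∞) ^ (1 / 2 : ℝ) * ∑' j, (a j * b j) ^ (1 / 2 : ℝ) := ENNReal.tsum_mul_left
      _ ≤ _ := by
          gcongr
          rw [← ENNReal.pow_le_pow_left_iff two_ne_zero, mul_pow, ennreal_sqrt_sq]
          calc _ ≤ (∑' j, a j) * ∑' j, b j := sq_tsum_sqrt_le a b
            _ ≤ (D * sqNorm μ s ε₁ f₁) * (D * sqNorm μ s ε₂ f₂) := by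
                gcongr
                · refine (hD μ _ _ f₁ (by fun_prop) (by fun_prop) h₁ (xWeight_nonneg s ε₁)
                    fun p => bracket_pos _).trans ?_
                  gcongr
                  exact lintegral_sq_weighted_le_sqNorm
                · refine (hD μ _ _ f₂ (by fun_prop) (by fun_prop) h₂ (xWeight_nonneg s ε₂)
                    fun p => bracket_pos _).trans ?_
                  gcongr
                  exact lintegral_sq_weighted_le_sqNorm
            _ = _ := by rw [hX]; ring
  calc _ ≤ _ := ENNReal.tsum_le_tsum hp
    _ ≤ dyadicSum * ((A : ℝ≥0∞) ^ (1 / 2 : ℝ) * X ^ (1 / 2 : ℝ)) +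
        (dyadicSum * ((A : ℝ≥0∞) ^ (1 / 2 : ℝ) * X ^ (1 / 2 : ℝ)) +
          (B : ℝ≥0∞) ^ (1 / 2 : ℝ) * (D * X ^ (1 / 2 : ℝ))) := by
        rw [ENNReal.tsum_add, ENNReal.tsum_add]
        exact add_le_add t1 (add_le_add t2 t3)
    _ = _ := by
        push_cast
        rw [ENNReal.coe_rpow_of_nonneg _ (by norm_num), ENNReal.coe_rpow_of_nonneg _ (by norm_num)]
        ring

/-- The estimate of the `L²` norms of a product at frequencies `|ξ| ≥ 1`. -/
lemma exists_high_le (hs : -1 / 2 ≤ s) (hs' : s ≤ 0) :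
    ∃ C : ℝ≥0, ∀ (μ : Measure ℝ) [SFinite μ], IsFreqMeasure μ → ∀ (ε₁ ε₂ : ℝ),
      (ε₁ = 1 ∨ ε₁ = -1) → (ε₂ = 1 ∨ ε₂ = -1) → ∀ (f₁ f₂ : ℝ × ℝ → ℝ≥0∞),
      Measurable f₁ → Measurable f₂ →
      outNorm μ (piece μ (yWeight s) f₁ f₂ {z | 1 ≤ |z.1.2|})
        ≤ C * (sqNorm μ s ε₁ f₁ * sqNorm μ s ε₂ f₂) ^ (1 / 2 : ℝ) := by
  obtain ⟨A, hA⟩ := exists_first_swap_le hs hs'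
  obtain ⟨B, hB⟩ := exists_highOut_le hs hs'
  refine ⟨(1 + dyadicSum) * A ^ (1 / 2 : ℝ) + 2 * B,
    fun μ _ hμ ε₁ ε₂ hε₁ hε₂ f₁ f₂ h₁ h₂ => ?_⟩
  set X := sqNorm μ s ε₁ f₁ * sqNorm μ s ε₂ f₂ with hX
  have hw := measurable_yWeight s
  have mE : MeasurableSet (firstSet ε₁ ∪ swapSet (firstSet ε₂)) :=
    (measurableSet_firstSet ε₁).union (measurableSet_swapSet (measurableSet_firstSet ε₂))
  have mF := measurableSet_highOutSet
  refine (outNorm_mono fun q => piece_le_add hw h₁ h₂ mE (high_subset hε₁ hε₂) q).trans ?_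
  refine (outNorm_add_le (measurable_piece hw h₁ h₂ mE) (measurable_piece hw h₁ h₂ mF)).trans ?_
  push_cast
  rw [add_mul]
  gcongr
  · refine (outNorm_le_lTwo (measurable_piece hw h₁ h₂ mE)).trans ?_
    push_cast
    rw [mul_assoc, ENNReal.coe_rpow_of_nonneg _ (by norm_num),
      ← ENNReal.mul_rpow_of_nonneg _ _ (by norm_num)]
    gcongr
    refine (le_of_eq ?_).trans (ENNReal.rpow_le_rpow (hA μ hμ ε₁ ε₂ hε₁ hε₂ f₁ f₂ h₁ h₂)
      (by norm_num))
    rw [← lTwo]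
    congr 1
    ext q
    rw [ofReal_mul_piece (a := fun q => outGain q ^ (3 / 4 : ℝ))
      (Real.rpow_nonneg (outGain_pos q).le _)]
    congr 1
    ext q
    rw [outWeight, yWeight, mul_comm]
  · refine (outNorm_le_tsum (measurable_piece hw h₁ h₂ mF)).trans ?_
    rw [mul_assoc]
    gcongr
    refine le_trans (ENNReal.tsum_le_tsum fun j => lTwo_mono fun q => ?_)
      (hB μ hμ ε₁ ε₂ hε₁ hε₂ f₁ f₂ h₁ h₂)
    refine Set.indicator_apply_le' (fun hq => le_of_eq ?_) fun _ => zero_le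
    rw [ofReal_mul_piece (a := fun q => bracket q.2 / modulation q)
      (div_pos (bracket_pos _) (bracket_pos _)).le, piece_inter_of_mem hq]
    congr 1
    ext q
    rw [ratioWeight, yWeight, mul_comm]

end


/-! ### Convolutions at low output frequencies -/

section
variable {μ : Measure ℝ} {s : ℝ} {f₁ f₂ φ₁ φ₂ : ℝ × ℝ → ℝ≥0∞}

/-- The convolution of two nonnegative functions. -/
noncomputable def conv (μ : Measure ℝ) (f₁ f₂ : ℝ × ℝ → ℝ≥0∞) (q : ℝ × ℝ) : ℝ≥0∞ :=
  ∫⁻ p, f₁ p * f₂ (q - p) ∂(stMeasure μ)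

lemma measurable_conv [SFinite μ] (h₁ : Measurable f₁) (h₂ : Measurable f₂) :
    Measurable (conv μ f₁ f₂) := by
  have : Measurable fun z : (ℝ × ℝ) × (ℝ × ℝ) => f₁ z.2 * f₂ (z.1 - z.2) := by fun_prop
  exact this.lintegral_prod_right'

lemma conv_comm_ae [SFinite μ] (hμ : IsFreqMeasure μ) (h₁ : Measurable f₁) (h₂ : Measurable f₂) :
    ∀ᵐ q ∂(stMeasure μ), conv μ f₁ f₂ q = conv μ f₂ f₁ q := by
  filter_upwards [hμ.lintegral_comp_reflect (u := fun q p => f₂ p * f₁ (q - p))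
    (by fun_prop)] with q hq
  rw [conv, conv, ← hq]
  refine lintegral_congr fun p => ?_
  rw [sub_sub_cancel, mul_comm]

/-- If the factor `M` is square integrable in the spatial frequency, then an `L^∞_ξ` bound of a
convolution suffices. -/
lemma lTwo_mul_conv_le [SFinite μ] (hμ : IsFreqMeasure μ) (h₁ : Measurable φ₁)
    (h₂ : Measurable φ₂) {M : ℝ → ℝ≥0∞} (hM : Measurable M) {B : ℝ≥0∞}
    (hB : ∫⁻ x, M x ^ 2 ∂μ ≤ B ^ 2) :
    lTwo μ (fun q => M q.2 * conv μ φ₁ φ₂ q)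
      ≤ B * (sqNormLOne μ φ₁ * ∫⁻ p, φ₂ p ^ 2 ∂(stMeasure μ)) ^ (1 / 2 : ℝ) := by
  have hc := measurable_conv (μ := μ) h₁ h₂
  rw [lTwo_le_iff, mul_pow, ennreal_sqrt_sq, IsFreqMeasure.lintegral_sq_eq (by fun_prop)]
  calc _ = ∫⁻ x, M x ^ 2 * ∫⁻ t, conv μ φ₁ φ₂ (t, x) ^ 2 ∂volume ∂μ := by
        refine lintegral_congr fun x => ?_
        rw [← lintegral_const_mul _ (by fun_prop)]
        exact lintegral_congr fun t => mul_pow _ _ _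
    _ ≤ ∫⁻ x, M x ^ 2 * (sqNormLOne μ φ₁ * ∫⁻ p, φ₂ p ^ 2 ∂(stMeasure μ)) ∂μ := by
        refine lintegral_mono_ae ?_
        filter_upwards [hμ.bilinear_sup_lTwo h₁ h₂] with x hx
        gcongr
        exact hx
    _ ≤ _ := by
        rw [lintegral_mul_const _ (by fun_prop)]
        gcongr

lemma lTwo_mul_conv_le' [SFinite μ] (hμ : IsFreqMeasure μ) (h₁ : Measurable φ₁)
    (h₂ : Measurable φ₂) {M : ℝ → ℝ≥0∞} (hM : Measurable M) {B : ℝ≥0∞}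
    (hB : ∫⁻ x, M x ^ 2 ∂μ ≤ B ^ 2) :
    lTwo μ (fun q => M q.2 * conv μ φ₁ φ₂ q)
      ≤ B * ((∫⁻ p, φ₁ p ^ 2 ∂(stMeasure μ)) * sqNormLOne μ φ₂) ^ (1 / 2 : ℝ) := by
  rw [mul_comm (∫⁻ p, φ₁ p ^ 2 ∂(stMeasure μ))]
  refine (lTwo_congr_ae ?_).trans_le (lTwo_mul_conv_le hμ h₂ h₁ hM hB)
  filter_upwards [conv_comm_ae hμ h₁ h₂] with q hq
  rw [hq]

/-- The symbol of `ω_lam²`. -/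
noncomputable def omegaSym (lam x : ℝ) : ℝ := lam ^ 2 * x ^ 2 / (1 + lam ^ 2 * x ^ 2)

@[fun_prop] lemma measurable_omegaSym (lam : ℝ) : Measurable (omegaSym lam) := by
  unfold omegaSym; fun_prop

lemma omegaSym_nonneg (lam x : ℝ) : 0 ≤ omegaSym lam x := by unfold omegaSym; positivity

lemma omegaSym_le_one (lam x : ℝ) : omegaSym lam x ≤ 1 := by
  unfold omegaSym
  rw [div_le_one (by positivity)]
  linarith

lemma omegaSym_le_sq (lam x : ℝ) : omegaSym lam x ≤ (lam * |x|) ^ 2 := by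
  unfold omegaSym
  rw [mul_pow, sq_abs]
  exact div_le_self (by positivity) (by nlinarith [mul_nonneg (sq_nonneg lam) (sq_nonneg x)])

/-- The spatial frequencies `0 < |ξ| ≤ 1`. -/
def lowBand : Set ℝ := {x | 0 < |x|} ∩ {x | |x| ≤ 1}

lemma measurableSet_lowBand : MeasurableSet lowBand :=
  (measurableSet_lt (by fun_prop) (by fun_prop)).inter
    (measurableSet_le (by fun_prop) (by fun_prop))

/-- At low output frequencies the resonance is at least `d ξ` times the frequency of the
factors. -/
structure IsLowResonance (ε₁ ε₂ : ℝ) (d : ℝ → ℝ) : Prop where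
  measurable : Measurable d
  pos : ∀ x ∈ lowBand, 0 < d x
  le_one : ∀ x ∈ lowBand, d x ≤ 1
  le : ∀ q p : ℝ × ℝ, q.2 ∈ lowBand → d q.2 * bracket p.2
    ≤ 6 * (modulation q + signedModulation ε₁ p + signedModulation ε₂ (q - p))

/-- The weight in the spatial frequency that is left over at low output frequencies. -/
noncomputable def lowWeight (s lam : ℝ) (d : ℝ → ℝ) (x : ℝ) : ℝ≥0∞ :=
  lowBand.indicator (fun x => ENNReal.ofReal (omegaSym lam x * d x ^ (2 * s))) x

lemma measurable_lowWeight {lam : ℝ} {d : ℝ → ℝ} (hd : Measurable d) :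
    Measurable (lowWeight s lam d) :=
  Measurable.indicator (by fun_prop) measurableSet_lowBand

lemma bracket_sub_le_two_mul {q p : ℝ × ℝ} (h : |q.2| ≤ 1) :
    bracket (q - p).2 ≤ 2 * bracket p.2 ∧ bracket p.2 ≤ 2 * bracket (q - p).2 := by
  have h1 := bracket_add_le (-p.2) q.2
  have h2 := bracket_add_le (-(q - p).2) q.2
  rw [bracket_neg] at h1 h2
  have e1 : -p.2 + q.2 = (q - p).2 := by simp; ring
  have e2 : -(q - p).2 + q.2 = p.2 := by simp
  rw [e1] at h1
  rw [e2] at h2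
  have := one_le_bracket p.2
  have := one_le_bracket (q - p).2
  constructor <;> linarith

variable {ε₁ ε₂ lam : ℝ} {d : ℝ → ℝ}

/-- Either the output or one of the factors carries the resonance. -/
lemma IsLowResonance.max_one_le (hd : IsLowResonance ε₁ ε₂ d) {q p : ℝ × ℝ} (hq : q.2 ∈ lowBand) :
    max 1 (d q.2 * bracket p.2) ≤ 12 * (modulation q + min (signedModulation ε₁ p) (bracket p.2) +
      min (signedModulation ε₂ (q - p)) (bracket (q - p).2)) := by
  have h1 := hd.le q p hq
  have h2 := hd.le_one _ hq
  obtain ⟨g1, g2⟩ := bracket_sub_le_two_mul (p := p) hq.2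
  have m1 := one_le_min_modulation ε₁ p
  have m2 := one_le_min_modulation ε₂ (q - p)
  have hL : 1 ≤ modulation q := one_le_bracket _
  have hn := one_le_bracket p.2
  have h3 : d q.2 * bracket p.2 ≤ bracket p.2 := by nlinarith
  refine max_le (by linarith) ?_
  rcases min_choice (signedModulation ε₁ p) (bracket p.2) with c1 | c1 <;>
  rcases min_choice (signedModulation ε₂ (q - p)) (bracket (q - p).2) with c2 | c2 <;>
  rw [c1, c2] <;> rw [c1] at m1 <;> rw [c2] at m2 <;> linarith

/-- With `A = d ξ ⟨ξ₁⟩` this is `1 ≤ A ^ (2 s) max (1, A)`, which needs `-1 / 2 ≤ s ≤ 0`. -/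
lemma IsLowResonance.one_le_rpow_mul (hd : IsLowResonance ε₁ ε₂ d) (hs : -1 / 2 ≤ s) (hs' : s ≤ 0)
    {q p : ℝ × ℝ} (hq : q.2 ∈ lowBand) :
    1 ≤ 2 * d q.2 ^ (2 * s) * (yWeight s p * yWeight s (q - p)) *
      max 1 (d q.2 * bracket p.2) := by
  obtain ⟨g1, g2⟩ := bracket_sub_le_two_mul (p := p) hq.2
  have hn := bracket_pos p.2
  have hn2 := bracket_pos (q - p).2
  have hd0 := hd.pos _ hq
  set A := d q.2 * bracket p.2 with hA
  have hA0 : 0 < A := by positivity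
  have h1 : 1 ≤ A ^ (2 * s) * max 1 A := by
    rcases le_total A 1 with h | h
    · rw [max_eq_left h, mul_one]
      exact Real.one_le_rpow_of_pos_of_le_one_of_nonpos hA0 h (by linarith)
    · rw [max_eq_right h, ← Real.rpow_add_one hA0.ne']
      exact Real.one_le_rpow h (by linarith)
  have h2 : bracket p.2 ^ s ≤ 2 * bracket (q - p).2 ^ s := by
    calc bracket p.2 ^ s = 2 * (2 ^ (-1 : ℝ) * bracket p.2 ^ s) := by rw [Real.rpow_neg_one]; ring
      _ ≤ 2 * (2 ^ s * bracket p.2 ^ s) := by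
          gcongr
          · norm_num
          · linarith
      _ = 2 * (2 * bracket p.2) ^ s := by rw [Real.mul_rpow (by norm_num) hn.le]
      _ ≤ _ := by
          gcongr 2 * ?_
          exact Real.rpow_le_rpow_of_nonpos hn2 g1 hs'
  refine h1.trans ?_
  gcongr
  rw [hA, Real.mul_rpow hd0.le hn.le, two_mul s, Real.rpow_add hn, yWeight, yWeight]
  calc d q.2 ^ (s + s) * (bracket p.2 ^ s * bracket p.2 ^ s)
      ≤ d q.2 ^ (s + s) * (bracket p.2 ^ s * (2 * bracket (q - p).2 ^ s)) := by gcongr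
    _ = _ := by ring

/-- The pointwise bound that carries the estimates at low output frequencies. -/
lemma IsLowResonance.one_le_weights (hd : IsLowResonance ε₁ ε₂ d) (hs : -1 / 2 ≤ s) (hs' : s ≤ 0)
    {q p : ℝ × ℝ} (hq : q.2 ∈ lowBand) :
    1 ≤ 24 * d q.2 ^ (2 * s) * (modulation q * (yWeight s p * yWeight s (q - p)) +
      (xWeight s ε₁ p * yWeight s (q - p) + yWeight s p * xWeight s ε₂ (q - p))) := by
  have hd0 := hd.pos _ hq
  have h1 := yWeight_nonneg s p
  have h2 := yWeight_nonneg s (q - p)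
  refine (hd.one_le_rpow_mul hs hs' (p := p) hq).trans ?_
  refine (mul_le_mul_of_nonneg_left (hd.max_one_le hq) (by positivity)).trans (le_of_eq ?_)
  simp only [xWeight, yWeight]
  ring

lemma yWeight_le_xWeight (s ε : ℝ) (p : ℝ × ℝ) : yWeight s p ≤ xWeight s ε p :=
  le_mul_of_one_le_right (yWeight_nonneg s p) (one_le_min_modulation ε p)

/-- A pointwise bound by three products of weights, inserted into the convolution. -/
lemma ofReal_mul_conv_le [SFinite μ] {w₁ w₂ v₁ v₂ u₁ u₂ : ℝ × ℝ → ℝ} (h₁ : Measurable f₁)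
    (h₂ : Measurable f₂) (hw₁ : Measurable w₁) (hw₂ : Measurable w₂) (hv₁ : Measurable v₁)
    (hv₂ : Measurable v₂) (p₁ : ∀ p, 0 ≤ w₁ p) (p₂ : ∀ p, 0 ≤ w₂ p) (r₁ : ∀ p, 0 ≤ v₁ p)
    (r₂ : ∀ p, 0 ≤ v₂ p) (t₁ : ∀ p, 0 ≤ u₁ p) (t₂ : ∀ p, 0 ≤ u₂ p) {a b c d : ℝ} (hb : 0 ≤ b)
    (hc : 0 ≤ c) (hd : 0 ≤ d) {q : ℝ × ℝ}
    (h : ∀ p, a ≤ b * (w₁ p * w₂ (q - p)) + c * (v₁ p * v₂ (q - p)) + d * (u₁ p * u₂ (q - p))) :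
    ENNReal.ofReal a * conv μ f₁ f₂ q
      ≤ ENNReal.ofReal b * conv μ (weighted w₁ f₁) (weighted w₂ f₂) q +
        ENNReal.ofReal c * conv μ (weighted v₁ f₁) (weighted v₂ f₂) q +
        ENNReal.ofReal d * conv μ (weighted u₁ f₁) (weighted u₂ f₂) q := by
  have m1 := measurable_weighted hw₁ h₁
  have m2 := measurable_weighted hw₂ h₂
  have m3 := measurable_weighted hv₁ h₁
  have m4 := measurable_weighted hv₂ h₂
  unfold conv
  simp only [← lintegral_const_mul' _ _ ENNReal.ofReal_ne_top]
  rw [← lintegral_add_left (by fun_prop), ← lintegral_add_left (by fun_prop)]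
  refine lintegral_mono fun p => ?_
  simp only [weighted]
  calc ENNReal.ofReal a * (f₁ p * f₂ (q - p))
      ≤ ENNReal.ofReal (b * (w₁ p * w₂ (q - p)) + c * (v₁ p * v₂ (q - p))
        + d * (u₁ p * u₂ (q - p))) * (f₁ p * f₂ (q - p)) := by gcongr; exact h p
    _ = _ := by
        have i1 := p₁ p; have i2 := p₂ (q - p); have i3 := r₁ p; have i4 := r₂ (q - p)
        have i5 := t₁ p; have i6 := t₂ (q - p)
        rw [ENNReal.ofReal_add (by positivity) (by positivity),
          ENNReal.ofReal_add (by positivity) (by positivity), ENNReal.ofReal_mul hb,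
          ENNReal.ofReal_mul hc, ENNReal.ofReal_mul hd, ENNReal.ofReal_mul i1,
          ENNReal.ofReal_mul i3, ENNReal.ofReal_mul i5]
        ring

/-- The contribution of the low output frequencies to the `L²` norm of `ω_lam² (u v)`, with the
weight `⟨τ + ξ ^ 2⟩⁻¹`. -/
lemma lTwo_low_le [SFinite μ] (hμ : IsFreqMeasure μ) (hd : IsLowResonance ε₁ ε₂ d)
    (hs : -1 / 2 ≤ s) (hs' : s ≤ 0) (h₁ : Measurable f₁) (h₂ : Measurable f₂) {B : ℝ≥0∞}
    (hB : ∫⁻ x, lowWeight s lam d x ^ 2 ∂μ ≤ B ^ 2) :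
    lTwo μ ({q : ℝ × ℝ | q.2 ∈ lowBand}.indicator fun q =>
      ENNReal.ofReal (omegaSym lam q.2 / modulation q) * conv μ f₁ f₂ q)
      ≤ 96 * B * (sqNorm μ s ε₁ f₁ * sqNorm μ s ε₂ f₂) ^ (1 / 2 : ℝ) := by
  have hM := measurable_lowWeight (s := s) (lam := lam) hd.measurable
  have w1 := measurable_weighted (measurable_xWeight s ε₁) h₁
  have w2 := measurable_weighted (measurable_yWeight s) h₂
  have w3 := measurable_weighted (measurable_yWeight s) h₁
  have w4 := measurable_weighted (measurable_xWeight s ε₂) h₂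
  have c1 := measurable_conv (μ := μ) w1 w2
  have c2 := measurable_conv (μ := μ) w3 w4
  set F₁ : ℝ × ℝ → ℝ≥0∞ := fun q => lowWeight s lam d q.2 *
    conv μ (weighted (xWeight s ε₁) f₁) (weighted (yWeight s) f₂) q with hF₁
  set F₂ : ℝ × ℝ → ℝ≥0∞ := fun q => lowWeight s lam d q.2 *
    conv μ (weighted (yWeight s) f₁) (weighted (xWeight s ε₂) f₂) q with hF₂
  have hF₁m : Measurable F₁ := by fun_prop
  have hF₂m : Measurable F₂ := by fun_prop
  calc _ ≤ lTwo μ (fun q => 48 * (F₁ q + F₂ q)) := by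
        refine lTwo_mono fun q => Set.indicator_apply_le' (fun hq => ?_) fun _ => zero_le
        have hq : q.2 ∈ lowBand := hq
        have hd0 := hd.pos _ hq
        have ho := omegaSym_nonneg lam q.2
        have hL : 1 ≤ modulation q := one_le_bracket _
        set b := 48 * (omegaSym lam q.2 * d q.2 ^ (2 * s)) with hb
        refine (ofReal_mul_conv_le (a := omegaSym lam q.2 / modulation q) (b := b) (c := b)
          (d := 0) h₁ h₂ (measurable_xWeight s ε₁) (measurable_yWeight s) (measurable_yWeight s)
          (measurable_xWeight s ε₂) (xWeight_nonneg s ε₁) (yWeight_nonneg s) (yWeight_nonneg s)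
          (xWeight_nonneg s ε₂) (yWeight_nonneg s) (yWeight_nonneg s)
          (by positivity) (by positivity) le_rfl fun p => ?_).trans ?_
        · have key := hd.one_le_weights hs hs' (p := p) hq
          have y1 := yWeight_nonneg s p
          have y2 := yWeight_nonneg s (q - p)
          have x1 := yWeight_le_xWeight s ε₁ p
          have x2 := xWeight_nonneg s ε₂ (q - p)
          rw [div_le_iff₀ (by linarith), zero_mul, add_zero]
          -- The term of `one_le_weights` in which the output carries the resonance is absorbed into the first
          -- of the other two, as `yWeight ≤ xWeight`.
          calc omegaSym lam q.2 = omegaSym lam q.2 * 1 := (mul_one _).symm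
            _ ≤ omegaSym lam q.2 * (24 * d q.2 ^ (2 * s) * (modulation q *
                  (xWeight s ε₁ p * yWeight s (q - p)) + modulation q *
                  (xWeight s ε₁ p * yWeight s (q - p) + yWeight s p * xWeight s ε₂ (q - p)))) := by
                refine mul_le_mul_of_nonneg_left (key.trans ?_) ho
                have x1' : 0 ≤ xWeight s ε₁ p := y1.trans x1
                gcongr 24 * d q.2 ^ (2 * s) * (modulation q * (?_ * yWeight s (q - p)) + ?_)
                exact le_mul_of_one_le_left (by positivity) hL
            _ ≤ _ := by
                have : 0 ≤ omegaSym lam q.2 * d q.2 ^ (2 * s) * modulation q *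
                  (yWeight s p * xWeight s ε₂ (q - p)) := by positivity
                rw [hb]
                nlinarith
        · have e : ENNReal.ofReal b = 48 * lowWeight s lam d q.2 := by
            rw [lowWeight, Set.indicator_of_mem hq, hb, ENNReal.ofReal_mul (by norm_num),
              ENNReal.ofReal_ofNat]
          rw [e, hF₁, hF₂, ENNReal.ofReal_zero, zero_mul, add_zero]
          apply le_of_eq
          ring
    _ ≤ 48 * (B * (sqNorm μ s ε₁ f₁ * sqNorm μ s ε₂ f₂) ^ (1 / 2 : ℝ) +
          B * (sqNorm μ s ε₁ f₁ * sqNorm μ s ε₂ f₂) ^ (1 / 2 : ℝ)) := by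
        rw [lTwo_const_mul _ (by fun_prop)]
        gcongr
        refine (lTwo_add_le hF₁m hF₂m).trans (add_le_add ?_ ?_)
        · refine (lTwo_mul_conv_le' hμ w1 w2 hM hB).trans ?_
          gcongr
          · exact lintegral_sq_weighted_le_sqNorm
          · exact sqNormLOne_le_sqNorm
        · refine (lTwo_mul_conv_le hμ w3 w4 hM hB).trans ?_
          gcongr
          · exact sqNormLOne_le_sqNorm
          · exact lintegral_sq_weighted_le_sqNorm
    _ = _ := by ring

end


section
variable {μ : Measure ℝ} {s : ℝ} {f₁ f₂ : ℝ × ℝ → ℝ≥0∞} {ε₁ ε₂ lam : ℝ} {d : ℝ → ℝ}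

/-- A weight `m` in the spatial frequency that dominates the low output frequencies when the output
carries the resonance, with a gain `dyadicDecay` that pays for the sum over dyadic modulations. -/
structure IsShellWeight (lam : ℝ) (d : ℝ → ℝ) (Λ : ℝ) (m : ℝ → ℝ) : Prop where
  measurable : Measurable m
  nonneg : ∀ x, 0 ≤ m x
  scale_pos : 0 < Λ
  le : ∀ x ∈ lowBand, ∀ y, 0 < y → d x * Λ * y ≤ 48 → omegaSym lam x * Λ * y ≤ m x * dyadicDecay y

/-- The localized `L²_ξ L¹_τ` norms are square summable over the dyadic shells, if the localization is in
the spatial frequency. -/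
lemma exists_tsum_sqNormLOne_localized_le : ∃ C : ℝ≥0, ∀ (μ : Measure ℝ) [SFinite μ]
    (w : ℝ × ℝ → ℝ) (Y : ℝ → ℝ) (f : ℝ × ℝ → ℝ≥0∞), Measurable w → Measurable Y → Measurable f →
    (∀ p, 0 ≤ w p) → (∀ p, 0 < Y p) →
    ∑' j, sqNormLOne μ (weighted (localized w (fun p => Y p.2) j) f)
      ≤ C * sqNormLOne μ (weighted w f) := by
  obtain ⟨C, hC⟩ := exists_tsum_dyadicDecay_le
  refine ⟨C, fun μ _ w Y f hw hY hf hw0 hY0 => ?_⟩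
  have hm : Measurable fun x => ∫⁻ t, weighted w f (t, x) :=
    ((measurable_weighted hw hf).comp measurable_swap).lintegral_prod_right'
  have e : ∀ j, sqNormLOne μ (weighted (localized w (fun p => Y p.2) j) f)
      = ∫⁻ x, ENNReal.ofReal (dyadicDecay (Y x / 2 ^ j)) * (∫⁻ t, weighted w f (t, x)) ^ 2 ∂μ := by
    intro j
    refine lintegral_congr fun x => ?_
    have h0 := dyadicDecay_nonneg (div_pos (hY0 x) (by positivity : (0 : ℝ) < 2 ^ j)).le
    have e' : (dyadicDecay (Y x / 2 ^ j) ^ (1 / 2 : ℝ)) ^ 2 = dyadicDecay (Y x / 2 ^ j) := by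
      rw [← Real.rpow_natCast, ← Real.rpow_mul h0]; norm_num
    have e'' : ENNReal.ofReal (dyadicDecay (Y x / 2 ^ j))
        = ENNReal.ofReal (dyadicDecay (Y x / 2 ^ j) ^ (1 / 2 : ℝ)) ^ 2 := by
      rw [← ENNReal.ofReal_pow (by positivity), e']
    rw [e'', ← mul_pow, ← lintegral_const_mul' _ _ ENNReal.ofReal_ne_top]
    congr 1
    refine lintegral_congr fun t => ?_
    rw [weighted, weighted, localized, ENNReal.ofReal_mul (hw0 _)]
    ring
  simp only [e]
  rw [← lintegral_tsum fun j => by fun_prop, sqNormLOne, ← lintegral_const_mul _ (by fun_prop)]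
  refine lintegral_mono fun x => ?_
  rw [ENNReal.tsum_mul_right]
  gcongr
  exact hC _ (hY0 x)

/-- On a dyadic shell of output modulations: either a factor carries the resonance, or the output
does, and then its modulation localizes the frequencies of the factors. -/
lemma IsLowResonance.shell_le (hd : IsLowResonance ε₁ ε₂ d) (hs : s = -1 / 2) {Λ : ℝ} {m : ℝ → ℝ}
    (hm : IsShellWeight lam d Λ m) {q p : ℝ × ℝ} (hq : q.2 ∈ lowBand) {j : ℕ}
    (hj : q ∈ dyadicRegion j) :
    omegaSym lam q.2 / modulation q ≤
      (dyadicRatio ^ j : ℝ≥0) * (48 * (omegaSym lam q.2 * d q.2 ^ (2 * s))) *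
          (xWeight s ε₁ p * yWeight s (q - p)) +
        (dyadicRatio ^ j : ℝ≥0) * (48 * (omegaSym lam q.2 * d q.2 ^ (2 * s))) *
          (yWeight s p * xWeight s ε₂ (q - p)) +
        4 * m q.2 * (localized (xWeight s ε₁) (fun p => bracket p.2 / Λ) j p *
          localized (yWeight s) (fun p => bracket p.2 / Λ) j (q - p)) := by
  obtain ⟨g1, g2⟩ := bracket_sub_le_two_mul (p := p) hq.2
  have hn := bracket_pos p.2
  have hn2 := bracket_pos (q - p).2
  have hd0 := hd.pos _ hq
  have ho := omegaSym_nonneg lam q.2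
  have hL : 1 ≤ modulation q := one_le_bracket _
  have hL0 : 0 < modulation q := by linarith
  have hΛ := hm.scale_pos
  have hm0 := hm.nonneg q.2
  have y1 := yWeight_nonneg s p
  have y2 := yWeight_nonneg s (q - p)
  have x1 := xWeight_nonneg s ε₁ p
  have x2 := xWeight_nonneg s ε₂ (q - p)
  have hM : (0 : ℝ) < 2 ^ j := by positivity
  have k1 := localized_nonneg (xWeight_nonneg s ε₁)
    (Y := fun p => bracket p.2 / Λ) (fun p => div_pos (bracket_pos _) hΛ) j p
  have k2 := localized_nonneg (yWeight_nonneg s)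
    (Y := fun p => bracket p.2 / Λ) (fun p => div_pos (bracket_pos _) hΛ) j (q - p)
  have hmax := hd.max_one_le hq (p := p)
  have hone := hd.one_le_rpow_mul hs.ge (by linarith) hq (p := p)
  set m₁ := min (signedModulation ε₁ p) (bracket p.2) with hm₁
  set m₂ := min (signedModulation ε₂ (q - p)) (bracket (q - p).2) with hm₂
  -- In the first case a factor carries the resonance and `⟨τ + ξ ^ 2⟩⁻¹` decays geometrically in `j`;
  -- in the second one `d ξ ⟨ξ₁⟩ ≤ 48 * 2 ^ j`, and the weight `m` pays
  -- for the decay of `⟨ξ₁⟩ / Λ` away from `2 ^ j`.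
  rcases le_total (modulation q) (m₁ + m₂) with h | h
  · have hρ : 1 / modulation q ≤ ((dyadicRatio ^ j : ℝ≥0) : ℝ) := by
      calc 1 / modulation q ≤ 1 / 2 ^ j := by gcongr; exact hj.1
        _ = ((2 : ℝ) ^ j) ^ (-1 : ℝ) := by rw [Real.rpow_neg_one, one_div]
        _ ≤ _ := two_pow_rpow_le (by norm_num) j
    have h3 : 1 ≤ 48 * d q.2 ^ (2 * s) *
        (xWeight s ε₁ p * yWeight s (q - p) + yWeight s p * xWeight s ε₂ (q - p)) := by
      calc 1 ≤ 2 * d q.2 ^ (2 * s) * (yWeight s p * yWeight s (q - p)) * (24 * (m₁ + m₂)) := by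
            refine hone.trans ?_
            gcongr
            linarith
        _ = _ := by simp only [xWeight, yWeight, hm₁, hm₂]; ring
    calc omegaSym lam q.2 / modulation q = 1 / modulation q * (omegaSym lam q.2 * 1) := by ring
      _ ≤ ((dyadicRatio ^ j : ℝ≥0) : ℝ) * (omegaSym lam q.2 * (48 * d q.2 ^ (2 * s) *
        (xWeight s ε₁ p * yWeight s (q - p) + yWeight s p * xWeight s ε₂ (q - p)))) := by gcongr
      _ ≤ _ := by
        have : 0 ≤ 4 * m q.2 * (localized (xWeight s ε₁) (fun p => bracket p.2 / Λ) j p *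
          localized (yWeight s) (fun p => bracket p.2 / Λ) j (q - p)) := by positivity
        refine le_trans (le_of_eq ?_) (le_add_of_nonneg_right this)
        ring
  · have hL2 : modulation q ≤ 2 * 2 ^ j := by rw [mul_comm, ← pow_succ]; exact hj.2.le
    have hA : d q.2 * bracket p.2 ≤ 48 * 2 ^ j := by
      have := le_max_right 1 (d q.2 * bracket p.2)
      linarith
    set a := bracket p.2 / Λ / 2 ^ j with ha
    set b := bracket (q - p).2 / Λ / 2 ^ j with hb
    have ha0 : 0 < a := by positivity
    have hb0 : 0 < b := by positivity
    have hab : a ≤ 2 * b := by rw [ha, hb, div_div, div_div, mul_div_assoc']; gcongr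
    have hba : b ≤ 2 * a := by rw [ha, hb, div_div, div_div, mul_div_assoc']; gcongr
    have hkey := hm.le _ hq a ha0 (by
      rw [ha]
      have : d q.2 * Λ * (bracket p.2 / Λ / 2 ^ j) = d q.2 * bracket p.2 / 2 ^ j := by field_simp
      rw [this, div_le_iff₀ hM]; exact hA)
    have da := dyadicDecay_nonneg ha0.le
    have db := dyadicDecay_nonneg hb0.le
    have hh : dyadicDecay a ≤ 2 * (dyadicDecay a ^ (1 / 2 : ℝ) * dyadicDecay b ^ (1 / 2 : ℝ)) := by
      have hle := dyadicDecay_le_of_le ha0 hab hba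
      calc dyadicDecay a = dyadicDecay a ^ (1 / 2 : ℝ) * dyadicDecay a ^ (1 / 2 : ℝ) := by
            rw [← Real.rpow_add_of_nonneg da (by norm_num) (by norm_num)]; norm_num
        _ ≤ dyadicDecay a ^ (1 / 2 : ℝ) * (2 * dyadicDecay b) ^ (1 / 2 : ℝ) := by gcongr
        _ = dyadicDecay a ^ (1 / 2 : ℝ) * (2 ^ (1 / 2 : ℝ) * dyadicDecay b ^ (1 / 2 : ℝ)) := by
            rw [Real.mul_rpow (by norm_num) db]
        _ ≤ dyadicDecay a ^ (1 / 2 : ℝ) * (2 ^ (1 : ℝ) * dyadicDecay b ^ (1 / 2 : ℝ)) := by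
            gcongr <;> norm_num
        _ = _ := by rw [Real.rpow_one]; ring
    have hy : (bracket p.2)⁻¹ ≤ 2 * (xWeight s ε₁ p * yWeight s (q - p)) := by
      have e1 : (bracket p.2)⁻¹ = bracket p.2 ^ s * bracket p.2 ^ s := by
        rw [← Real.rpow_add hn, hs, ← Real.rpow_neg_one]; norm_num
      have e2 : bracket p.2 ^ s ≤ 2 * bracket (q - p).2 ^ s := by
        have := hone
        calc bracket p.2 ^ s = 2 * (2 ^ (-1 : ℝ) * bracket p.2 ^ s) := by
              rw [Real.rpow_neg_one]; ring
          _ ≤ 2 * (2 ^ s * bracket p.2 ^ s) := by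
              gcongr
              · norm_num
              · rw [hs]; norm_num
          _ = 2 * (2 * bracket p.2) ^ s := by rw [Real.mul_rpow (by norm_num) hn.le]
          _ ≤ _ := by
              gcongr 2 * ?_
              exact Real.rpow_le_rpow_of_nonpos hn2 g1 (by rw [hs]; norm_num)
      calc (bracket p.2)⁻¹ = yWeight s p * bracket p.2 ^ s := e1
        _ ≤ xWeight s ε₁ p * (2 * yWeight s (q - p)) := by
            gcongr
            · exact yWeight_le_xWeight s ε₁ p
            · exact e2
        _ = _ := by ring
    have hfin : omegaSym lam q.2 / modulation q ≤
        4 * m q.2 * (localized (xWeight s ε₁) (fun p => bracket p.2 / Λ) j p *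
          localized (yWeight s) (fun p => bracket p.2 / Λ) j (q - p)) := by
      calc omegaSym lam q.2 / modulation q ≤ omegaSym lam q.2 / 2 ^ j := by gcongr; exact hj.1
        _ = omegaSym lam q.2 * Λ * a * (bracket p.2)⁻¹ := by rw [ha]; field_simp
        _ ≤ m q.2 * (2 * (dyadicDecay a ^ (1 / 2 : ℝ) * dyadicDecay b ^ (1 / 2 : ℝ))) *
              (2 * (xWeight s ε₁ p * yWeight s (q - p))) := by
            exact mul_le_mul (hkey.trans (mul_le_mul_of_nonneg_left hh hm0)) hy (by positivity)
              (by positivity)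
        _ = _ := by simp only [localized, ha, hb]; ring
    refine hfin.trans (le_add_of_nonneg_left ?_)
    positivity

/-- The contribution of the low output frequencies to the sum over dyadic modulations. -/
lemma exists_tsum_low_le : ∃ C : ℝ≥0, ∀ (μ : Measure ℝ) [SFinite μ], IsFreqMeasure μ →
    ∀ (s ε₁ ε₂ lam Λ : ℝ) (d m : ℝ → ℝ) (f₁ f₂ : ℝ × ℝ → ℝ≥0∞) (B : ℝ≥0∞), s = -1 / 2 →
    IsLowResonance ε₁ ε₂ d → IsShellWeight lam d Λ m → Measurable f₁ → Measurable f₂ →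
    ∫⁻ x, lowWeight s lam d x ^ 2 ∂μ ≤ B ^ 2 →
    ∫⁻ x, lowBand.indicator (fun x => ENNReal.ofReal (m x)) x ^ 2 ∂μ ≤ B ^ 2 →
    ∑' j, lTwo μ ((dyadicRegion j ∩ {q : ℝ × ℝ | q.2 ∈ lowBand}).indicator fun q =>
        ENNReal.ofReal (omegaSym lam q.2 / modulation q) * conv μ f₁ f₂ q)
      ≤ C * B * (sqNorm μ s ε₁ f₁ * sqNorm μ s ε₂ f₂) ^ (1 / 2 : ℝ) := by
  obtain ⟨D, hD⟩ := exists_tsum_localized_le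
  obtain ⟨E, hE⟩ := exists_tsum_sqNormLOne_localized_le
  refine ⟨96 * dyadicSum + 4 * (D * E) ^ (1 / 2 : ℝ),
    fun μ _ hμ s ε₁ ε₂ lam Λ d m f₁ f₂ B hs hd hm h₁ h₂ hB hBm => ?_⟩
  set X := sqNorm μ s ε₁ f₁ * sqNorm μ s ε₂ f₂ with hX
  have hM := measurable_lowWeight (s := s) (lam := lam) hd.measurable
  have hmm : Measurable (lowBand.indicator fun x => ENNReal.ofReal (m x)) :=
    Measurable.indicator (by have := hm.measurable; fun_prop) measurableSet_lowBand
  set Y : ℝ × ℝ → ℝ := fun p => bracket p.2 / Λ with hY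
  have hYm : Measurable Y := by fun_prop
  have hY0 : ∀ p, 0 < Y p := fun p => div_pos (bracket_pos _) hm.scale_pos
  have w1 := measurable_weighted (measurable_xWeight s ε₁) h₁
  have w2 := measurable_weighted (measurable_yWeight s) h₂
  have w3 := measurable_weighted (measurable_yWeight s) h₁
  have w4 := measurable_weighted (measurable_xWeight s ε₂) h₂
  have l5 : ∀ j, Measurable (localized (xWeight s ε₁) Y j) :=
    measurable_localized (by fun_prop) hYm
  have l6 : ∀ j, Measurable (localized (yWeight s) Y j) :=
    measurable_localized (by fun_prop) hYm
  have w5 : ∀ j, Measurable (weighted (localized (xWeight s ε₁) Y j) f₁) :=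
    fun j => measurable_weighted (l5 j) h₁
  have w6 : ∀ j, Measurable (weighted (localized (yWeight s) Y j) f₂) :=
    fun j => measurable_weighted (l6 j) h₂
  have c1 := measurable_conv (μ := μ) w1 w2
  have c2 := measurable_conv (μ := μ) w3 w4
  have c3 := fun j => measurable_conv (μ := μ) (w5 j) (w6 j)
  set F₁ : ℝ × ℝ → ℝ≥0∞ := fun q => lowWeight s lam d q.2 *
    conv μ (weighted (xWeight s ε₁) f₁) (weighted (yWeight s) f₂) q with hF₁
  set F₂ : ℝ × ℝ → ℝ≥0∞ := fun q => lowWeight s lam d q.2 *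
    conv μ (weighted (yWeight s) f₁) (weighted (xWeight s ε₂) f₂) q with hF₂
  set F₃ : ℕ → ℝ × ℝ → ℝ≥0∞ := fun j q => lowBand.indicator (fun x => ENNReal.ofReal (m x)) q.2 *
    conv μ (weighted (localized (xWeight s ε₁) Y j) f₁)
      (weighted (localized (yWeight s) Y j) f₂) q with hF₃
  have hF₁m : Measurable F₁ := by fun_prop
  have hF₂m : Measurable F₂ := by fun_prop
  have hF₃m : ∀ j, Measurable (F₃ j) := fun j => by have := c3 j; fun_prop
  have hF₁le : lTwo μ F₁ ≤ B * X ^ (1 / 2 : ℝ) := by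
    refine (lTwo_mul_conv_le' hμ w1 w2 hM hB).trans ?_
    rw [hX]
    gcongr
    · exact lintegral_sq_weighted_le_sqNorm
    · exact sqNormLOne_le_sqNorm
  have hF₂le : lTwo μ F₂ ≤ B * X ^ (1 / 2 : ℝ) := by
    refine (lTwo_mul_conv_le hμ w3 w4 hM hB).trans ?_
    rw [hX]
    gcongr
    · exact sqNormLOne_le_sqNorm
    · exact lintegral_sq_weighted_le_sqNorm
  set a := fun j : ℕ => ∫⁻ p, weighted (localized (xWeight s ε₁) Y j) f₁ p ^ 2 ∂(stMeasure μ)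
  set b := fun j : ℕ => sqNormLOne μ (weighted (localized (yWeight s) Y j) f₂)
  have hF₃le : ∑' j, lTwo μ (F₃ j) ≤ B * (((D * E : ℝ≥0) : ℝ≥0∞) * X) ^ (1 / 2 : ℝ) := by
    calc _ ≤ ∑' j, B * (a j * b j) ^ (1 / 2 : ℝ) :=
          ENNReal.tsum_le_tsum fun j => lTwo_mul_conv_le' hμ (w5 j) (w6 j) hmm hBm
      _ = B * ∑' j, (a j * b j) ^ (1 / 2 : ℝ) := ENNReal.tsum_mul_left
      _ ≤ _ := by
          gcongr
          rw [← ENNReal.pow_le_pow_left_iff two_ne_zero, ennreal_sqrt_sq]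
          calc _ ≤ (∑' j, a j) * ∑' j, b j := sq_tsum_sqrt_le a b
            _ ≤ (D * sqNorm μ s ε₁ f₁) * (E * sqNorm μ s ε₂ f₂) := by
                gcongr
                · refine (hD μ _ _ f₁ (by fun_prop) hYm h₁ (xWeight_nonneg s ε₁) hY0).trans ?_
                  gcongr
                  exact lintegral_sq_weighted_le_sqNorm
                · refine (hE μ _ (fun x => bracket x / Λ) f₂ (by fun_prop) (by fun_prop) h₂
                    (yWeight_nonneg s) fun p => div_pos (bracket_pos _) hm.scale_pos).trans ?_
                  gcongr
                  exact sqNormLOne_le_sqNorm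
            _ = _ := by rw [hX]; push_cast; ring
  have hpt : ∀ j, lTwo μ ((dyadicRegion j ∩ {q : ℝ × ℝ | q.2 ∈ lowBand}).indicator fun q =>
        ENNReal.ofReal (omegaSym lam q.2 / modulation q) * conv μ f₁ f₂ q)
      ≤ (dyadicRatio ^ j : ℝ≥0) * (48 * (lTwo μ F₁ + lTwo μ F₂)) + 4 * lTwo μ (F₃ j) := by
    intro j
    calc _ ≤ lTwo μ (fun q => (dyadicRatio ^ j : ℝ≥0) * (48 * (F₁ q + F₂ q)) + 4 * F₃ j q) := by
          refine lTwo_mono fun q => Set.indicator_apply_le' (fun hq => ?_) fun _ => zero_le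
          obtain ⟨hj, hq⟩ := hq
          have hq : q.2 ∈ lowBand := hq
          have hd0 := hd.pos _ hq
          have ho := omegaSym_nonneg lam q.2
          have hm0 := hm.nonneg q.2
          refine (ofReal_mul_conv_le h₁ h₂ (measurable_xWeight s ε₁) (measurable_yWeight s)
            (measurable_yWeight s) (measurable_xWeight s ε₂) (xWeight_nonneg s ε₁)
            (yWeight_nonneg s) (yWeight_nonneg s) (xWeight_nonneg s ε₂)
            (localized_nonneg (xWeight_nonneg s ε₁) hY0 j)
            (localized_nonneg (yWeight_nonneg s) hY0 j)
            (by positivity) (by positivity) (by positivity)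
            fun p => hd.shell_le hs hm (p := p) hq hj).trans (le_of_eq ?_)
          simp only [hF₁, hF₂, hF₃, lowWeight, Set.indicator_of_mem hq]
          rw [ENNReal.ofReal_mul (p := ((dyadicRatio ^ j : ℝ≥0) : ℝ)) (by positivity),
            ENNReal.ofReal_mul (p := 48) (by norm_num), ENNReal.ofReal_mul (p := 4) (by norm_num),
            ENNReal.ofReal_coe_nnreal, ENNReal.ofReal_ofNat, ENNReal.ofReal_ofNat]
          ring
      _ ≤ _ := by
          have := hF₃m j
          refine (lTwo_add_le (by fun_prop) (by fun_prop)).trans ?_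
          rw [lTwo_const_mul _ (by fun_prop), lTwo_const_mul _ (by fun_prop),
            lTwo_const_mul _ (by fun_prop)]
          gcongr
          exact lTwo_add_le hF₁m hF₂m
  calc _ ≤ _ := ENNReal.tsum_le_tsum hpt
    _ ≤ dyadicSum * (48 * (B * X ^ (1 / 2 : ℝ) + B * X ^ (1 / 2 : ℝ))) +
        4 * (B * (((D * E : ℝ≥0) : ℝ≥0∞) * X) ^ (1 / 2 : ℝ)) := by
        rw [ENNReal.tsum_add, ENNReal.tsum_mul_right, ENNReal.tsum_mul_left, tsum_dyadicRatio]
        gcongr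
    _ = _ := by
        rw [ENNReal.mul_rpow_of_nonneg ((D * E : ℝ≥0) : ℝ≥0∞) X (by norm_num)]
        push_cast
        rw [← ENNReal.coe_mul, ← ENNReal.coe_rpow_of_nonneg _ (by norm_num : (0 : ℝ) ≤ 1 / 2)]
        ring

end


/-! ### The `L²_ξ L¹_τ` norm of the output -/

section
variable {s : ℝ}

lemma lintegral_comp_div {c : ℝ} (hc : 0 < c) {f : ℝ → ℝ≥0∞} (hf : Measurable f) :
    ∫⁻ t, f (t / c) = ENNReal.ofReal c * ∫⁻ t, f t := by
  have h := Real.map_volume_mul_right (a := c⁻¹) (by positivity)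
  rw [inv_inv, abs_of_pos hc] at h
  calc ∫⁻ t, f (t / c) = ∫⁻ t, f t ∂(Measure.map (· * c⁻¹) volume) :=
        (lintegral_map hf (by fun_prop)).symm
    _ = _ := by rw [h, lintegral_smul_measure, smul_eq_mul]

/-- At modulations at least `⟨ξ⟩ ^ 2`, the factor `⟨ξ⟩ / ⟨τ + ξ ^ 2⟩` is square integrable in `τ`
uniformly in `ξ`. -/
lemma exists_lintegral_far_le : ∃ C : ℝ≥0, ∀ x : ℝ,
    ∫⁻ t, farRegion.indicator
      (fun q => ENNReal.ofReal ((bracket q.2 / modulation q) ^ 2)) (t, x) ≤ C := by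
  obtain ⟨C, hC⟩ := exists_lintegral_inv_bracket_sq_le
  refine ⟨2 * C, fun x => ?_⟩
  have hn := one_le_bracket x
  set c := bracket x ^ 2 with hc
  have hc0 : 0 < c := by positivity
  calc _ ≤ ∫⁻ t, ENNReal.ofReal (2 / c) *
        ENNReal.ofReal ((bracket ((t + x ^ 2) / c - 0) ^ 2)⁻¹) := by
        refine lintegral_mono fun t => Set.indicator_apply_le' (fun ht => ?_) fun _ => zero_le
        have ht : c ≤ modulation (t, x) := ht
        rw [← ENNReal.ofReal_mul (by positivity)]
        apply ENNReal.ofReal_le_ofReal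
        have hL : 0 < modulation (t, x) := bracket_pos _
        have h1 : (t + x ^ 2) ^ 2 ≤ modulation (t, x) ^ 2 :=
          sq_le_sq' (by linarith [neg_abs_le (t + x ^ 2), abs_le_bracket (t + x ^ 2),
            show modulation (t, x) = bracket (t + x ^ 2) from rfl])
            ((le_abs_self _).trans (abs_le_bracket _))
        have h2 : c ^ 2 ≤ modulation (t, x) ^ 2 := by gcongr
        rw [sub_zero, bracket_sq, div_pow, ← div_eq_mul_inv, div_div, div_le_div_iff₀ (by positivity)
          (by positivity)]
        have e : c * (1 + ((t + x ^ 2) / c) ^ 2) = (c ^ 2 + (t + x ^ 2) ^ 2) / c := by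
          field_simp
        rw [e, ← hc, mul_div_assoc', mul_div_cancel_left₀ _ hc0.ne']
        linarith
    _ = ENNReal.ofReal (2 / c) * (ENNReal.ofReal c *
          ∫⁻ t, ENNReal.ofReal ((bracket (t - 0) ^ 2)⁻¹)) := by
        rw [lintegral_const_mul _ (by fun_prop),
          lintegral_add_right_eq_self (fun t => ENNReal.ofReal ((bracket (t / c - 0) ^ 2)⁻¹)) (x ^ 2),
          lintegral_comp_div hc0 (f := fun t => ENNReal.ofReal ((bracket (t - 0) ^ 2)⁻¹))
            (by fun_prop)]
    _ ≤ ENNReal.ofReal (2 / c) * (ENNReal.ofReal c * C) := by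
        gcongr
        exact hC volume isFreqMeasure_volume 0
    _ = _ := by
        rw [← mul_assoc, ← ENNReal.ofReal_mul (by positivity), div_mul_cancel₀ _ hc0.ne']
        simp

/-- The pointwise bound for the high output frequencies and modulations. -/
lemma far_high_le (hs : -1 / 2 ≤ s) (hs' : s ≤ 0) {ε₁ ε₂ : ℝ} (h₁ : ε₁ = 1 ∨ ε₁ = -1)
    (h₂ : ε₂ = 1 ∨ ε₂ = -1) {q p : ℝ × ℝ} (hq : 1 ≤ |q.2|) (hfar : q ∈ farRegion) :
    bracket q.2 ^ s ≤ 270 * bracket q.2 ^ (-(3 / 2) : ℝ) *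
      (modulation q * (yWeight s p * yWeight s (q - p)) + bracket q.2 *
        (xWeight s ε₁ p * yWeight s (q - p) + yWeight s p * xWeight s ε₂ (q - p))) := by
  have h0 := sq_rpow_le hs hs' (one_le_bracket q.2) (one_le_bracket p.2)
    (one_le_bracket (q - p).2) (bracket_le_add_sub _ _)
  have hfar : bracket q.2 ^ 2 ≤ modulation q := hfar
  have hn := one_le_bracket q.2
  have hn1 := one_le_bracket p.2
  have hn2 := one_le_bracket (q - p).2
  have g1 := bracket_add_le' q.2 (-p.2)
  rw [bracket_neg, ← sub_eq_add_neg, ← Prod.snd_sub] at g1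
  have g2 := bracket_le_add_sub p.2 q.2
  rw [← neg_sub q.2 p.2, bracket_neg, ← Prod.snd_sub] at g2
  have k1 := one_le_min_modulation ε₁ p
  have k2 := one_le_min_modulation ε₂ (q - p)
  set m₁ := min (signedModulation ε₁ p) (bracket p.2) with hm₁
  set m₂ := min (signedModulation ε₂ (q - p)) (bracket (q - p).2) with hm₂
  set S := modulation q + bracket q.2 * (m₁ + m₂) with hS
  have hSL : modulation q ≤ S := le_add_of_nonneg_right (by positivity)
  have hS0 : 0 ≤ S := by nlinarith
  have key : 2 * (bracket p.2 * bracket (q - p).2 * bracket q.2 ^ 2) ≤ (270 * S) ^ 2 := by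
    rcases le_total (8 * bracket p.2) (bracket q.2) with c1 | c1
    · have h3 : bracket p.2 * bracket (q - p).2 ≤ bracket q.2 ^ 2 := by nlinarith
      have h4 : bracket p.2 * bracket (q - p).2 * bracket q.2 ^ 2 ≤ S * S := by
        gcongr <;> linarith
      nlinarith
    rcases le_total (8 * bracket (q - p).2) (bracket q.2) with c2 | c2
    · have h3 : bracket p.2 * bracket (q - p).2 ≤ bracket q.2 ^ 2 := by nlinarith
      have h4 : bracket p.2 * bracket (q - p).2 * bracket q.2 ^ 2 ≤ S * S := by
        gcongr <;> linarith
      nlinarith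
    · have h5 := mul_bracket_le_of_high h₁ h₂ hq c1 c2
      have h6 : bracket q.2 * bracket p.2 ≤ 54 * S := by
        rcases min_choice (signedModulation ε₁ p) (bracket p.2) with e1 | e1
        · rcases min_choice (signedModulation ε₂ (q - p)) (bracket (q - p).2) with e2 | e2
          · rw [← hm₁] at e1
            rw [← hm₂] at e2
            rw [← e1, ← e2] at h5
            nlinarith
          · rw [← hm₂] at e2
            rw [hS, e2]
            nlinarith
        · rw [← hm₁] at e1
          rw [hS, e1]
          nlinarith
      have h7 : bracket (q - p).2 ≤ 9 * bracket p.2 := by linarith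
      calc 2 * (bracket p.2 * bracket (q - p).2 * bracket q.2 ^ 2)
          ≤ 2 * (bracket p.2 * (9 * bracket p.2) * bracket q.2 ^ 2) := by gcongr
        _ = 18 * (bracket q.2 * bracket p.2) ^ 2 := by ring
        _ ≤ 18 * (54 * S) ^ 2 := by gcongr
        _ ≤ _ := by nlinarith
  have y1 := yWeight_nonneg s p
  have y2 := yWeight_nonneg s (q - p)
  have e : 270 * bracket q.2 ^ (-(3 / 2) : ℝ) *
      (modulation q * (yWeight s p * yWeight s (q - p)) + bracket q.2 *
        (xWeight s ε₁ p * yWeight s (q - p) + yWeight s p * xWeight s ε₂ (q - p)))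
      = 270 * bracket q.2 ^ (-(3 / 2) : ℝ) * (S * (yWeight s p * yWeight s (q - p))) := by
    simp only [xWeight, yWeight, hS, hm₁, hm₂]; ring
  rw [e]
  refine abs_le_of_sq_le_sq' ?_ (by positivity) |>.2
  have e2 : (bracket q.2 ^ (-(3 / 2) : ℝ)) ^ 2 = (bracket q.2 ^ 3)⁻¹ := by
    rw [← Real.rpow_natCast (_ ^ (-(3 / 2) : ℝ)), ← Real.rpow_mul (by positivity),
      ← Real.rpow_natCast, ← Real.rpow_neg (by positivity)]
    norm_num
  calc (bracket q.2 ^ s) ^ 2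
      ≤ 2 * (bracket p.2 * bracket (q - p).2 / bracket q.2) *
          (bracket p.2 ^ s * bracket (q - p).2 ^ s) ^ 2 := h0
    _ = 2 * (bracket p.2 * bracket (q - p).2 * bracket q.2 ^ 2) * (bracket q.2 ^ 3)⁻¹ *
          (yWeight s p * yWeight s (q - p)) ^ 2 := by
        simp only [yWeight]; field_simp
    _ ≤ (270 * S) ^ 2 * (bracket q.2 ^ 3)⁻¹ * (yWeight s p * yWeight s (q - p)) ^ 2 := by
        gcongr
    _ = _ := by rw [← e2]; ring

lemma ennreal_add_three_sq_le (a b c : ℝ≥0∞) :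
    (a + b + c) ^ 2 ≤ 4 * (a ^ 2 + b ^ 2 + c ^ 2) := by
  calc (a + b + c) ^ 2 ≤ 2 * (2 * (a ^ 2 + b ^ 2) + c ^ 2) :=
        (ennreal_add_sq_le _ _).trans (by gcongr; exact ennreal_add_sq_le _ _)
    _ ≤ 2 * (2 * (a ^ 2 + b ^ 2) + 2 * c ^ 2) := by
        gcongr; exact le_mul_of_one_le_left zero_le (by norm_num)
    _ = _ := by ring

/-- The `L²_ξ L¹_τ` norm of the output at modulations at least `⟨ξ⟩ ^ 2`. If the output carries the
resonance, both factors are in `L²_ξ L¹_τ`; otherwise one of them is in `L²`, and the integral over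
`τ` is done with `exists_lintegral_far_le`. -/
lemma exists_far_le (hs : -1 / 2 ≤ s) (hs' : s ≤ 0) : ∃ C : ℝ≥0, ∀ (μ : Measure ℝ) [SFinite μ],
    IsFreqMeasure μ → ∀ (ε₁ ε₂ lam : ℝ) (d : ℝ → ℝ) (f₁ f₂ : ℝ × ℝ → ℝ≥0∞) (B : ℝ≥0∞),
    (ε₁ = 1 ∨ ε₁ = -1) → (ε₂ = 1 ∨ ε₂ = -1) → IsLowResonance ε₁ ε₂ d → Measurable f₁ →
    Measurable f₂ → 1 ≤ B → ∫⁻ x, lowWeight s lam d x ^ 2 ∂μ ≤ B ^ 2 →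
    sqNormLOne μ (farRegion.indicator fun q =>
        ENNReal.ofReal (omegaSym lam q.2 * bracket q.2 ^ s / modulation q) * conv μ f₁ f₂ q)
      ≤ C * B ^ 2 * (sqNorm μ s ε₁ f₁ * sqNorm μ s ε₂ f₂) := by
  obtain ⟨D, hD⟩ := exists_lintegral_far_le
  obtain ⟨E, hE⟩ := exists_lintegral_bracket_rpow_le (β := 3) (by norm_num)
  refine ⟨(2 * (24 ^ 2 + 270 ^ 2 * E)) * (4 * (1 + D + D)), fun μ _ hμ ε₁ ε₂ lam d f₁ f₂ B hε₁ hε₂ hd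
    h₁ h₂ hB1 hB => ?_⟩
  set X := sqNorm μ s ε₁ f₁ * sqNorm μ s ε₂ f₂ with hX
  have hdm := hd.measurable
  have hfarm := measurableSet_farRegion
  have x1 := measurable_weighted (measurable_xWeight s ε₁) h₁
  have y2 := measurable_weighted (measurable_yWeight s) h₂
  have y1 := measurable_weighted (measurable_yWeight s) h₁
  have x2 := measurable_weighted (measurable_xWeight s ε₂) h₂
  have c1 := measurable_conv (μ := μ) y1 y2
  have c2 := measurable_conv (μ := μ) x1 y2
  have c3 := measurable_conv (μ := μ) y1 x2
  -- The loss `v` in the spatial frequency: `lowWeight` at low output frequencies, and `⟨ξ⟩ ^ (-3 / 2)`,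
  -- which is square integrable, at high ones.
  set v : ℝ → ℝ := fun x => lowBand.indicator (fun x => 24 * (omegaSym lam x * d x ^ (2 * s))) x +
    270 * bracket x ^ (-(3 / 2) : ℝ) with hv
  have hl0 : ∀ x, 0 ≤ lowBand.indicator (fun x => 24 * (omegaSym lam x * d x ^ (2 * s))) x := by
    intro x
    refine Set.indicator_nonneg (fun x hx => ?_) x
    have := hd.pos _ hx
    have := omegaSym_nonneg lam x
    positivity
  have hv0 : ∀ x, 0 ≤ v x := fun x => add_nonneg (hl0 x) (by have := bracket_pos x; positivity)
  have hvm : Measurable v :=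
    (Measurable.indicator (by fun_prop) measurableSet_lowBand).add (by fun_prop)
  have hvB : ∫⁻ x, ENNReal.ofReal (v x) ^ 2 ∂μ ≤ (2 * (24 ^ 2 + 270 ^ 2 * E) : ℝ≥0) * B ^ 2 := by
    calc _ ≤ ∫⁻ x, 2 * ((24 * lowWeight s lam d x) ^ 2 +
          270 ^ 2 * ENNReal.ofReal (bracket (x - 0) ^ (-3 : ℝ))) ∂μ := by
          refine lintegral_mono fun x => ?_
          rw [hv, ENNReal.ofReal_add (hl0 x) (by have := bracket_pos x; positivity)]
          refine (ennreal_add_sq_le _ _).trans (le_of_eq ?_)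
          congr 3
          · by_cases hx : x ∈ lowBand
            · rw [lowWeight, Set.indicator_of_mem hx, Set.indicator_of_mem hx,
                ENNReal.ofReal_mul (by norm_num), ENNReal.ofReal_ofNat]
            · rw [lowWeight, Set.indicator_of_notMem hx, Set.indicator_of_notMem hx]; simp
          · rw [ENNReal.ofReal_mul (by norm_num), mul_pow, ENNReal.ofReal_ofNat,
              ← ENNReal.ofReal_pow (Real.rpow_nonneg (bracket_pos x).le _), sub_zero,
              ← Real.rpow_natCast (_ ^ (-(3 / 2) : ℝ)), ← Real.rpow_mul (bracket_pos x).le]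
            norm_num
      _ ≤ 2 * (24 ^ 2 * B ^ 2 + 270 ^ 2 * (E * B ^ 2)) := by
          have hM := measurable_lowWeight (s := s) (lam := lam) hd.measurable
          rw [lintegral_const_mul _ (by fun_prop), lintegral_add_left (by fun_prop)]
          simp only [mul_pow]
          rw [lintegral_const_mul _ (by fun_prop), lintegral_const_mul _ (by fun_prop)]
          gcongr
          exact (hE μ hμ 0).trans (le_mul_of_one_le_right zero_le (one_le_pow₀ hB1))
      _ = _ := by push_cast; ring
  set R : ℝ × ℝ → ℝ≥0∞ := farRegion.indicator
    fun q => ENNReal.ofReal (bracket q.2 / modulation q) with hR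
  have hRm : Measurable R := Measurable.indicator (by fun_prop) hfarm
  set J₁ := conv μ (weighted (yWeight s) f₁) (weighted (yWeight s) f₂) with hJ₁
  set J₂ := conv μ (weighted (xWeight s ε₁) f₁) (weighted (yWeight s) f₂) with hJ₂
  set J₃ := conv μ (weighted (yWeight s) f₁) (weighted (xWeight s ε₂) f₂) with hJ₃
  have hpt : ∀ q, farRegion.indicator (fun q =>
        ENNReal.ofReal (omegaSym lam q.2 * bracket q.2 ^ s / modulation q) * conv μ f₁ f₂ q) q
      ≤ ENNReal.ofReal (v q.2) * (J₁ q + R q * J₂ q + R q * J₃ q) := by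
    intro q
    refine Set.indicator_apply_le' (fun hq => ?_) fun _ => zero_le
    have hn := one_le_bracket q.2
    have hL : 0 < modulation q := bracket_pos _
    have ho := omegaSym_nonneg lam q.2
    have ho1 := omegaSym_le_one lam q.2
    have hns : bracket q.2 ^ s ≤ 1 := Real.rpow_le_one_of_one_le_of_nonpos hn hs'
    have hns0 : 0 ≤ bracket q.2 ^ s := by positivity
    rw [hR]
    simp only [Set.indicator_of_mem hq]
    refine (ofReal_mul_conv_le (b := v q.2) (c := v q.2 * (bracket q.2 / modulation q))
      (d := v q.2 * (bracket q.2 / modulation q)) h₁ h₂ (measurable_yWeight s)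
      (measurable_yWeight s) (measurable_xWeight s ε₁) (measurable_yWeight s) (yWeight_nonneg s)
      (yWeight_nonneg s) (xWeight_nonneg s ε₁) (yWeight_nonneg s) (yWeight_nonneg s)
      (xWeight_nonneg s ε₂) (hv0 _) (mul_nonneg (hv0 _) (by positivity))
      (mul_nonneg (hv0 _) (by positivity)) fun p => ?_).trans (le_of_eq ?_)
    · have i1 := yWeight_nonneg s p
      have i2 := yWeight_nonneg s (q - p)
      have i3 := xWeight_nonneg s ε₁ p
      have i4 := xWeight_nonneg s ε₂ (q - p)
      set Y := yWeight s p * yWeight s (q - p) with hY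
      set W := xWeight s ε₁ p * yWeight s (q - p) + yWeight s p * xWeight s ε₂ (q - p) with hW
      have hY0 : 0 ≤ Y := by positivity
      have hW0 : 0 ≤ W := by positivity
      have goal : omegaSym lam q.2 * bracket q.2 ^ s ≤ v q.2 * (modulation q * Y + bracket q.2 * W) := by
        rcases eq_or_ne q.2 0 with hx0 | hx0
        · have : omegaSym lam q.2 = 0 := by rw [omegaSym, hx0]; simp
          rw [this, zero_mul]
          have := hv0 q.2
          positivity
        rcases le_total 1 |q.2| with hx | hx
        · calc omegaSym lam q.2 * bracket q.2 ^ s ≤ 1 * bracket q.2 ^ s := by gcongr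
            _ ≤ 270 * bracket q.2 ^ (-(3 / 2) : ℝ) * (modulation q * Y + bracket q.2 * W) := by
                rw [one_mul]; exact far_high_le hs hs' hε₁ hε₂ hx hq
            _ ≤ _ := by
                refine mul_le_mul_of_nonneg_right ?_ (by positivity)
                rw [hv]
                exact le_add_of_nonneg_left (hl0 _)
        · have hlow : q.2 ∈ lowBand := ⟨abs_pos.2 hx0, hx⟩
          have hd0 := hd.pos _ hlow
          calc omegaSym lam q.2 * bracket q.2 ^ s ≤ omegaSym lam q.2 * 1 := by gcongr
            _ ≤ omegaSym lam q.2 * (24 * d q.2 ^ (2 * s) * (modulation q * Y + W)) := by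
                gcongr; exact hd.one_le_weights hs hs' hlow
            _ ≤ omegaSym lam q.2 * (24 * d q.2 ^ (2 * s) * (modulation q * Y + bracket q.2 * W)) := by
                gcongr; exact le_mul_of_one_le_left hW0 hn
            _ = 24 * (omegaSym lam q.2 * d q.2 ^ (2 * s)) *
                  (modulation q * Y + bracket q.2 * W) := by ring
            _ ≤ _ := by
                refine mul_le_mul_of_nonneg_right ?_ (by positivity)
                rw [hv]
                simp only [Set.indicator_of_mem hlow]
                exact le_add_of_nonneg_right (by positivity)
      rw [div_le_iff₀ hL]
      refine goal.trans (le_of_eq ?_)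
      rw [hW]
      field_simp
      ring
    · rw [ENNReal.ofReal_mul (hv0 _)]
      ring
  have hRJ : ∀ {J : ℝ × ℝ → ℝ≥0∞}, Measurable J → ∀ x,
      (∫⁻ t, R (t, x) * J (t, x)) ^ 2 ≤ D * ∫⁻ t, J (t, x) ^ 2 := by
    intro J hJ x
    refine (sq_lintegral_le_of_sq_le (v := fun t => R (t, x) ^ 2) (w := fun t => J (t, x) ^ 2)
      (by fun_prop) (by fun_prop) fun t => (mul_pow _ _ _).le).trans ?_
    gcongr
    refine le_trans (lintegral_mono fun t => ?_) (hD x)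
    by_cases ht : (t, x) ∈ farRegion
    · rw [hR, Set.indicator_of_mem ht, Set.indicator_of_mem ht, ENNReal.ofReal_pow]
      exact (div_pos (bracket_pos _) (bracket_pos _)).le
    · rw [hR, Set.indicator_of_notMem ht]; simp
  have hcomm := conv_comm_ae hμ x1 y2
  calc sqNormLOne μ _
      ≤ sqNormLOne μ fun q => ENNReal.ofReal (v q.2) * (J₁ q + R q * J₂ q + R q * J₃ q) := by
        unfold sqNormLOne
        gcongr with x t
        exact hpt (t, x)
    _ ≤ ∫⁻ x, ENNReal.ofReal (v x) ^ 2 * (4 * (1 + D + D) * X) ∂μ := by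
        refine lintegral_mono_ae ?_
        have hswap : ∀ᵐ x ∂μ, ∀ᵐ t : ℝ, J₂ (t, x) =
            conv μ (weighted (yWeight s) f₂) (weighted (xWeight s ε₁) f₁) (t, x) :=
          Measure.ae_ae_of_ae_prod (Measure.measurePreserving_swap.quasiMeasurePreserving.ae hcomm)
        filter_upwards [hμ.bilinear_sup_lOne y1 y2, hμ.bilinear_sup_lTwo y2 x1,
          hμ.bilinear_sup_lTwo y1 x2, hswap] with x b1 b2 b3 b4
        have b1' : (∫⁻ t, J₁ (t, x)) ^ 2 ≤ X := b1.trans (by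
          rw [hX]; gcongr <;> exact sqNormLOne_le_sqNorm)
        have b2' : ∫⁻ t, J₂ (t, x) ^ 2 ≤ X := by
          rw [lintegral_congr_ae (b4.mono fun t ht => by rw [ht]), hX, mul_comm]
          exact b2.trans (by
            gcongr
            · exact sqNormLOne_le_sqNorm
            · exact lintegral_sq_weighted_le_sqNorm)
        have b3' : ∫⁻ t, J₃ (t, x) ^ 2 ≤ X := b3.trans (by
          rw [hX]
          gcongr
          · exact sqNormLOne_le_sqNorm
          · exact lintegral_sq_weighted_le_sqNorm)
        rw [lintegral_const_mul _ (by fun_prop), mul_pow]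
        gcongr
        rw [lintegral_add_left (by fun_prop), lintegral_add_left (by fun_prop)]
        calc _ ≤ 4 * ((∫⁻ t, J₁ (t, x)) ^ 2 + (∫⁻ t, R (t, x) * J₂ (t, x)) ^ 2 +
              (∫⁻ t, R (t, x) * J₃ (t, x)) ^ 2) := ennreal_add_three_sq_le _ _ _
          _ ≤ 4 * (X + D * X + D * X) := by
              gcongr
              · exact (hRJ c2 x).trans (by gcongr)
              · exact (hRJ c3 x).trans (by gcongr)
          _ = _ := by ring
    _ ≤ ((2 * (24 ^ 2 + 270 ^ 2 * E) : ℝ≥0) * B ^ 2) * (4 * (1 + D + D) * X) := by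
        rw [lintegral_mul_const _ (by fun_prop)]
        gcongr
    _ = _ := by push_cast; ring

end


/-! ### The factor lost at low output frequencies -/

/-- For `u v̄` the resonance `ξ ^ 2 - ξ₁ ^ 2 + (ξ - ξ₁) ^ 2 = 2 ξ (ξ - ξ₁)` degenerates at `ξ = 0`. -/
lemma isLowResonance_conj : IsLowResonance 1 (-1) (fun x => |x|) where
  measurable := by fun_prop
  pos x hx := hx.1
  le_one x hx := hx.2
  le q p hq := by
    have h1 : |q.2| ≤ 1 := hq.2
    have hL : |q.1 + q.2 ^ 2| ≤ modulation q := abs_le_bracket _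
    have hl₁ : |p.1 + 1 * p.2 ^ 2| ≤ signedModulation 1 p := abs_le_bracket _
    have hl₂ : |(q - p).1 + (-1) * (q - p).2 ^ 2| ≤ signedModulation (-1) (q - p) :=
      abs_le_bracket _
    have l0 : 1 ≤ modulation q := one_le_bracket _
    have l1 := one_le_signedModulation 1 p
    have l2 := one_le_signedModulation (-1) (q - p)
    have hb := bracket_le_one_add_abs p.2
    rw [Prod.fst_sub, Prod.snd_sub] at hl₂
    set x := q.2
    set y := p.2
    have e : 2 * (x * y) = 2 * x ^ 2 - ((q.1 + x ^ 2) - (p.1 + 1 * y ^ 2)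
      - ((q.1 - p.1) + (-1) * (x - y) ^ 2)) := by ring
    have hx2 : x ^ 2 ≤ 1 := by rw [← sq_abs]; exact pow_le_one₀ (abs_nonneg _) h1
    have hxy : |x| * |y| ≤ 1 + (modulation q + signedModulation 1 p +
        signedModulation (-1) (q - p)) / 2 := by
      rw [← abs_mul, abs_le]
      rw [abs_le] at hL hl₁ hl₂
      have := sq_nonneg x
      constructor <;> linarith [hL.1, hL.2, hl₁.1, hl₁.2, hl₂.1, hl₂.2]
    calc |x| * bracket y ≤ |x| * (1 + |y|) := by gcongr
      _ = |x| + |x| * |y| := by ring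
      _ ≤ _ := by linarith

/-- For `u v` and `ū v̄` the resonance is of the order `⟨ξ₁⟩ ^ 2` if `|ξ₁|` is large; the first power of
`⟨ξ₁⟩` suffices. -/
lemma isLowResonance_same {ε : ℝ} (hε : ε = 1 ∨ ε = -1) : IsLowResonance ε ε (fun _ => 1) where
  measurable := by fun_prop
  pos x hx := one_pos
  le_one x hx := le_rfl
  le q p hq := by
    have h1 : |q.2| ≤ 1 := hq.2
    have hL : |q.1 + q.2 ^ 2| ≤ modulation q := abs_le_bracket _
    have hl₁ : |p.1 + ε * p.2 ^ 2| ≤ signedModulation ε p := abs_le_bracket _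
    have hl₂ : |(q - p).1 + ε * (q - p).2 ^ 2| ≤ signedModulation ε (q - p) :=
      abs_le_bracket _
    have l0 : 1 ≤ modulation q := one_le_bracket _
    have l1 := one_le_signedModulation ε p
    have l2 := one_le_signedModulation ε (q - p)
    have hb := bracket_le_one_add_abs p.2
    rw [Prod.fst_sub, Prod.snd_sub] at hl₂
    rw [abs_le] at hL hl₁ hl₂ h1
    set x := q.2
    set y := p.2
    have hy2 : |y| ^ 2 = y ^ 2 := sq_abs y
    have hy0 := abs_nonneg y
    have hxy : |x * y| ≤ |y| := by
      rw [abs_mul]; exact mul_le_of_le_one_left hy0 (abs_le.2 h1)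
    have hxy' := le_abs_self (x * y)
    have hsq : y ^ 2 ≤ |y| + (modulation q + signedModulation ε p + signedModulation ε (q - p)) := by
      rcases hε with rfl | rfl
      · nlinarith [hL.1, hL.2, hl₁.1, hl₁.2, hl₂.1, hl₂.2]
      · nlinarith [hL.1, hL.2, hl₁.1, hl₁.2, hl₂.1, hl₂.2, sq_nonneg x, sq_nonneg (x - y)]
    rw [one_mul]
    nlinarith [sq_nonneg (|y| - 1)]

/-- At the scale `1 / lam`, a power decay faster than `|x|⁻¹` is integrable over the nonzero
frequencies, with the bound `1 / lam` of the case of the line: this is where the torus must not see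
the frequency `0`. -/
lemma lintegral_min_one_rpow_le {μ : Measure ℝ} (hμ : IsFreqMeasure μ) {lam β : ℝ} (hl : 0 < lam)
    (h1 : 1 < β) (h2 : β ≤ 2) :
    ∫⁻ x, ({x : ℝ | 0 < |x|}.indicator
        fun x => ENNReal.ofReal (min 1 ((lam * |x|) ^ (-β)))) x ∂μ
      ≤ ENNReal.ofReal (16 / ((β - 1) * lam)) := by
  set r : ℝ := (2 : ℝ) ^ (-(β - 1)) with hr
  have hr0 : 0 < r := by positivity
  have hr1 : 1 - r ≥ (β - 1) / 2 := by
    have : ((1 : ℝ) + (-1 / 2)) ^ (β - 1) ≤ 1 + (β - 1) * (-1 / 2) :=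
      rpow_one_add_le_one_add_mul_self (by norm_num) (by linarith) (by linarith)
    have e : r = ((1 : ℝ) + (-1 / 2)) ^ (β - 1) := by
      rw [hr, Real.rpow_neg (by norm_num), ← Real.inv_rpow (by norm_num)]; norm_num
    rw [e]; linarith
  refine (lintegral_le_tsum_of_cover (S := fun k : ℕ => {x | 0 < |x| ∧ |x| ≤ 2 ^ k / lam})
    (w := fun k => ENNReal.ofReal (4 * ((2 : ℝ) ^ k) ^ (-β))) (fun k => ?_) fun x hx => ?_).trans ?_
  · have : MeasurableSet ({x : ℝ | 0 < |x|} ∩ {x | |x| ≤ 2 ^ k / lam}) :=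
      (measurableSet_lt (by fun_prop) (by fun_prop)).inter
        (measurableSet_le (by fun_prop) (by fun_prop))
    exact this
  · have hx0 : 0 < |x| := by
      by_contra h; exact hx (Set.indicator_of_notMem (s := {x : ℝ | 0 < |x|}) h _)
    rw [Set.indicator_of_mem (show x ∈ {x : ℝ | 0 < |x|} from hx0)]
    rcases le_total (lam * |x|) 1 with hz | hz
    · refine ⟨0, ⟨hx0, ?_⟩, ENNReal.ofReal_le_ofReal ?_⟩
      · rw [pow_zero, le_div_iff₀ hl]; linarith
      · rw [pow_zero, Real.one_rpow]; exact (min_le_left _ _).trans (by norm_num)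
    · obtain ⟨k, hk, hk'⟩ := exists_nat_pow_near hz (one_lt_two (α := ℝ))
      refine ⟨k + 1, ⟨hx0, ?_⟩, ENNReal.ofReal_le_ofReal ?_⟩
      · rw [le_div_iff₀ hl]; linarith
      · refine (min_le_right _ _).trans ?_
        refine (Real.rpow_le_rpow_of_nonpos (by positivity) hk (by linarith)).trans ?_
        rw [pow_succ, Real.mul_rpow (by positivity) (by norm_num)]
        have : (1 : ℝ) ≤ 4 * 2 ^ (-β) := by
          calc (1 : ℝ) = 4 * 2 ^ (-2 : ℝ) := by
                rw [Real.rpow_neg (by norm_num)]; norm_num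
            _ ≤ _ := by gcongr; norm_num
        nlinarith [Real.rpow_nonneg (show (0 : ℝ) ≤ 2 ^ k by positivity) (-β)]
  · calc ∑' k : ℕ, ENNReal.ofReal (4 * ((2 : ℝ) ^ k) ^ (-β)) * μ {x | 0 < |x| ∧ |x| ≤ 2 ^ k / lam}
        ≤ ∑' k : ℕ, ENNReal.ofReal (8 / lam * r ^ k) := by
          refine ENNReal.tsum_le_tsum fun k => ?_
          calc _ ≤ ENNReal.ofReal (4 * ((2 : ℝ) ^ k) ^ (-β)) * ENNReal.ofReal (2 * (2 ^ k / lam)) := by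
                gcongr; exact hμ.punctured _ (by positivity)
            _ = _ := by
                rw [← ENNReal.ofReal_mul (by positivity)]
                congr 1
                have : r ^ k = ((2 : ℝ) ^ k) ^ (-β) * 2 ^ k := by
                  rw [hr, ← Real.rpow_natCast, ← Real.rpow_mul (by norm_num), mul_comm,
                    Real.rpow_mul (by norm_num), Real.rpow_natCast]
                  nth_rewrite 3 [← Real.rpow_one ((2 : ℝ) ^ k)]
                  rw [← Real.rpow_add (by positivity)]
                  congr 1; ring
                rw [this]; ring
      _ = ENNReal.ofReal (8 / lam * (1 - r)⁻¹) := by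
          rw [← ENNReal.ofReal_tsum_of_nonneg (fun k => by positivity)
            ((summable_geometric_of_lt_one hr0.le (by linarith)).mul_left _), tsum_mul_left,
            tsum_geometric_of_lt_one hr0.le (by linarith)]
      _ ≤ _ := by
          refine ENNReal.ofReal_le_ofReal ?_
          have hb : 0 < (β - 1) / 2 := by linarith
          calc 8 / lam * (1 - r)⁻¹ ≤ 8 / lam * ((β - 1) / 2)⁻¹ := by gcongr
            _ = 16 / ((β - 1) * lam) := by
                have : β - 1 ≠ 0 := by linarith
                field_simp; norm_num

/-- A bound `B` for the contribution of the low output frequencies, for factors with the modulations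
`⟨τ + ε₁ ξ ^ 2⟩` and `⟨τ + ε₂ ξ ^ 2⟩`; the bound through a shell weight is only needed for the
summation over dyadic modulations at the endpoint. -/
def IsLowBound (μ : Measure ℝ) (s lam ε₁ ε₂ : ℝ) (B : ℝ≥0∞) : Prop :=
  1 ≤ B ∧ ∃ d : ℝ → ℝ, IsLowResonance ε₁ ε₂ d ∧ ∫⁻ x, lowWeight s lam d x ^ 2 ∂μ ≤ B ^ 2 ∧
    (s = -1 / 2 → ∃ (Λ : ℝ) (m : ℝ → ℝ), IsShellWeight lam d Λ m ∧
      ∫⁻ x, lowBand.indicator (fun x => ENNReal.ofReal (m x)) x ^ 2 ∂μ ≤ B ^ 2)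

lemma IsFreqMeasure.lowBand_le {μ : Measure ℝ} (hμ : IsFreqMeasure μ) : μ lowBand ≤ 3 := by
  refine (measure_mono fun x hx => ?_).trans ((hμ.ball 0 1 zero_le_one).trans (by norm_num))
  rw [Metric.mem_closedBall, dist_zero_right, Real.norm_eq_abs]
  exact hx.2

lemma lintegral_sq_indicator_lowBand_le {μ : Measure ℝ} (hμ : IsFreqMeasure μ) {φ : ℝ → ℝ≥0∞}
    {c : ℝ≥0∞} (h : ∀ x, φ x ≤ c) : ∫⁻ x, lowBand.indicator φ x ^ 2 ∂μ ≤ 3 * c ^ 2 :=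
  calc ∫⁻ x, lowBand.indicator φ x ^ 2 ∂μ ≤ ∫⁻ x, lowBand.indicator (fun _ => c ^ 2) x ∂μ := by
        refine lintegral_mono fun x => ?_
        by_cases hx : x ∈ lowBand
        · simp only [Set.indicator_of_mem hx]; gcongr; exact h x
        · simp [Set.indicator_of_notMem hx]
    _ ≤ 3 * c ^ 2 := by
        rw [lintegral_indicator_const measurableSet_lowBand, mul_comm]
        gcongr; exact hμ.lowBand_le

lemma isShellWeight_same (lam : ℝ) : IsShellWeight lam (fun _ => 1) 1 (fun _ => 48 ^ 2) where
  measurable := by fun_prop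
  nonneg _ := by norm_num
  scale_pos := one_pos
  le x _ y hy hy48 := by
    have ho := omegaSym_nonneg lam x
    have ho1 := omegaSym_le_one lam x
    rw [one_mul, one_mul] at hy48
    rw [mul_one]
    refine (mul_le_of_le_one_left hy.le ho1).trans ?_
    rcases le_total y 1 with h | h
    · rw [dyadicDecay_of_le_one hy h]
      calc y = y ^ (1 : ℝ) := (Real.rpow_one y).symm
        _ ≤ y ^ (1 / 4 : ℝ) := Real.rpow_le_rpow_of_exponent_ge hy h (by norm_num)
        _ ≤ _ := le_mul_of_one_le_left (by positivity) (by norm_num)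
    · rw [dyadicDecay_of_one_le h]
      calc y = y ^ (5 / 4 : ℝ) * y ^ (-(1 / 4) : ℝ) := by
            rw [← Real.rpow_add hy]; norm_num
        _ ≤ y ^ (2 : ℝ) * y ^ (-(1 / 4) : ℝ) := by gcongr; linarith
        _ ≤ _ := by rw [Real.rpow_two]; gcongr

/-- There is no loss in the estimates of `u v` and `ū v̄`. -/
lemma isLowBound_same {μ : Measure ℝ} (hμ : IsFreqMeasure μ) (s lam : ℝ) {ε : ℝ}
    (hε : ε = 1 ∨ ε = -1) : IsLowBound μ s lam ε ε (48 ^ 3 : ℝ≥0) := by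
  refine ⟨by norm_num, fun _ => 1, isLowResonance_same hε, ?_, fun _ => ⟨1, fun _ => 48 ^ 2,
    isShellWeight_same lam, ?_⟩⟩
  · refine (lintegral_sq_indicator_lowBand_le hμ (c := 1) fun x => ?_).trans ?_
    · rw [Real.one_rpow, mul_one, ENNReal.ofReal_le_one]; exact omegaSym_le_one _ _
    · push_cast; norm_num
  · refine (lintegral_sq_indicator_lowBand_le hμ (c := 48 ^ 2) fun x => ?_).trans ?_
    · rw [ENNReal.ofReal_pow (by norm_num), ENNReal.ofReal_ofNat]
    · push_cast; norm_num

/-- The multiplier `ω_lam²` removes the singularity of `|ξ| ^ (2 s)` at the scale `1 / lam`. -/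
lemma omegaSym_sq_mul_rpow_le {s lam x : ℝ} (hl : 0 < lam) (hs : -1 / 2 ≤ s) (hs' : s ≤ 0)
    (hx : 0 < |x|) : (omegaSym lam x * |x| ^ (2 * s)) ^ 2
      ≤ lam ^ (-4 * s) * min 1 ((lam * |x|) ^ (4 * s)) := by
  have hz : 0 < lam * |x| := by positivity
  have ho := omegaSym_nonneg lam x
  have e : (omegaSym lam x * |x| ^ (2 * s)) ^ 2
      = lam ^ (-4 * s) * (omegaSym lam x ^ 2 * (lam * |x|) ^ (4 * s)) := by
    rw [Real.mul_rpow hl.le hx.le, mul_pow, ← Real.rpow_natCast (|x| ^ _), ← Real.rpow_mul hx.le]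
    have : lam ^ (-4 * s) * lam ^ (4 * s) = 1 := by rw [← Real.rpow_add hl]; simp
    have e2 : 2 * s * ((2 : ℕ) : ℝ) = 4 * s := by push_cast; ring
    rw [e2]
    linear_combination (-(omegaSym lam x ^ 2 * |x| ^ (4 * s))) * this
  rw [e]
  gcongr
  refine le_min ?_ (mul_le_of_le_one_left (by positivity) (pow_le_one₀ ho (omegaSym_le_one _ _)))
  rcases le_total (lam * |x|) 1 with h | h
  · calc omegaSym lam x ^ 2 * (lam * |x|) ^ (4 * s)
        ≤ ((lam * |x|) ^ 2) ^ 2 * (lam * |x|) ^ (4 * s) := by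
          gcongr; exact omegaSym_le_sq _ _
      _ = (lam * |x|) ^ (4 + 4 * s) := by
          rw [Real.rpow_add hz, ← pow_mul]; norm_cast
      _ ≤ 1 := Real.rpow_le_one hz.le h (by linarith)
  · exact mul_le_one₀ (pow_le_one₀ ho (omegaSym_le_one _ _)) (by positivity)
      (Real.rpow_le_one_of_one_le_of_nonpos h (by linarith))

lemma lintegral_sq_lowWeight_le {μ : Measure ℝ} (hμ : IsFreqMeasure μ) {s lam β K : ℝ} (hl : 0 < lam)
    (hs : -1 / 2 ≤ s) (hs' : s ≤ 0) (h1 : 1 < β) (h2 : β ≤ 2) (hK : 0 ≤ K)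
    (h : ∀ x ∈ lowBand, min 1 ((lam * |x|) ^ (4 * s)) ≤ K * min 1 ((lam * |x|) ^ (-β))) :
    ∫⁻ x, lowWeight s lam (fun x => |x|) x ^ 2 ∂μ
      ≤ ENNReal.ofReal (lam ^ (-4 * s) * K * (16 / ((β - 1) * lam))) := by
  rw [ENNReal.ofReal_mul (by positivity)]
  refine le_trans ?_ (mul_le_mul_right (lintegral_min_one_rpow_le hμ hl h1 h2) _)
  rw [← lintegral_const_mul' _ _ ENNReal.ofReal_ne_top]
  refine lintegral_mono fun x => ?_
  unfold lowWeight
  by_cases hx : x ∈ lowBand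
  · rw [Set.indicator_of_mem hx, Set.indicator_of_mem (show x ∈ {x : ℝ | 0 < |x|} from hx.1),
      ← ENNReal.ofReal_pow (mul_nonneg (omegaSym_nonneg _ _) (by positivity)),
      ← ENNReal.ofReal_mul (by positivity)]
    refine ENNReal.ofReal_le_ofReal ((omegaSym_sq_mul_rpow_le hl hs hs' hx.1).trans ?_)
    rw [mul_assoc]
    gcongr
    exact h x hx
  · rw [Set.indicator_of_notMem hx]; simp

/-- The frequencies of the factors are compared with `lam * 2 ^ j`; the weight decays
beyond `|ξ| ∼ 1 / lam`. -/
lemma isShellWeight_conj {lam : ℝ} (hl : 0 < lam) :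
    IsShellWeight lam (fun x => |x|) lam
      (fun x => 48 ^ 2 * lam * min 1 ((lam * |x|) ^ (-(3 / 4) : ℝ))) where
  measurable := by fun_prop
  nonneg _ := by positivity
  scale_pos := hl
  le x hx y hy hy48 := by
    have hx0 : 0 < |x| := hx.1
    have ho := omegaSym_nonneg lam x
    have ho1 := omegaSym_le_one lam x
    have ho2 := omegaSym_le_sq lam x
    set z := lam * |x| with hz
    have hz0 : 0 < z := by positivity
    have hzy : z * y ≤ 48 := by rw [hz]; linarith
    have hyz : y ≤ 48 * z⁻¹ := by rw [← div_eq_mul_inv, le_div_iff₀ hz0]; linarith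
    suffices h : omegaSym lam x * y ≤ 48 ^ 2 * min 1 (z ^ (-(3 / 4) : ℝ)) * dyadicDecay y by
      calc omegaSym lam x * lam * y = lam * (omegaSym lam x * y) := by ring
        _ ≤ lam * (48 ^ 2 * min 1 (z ^ (-(3 / 4) : ℝ)) * dyadicDecay y) := by gcongr
        _ = _ := by ring
    have hmin1 : z ≤ 1 → min 1 (z ^ (-(3 / 4) : ℝ)) = 1 := fun h =>
      min_eq_left (Real.one_le_rpow_of_pos_of_le_one_of_nonpos hz0 h (by norm_num))
    have hmin2 : 1 ≤ z → min 1 (z ^ (-(3 / 4) : ℝ)) = z ^ (-(3 / 4) : ℝ) := fun h =>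
      min_eq_right (Real.rpow_le_one_of_one_le_of_nonpos h (by norm_num))
    have h48 : (48 : ℝ) ^ (5 / 4 : ℝ) ≤ 48 ^ 2 := by
      rw [← Real.rpow_two]; gcongr <;> norm_num
    have h48' : (48 : ℝ) ^ (3 / 4 : ℝ) ≤ 48 ^ 2 := by
      rw [← Real.rpow_two]; gcongr <;> norm_num
    rcases le_total y 1 with h | h
    · rw [dyadicDecay_of_le_one hy h]
      have e : y = y ^ (3 / 4 : ℝ) * y ^ (1 / 4 : ℝ) := by
        rw [← Real.rpow_add hy]; norm_num
      have key : omegaSym lam x * y ^ (3 / 4 : ℝ) ≤ 48 ^ 2 * min 1 (z ^ (-(3 / 4) : ℝ)) := by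
        rcases le_total z 1 with h' | h'
        · rw [hmin1 h', mul_one]
          exact (mul_le_one₀ ho1 (by positivity) (Real.rpow_le_one hy.le h (by norm_num))).trans
            (by norm_num)
        · rw [hmin2 h']
          calc omegaSym lam x * y ^ (3 / 4 : ℝ) ≤ 1 * (48 * z⁻¹) ^ (3 / 4 : ℝ) := by gcongr
            _ = 48 ^ (3 / 4 : ℝ) * z ^ (-(3 / 4) : ℝ) := by
                rw [Real.mul_rpow (by norm_num) (by positivity), Real.inv_rpow hz0.le,
                  Real.rpow_neg hz0.le, one_mul]
            _ ≤ _ := by gcongr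
      calc omegaSym lam x * y = omegaSym lam x * y ^ (3 / 4 : ℝ) * y ^ (1 / 4 : ℝ) := by
            nth_rewrite 1 [e]; ring
        _ ≤ _ := by gcongr
    · rw [dyadicDecay_of_one_le h]
      have e : y = y ^ (5 / 4 : ℝ) * y ^ (-(1 / 4) : ℝ) := by
        rw [← Real.rpow_add hy]; norm_num
      have h54 : y ^ (5 / 4 : ℝ) ≤ 48 ^ 2 * z ^ (-(5 / 4) : ℝ) := by
        calc y ^ (5 / 4 : ℝ) ≤ (48 * z⁻¹) ^ (5 / 4 : ℝ) := by gcongr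
          _ = 48 ^ (5 / 4 : ℝ) * z ^ (-(5 / 4) : ℝ) := by
                rw [Real.mul_rpow (by norm_num) (by positivity), Real.inv_rpow hz0.le,
                  Real.rpow_neg hz0.le]
          _ ≤ _ := by gcongr
      have key : omegaSym lam x * y ^ (5 / 4 : ℝ) ≤ 48 ^ 2 * min 1 (z ^ (-(3 / 4) : ℝ)) := by
        rcases le_total z 1 with h' | h'
        · rw [hmin1 h', mul_one]
          calc omegaSym lam x * y ^ (5 / 4 : ℝ) ≤ z ^ 2 * (48 ^ 2 * z ^ (-(5 / 4) : ℝ)) := by gcongr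
            _ = 48 ^ 2 * z ^ (3 / 4 : ℝ) := by
                have : z ^ (3 / 4 : ℝ) = z ^ (2 : ℝ) * z ^ (-(5 / 4) : ℝ) := by
                  rw [← Real.rpow_add hz0]; norm_num
                rw [this, Real.rpow_two]; ring
            _ ≤ 48 ^ 2 := mul_le_of_le_one_right (by norm_num)
                (Real.rpow_le_one hz0.le h' (by norm_num))
        · rw [hmin2 h']
          calc omegaSym lam x * y ^ (5 / 4 : ℝ) ≤ 1 * (48 ^ 2 * z ^ (-(5 / 4) : ℝ)) := by gcongr
            _ ≤ _ := by rw [one_mul]; gcongr; linarith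
      calc omegaSym lam x * y = omegaSym lam x * y ^ (5 / 4 : ℝ) * y ^ (-(1 / 4) : ℝ) := by
            nth_rewrite 1 [e]; ring
        _ ≤ _ := by gcongr

lemma lintegral_sq_shellWeight_conj_le {μ : Measure ℝ} (hμ : IsFreqMeasure μ) {lam : ℝ}
    (hl : 0 < lam) :
    ∫⁻ x, lowBand.indicator (fun x => ENNReal.ofReal
        (48 ^ 2 * lam * min 1 ((lam * |x|) ^ (-(3 / 4) : ℝ)))) x ^ 2 ∂μ
      ≤ ENNReal.ofReal (32 * 48 ^ 4 * lam) := by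
  have e : 32 * 48 ^ 4 * lam = (48 ^ 2 * lam) ^ 2 * (16 / ((3 / 2 - 1) * lam)) := by
    field_simp; norm_num
  rw [e, ENNReal.ofReal_mul (by positivity)]
  refine le_trans ?_ (mul_le_mul_right (lintegral_min_one_rpow_le hμ hl (β := 3 / 2)
    (by norm_num) (by norm_num)) _)
  rw [← lintegral_const_mul' _ _ ENNReal.ofReal_ne_top]
  refine lintegral_mono fun x => ?_
  by_cases hx : x ∈ lowBand
  · have hx0 : 0 < |x| := hx.1
    rw [Set.indicator_of_mem hx, Set.indicator_of_mem (show x ∈ {x : ℝ | 0 < |x|} from hx.1),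
      ← ENNReal.ofReal_pow (by positivity), ← ENNReal.ofReal_mul (by positivity), mul_pow]
    refine ENNReal.ofReal_le_ofReal ?_
    gcongr
    have h0 : 0 ≤ min 1 ((lam * |x|) ^ (-(3 / 4) : ℝ)) := by positivity
    refine le_min (pow_le_one₀ h0 (min_le_left _ _)) ?_
    calc _ ≤ ((lam * |x|) ^ (-(3 / 4) : ℝ)) ^ 2 := by gcongr; exact min_le_right _ _
      _ = _ := by
          rw [← Real.rpow_natCast, ← Real.rpow_mul (by positivity)]; norm_num
  · rw [Set.indicator_of_notMem hx]; simp

lemma lossFactor_sq_of_ne {s lam : ℝ} (hs : s ≠ -1 / 4) (hl : 0 < lam) :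
    lossFactor s lam ^ 2 = lam ^ (-4 * s) * lam⁻¹ := by
  rw [lossFactor, if_neg hs, ← Real.rpow_natCast, ← Real.rpow_mul hl.le, ← Real.rpow_neg_one,
    ← Real.rpow_add hl]
  congr 1; push_cast; ring

lemma lossFactor_sq_quarter {lam : ℝ} (hl : 0 < lam) :
    lossFactor (-1 / 4) lam ^ 2 = Real.log (1 + lam) := by
  rw [lossFactor, if_pos rfl, ← Real.rpow_natCast, ← Real.rpow_mul (Real.log_nonneg (by linarith))]
  norm_num

lemma lossFactor_nonneg {s lam : ℝ} (hl : 0 ≤ lam) : 0 ≤ lossFactor s lam := by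
  unfold lossFactor
  have := Real.log_nonneg (show 1 ≤ 1 + lam by linarith)
  split_ifs <;> positivity

lemma half_le_lossFactor {s lam : ℝ} (hs' : s ≤ -1 / 4) (hl : 1 ≤ lam) : 1 / 2 ≤ lossFactor s lam := by
  by_cases h : s = -1 / 4
  · refine le_of_sq_le_sq ?_ (lossFactor_nonneg (by linarith))
    rw [h, lossFactor_sq_quarter (by linarith)]
    have h1 : Real.log 2 ≤ Real.log (1 + lam) := Real.log_le_log (by norm_num) (by linarith)
    have h2 := Real.log_two_gt_d9
    norm_num at h2 ⊢; linarith
  · rw [lossFactor, if_neg h]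
    exact le_trans (by norm_num) (Real.one_le_rpow hl (by linarith))

/-- The `L²` norm of `ω_lam² |ξ| ^ (2 s)` over `0 < |ξ| ≤ 1` is at most a multiple of
`lossFactor`. -/
lemma exists_lintegral_sq_lowWeight_conj_le {s : ℝ} (hs : -1 / 2 ≤ s) (hs' : s ≤ -1 / 4) :
    ∃ K : ℝ≥0, ∀ (μ : Measure ℝ), IsFreqMeasure μ → ∀ lam : ℝ, 1 ≤ lam →
      ∫⁻ x, lowWeight s lam (fun x => |x|) x ^ 2 ∂μ
        ≤ K * ENNReal.ofReal (lossFactor s lam) ^ 2 := by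
  by_cases h : s = -1 / 4
  · refine ⟨100, fun μ hμ lam hl => ?_⟩
    have hl0 : 0 < lam := by linarith
    have hlog2 : 0 < Real.log 2 := Real.log_pos (by norm_num)
    have hlog : Real.log 2 ≤ Real.log (1 + lam) := Real.log_le_log (by norm_num) (by linarith)
    have hlog0 : 0 < Real.log (1 + lam) := hlog2.trans_le hlog
    -- this exponent turns the logarithmic divergence at `β = 1` into the factor `log (1 + lam)`
    set β : ℝ := 1 + Real.log 2 / Real.log (1 + lam) with hβ
    have hβ1 : 1 < β := by rw [hβ]; linarith [div_pos hlog2 hlog0]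
    have hβ2 : β ≤ 2 := by rw [hβ]; linarith [(div_le_one hlog0).2 hlog]
    refine (lintegral_sq_lowWeight_le hμ hl0 hs (by linarith) hβ1 hβ2 (K := 2) (by norm_num)
      fun x hx => ?_).trans ?_
    · have hx0 : 0 < |x| := hx.1
      have hx1 : |x| ≤ 1 := hx.2
      set z := lam * |x| with hz
      have hz0 : 0 < z := by positivity
      have e : 4 * s = -1 := by rw [h]; norm_num
      rw [e]
      rcases le_total z 1 with h' | h'
      · have : min 1 (z ^ (-β)) = 1 :=
          min_eq_left (Real.one_le_rpow_of_pos_of_le_one_of_nonpos hz0 h' (by linarith))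
        rw [this]
        exact (min_le_left _ _).trans (by norm_num)
      · have : min 1 (z ^ (-β)) = z ^ (-β) :=
          min_eq_right (Real.rpow_le_one_of_one_le_of_nonpos h' (by linarith))
        rw [this]
        refine (min_le_right _ _).trans ?_
        have hz2 : z ^ (β - 1) ≤ 2 := by
          have hzl : z ≤ 1 + lam := by
            rw [hz]; linarith [mul_le_of_le_one_right hl0.le hx1]
          calc z ^ (β - 1) ≤ (1 + lam) ^ (β - 1) := by gcongr
            _ = 2 := by
                rw [Real.rpow_def_of_pos (by linarith), hβ, add_sub_cancel_left,
                  mul_div_cancel₀ _ hlog0.ne', Real.exp_log two_pos]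
        calc z ^ (-1 : ℝ) = z ^ (β - 1) * z ^ (-β) := by
              rw [← Real.rpow_add hz0]; congr 1; ring
          _ ≤ _ := by gcongr
    · rw [← ENNReal.ofReal_pow (lossFactor_nonneg hl0.le), h, lossFactor_sq_quarter hl0,
        ← ENNReal.ofReal_coe_nnreal, ← ENNReal.ofReal_mul (by positivity)]
      refine ENNReal.ofReal_le_ofReal ?_
      have e1 : lam ^ (-4 * (-1 / 4) : ℝ) = lam := by norm_num
      rw [e1, hβ, add_sub_cancel_left]
      have e2 : lam * 2 * (16 / (Real.log 2 / Real.log (1 + lam) * lam))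
          = 32 / Real.log 2 * Real.log (1 + lam) := by field_simp; norm_num
      rw [e2]
      have : 32 / Real.log 2 ≤ 100 := by
        rw [div_le_iff₀ hlog2]; have := Real.log_two_gt_d9; norm_num at this ⊢; linarith
      push_cast
      gcongr
  · refine ⟨Real.toNNReal (16 / (-4 * s - 1)), fun μ hμ lam hl => ?_⟩
    have hl0 : 0 < lam := by linarith
    have hs4 : s < -1 / 4 := lt_of_le_of_ne hs' h
    have hpos : 0 < -4 * s - 1 := by linarith
    refine (lintegral_sq_lowWeight_le hμ hl0 hs (by linarith) (β := -4 * s) (by linarith)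
      (by linarith) (K := 1) (by norm_num) fun x hx => ?_).trans ?_
    · rw [one_mul]; exact le_of_eq (by congr 2; ring)
    · rw [← ENNReal.ofReal_pow (lossFactor_nonneg hl0.le), lossFactor_sq_of_ne h hl0]
      change _ ≤ ENNReal.ofReal _ * _
      rw [← ENNReal.ofReal_mul (by positivity)]
      refine ENNReal.ofReal_le_ofReal (le_of_eq ?_)
      field_simp

/-- The loss in the estimate of `u v̄`. -/
lemma exists_isLowBound_conj {s : ℝ} (hs : -1 / 2 ≤ s) (hs' : s ≤ -1 / 4) :
    ∃ C : ℝ≥0, ∀ (μ : Measure ℝ), IsFreqMeasure μ → ∀ lam : ℝ, 1 ≤ lam →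
      IsLowBound μ s lam 1 (-1) (C * ENNReal.ofReal (lossFactor s lam)) := by
  obtain ⟨K, hK⟩ := exists_lintegral_sq_lowWeight_conj_le hs hs'
  refine ⟨K + 48 ^ 3, fun μ hμ lam hl => ?_⟩
  have hl0 : 0 < lam := by linarith
  have hsq : ∀ a : ℝ≥0, a ≤ (K + 48 ^ 3) ^ 2 → (a : ℝ≥0∞) * ENNReal.ofReal (lossFactor s lam) ^ 2
      ≤ (((K + 48 ^ 3 : ℝ≥0) : ℝ≥0∞) * ENNReal.ofReal (lossFactor s lam)) ^ 2 := by
    intro a ha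
    rw [mul_pow]
    gcongr
    exact_mod_cast ha
  refine ⟨?_, fun x => |x|, isLowResonance_conj, (hK μ hμ lam hl).trans (hsq K ?_), fun hs2 =>
    ⟨lam, fun x => 48 ^ 2 * lam * min 1 ((lam * |x|) ^ (-(3 / 4) : ℝ)), isShellWeight_conj hl0,
      (lintegral_sq_shellWeight_conj_le hμ hl0).trans (le_trans (le_of_eq ?_)
        (hsq (32 * 48 ^ 4) ?_))⟩⟩
  · rw [← ENNReal.ofReal_coe_nnreal, ← ENNReal.ofReal_mul (by positivity),
      ENNReal.one_le_ofReal]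
    have := half_le_lossFactor hs' hl
    have hK0 : (0 : ℝ) ≤ K := K.2
    push_cast
    nlinarith
  · nlinarith [zero_le (a := K), zero_le (a := K ^ 2)]
  · rw [← ENNReal.ofReal_pow (lossFactor_nonneg hl0.le), lossFactor_sq_of_ne (by rw [hs2]; norm_num)
      hl0, ← ENNReal.ofReal_coe_nnreal, ← ENNReal.ofReal_mul (by positivity)]
    congr 1
    have : lam ^ (-4 * s) = lam ^ 2 := by rw [hs2, ← Real.rpow_two]; norm_num
    rw [this]
    push_cast
    field_simp
  · calc (32 * 48 ^ 4 : ℝ≥0) ≤ (48 ^ 3) ^ 2 := by norm_num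
      _ ≤ _ := by gcongr; exact le_add_self


/-! ### The bilinear estimate for nonnegative functions -/

section
variable {μ : Measure ℝ} {s lam : ℝ} {f₁ f₂ : ℝ × ℝ → ℝ≥0∞}

/-- The symbol of `⟨ξ⟩ ^ s ω_lam²` applied to the convolution of `f₁` and `f₂`. -/
noncomputable def outConv (μ : Measure ℝ) (s lam : ℝ) (f₁ f₂ : ℝ × ℝ → ℝ≥0∞) (q : ℝ × ℝ) : ℝ≥0∞ :=
  ENNReal.ofReal (omegaSym lam q.2 * yWeight s q) * conv μ f₁ f₂ q

/-- The part of `outConv` at low output frequencies. -/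
noncomputable def lowConv (μ : Measure ℝ) (lam : ℝ) (f₁ f₂ : ℝ × ℝ → ℝ≥0∞) : ℝ × ℝ → ℝ≥0∞ :=
  {q : ℝ × ℝ | q.2 ∈ lowBand}.indicator fun q => ENNReal.ofReal (omegaSym lam q.2) * conv μ f₁ f₂ q

lemma measurableSet_snd_mem_lowBand : MeasurableSet {q : ℝ × ℝ | q.2 ∈ lowBand} :=
  measurable_snd measurableSet_lowBand

lemma measurable_lowConv [SFinite μ] (h₁ : Measurable f₁) (h₂ : Measurable f₂) :
    Measurable (lowConv μ lam f₁ f₂) := by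
  have := measurable_conv (μ := μ) h₁ h₂
  exact Measurable.indicator (by fun_prop) measurableSet_snd_mem_lowBand

/-- The output frequencies are `|ξ| ≥ 1` and `0 < |ξ| ≤ 1`; the symbol of `ω_lam²` vanishes at `ξ = 0`. -/
lemma outConv_le (h₁ : Measurable f₁) (h₂ : Measurable f₂) (hs' : s ≤ 0) (q : ℝ × ℝ) :
    outConv μ s lam f₁ f₂ q
      ≤ piece μ (yWeight s) f₁ f₂ {z | 1 ≤ |z.1.2|} q + lowConv μ lam f₁ f₂ q := by
  have ho := omegaSym_nonneg lam q.2
  have ho1 := omegaSym_le_one lam q.2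
  have hy0 := yWeight_nonneg s q
  have hy1 : yWeight s q ≤ 1 := Real.rpow_le_one_of_one_le_of_nonpos (one_le_bracket _) hs'
  unfold outConv
  rcases eq_or_ne q.2 0 with hx0 | hx0
  · have : omegaSym lam q.2 = 0 := by rw [omegaSym, hx0]; simp
    simp [this]
  rcases le_total 1 |q.2| with hx | hx
  · refine le_add_right ?_
    unfold piece conv
    rw [← lintegral_const_mul _ (by fun_prop)]
    refine lintegral_mono fun p => ?_
    rw [Set.indicator_of_mem (show (q, p) ∈ {z : (ℝ × ℝ) × (ℝ × ℝ) | 1 ≤ |z.1.2|} from hx)]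
    gcongr
    exact mul_le_of_le_one_left hy0 ho1
  · refine le_add_left ?_
    unfold lowConv
    rw [Set.indicator_of_mem (show q ∈ {q : ℝ × ℝ | q.2 ∈ lowBand} from ⟨abs_pos.2 hx0, hx⟩)]
    gcongr
    exact mul_le_of_le_one_right ho hy1

lemma bracket_div_mul_lowConv_le (q : ℝ × ℝ) :
    ENNReal.ofReal (bracket q.2 / modulation q) * lowConv μ lam f₁ f₂ q
      ≤ 2 * {q : ℝ × ℝ | q.2 ∈ lowBand}.indicator (fun q =>
        ENNReal.ofReal (omegaSym lam q.2 / modulation q) * conv μ f₁ f₂ q) q := by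
  unfold lowConv
  by_cases hq : q ∈ {q : ℝ × ℝ | q.2 ∈ lowBand}
  · have hL : 0 < modulation q := bracket_pos _
    have hn := bracket_le_of_abs_le_one hq.2
    have hn0 := bracket_pos q.2
    simp only [Set.indicator_of_mem hq]
    rw [← mul_assoc, ← mul_assoc, ← ENNReal.ofReal_mul (by positivity), ← ENNReal.ofReal_ofNat 2,
      ← ENNReal.ofReal_mul (by norm_num)]
    refine mul_le_mul_left (ENNReal.ofReal_le_ofReal ?_) _
    have ho := omegaSym_nonneg lam q.2
    rw [div_mul_eq_mul_div, ← mul_div_assoc]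
    gcongr
    linarith
  · simp [Set.indicator_of_notMem hq]

/-- The `L²` norms of the output, over all output frequencies. -/
lemma exists_outConv_le (hs : -1 / 2 ≤ s) (hs' : s ≤ 0) : ∃ C : ℝ≥0, ∀ (μ : Measure ℝ) [SFinite μ],
    IsFreqMeasure μ → ∀ (ε₁ ε₂ lam : ℝ) (f₁ f₂ : ℝ × ℝ → ℝ≥0∞) (B : ℝ≥0∞),
    (ε₁ = 1 ∨ ε₁ = -1) → (ε₂ = 1 ∨ ε₂ = -1) → IsLowBound μ s lam ε₁ ε₂ B → Measurable f₁ →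
    Measurable f₂ →
    lTwo μ (fun q => ENNReal.ofReal (outGain q) * outConv μ s lam f₁ f₂ q)
        ≤ C * B * (sqNorm μ s ε₁ f₁ * sqNorm μ s ε₂ f₂) ^ (1 / 2 : ℝ) ∧
      (s = -1 / 2 → ∑' j, lTwo μ ((dyadicRegion j ∩ farRegion).indicator fun q =>
          ENNReal.ofReal (bracket q.2 / modulation q) * outConv μ s lam f₁ f₂ q)
        ≤ C * B * (sqNorm μ s ε₁ f₁ * sqNorm μ s ε₂ f₂) ^ (1 / 2 : ℝ)) := by
  obtain ⟨C₁, hC₁⟩ := exists_high_le hs hs'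
  obtain ⟨C₂, hC₂⟩ := exists_tsum_low_le
  refine ⟨C₁ + 192 + 2 * C₂, fun μ _ hμ ε₁ ε₂ lam f₁ f₂ B hε₁ hε₂ hB h₁ h₂ => ?_⟩
  obtain ⟨hB1, d, hd, hBd, hBs⟩ := hB
  set X := (sqNorm μ s ε₁ f₁ * sqNorm μ s ε₂ f₂) ^ (1 / 2 : ℝ) with hX
  have hhigh : outNorm μ (piece μ (yWeight s) f₁ f₂ {z | 1 ≤ |z.1.2|}) ≤ C₁ * B * X := by
    refine (hC₁ μ hμ ε₁ ε₂ hε₁ hε₂ f₁ f₂ h₁ h₂).trans ?_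
    rw [← hX]
    gcongr
    exact le_mul_of_one_le_right zero_le hB1
  set H := piece μ (yWeight s) f₁ f₂ {z | 1 ≤ |z.1.2|} with hH
  have hHm : Measurable H := measurable_piece (measurable_yWeight s) h₁ h₂
    (measurableSet_le (by fun_prop) (by fun_prop))
  have hlm : Measurable (lowConv μ lam f₁ f₂) := measurable_lowConv h₁ h₂
  have hcm := measurable_conv (μ := μ) h₁ h₂
  have hl2m : Measurable ({q : ℝ × ℝ | q.2 ∈ lowBand}.indicator fun q =>
      ENNReal.ofReal (omegaSym lam q.2 / modulation q) * conv μ f₁ f₂ q) :=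
    Measurable.indicator (by fun_prop) measurableSet_snd_mem_lowBand
  have hC : ∀ a b : ℝ≥0, a + b ≤ C₁ + 192 + 2 * C₂ →
      a * B * X + b * B * X ≤ (C₁ + 192 + 2 * C₂ : ℝ≥0) * B * X := by
    intro a b hab
    rw [← add_mul, ← add_mul]
    gcongr
    exact_mod_cast hab
  constructor
  · calc _ ≤ lTwo μ (fun q => ENNReal.ofReal (outGain q) * H q +
            ENNReal.ofReal (outGain q) * lowConv μ lam f₁ f₂ q) := by
          refine lTwo_mono fun q => ?_
          rw [← mul_add]
          gcongr
          exact outConv_le h₁ h₂ hs' q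
      _ ≤ lTwo μ (fun q => ENNReal.ofReal (outGain q) * H q) +
            lTwo μ (fun q => ENNReal.ofReal (outGain q) * lowConv μ lam f₁ f₂ q) :=
          lTwo_add_le (by fun_prop) (by fun_prop)
      _ ≤ C₁ * B * X + (192 : ℝ≥0) * B * X := by
          gcongr
          · exact le_self_add.trans hhigh
          · calc _ ≤ lTwo μ (fun q => 2 * {q : ℝ × ℝ | q.2 ∈ lowBand}.indicator (fun q =>
                    ENNReal.ofReal (omegaSym lam q.2 / modulation q) * conv μ f₁ f₂ q) q) := by
                  refine lTwo_mono fun q => le_trans ?_ (bracket_div_mul_lowConv_le q)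
                  gcongr
                  exact gain_le_div _ _
              _ ≤ 2 * (96 * B * X) := by
                  rw [lTwo_const_mul _ hl2m]
                  gcongr
                  exact lTwo_low_le hμ hd hs hs' h₁ h₂ hBd
              _ = _ := by push_cast; ring
      _ ≤ _ := hC _ _ le_self_add
  · intro hs2
    obtain ⟨Λ, m, hm, hBm⟩ := hBs hs2
    have hm' : ∀ j, MeasurableSet (dyadicRegion j ∩ farRegion) := fun j =>
      (measurableSet_dyadicRegion j).inter measurableSet_farRegion
    have hl3m : ∀ j, Measurable ((dyadicRegion j ∩ {q : ℝ × ℝ | q.2 ∈ lowBand}).indicator fun q =>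
        ENNReal.ofReal (omegaSym lam q.2 / modulation q) * conv μ f₁ f₂ q) := fun j =>
      Measurable.indicator (by fun_prop)
        ((measurableSet_dyadicRegion j).inter measurableSet_snd_mem_lowBand)
    calc _ ≤ ∑' j, (lTwo μ ((dyadicRegion j ∩ farRegion).indicator fun q =>
              ENNReal.ofReal (bracket q.2 / modulation q) * H q) +
            2 * lTwo μ ((dyadicRegion j ∩ {q : ℝ × ℝ | q.2 ∈ lowBand}).indicator fun q =>
              ENNReal.ofReal (omegaSym lam q.2 / modulation q) * conv μ f₁ f₂ q)) := by
          gcongr with j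
          rw [← lTwo_const_mul _ (hl3m j)]
          refine le_trans (lTwo_mono fun q => ?_) (lTwo_add_le
            (Measurable.indicator (by fun_prop) (hm' j)) ((hl3m j).const_mul 2))
          refine Set.indicator_apply_le' (fun hq => ?_) fun _ => zero_le
          rw [Set.indicator_of_mem hq]
          refine (mul_le_mul_right (outConv_le h₁ h₂ hs' q) _).trans ?_
          rw [mul_add]
          refine add_le_add le_rfl ?_
          refine (bracket_div_mul_lowConv_le (μ := μ) q).trans (mul_le_mul_right ?_ _)
          by_cases hl : q ∈ {q : ℝ × ℝ | q.2 ∈ lowBand}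
          · rw [Set.indicator_of_mem hl, Set.indicator_of_mem (Set.mem_inter hq.1 hl)]
          · rw [Set.indicator_of_notMem hl]; exact zero_le
      _ = (∑' j, lTwo μ ((dyadicRegion j ∩ farRegion).indicator fun q =>
              ENNReal.ofReal (bracket q.2 / modulation q) * H q)) +
            2 * ∑' j, lTwo μ ((dyadicRegion j ∩ {q : ℝ × ℝ | q.2 ∈ lowBand}).indicator fun q =>
              ENNReal.ofReal (omegaSym lam q.2 / modulation q) * conv μ f₁ f₂ q) := by
          rw [ENNReal.tsum_add, ENNReal.tsum_mul_left]
      _ ≤ C₁ * B * X + (2 * C₂ : ℝ≥0) * B * X := by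
          refine add_le_add ?_ ?_
          · exact le_add_self.trans hhigh
          · refine (mul_le_mul_right (hC₂ μ hμ s ε₁ ε₂ lam Λ d m f₁ f₂ B hs2 hd hm h₁ h₂ hBd hBm)
              2).trans (le_of_eq ?_)
            rw [← hX]; push_cast; ring
      _ ≤ _ := hC _ _ (by rw [add_right_comm]; exact le_self_add)

end


/-! ### The norm of `W^s` in terms of nonnegative functions -/

section
variable {Z : Geometry} {lam s b : ℝ} {f g : ℝ × ℝ → ℂ}

lemma specMeasure_eq (Z : Geometry) (lam : ℝ) : specMeasure Z lam = stMeasure (freqMeasure Z lam) :=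
  rfl

lemma mixedNorm_congr_ae {p : ℝ≥0∞} (h : f =ᵐ[specMeasure Z lam] g) :
    mixedNorm Z lam p f = mixedNorm Z lam p g := by
  unfold mixedNorm
  refine eLpNorm_congr_ae ?_
  have : ∀ᵐ x ∂(freqMeasure Z lam), ∀ᵐ t : ℝ, f (t, x) = g (t, x) :=
    Measure.ae_ae_of_ae_prod (Measure.measurePreserving_swap.quasiMeasurePreserving.ae h)
  filter_upwards [this] with x hx
  exact eLpNorm_congr_ae hx

lemma xNorm_congr_ae (h : f =ᵐ[specMeasure Z lam] g) : xNorm Z lam s b f = xNorm Z lam s b g :=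
  mixedNorm_congr_ae (h.mono fun q hq => by simp only [hq])

lemma yNorm_congr_ae (h : f =ᵐ[specMeasure Z lam] g) : yNorm Z lam s f = yNorm Z lam s g :=
  mixedNorm_congr_ae (h.mono fun q hq => by simp only [hq])

lemma wNorm_congr_ae (h : f =ᵐ[specMeasure Z lam] g) : wNorm Z lam s f = wNorm Z lam s g := by
  have hi : ∀ S : Set (ℝ × ℝ), S.indicator f =ᵐ[specMeasure Z lam] S.indicator g := fun S =>
    h.mono fun q hq => by by_cases hS : q ∈ S <;> simp [hS, hq]
  unfold wNorm
  simp only [fun s b S => xNorm_congr_ae (s := s) (b := b) (hi S),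
    fun s S => yNorm_congr_ae (s := s) (hi S)]

lemma mixedNorm_two_eq (hf : Measurable f) :
    mixedNorm Z lam 2 f = lTwo (freqMeasure Z lam) fun q => ‖f q‖ₑ := by
  unfold mixedNorm lTwo stMeasure
  rw [eLpNorm_eq_lintegral_rpow_enorm_toReal (by norm_num) (by norm_num),
    lintegral_prod_symm' _ (by fun_prop)]
  simp only [ENNReal.toReal_ofNat, ENNReal.rpow_ofNat]
  congr 1
  refine lintegral_congr fun x => ?_
  rw [eLpNorm_eq_lintegral_rpow_enorm_toReal (by norm_num) (by norm_num)]
  simp only [ENNReal.toReal_ofNat, ENNReal.rpow_ofNat, enorm_eq_self]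
  rw [ennreal_sqrt_sq]

lemma mixedNorm_one_eq (f : ℝ × ℝ → ℂ) :
    mixedNorm Z lam 1 f = sqNormLOne (freqMeasure Z lam) (fun q => ‖f q‖ₑ) ^ (1 / 2 : ℝ) := by
  unfold mixedNorm sqNormLOne
  rw [eLpNorm_eq_lintegral_rpow_enorm_toReal (by norm_num) (by norm_num)]
  simp only [ENNReal.toReal_ofNat, ENNReal.rpow_ofNat, enorm_eq_self,
    eLpNorm_one_eq_lintegral_enorm]

lemma enorm_ofReal_mul_indicator (r : ℝ) (hr : 0 ≤ r) (S : Set (ℝ × ℝ)) (q : ℝ × ℝ) :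
    ‖((r : ℝ) : ℂ) * S.indicator f q‖ₑ
      = S.indicator (fun q => ENNReal.ofReal r * ‖f q‖ₑ) q := by
  rw [enorm_mul, ← enorm_norm ((r : ℝ) : ℂ), Complex.norm_real, enorm_norm, Real.enorm_of_nonneg hr,
    enorm_indicator_eq_indicator_enorm]
  by_cases hq : q ∈ S <;> simp [hq]

lemma xNorm_indicator_eq (hf : Measurable f) {S : Set (ℝ × ℝ)} (hS : MeasurableSet S) :
    xNorm Z lam s b (S.indicator f) = lTwo (freqMeasure Z lam) (S.indicator
      fun q => ENNReal.ofReal (bracket q.2 ^ s * modulation q ^ b) * ‖f q‖ₑ) := by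
  have hm : Measurable fun q : ℝ × ℝ =>
      ((bracket q.2 ^ s * modulation q ^ b : ℝ) : ℂ) * S.indicator f q := by
    have := hf.indicator hS
    fun_prop
  rw [xNorm, mixedNorm_two_eq hm]
  congr 1
  funext q
  have h1 := bracket_pos q.2
  have h2 : 0 < modulation q := bracket_pos _
  rw [enorm_ofReal_mul_indicator _ (by positivity)]
  by_cases hq : q ∈ S <;> simp [hq]

lemma yNorm_indicator_eq (S : Set (ℝ × ℝ)) :
    yNorm Z lam s (S.indicator f) = sqNormLOne (freqMeasure Z lam) (S.indicator
      fun q => ENNReal.ofReal (bracket q.2 ^ s) * ‖f q‖ₑ) ^ (1 / 2 : ℝ) := by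
  rw [yNorm, mixedNorm_one_eq]
  congr 2
  funext q
  have h1 := bracket_pos q.2
  rw [enorm_ofReal_mul_indicator _ (by positivity)]
  by_cases hq : q ∈ S <;> simp [hq]

lemma measurableSet_nearRegion : MeasurableSet nearRegion :=
  measurableSet_le measurable_modulation (by fun_prop)

lemma measurableSet_awayRegion : MeasurableSet awayRegion :=
  measurableSet_le (by fun_prop) measurable_modulation

lemma measurableSet_middleRegion : MeasurableSet middleRegion :=
  (measurableSet_le (by fun_prop) measurable_modulation).inter
    (measurableSet_le measurable_modulation (by fun_prop))

lemma exists_mem_dyadicRegion (q : ℝ × ℝ) : ∃ j, q ∈ dyadicRegion j := by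
  obtain ⟨j, h1, h2⟩ := exists_nat_pow_near (one_le_bracket (q.1 + q.2 ^ 2)) (one_lt_two (α := ℝ))
  exact ⟨j, h1, h2⟩

/-- The `L²` part of the norm of `W^s` away from the parabola, with the weight of `X^{s+1,0}`. -/
lemma lTwo_awayRegion_le_wNorm (hf : Measurable f) :
    lTwo (freqMeasure Z lam) (nearRegion.indicator
        fun q => ENNReal.ofReal (bracket q.2 ^ s * modulation q ^ (1 : ℝ)) * ‖f q‖ₑ) +
      lTwo (freqMeasure Z lam) (awayRegion.indicator
        fun q => ENNReal.ofReal (bracket q.2 ^ (s + 1) * modulation q ^ (0 : ℝ)) * ‖f q‖ₑ)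
      ≤ wNorm Z lam s f := by
  have hm : ∀ S, MeasurableSet S → Measurable (S.indicator
      fun q : ℝ × ℝ => ENNReal.ofReal (bracket q.2 ^ (s + 1) * modulation q ^ (0 : ℝ)) * ‖f q‖ₑ) :=
    fun S hS => Measurable.indicator (by fun_prop) hS
  have hd : ∀ j, MeasurableSet (dyadicRegion j ∩ farRegion) := fun j =>
    (measurableSet_dyadicRegion j).inter measurableSet_farRegion
  unfold wNorm
  split_ifs with h
  · rw [← h, show (1 / 2 : ℝ) = s + 1 by rw [h]; norm_num]
    rw [xNorm_indicator_eq hf measurableSet_nearRegion,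
      xNorm_indicator_eq hf measurableSet_middleRegion]
    simp only [fun j => xNorm_indicator_eq (Z := Z) (lam := lam) (s := s + 1) (b := 0) hf (hd j)]
    refine le_trans ?_ le_self_add
    rw [add_assoc]
    gcongr
    refine le_trans ?_ (add_le_add_right (lTwo_tsum_le fun j => hm _ (hd j)) _)
    refine le_trans (lTwo_mono fun q => ?_) (lTwo_add_le (hm _ measurableSet_middleRegion)
      (Measurable.tsum fun j => hm _ (hd j)))
    refine Set.indicator_apply_le' (fun hq => ?_) fun _ => zero_le
    by_cases hmid : q ∈ middleRegion
    · rw [Set.indicator_of_mem hmid]; exact le_self_add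
    · obtain ⟨j, hj⟩ := exists_mem_dyadicRegion q
      have hfar : q ∈ farRegion := by
        by_contra hc
        exact hmid ⟨hq, (not_le.1 hc).le⟩
      refine le_add_left (le_trans ?_ (ENNReal.le_tsum j))
      rw [Set.indicator_of_mem (Set.mem_inter hj hfar)]
  · rw [xNorm_indicator_eq hf measurableSet_nearRegion,
      xNorm_indicator_eq hf measurableSet_awayRegion]
    exact le_self_add

lemma lTwo_xWeight_le_wNorm (hf : Measurable f) :
    lTwo (freqMeasure Z lam) (weighted (xWeight s 1) fun q => ‖f q‖ₑ) ≤ wNorm Z lam s f := by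
  refine le_trans (le_trans (lTwo_mono fun q => ?_) (lTwo_add_le
    (Measurable.indicator (by fun_prop) measurableSet_nearRegion)
    (Measurable.indicator (by fun_prop) measurableSet_awayRegion))) (lTwo_awayRegion_le_wNorm hf)
  have e : signedModulation 1 q = modulation q := by simp [signedModulation, modulation]
  have hn := bracket_pos q.2
  unfold weighted xWeight
  rw [e]
  rcases le_total (modulation q) (bracket q.2) with h | h
  · rw [Set.indicator_of_mem (show q ∈ nearRegion from h), min_eq_left h, Real.rpow_one]
    exact le_self_add
  · rw [Set.indicator_of_mem (show q ∈ awayRegion from h), min_eq_right h, Real.rpow_zero, mul_one,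
      Real.rpow_add_one hn.ne']
    exact le_add_self

lemma sqNormLOne_farRegion_le_wNorm :
    sqNormLOne (freqMeasure Z lam) (farRegion.indicator (weighted (yWeight s) fun q => ‖f q‖ₑ))
      ≤ wNorm Z lam s f ^ 2 := by
  have h : yNorm Z lam s (farRegion.indicator f) ≤ wNorm Z lam s f := by
    unfold wNorm
    split_ifs with h
    · rw [← h]; exact le_add_self
    · exact le_add_self
  rw [yNorm_indicator_eq] at h
  have h2 := pow_le_pow_left₀ zero_le h 2
  rwa [ennreal_sqrt_sq] at h2

lemma besovNorm_le_wNorm (hf : Measurable f) (hs : s = -1 / 2) :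
    besovNorm (freqMeasure Z lam) s 1 (fun q => ‖f q‖ₑ) ≤ wNorm Z lam s f := by
  have hd : ∀ j, MeasurableSet (dyadicRegion j ∩ farRegion) := fun j =>
    (measurableSet_dyadicRegion j).inter measurableSet_farRegion
  unfold wNorm
  rw [if_pos hs]
  refine le_trans (le_of_eq ?_) (le_self_add.trans' le_add_self)
  unfold besovNorm
  refine tsum_congr fun j => ?_
  rw [xNorm_indicator_eq hf (hd j)]
  unfold lTwo
  congr 1
  refine lintegral_congr fun q => ?_
  have e : ∀ p, signedModulation 1 p = modulation p := fun p => by simp [signedModulation, modulation]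
  have e2 : q ∈ farDyadic 1 j ↔ q ∈ dyadicRegion j ∩ farRegion := by
    simp only [farDyadic, dyadicRegion, farRegion, Set.mem_inter_iff, Set.mem_ofPred_eq, e]
  have e3 : s + 1 = 1 / 2 := by rw [hs]; norm_num
  congr 1
  unfold weighted
  by_cases hq : q ∈ farDyadic 1 j
  · rw [Set.indicator_of_mem hq, Set.indicator_of_mem (e2.1 hq), Real.rpow_zero, mul_one, e3]
  · rw [Set.indicator_of_notMem hq, Set.indicator_of_notMem (fun h => hq (e2.2 h)), mul_zero]

/-- Below the modulation `⟨ξ⟩ ^ 2` the `L²_ξ L¹_τ` norm is controlled by the `L²` norms. -/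
lemma exists_lintegral_near_parabola_le : ∃ D : ℝ≥0, ∀ x : ℝ,
    ∫⁻ t, (farRegionᶜ.indicator fun q => ENNReal.ofReal
      ((min (modulation q) (bracket q.2) ^ 2)⁻¹)) (t, x) ≤ D := by
  obtain ⟨C, hC⟩ := exists_lintegral_inv_bracket_sq_le
  refine ⟨C + 2, fun x => ?_⟩
  have hn := one_le_bracket x
  have hball : ∀ t : ℝ, (farRegionᶜ.indicator fun q : ℝ × ℝ => ENNReal.ofReal
        ((min (modulation q) (bracket q.2) ^ 2)⁻¹)) (t, x)
      ≤ ENNReal.ofReal ((bracket (t - -x ^ 2) ^ 2)⁻¹) +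
        (Metric.closedBall (-x ^ 2) (bracket x ^ 2)).indicator
          (fun _ => ENNReal.ofReal ((bracket x ^ 2)⁻¹)) t := by
    intro t
    refine Set.indicator_apply_le' (fun hq => ?_) fun _ => zero_le
    have hlt : modulation (t, x) < bracket x ^ 2 := not_le.1 hq
    have hmem : t ∈ Metric.closedBall (-x ^ 2) (bracket x ^ 2) := by
      rw [Metric.mem_closedBall, Real.dist_eq]
      have := abs_le_bracket (t + x ^ 2)
      rw [sub_neg_eq_add]
      exact this.trans hlt.le
    rw [Set.indicator_of_mem hmem, sub_neg_eq_add]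
    rcases le_total (modulation (t, x)) (bracket x) with h | h
    · rw [min_eq_left h]; exact le_self_add
    · rw [min_eq_right h]; exact le_add_self
  calc _ ≤ ∫⁻ t, (ENNReal.ofReal ((bracket (t - -x ^ 2) ^ 2)⁻¹) +
        (Metric.closedBall (-x ^ 2) (bracket x ^ 2)).indicator
          (fun _ => ENNReal.ofReal ((bracket x ^ 2)⁻¹)) t) := lintegral_mono hball
    _ = (∫⁻ t, ENNReal.ofReal ((bracket (t - -x ^ 2) ^ 2)⁻¹)) +
          ENNReal.ofReal ((bracket x ^ 2)⁻¹) * ENNReal.ofReal (2 * bracket x ^ 2) := by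
        rw [lintegral_add_left (by fun_prop),
          lintegral_indicator_const Metric.isClosed_closedBall.measurableSet, Real.volume_closedBall]
    _ ≤ C + 2 := by
        gcongr
        · exact hC volume isFreqMeasure_volume _
        · rw [← ENNReal.ofReal_mul (by positivity)]
          refine le_of_eq ?_
          rw [show (bracket x ^ 2)⁻¹ * (2 * bracket x ^ 2) = 2 by field_simp]
          simp
    _ = _ := by push_cast; rfl

/-- The norm of `W^s` controls what the estimates use of a factor. -/
lemma exists_sqNorm_le_wNorm : ∃ C : ℝ≥0, ∀ (Z : Geometry) (lam s : ℝ) (f : ℝ × ℝ → ℂ),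
    Measurable f →
    sqNorm (freqMeasure Z lam) s 1 (fun q => ‖f q‖ₑ) ≤ (C * wNorm Z lam s f) ^ 2 := by
  obtain ⟨D, hD⟩ := exists_lintegral_near_parabola_le
  refine ⟨4 + 2 * D, fun Z lam s f hf => ?_⟩
  set μ := freqMeasure Z lam with hμ
  set W := wNorm Z lam s f with hW
  set F : ℝ × ℝ → ℝ≥0∞ := fun q => ‖f q‖ₑ with hF
  have hFm : Measurable F := by fun_prop
  have hx : ∫⁻ q, weighted (xWeight s 1) F q ^ 2 ∂(stMeasure μ) ≤ W ^ 2 :=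
    lTwo_le_iff.1 (lTwo_xWeight_le_wNorm hf)
  have hym : Measurable (weighted (yWeight s) F) := by fun_prop
  have hfarm := measurableSet_farRegion
  have hnear : sqNormLOne μ (farRegionᶜ.indicator (weighted (yWeight s) F)) ≤ D * W ^ 2 := by
    calc sqNormLOne μ (farRegionᶜ.indicator (weighted (yWeight s) F))
        ≤ ∫⁻ x, D * ∫⁻ t, weighted (xWeight s 1) F (t, x) ^ 2 ∂volume ∂μ := by
          unfold sqNormLOne
          refine lintegral_mono fun x => ?_
          have hm1 : Measurable (farRegionᶜ.indicator fun q : ℝ × ℝ => ENNReal.ofReal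
            ((min (modulation q) (bracket q.2) ^ 2)⁻¹)) :=
              Measurable.indicator (by fun_prop) hfarm.compl
          refine (sq_lintegral_le_of_sq_le (v := fun t => (farRegionᶜ.indicator fun q : ℝ × ℝ =>
            ENNReal.ofReal ((min (modulation q) (bracket q.2) ^ 2)⁻¹)) (t, x))
            (w := fun t => weighted (xWeight s 1) F (t, x) ^ 2) (by fun_prop) (by fun_prop)
            fun t => ?_).trans (by gcongr; exact hD x)
          by_cases hq : (t, x) ∈ farRegionᶜ
          · rw [Set.indicator_of_mem hq, Set.indicator_of_mem hq]
            have e : signedModulation 1 (t, x) = modulation (t, x) := by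
              simp [signedModulation, modulation]
            have hn := bracket_pos x
            have hm0 : 0 < min (modulation (t, x)) (bracket x) :=
              lt_min (bracket_pos _) (bracket_pos _)
            unfold weighted xWeight yWeight
            rw [e, mul_pow, mul_pow, ← mul_assoc, ← ENNReal.ofReal_pow (by positivity),
              ← ENNReal.ofReal_pow (by positivity), ← ENNReal.ofReal_mul (by positivity)]
            gcongr
            rw [mul_pow]
            refine le_of_eq ?_
            field_simp
          · rw [Set.indicator_of_notMem hq]; simp
      _ = D * ∫⁻ q, weighted (xWeight s 1) F q ^ 2 ∂(stMeasure μ) := by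
          rw [lintegral_const_mul _ (by fun_prop), IsFreqMeasure.lintegral_sq_eq (by fun_prop)]
      _ ≤ D * W ^ 2 := by gcongr
  have hy : sqNormLOne μ (weighted (yWeight s) F) ≤ 2 * (D * W ^ 2 + W ^ 2) := by
    calc sqNormLOne μ (weighted (yWeight s) F)
        ≤ ∫⁻ x, 2 * ((∫⁻ t, farRegionᶜ.indicator (weighted (yWeight s) F) (t, x)) ^ 2 +
            (∫⁻ t, farRegion.indicator (weighted (yWeight s) F) (t, x)) ^ 2) ∂μ := by
          unfold sqNormLOne
          refine lintegral_mono fun x => le_trans (le_of_eq ?_) (ennreal_add_sq_le _ _)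
          have hm2 := hym.indicator hfarm.compl
          rw [← lintegral_add_left (by fun_prop)]
          congr 2
          funext t
          by_cases hq : (t, x) ∈ farRegion
          · rw [Set.indicator_of_mem hq, Set.indicator_of_notMem (Set.notMem_compl_iff.2 hq), zero_add]
          · rw [Set.indicator_of_notMem hq, Set.indicator_of_mem (show (t, x) ∈ farRegionᶜ from hq),
              add_zero]
      _ = 2 * (sqNormLOne μ (farRegionᶜ.indicator (weighted (yWeight s) F)) +
            sqNormLOne μ (farRegion.indicator (weighted (yWeight s) F))) := by
          have hm2 := hym.indicator hfarm.compl
          have hm3 := hym.indicator hfarm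
          have hm4 : Measurable fun x => (∫⁻ t, farRegionᶜ.indicator (weighted (yWeight s) F) (t, x)) ^ 2 :=
            hm2.lintegral_prod_left'.pow_const 2
          have hm5 : Measurable fun x => (∫⁻ t, farRegion.indicator (weighted (yWeight s) F) (t, x)) ^ 2 :=
            hm3.lintegral_prod_left'.pow_const 2
          rw [lintegral_const_mul' _ _ (by norm_num), lintegral_add_left hm4]
          rfl
      _ ≤ _ := by gcongr; exact sqNormLOne_farRegion_le_wNorm
  have hb : (if s = -1 / 2 then besovNorm μ s 1 F ^ 2 else 0) ≤ W ^ 2 := by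
    split_ifs with h
    · gcongr; exact besovNorm_le_wNorm hf h
    · exact zero_le
  calc sqNorm μ s 1 F ≤ W ^ 2 + 2 * (D * W ^ 2 + W ^ 2) + W ^ 2 := by
        unfold sqNorm
        gcongr
    _ = (4 + 2 * D) * W ^ 2 := by ring
    _ ≤ (4 + 2 * D) ^ 2 * W ^ 2 := by
        gcongr
        refine le_self_pow₀ ?_ two_ne_zero
        exact le_add_right (by norm_num)
    _ = _ := by rw [mul_pow]; push_cast; rfl

/-- The reflection of the frequencies, by which complex conjugation acts, exchanges the two parabolas. -/
lemma sqNorm_neg {μ : Measure ℝ} [SFinite μ] (hμ : IsFreqMeasure μ) {F : ℝ × ℝ → ℝ≥0∞}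
    (hF : Measurable F) : sqNorm μ s (-1) (fun q => F (-q)) = sqNorm μ s 1 F := by
  have hneg : MeasurePreserving (fun p : ℝ × ℝ => -p) (stMeasure μ) (stMeasure μ) :=
    (Measure.measurePreserving_neg (volume : Measure ℝ)).prod hμ.neg
  have e : ∀ p, signedModulation (-1) p = signedModulation 1 (-p) := fun p => by
    unfold signedModulation
    rw [← bracket_neg]
    congr 1
    simp only [Prod.fst_neg, Prod.snd_neg]; ring
  have hb : ∀ p : ℝ × ℝ, bracket p.2 = bracket (-p).2 := fun p => by simp
  have ex : ∀ p, xWeight s (-1) p = xWeight s 1 (-p) := fun p => by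
    unfold xWeight; rw [e, hb]
  have ey : ∀ p, yWeight s p = yWeight s (-p) := fun p => by unfold yWeight; rw [hb]
  have hd : ∀ j p, (farDyadic (-1) j).indicator (fun q => F (-q)) p
      = (farDyadic 1 j).indicator F (-p) := fun j p => by
    have : p ∈ farDyadic (-1) j ↔ -p ∈ farDyadic 1 j := by
      simp only [farDyadic, Set.mem_inter_iff, Set.mem_ofPred_eq, e, ← hb p]
    by_cases hp : p ∈ farDyadic (-1) j
    · rw [Set.indicator_of_mem hp, Set.indicator_of_mem (this.1 hp)]
    · rw [Set.indicator_of_notMem hp, Set.indicator_of_notMem (fun h => hp (this.2 h))]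
  have hFd : ∀ j, Measurable ((farDyadic 1 j).indicator F) := fun j =>
    hF.indicator (measurableSet_farDyadic 1 j)
  have h1 : ∫⁻ p, weighted (xWeight s (-1)) (fun q => F (-q)) p ^ 2 ∂(stMeasure μ)
      = ∫⁻ p, weighted (xWeight s 1) F p ^ 2 ∂(stMeasure μ) := by
    simp only [weighted, ex]
    exact hneg.lintegral_comp (f := fun p => (ENNReal.ofReal (xWeight s 1 p) * F p) ^ 2)
      (by fun_prop)
  have h2 : sqNormLOne μ (weighted (yWeight s) (fun q => F (-q)))
      = sqNormLOne μ (weighted (yWeight s) F) := by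
    have hm : Measurable fun x => (∫⁻ t, weighted (yWeight s) F (t, x)) ^ 2 :=
      (show Measurable (weighted (yWeight s) F) by fun_prop).lintegral_prod_left'.pow_const 2
    unfold sqNormLOne
    rw [← hμ.neg.lintegral_comp hm]
    refine lintegral_congr fun x => ?_
    congr 1
    rw [← (Measure.measurePreserving_neg (volume : Measure ℝ)).lintegral_comp (by fun_prop)]
    refine lintegral_congr fun t => ?_
    unfold weighted
    rw [ey (-t, x), Prod.neg_mk, neg_neg]
    simp only [Prod.neg_mk, neg_neg]
  have h3 : besovNorm μ s (-1) (fun q => F (-q)) = besovNorm μ s 1 F := by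
    unfold besovNorm
    refine tsum_congr fun j => ?_
    congr 1
    rw [← hneg.lintegral_comp (f := fun p => weighted (fun p => bracket p.2 ^ (s + 1))
      ((farDyadic 1 j).indicator F) p ^ 2) (by have := hFd j; fun_prop)]
    refine lintegral_congr fun p => ?_
    unfold weighted
    simp only [hd, hb p]
  unfold sqNorm
  rw [h1, h2, h3]

end


/-! ### The bilinear estimate in `W^s` -/

section
variable {Z : Geometry} {lam s : ℝ} {f g f' g' : ℝ × ℝ → ℂ}

lemma enorm_prodHat_le (q : ℝ × ℝ) :
    ‖prodHat Z lam f g q‖ₑ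
      ≤ conv (freqMeasure Z lam) (fun p => ‖f p‖ₑ) (fun p => ‖g p‖ₑ) q := by
  have hpi : 1 / (2 * Real.pi) ≤ 1 := by
    rw [div_le_one (by positivity)]; linarith [Real.pi_gt_three]
  unfold prodHat conv
  rw [enorm_mul, ← enorm_norm (((1 / (2 * Real.pi) : ℝ)) : ℂ), Complex.norm_real, enorm_norm,
    Real.enorm_of_nonneg (by positivity)]
  calc _ ≤ 1 * ∫⁻ p, ‖f p * g (q - p)‖ₑ ∂(specMeasure Z lam) := by
        gcongr
        · exact ENNReal.ofReal_le_one.2 hpi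
        · exact enorm_integral_le_lintegral_enorm _
    _ = _ := by simp only [one_mul, enorm_mul]; rfl

lemma prodHatExistsAt_iff (hf : Measurable f) (hg : Measurable g) (q : ℝ × ℝ) :
    ProdHatExistsAt Z lam f g q ↔
      conv (freqMeasure Z lam) (fun p => ‖f p‖ₑ) (fun p => ‖g p‖ₑ) q < ⊤ := by
  have hm : Measurable fun p => f p * g (q - p) := by fun_prop
  unfold ProdHatExistsAt conv
  rw [Integrable, and_iff_right hm.aestronglyMeasurable, hasFiniteIntegral_iff_enorm]
  simp only [enorm_mul]
  rfl

lemma measurable_prodHat (hf : Measurable f) (hg : Measurable g) :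
    Measurable (prodHat Z lam f g) := by
  have hm : Measurable fun z : (ℝ × ℝ) × (ℝ × ℝ) => f z.2 * g (z.1 - z.2) := by fun_prop
  have : SFinite (specMeasure Z lam) := by unfold specMeasure; infer_instance
  exact (hm.stronglyMeasurable.integral_prod_right' (ν := specMeasure Z lam)).measurable.const_mul _

lemma measurable_output (hf : Measurable f) (hg : Measurable g) :
    Measurable (lambdaPow (-1) (omegaSq lam (prodHat Z lam f g))) := by
  have := measurable_prodHat (Z := Z) (lam := lam) hf hg
  unfold lambdaPow omegaSq
  fun_prop

lemma enorm_output_le (q : ℝ × ℝ) :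
    ‖lambdaPow (-1) (omegaSq lam (prodHat Z lam f g)) q‖ₑ
      ≤ ENNReal.ofReal (omegaSym lam q.2 / modulation q) *
        conv (freqMeasure Z lam) (fun p => ‖f p‖ₑ) (fun p => ‖g p‖ₑ) q := by
  have hL : 0 < modulation q := bracket_pos _
  have ho := omegaSym_nonneg lam q.2
  have e : lambdaPow (-1) (omegaSq lam (prodHat Z lam f g)) q
      = ((omegaSym lam q.2 / modulation q : ℝ) : ℂ) * prodHat Z lam f g q := by
    unfold lambdaPow omegaSq omegaSym
    rw [Real.rpow_neg_one]
    push_cast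
    ring
  rw [e, enorm_mul, ← enorm_norm ((omegaSym lam q.2 / modulation q : ℝ) : ℂ), Complex.norm_real,
    enorm_norm, Real.enorm_of_nonneg (by positivity)]
  gcongr
  exact enorm_prodHat_le q

/-- The norm of `W^s` of a product is bounded through its `L²` norm with the weight `outGain`, the `ℓ¹` sum
over dyadic modulations, and the `L²_ξ L¹_τ` norm at modulations at least `⟨ξ⟩ ^ 2`. -/
lemma wNorm_le_of_enorm_le {h : ℝ × ℝ → ℂ} (hh : Measurable h) {φ : ℝ × ℝ → ℝ≥0∞} {A : ℝ≥0∞}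
    (hle : ∀ q, ‖h q‖ₑ ≤ ENNReal.ofReal (omegaSym lam q.2 / modulation q) * φ q)
    (h₁ : lTwo (freqMeasure Z lam) (fun q => ENNReal.ofReal (outGain q) *
      (ENNReal.ofReal (omegaSym lam q.2 * yWeight s q) * φ q)) ≤ A)
    (h₂ : s = -1 / 2 → ∑' j, lTwo (freqMeasure Z lam) ((dyadicRegion j ∩ farRegion).indicator
      fun q => ENNReal.ofReal (bracket q.2 / modulation q) *
        (ENNReal.ofReal (omegaSym lam q.2 * yWeight s q) * φ q)) ≤ A)
    (h₃ : sqNormLOne (freqMeasure Z lam) (farRegion.indicator fun q =>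
      ENNReal.ofReal (omegaSym lam q.2 * bracket q.2 ^ s / modulation q) * φ q) ≤ A ^ 2) :
    wNorm Z lam s h ≤ 4 * A := by
  have hL : ∀ q, 0 < modulation q := fun q => bracket_pos _
  have hn : ∀ q : ℝ × ℝ, 0 < bracket q.2 := fun q => bracket_pos _
  have ho : ∀ q : ℝ × ℝ, 0 ≤ omegaSym lam q.2 := fun q => omegaSym_nonneg _ _
  have hy : ∀ q : ℝ × ℝ, 0 ≤ yWeight s q := fun q => yWeight_nonneg _ _
  have hmul : ∀ (a b : ℝ) q, 0 ≤ a → a * (omegaSym lam q.2 / modulation q)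
      ≤ b * (omegaSym lam q.2 * yWeight s q) → ENNReal.ofReal a * ‖h q‖ₑ ≤ ENNReal.ofReal b *
        (ENNReal.ofReal (omegaSym lam q.2 * yWeight s q) * φ q) := by
    intro a b q ha hab
    calc _ ≤ ENNReal.ofReal a * (ENNReal.ofReal (omegaSym lam q.2 / modulation q) * φ q) := by
          gcongr; exact hle q
      _ = ENNReal.ofReal (a * (omegaSym lam q.2 / modulation q)) * φ q := by
          rw [← mul_assoc, ← ENNReal.ofReal_mul ha]
      _ ≤ ENNReal.ofReal (b * (omegaSym lam q.2 * yWeight s q)) * φ q := by gcongr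
      _ = _ := by
          rw [ENNReal.ofReal_mul' (mul_nonneg (ho q) (hy q)), mul_assoc]
  have hratio : ∀ q : ℝ × ℝ, bracket q.2 ^ (s + 1) * modulation q ^ (0 : ℝ) *
      (omegaSym lam q.2 / modulation q)
      = bracket q.2 / modulation q * (omegaSym lam q.2 * yWeight s q) := by
    intro q
    rw [Real.rpow_zero, Real.rpow_add_one (hn q).ne', yWeight]
    ring
  have hnear : xNorm Z lam s 1 (nearRegion.indicator h) ≤ A := by
    rw [xNorm_indicator_eq hh measurableSet_nearRegion]
    refine le_trans (lTwo_mono fun q => Set.indicator_apply_le' (fun hq => ?_) fun _ => zero_le) h₁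
    have hg : outGain q = 1 := min_eq_left ((one_le_div (hL q)).2 hq)
    have := hL q
    have := hn q
    refine hmul _ _ q (by positivity) (le_of_eq ?_)
    rw [hg, Real.rpow_one, yWeight]
    field_simp
  have haway : ∀ S, MeasurableSet S → S ⊆ awayRegion →
      xNorm Z lam (s + 1) 0 (S.indicator h) ≤ A := by
    intro S hS hSa
    rw [xNorm_indicator_eq hh hS]
    refine le_trans (lTwo_mono fun q => Set.indicator_apply_le' (fun hq => ?_) fun _ => zero_le) h₁
    have hg : outGain q = bracket q.2 / modulation q :=
      min_eq_right ((div_le_one (hL q)).2 (hSa hq))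
    have := hL q
    have := hn q
    refine hmul _ _ q (by positivity) (le_of_eq ?_)
    rw [hg, hratio]
  have hfar : yNorm Z lam s (farRegion.indicator h) ≤ A := by
    rw [yNorm_indicator_eq]
    calc _ ≤ (A ^ 2) ^ (1 / 2 : ℝ) := by
          gcongr
          refine le_trans ?_ h₃
          unfold sqNormLOne
          refine lintegral_mono fun x => pow_le_pow_left₀ zero_le (lintegral_mono fun t => ?_) 2
          refine Set.indicator_le_indicator ?_
          refine (mul_le_mul_right (hle (t, x)) _).trans (le_of_eq ?_)
          rw [← mul_assoc, ← ENNReal.ofReal_mul (Real.rpow_nonneg (hn (t, x)).le s)]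
          congr 2
          ring
      _ = A := ennreal_sq_sqrt A
  have hmid : middleRegion ⊆ awayRegion := fun q hq => hq.1
  unfold wNorm
  split_ifs with hs2
  · have hd : ∀ j, MeasurableSet (dyadicRegion j ∩ farRegion) := fun j =>
      (measurableSet_dyadicRegion j).inter measurableSet_farRegion
    have hdy : ∑' j, xNorm Z lam (s + 1) 0 ((dyadicRegion j ∩ farRegion).indicator h) ≤ A := by
      refine le_trans (ENNReal.tsum_le_tsum fun j => ?_) (h₂ hs2)
      rw [xNorm_indicator_eq hh (hd j)]
      refine lTwo_mono fun q => Set.indicator_le_indicator ?_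
      have := hL q
      have := hn q
      exact hmul _ _ q (by positivity) (hratio q).le
    rw [← hs2, show (1 / 2 : ℝ) = s + 1 by rw [hs2]; norm_num]
    calc _ ≤ A + A + A + A := by
          gcongr
          exact haway _ measurableSet_middleRegion hmid
      _ = 4 * A := by ring
  · calc _ ≤ A + A + A := by
          gcongr
          exact haway _ measurableSet_awayRegion le_rfl
      _ = 3 * A := by ring
      _ ≤ 4 * A := by gcongr; norm_num

lemma exists_wNorm_output_le (hs : -1 / 2 ≤ s) (hs' : s ≤ 0) : ∃ C : ℝ≥0, ∀ (Z : Geometry)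
    (lam : ℝ), 1 ≤ lam → ∀ (ε₁ ε₂ : ℝ) (f g : ℝ × ℝ → ℂ) (B : ℝ≥0∞), (ε₁ = 1 ∨ ε₁ = -1) →
    (ε₂ = 1 ∨ ε₂ = -1) → IsLowBound (freqMeasure Z lam) s lam ε₁ ε₂ B → Measurable f →
    Measurable g →
    wNorm Z lam s (lambdaPow (-1) (omegaSq lam (prodHat Z lam f g)))
      ≤ C * B * (sqNorm (freqMeasure Z lam) s ε₁ (fun q => ‖f q‖ₑ) *
        sqNorm (freqMeasure Z lam) s ε₂ (fun q => ‖g q‖ₑ)) ^ (1 / 2 : ℝ) := by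
  obtain ⟨C₁, hC₁⟩ := exists_outConv_le hs hs'
  obtain ⟨C₂, hC₂⟩ := exists_far_le hs hs'
  refine ⟨4 * (C₁ + C₂ + 1), fun Z lam hl ε₁ ε₂ f g B hε₁ hε₂ hB hf hg => ?_⟩
  set μ := freqMeasure Z lam with hμdef
  have hμ : IsFreqMeasure μ := isFreqMeasure Z hl
  set X := sqNorm μ s ε₁ (fun q => ‖f q‖ₑ) * sqNorm μ s ε₂ (fun q => ‖g q‖ₑ) with hX
  have hF : Measurable fun q => ‖f q‖ₑ := by fun_prop
  have hG : Measurable fun q => ‖g q‖ₑ := by fun_prop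
  obtain ⟨a1, a2⟩ := hC₁ μ hμ ε₁ ε₂ lam _ _ B hε₁ hε₂ hB hF hG
  obtain ⟨hB1, d, hd, hBd, -⟩ := hB
  have a3 := hC₂ μ hμ ε₁ ε₂ lam d _ _ B hε₁ hε₂ hd hF hG hB1 hBd
  have hCC : (C₁ : ℝ≥0∞) * B * X ^ (1 / 2 : ℝ) ≤ (C₁ + C₂ + 1 : ℝ≥0) * B * X ^ (1 / 2 : ℝ) := by
    gcongr
    exact_mod_cast (le_self_add (a := C₁) (b := C₂)).trans le_self_add
  refine (wNorm_le_of_enorm_le (A := (C₁ + C₂ + 1 : ℝ≥0) * B * X ^ (1 / 2 : ℝ))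
    (measurable_output hf hg) enorm_output_le (a1.trans hCC) (fun h => (a2 h).trans hCC)
    (a3.trans ?_)).trans (le_of_eq ?_)
  · rw [mul_pow, mul_pow, ennreal_sqrt_sq]
    gcongr
    have : C₂ ≤ (C₁ + C₂ + 1) ^ 2 :=
      (show C₂ ≤ C₁ + C₂ + 1 from le_add_right le_add_self).trans
        (le_self_pow₀ le_add_self two_ne_zero)
    exact_mod_cast this
  · push_cast; ring

/-- The convolution of the absolute values has a finite norm with a weight that is positive for `ξ ≠ 0`,
so it is finite at almost every such frequency. -/
lemma exists_ae_prodHatExistsAt (hs : -1 / 2 ≤ s) (hs' : s ≤ 0) (hl : 1 ≤ lam) {ε₁ ε₂ : ℝ}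
    {B : ℝ≥0∞} (hε₁ : ε₁ = 1 ∨ ε₁ = -1) (hε₂ : ε₂ = 1 ∨ ε₂ = -1)
    (hB : IsLowBound (freqMeasure Z lam) s lam ε₁ ε₂ B) (hB' : B ≠ ⊤) (hf : Measurable f)
    (hg : Measurable g) (hF : sqNorm (freqMeasure Z lam) s ε₁ (fun q => ‖f q‖ₑ) ≠ ⊤)
    (hG : sqNorm (freqMeasure Z lam) s ε₂ (fun q => ‖g q‖ₑ) ≠ ⊤) :
    ∀ᵐ q ∂(specMeasure Z lam), q.2 ≠ 0 → ProdHatExistsAt Z lam f g q := by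
  obtain ⟨C₁, hC₁⟩ := exists_outConv_le hs hs'
  have hFm : Measurable fun q => ‖f q‖ₑ := by fun_prop
  have hGm : Measurable fun q => ‖g q‖ₑ := by fun_prop
  obtain ⟨a1, -⟩ := hC₁ (freqMeasure Z lam) (isFreqMeasure Z hl) ε₁ ε₂ lam _ _ B hε₁ hε₂ hB hFm hGm
  have hcm := measurable_conv (μ := freqMeasure Z lam) hFm hGm
  have htop : ∫⁻ q, (ENNReal.ofReal (outGain q) * outConv (freqMeasure Z lam) s lam
      (fun q => ‖f q‖ₑ) (fun q => ‖g q‖ₑ) q) ^ 2 ∂(stMeasure (freqMeasure Z lam)) ≠ ⊤ := by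
    rw [← lTwo_sq]
    refine ENNReal.pow_ne_top (ne_top_of_le_ne_top ?_ a1)
    exact ENNReal.mul_ne_top (ENNReal.mul_ne_top ENNReal.coe_ne_top hB')
      (ENNReal.rpow_ne_top_of_nonneg (by norm_num) (ENNReal.mul_ne_top hF hG))
  have hm : Measurable fun q => (ENNReal.ofReal (outGain q) * outConv (freqMeasure Z lam) s lam
      (fun q => ‖f q‖ₑ) (fun q => ‖g q‖ₑ) q) ^ 2 := by
    unfold outConv; fun_prop
  rw [specMeasure_eq]
  filter_upwards [ae_lt_top hm htop] with q hq hq0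
  rw [prodHatExistsAt_iff hf hg]
  by_contra hc
  rw [not_lt, top_le_iff] at hc
  have ho : 0 < omegaSym lam q.2 := by
    have : 0 < q.2 ^ 2 := by positivity
    have : 0 < lam := by linarith
    unfold omegaSym; positivity
  have hy : 0 < yWeight s q := Real.rpow_pos_of_pos (bracket_pos _) _
  unfold outConv at hq
  rw [hc, ENNReal.mul_top (by simpa using mul_pos ho hy),
    ENNReal.mul_top (by simpa using outGain_pos q)] at hq
  simp at hq

/-- Almost every convolution integral is unchanged when the factors change on null sets. -/
lemma ae_prod_eq (hl : 1 ≤ lam) (hf : f =ᵐ[specMeasure Z lam] f')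
    (hg : g =ᵐ[specMeasure Z lam] g') : ∀ᵐ q ∂(specMeasure Z lam),
      (fun p => f p * g (q - p)) =ᵐ[specMeasure Z lam] fun p => f' p * g' (q - p) := by
  rw [specMeasure_eq] at *
  filter_upwards [(isFreqMeasure Z hl).ae_reflect] with q hq
  filter_upwards [hf, hq.quasiMeasurePreserving.ae hg] with p h1 h2
  rw [h1, h2]

lemma conjHat_congr_ae (hl : 1 ≤ lam) (hf : f =ᵐ[specMeasure Z lam] f') :
    conjHat f =ᵐ[specMeasure Z lam] conjHat f' := by
  have hneg : MeasurePreserving (fun p : ℝ × ℝ => -p) (specMeasure Z lam) (specMeasure Z lam) :=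
    (Measure.measurePreserving_neg (volume : Measure ℝ)).prod (isFreqMeasure Z hl).neg
  filter_upwards [hneg.quasiMeasurePreserving.ae hf] with p hp
  rw [conjHat, conjHat, hp]

lemma prodHat_congr_ae (hl : 1 ≤ lam) (hf : f =ᵐ[specMeasure Z lam] f')
    (hg : g =ᵐ[specMeasure Z lam] g') :
    prodHat Z lam f g =ᵐ[specMeasure Z lam] prodHat Z lam f' g' := by
  filter_upwards [ae_prod_eq hl hf hg] with q hq
  rw [prodHat, prodHat, integral_congr_ae hq]

lemma output_congr_ae {h h' : ℝ × ℝ → ℂ} (H : h =ᵐ[specMeasure Z lam] h') :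
    lambdaPow (-1) (omegaSq lam h) =ᵐ[specMeasure Z lam] lambdaPow (-1) (omegaSq lam h') := by
  filter_upwards [H] with q hq
  simp only [lambdaPow, omegaSq, hq]

lemma measurable_conjHat (hf : Measurable f) : Measurable (conjHat f) := by
  have : Measurable fun q => f (-q) := by fun_prop
  exact Complex.continuous_conj.measurable.comp this

lemma enorm_conjHat (f : ℝ × ℝ → ℂ) : (fun q => ‖conjHat f q‖ₑ) = fun q => ‖f (-q)‖ₑ := by
  funext q
  rw [conjHat, ← enorm_norm, RCLike.norm_conj, enorm_norm]

/-- The transform of a factor or of its complex conjugate, with the sign `ε` of the parabola near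
which it is large. -/
def IsFactor (ε : ℝ) (f F : ℝ × ℝ → ℂ) : Prop := (ε = 1 ∧ F = f) ∨ (ε = -1 ∧ F = conjHat f)

lemma IsFactor.sign {ε : ℝ} {F : ℝ × ℝ → ℂ} (h : IsFactor ε f F) : ε = 1 ∨ ε = -1 := by
  rcases h with ⟨h, -⟩ | ⟨h, -⟩
  · exact Or.inl h
  · exact Or.inr h

/-- The bilinear estimate for all combinations of conjugates. The bound of the norm does not suppose
that the norms of the factors are finite. -/
lemma exists_product_le (hs : -1 / 2 ≤ s) (hs' : s ≤ 0) : ∃ C : ℝ≥0, ∀ (Z : Geometry)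
    (lam : ℝ), 1 ≤ lam → ∀ (ε₁ ε₂ : ℝ) (f g F G : ℝ × ℝ → ℂ) (B : ℝ≥0∞), IsFactor ε₁ f F →
    IsFactor ε₂ g G → IsLowBound (freqMeasure Z lam) s lam ε₁ ε₂ B → B ≠ ⊤ →
    AEStronglyMeasurable f (specMeasure Z lam) → AEStronglyMeasurable g (specMeasure Z lam) →
    wNorm Z lam s (lambdaPow (-1) (omegaSq lam (prodHat Z lam F G)))
        ≤ C * B * wNorm Z lam s f * wNorm Z lam s g ∧
      (wNorm Z lam s f < ⊤ → wNorm Z lam s g < ⊤ →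
        ProductBound Z lam s F G (C * B * wNorm Z lam s f * wNorm Z lam s g)) := by
  obtain ⟨C₁, hC₁⟩ := exists_wNorm_output_le hs hs'
  obtain ⟨C₂, hC₂⟩ := exists_sqNorm_le_wNorm
  refine ⟨C₁ * C₂ ^ 2, fun Z lam hl ε₁ ε₂ f g F G B hF hG hB hBtop hfm hgm => ?_⟩
  have hμ : IsFreqMeasure (freqMeasure Z lam) := isFreqMeasure Z hl
  have key : ∀ {ε : ℝ} {f F : ℝ × ℝ → ℂ}, IsFactor ε f F →
      AEStronglyMeasurable f (specMeasure Z lam) → ∃ F', Measurable F' ∧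
        F =ᵐ[specMeasure Z lam] F' ∧ sqNorm (freqMeasure Z lam) s ε (fun q => ‖F' q‖ₑ)
          ≤ (C₂ * wNorm Z lam s f) ^ 2 := by
    intro ε f F hF hfm
    have hm : Measurable (hfm.mk f) := hfm.stronglyMeasurable_mk.measurable
    rw [wNorm_congr_ae hfm.ae_eq_mk]
    rcases hF with ⟨rfl, rfl⟩ | ⟨rfl, rfl⟩
    · exact ⟨_, hm, hfm.ae_eq_mk, hC₂ Z lam s _ hm⟩
    · refine ⟨conjHat (hfm.mk f), measurable_conjHat hm, conjHat_congr_ae hl hfm.ae_eq_mk, ?_⟩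
      rw [enorm_conjHat, sqNorm_neg hμ (F := fun q => ‖hfm.mk f q‖ₑ) (by fun_prop)]
      exact hC₂ Z lam s _ hm
  obtain ⟨F', hF'm, hFF', hF'⟩ := key hF hfm
  obtain ⟨G', hG'm, hGG', hG'⟩ := key hG hgm
  have hout := output_congr_ae (prodHat_congr_ae hl hFF' hGG')
  have hbound : wNorm Z lam s (lambdaPow (-1) (omegaSq lam (prodHat Z lam F G)))
        ≤ (C₁ * C₂ ^ 2 : ℝ≥0) * B * wNorm Z lam s f * wNorm Z lam s g := by
    rw [wNorm_congr_ae hout]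
    refine (hC₁ Z lam hl ε₁ ε₂ F' G' B hF.sign hG.sign hB hF'm hG'm).trans ?_
    calc _ ≤ C₁ * B * ((C₂ * wNorm Z lam s f) ^ 2 * (C₂ * wNorm Z lam s g) ^ 2) ^ (1 / 2 : ℝ) := by
          gcongr
      _ = _ := by rw [← mul_pow, ennreal_sq_sqrt]; push_cast; ring
  refine ⟨hbound, fun hf hg => ⟨?_, ⟨?_, lt_of_le_of_lt hbound ?_⟩, hbound⟩⟩
  · have htop : ∀ {a : ℝ≥0∞}, a < ⊤ → (C₂ * a) ^ 2 ≠ ⊤ := fun ha =>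
      ENNReal.pow_ne_top (ENNReal.mul_ne_top ENNReal.coe_ne_top ha.ne)
    filter_upwards [exists_ae_prodHatExistsAt hs hs' hl hF.sign hG.sign hB hBtop hF'm hG'm
      (ne_top_of_le_ne_top (htop hf) hF') (ne_top_of_le_ne_top (htop hg) hG'),
      ae_prod_eq hl hFF' hGG'] with q h1 h2 hq
    exact (h1 hq).congr h2.symm
  · exact (measurable_output hF'm hG'm).aestronglyMeasurable.congr hout.symm
  · exact ENNReal.mul_lt_top (ENNReal.mul_lt_top (ENNReal.mul_lt_top ENNReal.coe_lt_top
      hBtop.lt_top) hf) hg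

end


/-! ### Products of functions with an integrable Fourier transform -/

section
variable {Z : Geometry} {lam : ℝ} {u v : ℝ × ℝ → ℂ}

/-- The character `exp (i a)`. -/
noncomputable def chi (a : ℝ) : ℂ := Complex.exp (Complex.I * (a : ℂ))

@[fun_prop] lemma continuous_chi : Continuous chi := by unfold chi; fun_prop

@[fun_prop] lemma Measurable.chi {α : Type*} [MeasurableSpace α] {f : α → ℝ} (hf : Measurable f) :
    Measurable fun a => chi (f a) := continuous_chi.measurable.comp hf

lemma norm_chi (a : ℝ) : ‖chi a‖ = 1 := by
  rw [chi, mul_comm]; exact Complex.norm_exp_ofReal_mul_I a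

lemma chi_add (a b : ℝ) : chi (a + b) = chi a * chi b := by
  unfold chi; push_cast; rw [mul_add, Complex.exp_add]

lemma conj_chi (a : ℝ) : conj (chi a) = chi (-a) := by
  unfold chi
  rw [← Complex.exp_conj, map_mul, Complex.conj_I, Complex.conj_ofReal]
  push_cast; congr 1; ring

lemma hasDerivAt_chi_mul (c t : ℝ) :
    HasDerivAt (fun t : ℝ => chi (-(t * c))) (-(Complex.I * c) * chi (-(t * c))) t := by
  unfold chi
  have h : HasDerivAt (fun t : ℝ => Complex.I * (((-(t * c)) : ℝ) : ℂ)) (-(Complex.I * c)) t := by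
    have h1 : HasDerivAt (fun t : ℝ => -(t * c)) (-c) t := by
      simpa using ((hasDerivAt_id t).mul_const c).fun_neg
    simpa using h1.ofReal_comp.const_mul Complex.I
  simpa [mul_comm] using h.cexp

/-- Lebesgue measure on physical space-time. -/
noncomputable def physMeasure (Z : Geometry) (lam : ℝ) : Measure (ℝ × ℝ) :=
  (volume : Measure ℝ).prod (spaceMeasure Z lam)

instance (Z : Geometry) (lam : ℝ) : SFinite (spaceMeasure Z lam) := by
  cases Z <;> unfold spaceMeasure <;> infer_instance

instance (Z : Geometry) (lam : ℝ) : SFinite (physMeasure Z lam) := by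
  unfold physMeasure; infer_instance

instance (Z : Geometry) (lam : ℝ) : SFinite (specMeasure Z lam) := by
  unfold specMeasure; infer_instance

lemma stFourier_eq (q : ℝ × ℝ) : stFourier Z lam u q = ((1 / (2 * Real.pi) : ℝ) : ℂ) *
    ∫ p, chi (-(p.1 * q.1 + p.2 * q.2)) * u p ∂(physMeasure Z lam) := by
  unfold stFourier chi physMeasure
  congr 2
  funext p
  congr 2
  push_cast; ring

/-- The function `u` is integrable, its Fourier transform is integrable, and the inversion formula
holds. -/
structure IsInvertible (Z : Geometry) (lam : ℝ) (u : ℝ × ℝ → ℂ) : Prop where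
  integrable : Integrable u (physMeasure Z lam)
  integrable_stFourier : Integrable (stFourier Z lam u) (specMeasure Z lam)
  inversion : ∀ p, u p = ((1 / (2 * Real.pi) : ℝ) : ℂ) *
    ∫ q, chi (p.1 * q.1 + p.2 * q.2) * stFourier Z lam u q ∂(specMeasure Z lam)

lemma stFourier_conj : stFourier Z lam (fun p => conj (u p)) = conjHat (stFourier Z lam u) := by
  funext q
  rw [conjHat, stFourier_eq, stFourier_eq, map_mul, Complex.conj_ofReal, ← integral_conj]
  congr 2
  funext p
  rw [map_mul, conj_chi]
  congr 2
  simp only [Prod.fst_neg, Prod.snd_neg]; ring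

lemma measurePreserving_neg_specMeasure (Z : Geometry) (hl : 1 ≤ lam) :
    MeasurePreserving (fun p : ℝ × ℝ => -p) (specMeasure Z lam) (specMeasure Z lam) :=
  (Measure.measurePreserving_neg (volume : Measure ℝ)).prod (isFreqMeasure Z hl).neg

lemma measurableEmbedding_neg : MeasurableEmbedding fun p : ℝ × ℝ => -p :=
  (MeasurableEquiv.neg (ℝ × ℝ)).measurableEmbedding

lemma IsInvertible.conj (hl : 1 ≤ lam) (hu : IsInvertible Z lam u) :
    IsInvertible Z lam fun p => conj (u p) where
  integrable := (LinearIsometryEquiv.integrable_comp_iff Complex.conjLIE).2 hu.integrable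
  integrable_stFourier := by
    rw [stFourier_conj]
    have h : Integrable (fun q => stFourier Z lam u (-q)) (specMeasure Z lam) :=
      (measurePreserving_neg_specMeasure Z hl).integrable_comp_emb measurableEmbedding_neg |>.2
        hu.integrable_stFourier
    exact (LinearIsometryEquiv.integrable_comp_iff Complex.conjLIE).2 h
  inversion p := by
    rw [stFourier_conj, hu.inversion p, map_mul, Complex.conj_ofReal, ← integral_conj,
      ← (measurePreserving_neg_specMeasure Z hl).integral_comp measurableEmbedding_neg]
    congr 2
    funext q
    rw [map_mul, conj_chi]
    simp only [conjHat, Prod.fst_neg, Prod.snd_neg]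
    congr 2
    ring

/-- The Fourier transform of a product is the convolution of the Fourier transforms: insert the
inversion formula for one factor. -/
lemma IsInvertible.stFourier_mul (hu : IsInvertible Z lam u)
    (hv : Integrable v (physMeasure Z lam)) :
    stFourier Z lam (fun p => u p * v p) = prodHat Z lam (stFourier Z lam u) (stFourier Z lam v) := by
  funext q
  set c : ℂ := ((1 / (2 * Real.pi) : ℝ) : ℂ) with hc
  set U := stFourier Z lam u with hU
  have hint : Integrable (Function.uncurry fun p q' : ℝ × ℝ =>
      chi (-(p.1 * q.1 + p.2 * q.2)) * (chi (p.1 * q'.1 + p.2 * q'.2) * U q' * v p))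
      ((physMeasure Z lam).prod (specMeasure Z lam)) := by
    have h := hv.mul_prod hu.integrable_stFourier
    refine (h.bdd_mul (c := 1) (f := fun z : (ℝ × ℝ) × (ℝ × ℝ) =>
      chi (-(z.1.1 * q.1 + z.1.2 * q.2)) * chi (z.1.1 * z.2.1 + z.1.2 * z.2.2)) ?_ ?_).congr ?_
    · exact Measurable.aestronglyMeasurable (by fun_prop)
    · refine Filter.Eventually.of_forall fun z => ?_
      rw [norm_mul, norm_chi, norm_chi, one_mul]
    · refine Filter.Eventually.of_forall fun z => ?_
      simp only [Function.uncurry]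
      ring
  calc stFourier Z lam (fun p => u p * v p) q
      = c * ∫ p, (c * ∫ q', chi (-(p.1 * q.1 + p.2 * q.2)) *
          (chi (p.1 * q'.1 + p.2 * q'.2) * U q' * v p) ∂(specMeasure Z lam)) ∂(physMeasure Z lam) := by
        rw [stFourier_eq]
        congr 2
        funext p
        rw [integral_const_mul, integral_mul_const, hu.inversion p]
        ring
    _ = c * (c * ∫ q', ∫ p, chi (-(p.1 * q.1 + p.2 * q.2)) *
          (chi (p.1 * q'.1 + p.2 * q'.2) * U q' * v p) ∂(physMeasure Z lam) ∂(specMeasure Z lam)) := by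
        rw [integral_const_mul, integral_integral_swap hint]
    _ = c * ∫ q', U q' * stFourier Z lam v (q - q') ∂(specMeasure Z lam) := by
        rw [← integral_const_mul]
        congr 2
        funext q'
        rw [stFourier_eq, mul_left_comm]
        congr 1
        rw [← integral_const_mul]
        congr 1
        funext p
        have e : -(p.1 * (q - q').1 + p.2 * (q - q').2)
            = -(p.1 * q.1 + p.2 * q.2) + (p.1 * q'.1 + p.2 * q'.2) := by
          simp only [Prod.fst_sub, Prod.snd_sub]; ring
        rw [e, chi_add (-(p.1 * q.1 + p.2 * q.2))]
        ring

/-! ### Fourier inversion in one variable -/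

/-- Fourier inversion on the line, in the normalization of `stFourier`. -/
lemma line_inversion {g : ℝ → ℂ} (hc : Continuous g) (hi : Integrable g)
    (hi' : Integrable fun τ => ∫ t, chi (-(t * τ)) * g t) (t : ℝ) :
    g t = ((1 / (2 * Real.pi) : ℝ) : ℂ) * ∫ τ, chi (t * τ) * ∫ r, chi (-(r * τ)) * g r := by
  set G : ℝ → ℂ := fun τ => ∫ t, chi (-(t * τ)) * g t with hG
  have hpi : (2 * Real.pi) ≠ 0 := by positivity
  have hF : FourierTransform.fourier g = fun w => G (2 * Real.pi * w) := by
    funext w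
    rw [Real.fourier_real_eq_integral_exp_smul]
    refine integral_congr_ae (Filter.Eventually.of_forall fun r => ?_)
    simp only [chi, smul_eq_mul]
    congr 2
    push_cast; ring
  have hFi : Integrable (FourierTransform.fourier g) := by
    rw [hF]; exact hi'.comp_mul_left' hpi
  have hinv := congrFun (hc.fourierInv_fourier_eq hi hFi) t
  rw [← hinv, Real.fourierInv_eq', hF]
  have e : ∀ w : ℝ, Complex.exp (((2 * Real.pi * inner ℝ w t : ℝ) : ℂ) * Complex.I) •
      (fun w => G (2 * Real.pi * w)) w
      = (fun τ => chi (t * τ) * G τ) (2 * Real.pi * w) := by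
    intro w
    simp only [chi, smul_eq_mul]
    congr 2
    have : inner ℝ w t = w * t := by simp [mul_comm]
    rw [this]
    push_cast; ring
  refine (integral_congr_ae (Filter.Eventually.of_forall e)).trans ?_
  refine (Measure.integral_comp_mul_left (fun τ => chi (t * τ) * G τ) (2 * Real.pi)).trans ?_
  rw [abs_of_pos (by positivity), Complex.real_smul, one_div]

/-- A continuous periodic function with an absolutely convergent Fourier series is the sum of the series,
here written as an integral over the frequencies `n / lam`. -/
lemma torus_inversion (hl : 0 < lam) {g : ℝ → ℂ} (hc : Continuous g)
    (hp : ∀ x, g (x + 2 * Real.pi * lam) = g x)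
    (hi : Integrable (fun ξ => ∫ y, chi (-(y * ξ)) * g y ∂(spaceMeasure .torus lam))
      (freqMeasure .torus lam)) (x : ℝ) :
    g x = ((1 / (2 * Real.pi) : ℝ) : ℂ) * ∫ ξ, chi (x * ξ) *
      ∫ y, chi (-(y * ξ)) * g y ∂(spaceMeasure .torus lam) ∂(freqMeasure .torus lam) := by
  set G : ℝ → ℂ := fun ξ => ∫ y, chi (-(y * ξ)) * g y ∂(spaceMeasure .torus lam) with hG
  set T : ℝ := 2 * Real.pi * lam with hT
  have hT0 : 0 < T := by positivity
  have : Fact (0 < T) := ⟨hT0⟩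
  have hper : Function.Periodic g T := hp
  let f : C(AddCircle T, ℂ) := ⟨hper.lift, continuous_coinduced_dom.mpr hc⟩
  have hf : ∀ y : ℝ, f (y : AddCircle T) = g y := fun y => rfl
  have hcoeff : ∀ n : ℤ, fourierCoeff f n = ((1 / T : ℝ) : ℂ) * G (n / lam) := by
    intro n
    rw [fourierCoeff_eq_intervalIntegral f n 0, zero_add, Complex.real_smul,
      intervalIntegral.integral_of_le hT0.le]
    congr 1
    refine integral_congr_ae (Filter.Eventually.of_forall fun y => ?_)
    simp only [hf, smul_eq_mul, fourier_coe_apply, chi]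
    congr 2
    have hpi : (Real.pi : ℂ) ≠ 0 := by exact_mod_cast Real.pi_ne_zero
    have hlc : (lam : ℂ) ≠ 0 := by exact_mod_cast hl.ne'
    rw [hT]; push_cast
    field_simp
  have hsum : Summable fun n : ℤ => G (n / lam) := by
    rw [freqMeasure_torus_eq_map, (measurableEmbedding_lattice hl.ne').integrable_map_iff,
      integrable_smul_measure (by simpa using hl) ENNReal.ofReal_ne_top, integrable_count_iff] at hi
    exact hi.of_norm
  have hfs : Summable (fourierCoeff f) := by
    rw [show fourierCoeff f = fun n : ℤ => ((1 / T : ℝ) : ℂ) * G (n / lam) from funext hcoeff]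
    exact hsum.mul_left _
  have hsf := (has_pointwise_sum_fourier_series_of_summable hfs (x : AddCircle T)).tsum_eq
  have hi2 : Integrable (fun ξ => chi (x * ξ) * G ξ) (freqMeasure .torus lam) :=
    hi.bdd_mul (c := 1) (Measurable.aestronglyMeasurable (by fun_prop))
      (Filter.Eventually.of_forall fun ξ => (norm_chi _).le)
  rw [← hf x, ← hsf, freqMeasure, integral_sum_measure hi2, ← tsum_mul_left]
  refine tsum_congr fun n => ?_
  rw [integral_smul_measure, integral_dirac, hcoeff, fourier_coe_apply,
    ENNReal.toReal_ofReal (by positivity), Complex.real_smul, smul_eq_mul, chi]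
  have hpi : (Real.pi : ℂ) ≠ 0 := by exact_mod_cast Real.pi_ne_zero
  have hlc : (lam : ℂ) ≠ 0 := by exact_mod_cast hl.ne'
  have e : 2 * (Real.pi : ℂ) * Complex.I * n * x / T = Complex.I * ((x * (n / lam) : ℝ) : ℂ) := by
    rw [hT]; push_cast
    field_simp
  rw [e, hT]
  push_cast
  field_simp

end


/-! ### Schwartz functions have an integrable Fourier transform -/

section
variable {Z : Geometry} {lam : ℝ} {u : ℝ × ℝ → ℂ}

/-- The weight that makes a function integrable in space. -/
def spaceDecay : Geometry → ℝ → ℝ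
  | .line, x => 1 + x ^ 2
  | .torus, _ => 1

lemma one_le_spaceDecay (Z : Geometry) (x : ℝ) : 1 ≤ spaceDecay Z x := by
  cases Z <;> simp [spaceDecay, sq_nonneg]

lemma integrable_inv_spaceDecay (Z : Geometry) (lam : ℝ) :
    Integrable (fun x => (spaceDecay Z x)⁻¹) (spaceMeasure Z lam) := by
  cases Z with
  | line => exact integrable_inv_one_add_sq
  | torus =>
      have : IsFiniteMeasure (spaceMeasure .torus lam) := by unfold spaceMeasure; infer_instance
      simp only [spaceDecay]
      exact integrable_const _

/-- Smooth functions, periodic in the case of the torus, all of whose derivatives decrease at an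
integrable rate. Unlike `IsSchwartz`, this description is the same for both geometries. -/
structure HasSmoothDecay (Z : Geometry) (lam : ℝ) (u : ℝ × ℝ → ℂ) : Prop where
  contDiff : ContDiff ℝ ∞ u
  periodic : Z = .torus → ∀ t x, u (t, x + 2 * Real.pi * lam) = u (t, x)
  decay : ∀ n : ℕ, ∃ C, ∀ t x,
    (1 + t ^ 2) * spaceDecay Z x * ‖iteratedFDeriv ℝ n u (t, x)‖ ≤ C

lemma IsSchwartz.hasSmoothDecay (h : IsSchwartz Z lam u) : HasSmoothDecay Z lam u := by
  cases Z with
  | line =>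
      obtain ⟨φ, rfl⟩ := h
      refine ⟨φ.smooth', fun h => (by simp at h), fun n => ?_⟩
      obtain ⟨C₀, h₀⟩ := φ.decay' 0 n
      obtain ⟨C₂, h₂⟩ := φ.decay' 2 n
      obtain ⟨C₄, h₄⟩ := φ.decay' 4 n
      refine ⟨C₀ + 2 * C₂ + C₄, fun t x => ?_⟩
      have i0 := h₀ (t, x)
      have i2 := h₂ (t, x)
      have i4 := h₄ (t, x)
      have ht : t ^ 2 ≤ ‖((t, x) : ℝ × ℝ)‖ ^ 2 := by
        rw [← sq_abs t]; gcongr; exact norm_fst_le ((t, x) : ℝ × ℝ)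
      have hx : x ^ 2 ≤ ‖((t, x) : ℝ × ℝ)‖ ^ 2 := by
        rw [← sq_abs x]; gcongr; exact norm_snd_le ((t, x) : ℝ × ℝ)
      set r := ‖((t, x) : ℝ × ℝ)‖
      change (1 + t ^ 2) * (1 + x ^ 2) * ‖iteratedFDeriv ℝ n φ.toFun (t, x)‖ ≤ _
      set A := ‖iteratedFDeriv ℝ n φ.toFun (t, x)‖
      calc (1 + t ^ 2) * (1 + x ^ 2) * A ≤ (1 + r ^ 2) * (1 + r ^ 2) * A := by gcongr
        _ = r ^ 0 * A + 2 * (r ^ 2 * A) + r ^ 4 * A := by ring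
        _ ≤ _ := by linarith
  | torus =>
      obtain ⟨h1, h2, h3⟩ := h
      refine ⟨h1, fun _ => h2, fun n => ?_⟩
      obtain ⟨C₀, h₀⟩ := h3 0 n
      obtain ⟨C₂, h₂⟩ := h3 2 n
      refine ⟨C₀ + C₂, fun t x => ?_⟩
      have i0 := h₀ t x
      have i2 := h₂ t x
      rw [sq_abs] at i2
      rw [pow_zero, one_mul] at i0
      rw [spaceDecay, mul_one, add_mul, one_mul]
      linarith

namespace HasSmoothDecay

lemma fderiv (h : HasSmoothDecay Z lam u) (v : ℝ × ℝ) :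
    HasSmoothDecay Z lam fun p => fderiv ℝ u p v where
  contDiff := (h.contDiff.fderiv_right (m := ∞) (by simp)).clm_apply contDiff_const
  periodic hZ t x := by
    have e : (fun p : ℝ × ℝ => u (p + (0, 2 * Real.pi * lam))) = u := by
      funext p
      have := h.periodic hZ p.1 p.2
      rw [← this]
      congr 1
      ext <;> simp
    have e2 := fderiv_comp_add_right (𝕜 := ℝ) (f := u) (x := (t, x)) (0, 2 * Real.pi * lam)
    rw [e] at e2
    rw [e2]
    simp
  decay n := by
    obtain ⟨C, hC⟩ := h.decay (n + 1)
    refine ⟨‖ContinuousLinearMap.apply ℝ ℂ v‖ * C, fun t x => ?_⟩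
    have h1 : ‖iteratedFDeriv ℝ n (fun p => _root_.fderiv ℝ u p v) (t, x)‖
        ≤ ‖ContinuousLinearMap.apply ℝ ℂ v‖ * ‖iteratedFDeriv ℝ (n + 1) u (t, x)‖ := by
      rw [← norm_iteratedFDeriv_fderiv]
      exact (ContinuousLinearMap.apply ℝ ℂ v).norm_iteratedFDeriv_comp_left
        (f := _root_.fderiv ℝ u) (N := ∞)
        (h.contDiff.fderiv_right (m := ∞) (by simp)).contDiffAt (by exact_mod_cast le_top)
    have h2 := one_le_spaceDecay Z x
    calc _ ≤ (1 + t ^ 2) * spaceDecay Z x *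
          (‖ContinuousLinearMap.apply ℝ ℂ v‖ * ‖iteratedFDeriv ℝ (n + 1) u (t, x)‖) := by gcongr
      _ = ‖ContinuousLinearMap.apply ℝ ℂ v‖ *
          ((1 + t ^ 2) * spaceDecay Z x * ‖iteratedFDeriv ℝ (n + 1) u (t, x)‖) := by ring
      _ ≤ _ := by gcongr; exact hC t x

lemma exists_norm_le (h : HasSmoothDecay Z lam u) : ∃ C, 0 ≤ C ∧ ∀ t x,
    ‖u (t, x)‖ ≤ C * ((1 + t ^ 2)⁻¹ * (spaceDecay Z x)⁻¹) := by
  obtain ⟨C, hC⟩ := h.decay 0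
  refine ⟨C, ?_, fun t x => ?_⟩
  · refine le_trans ?_ (hC 0 0)
    have := one_le_spaceDecay Z 0
    positivity
  · have h1 := hC t x
    rw [norm_iteratedFDeriv_zero] at h1
    have h2 := one_le_spaceDecay Z x
    rw [← mul_inv, ← div_eq_mul_inv, le_div_iff₀ (by positivity)]
    linarith

lemma integrable (h : HasSmoothDecay Z lam u) : Integrable u (physMeasure Z lam) := by
  obtain ⟨C, -, hC⟩ := h.exists_norm_le
  have hi := (integrable_inv_one_add_sq.mul_prod (integrable_inv_spaceDecay Z lam)).const_mul C
  exact hi.mono' h.contDiff.continuous.aestronglyMeasurable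
    (Filter.Eventually.of_forall fun p => hC p.1 p.2)

lemma integrable_time (h : HasSmoothDecay Z lam u) (x : ℝ) : Integrable fun t => u (t, x) := by
  obtain ⟨C, hC0, hC⟩ := h.exists_norm_le
  have hc := h.contDiff.continuous
  refine (integrable_inv_one_add_sq.const_mul C).mono' (by fun_prop)
    (Filter.Eventually.of_forall fun t => (hC t x).trans ?_)
  gcongr
  exact mul_le_of_le_one_right (by positivity) (inv_le_one_of_one_le₀ (one_le_spaceDecay Z x))

lemma integrable_space (h : HasSmoothDecay Z lam u) (t : ℝ) :
    Integrable (fun x => u (t, x)) (spaceMeasure Z lam) := by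
  obtain ⟨C, hC0, hC⟩ := h.exists_norm_le
  have hc := h.contDiff.continuous
  refine ((integrable_inv_spaceDecay Z lam).const_mul C).mono' (by fun_prop)
    (Filter.Eventually.of_forall fun x => (hC t x).trans ?_)
  have := one_le_spaceDecay Z x
  gcongr
  exact mul_le_of_le_one_left (by positivity) (inv_le_one_of_one_le₀ (by nlinarith))

lemma hasDerivAt_time (h : HasSmoothDecay Z lam u) (t x : ℝ) :
    HasDerivAt (fun t => u (t, x)) (_root_.fderiv ℝ u (t, x) (1, 0)) t :=
  ((h.contDiff.differentiable (by simp)) (t, x)).hasFDerivAt.comp_hasDerivAt t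
    ((hasDerivAt_id t).prodMk (hasDerivAt_const t x))

lemma hasDerivAt_space (h : HasSmoothDecay Z lam u) (t x : ℝ) :
    HasDerivAt (fun x => u (t, x)) (_root_.fderiv ℝ u (t, x) (0, 1)) x :=
  ((h.contDiff.differentiable (by simp)) (t, x)).hasFDerivAt.comp_hasDerivAt x
    ((hasDerivAt_const x t).prodMk (hasDerivAt_id x))

end HasSmoothDecay

lemma integrable_chi_mul {α : Type*} [MeasurableSpace α] {ν : Measure α} {g : α → ℂ} {θ : α → ℝ}
    (hθ : Measurable θ) (hg : Integrable g ν) : Integrable (fun a => chi (θ a) * g a) ν :=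
  hg.bdd_mul (c := 1) (Measurable.aestronglyMeasurable (by fun_prop))
    (Filter.Eventually.of_forall fun a => (norm_chi _).le)

lemma line_integral_chi_mul_deriv {g g' : ℝ → ℂ} (hg : ∀ t, HasDerivAt g (g' t) t)
    (hi : Integrable g) (hi' : Integrable g') (c : ℝ) :
    ∫ t, chi (-(t * c)) * g' t = Complex.I * c * ∫ t, chi (-(t * c)) * g t := by
  have e : ((fun t : ℝ => -(Complex.I * c) * chi (-(t * c))) * g)
      = fun t => -(Complex.I * c) * (chi (-(t * c)) * g t) := by
    funext t; simp only [Pi.mul_apply]; ring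
  have i0 : Integrable fun t => chi (-(t * c)) * g t := integrable_chi_mul (by fun_prop) hi
  have i1 : Integrable fun t => chi (-(t * c)) * g' t := integrable_chi_mul (by fun_prop) hi'
  rw [integral_mul_deriv_eq_deriv_mul_of_integrable (u := fun t => chi (-(t * c)))
    (v := g) (u' := fun t => -(Complex.I * c) * chi (-(t * c)))
    (fun t _ => hasDerivAt_chi_mul c t) (fun t _ => hg t) i1 (by rw [e]; exact i0.const_mul _) i0]
  rw [← integral_const_mul, ← integral_neg]
  congr 1
  funext t
  ring

/-- The frequencies for which `exp (i x ξ)` is a function on `Z_lam`. -/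
def IsFrequency (Z : Geometry) (lam ξ : ℝ) : Prop :=
  Z = .torus → chi (-(2 * Real.pi * lam * ξ)) = 1

lemma ae_isFrequency (Z : Geometry) (hl : 1 ≤ lam) : ∀ᵐ ξ ∂(freqMeasure Z lam), IsFrequency Z lam ξ := by
  cases Z with
  | line => exact Filter.Eventually.of_forall fun ξ h => by simp at h
  | torus =>
      have hm : MeasurableSet {ξ : ℝ | chi (-(2 * Real.pi * lam * ξ)) = 1} :=
        measurableSet_eq_fun (by fun_prop) measurable_const
      have : ∀ᵐ ξ ∂(freqMeasure .torus lam), chi (-(2 * Real.pi * lam * ξ)) = 1 := by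
        rw [freqMeasure_torus_eq_map, ae_map_iff (by fun_prop) hm]
        refine Filter.Eventually.of_forall fun n => ?_
        have hlc : (lam : ℂ) ≠ 0 := by exact_mod_cast (by linarith : (0:ℝ) < lam).ne'
        have e : Complex.I * ((-(2 * Real.pi * lam * (n / lam)) : ℝ) : ℂ)
            = ((-n : ℤ) : ℂ) * (2 * Real.pi * Complex.I) := by
          push_cast; field_simp
        rw [chi, e, Complex.exp_int_mul_two_pi_mul_I]
      exact this.mono fun ξ h _ => h

lemma torus_integral_chi_mul_deriv (hl : 0 < lam) {g g' : ℝ → ℂ} (hg : ∀ x, HasDerivAt g (g' x) x)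
    (hc' : Continuous g') (hp : ∀ x, g (x + 2 * Real.pi * lam) = g x) {c : ℝ}
    (h1 : chi (-(2 * Real.pi * lam * c)) = 1) :
    ∫ x, chi (-(x * c)) * g' x ∂(spaceMeasure .torus lam)
      = Complex.I * c * ∫ x, chi (-(x * c)) * g x ∂(spaceMeasure .torus lam) := by
  have hT : 0 ≤ 2 * Real.pi * lam := by positivity
  have hint := intervalIntegral.integral_mul_deriv_eq_deriv_mul (a := 0) (b := 2 * Real.pi * lam)
    (u := fun t => chi (-(t * c))) (v := g) (u' := fun t => -(Complex.I * c) * chi (-(t * c)))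
    (fun t _ => hasDerivAt_chi_mul c t) (fun t _ => hg t)
    (Continuous.intervalIntegrable (by fun_prop) _ _) (hc'.intervalIntegrable _ _)
  have hp0 := hp 0
  rw [zero_add] at hp0
  rw [hp0, h1, zero_mul, neg_zero, show chi 0 = 1 by simp [chi], sub_self, zero_sub,
    intervalIntegral.integral_of_le hT, intervalIntegral.integral_of_le hT] at hint
  refine hint.trans ?_
  rw [← integral_const_mul, ← integral_neg]
  congr 1
  funext t
  ring

namespace HasSmoothDecay

lemma stFourier_time (h : HasSmoothDecay Z lam u) (q : ℝ × ℝ) :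
    stFourier Z lam (fun p => _root_.fderiv ℝ u p (1, 0)) q
      = Complex.I * q.1 * stFourier Z lam u q := by
  have h' := h.fderiv (1, 0)
  rw [stFourier_eq, stFourier_eq, mul_left_comm]
  congr 1
  unfold physMeasure
  rw [integral_prod_symm _ (integrable_chi_mul (by fun_prop) h'.integrable),
    integral_prod_symm _ (integrable_chi_mul (by fun_prop) h.integrable), ← integral_const_mul]
  congr 1
  funext x
  have e : ∀ t : ℝ, chi (-(t * q.1 + x * q.2)) = chi (-(x * q.2)) * chi (-(t * q.1)) := fun t => by
    rw [← chi_add]; congr 1; ring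
  simp only [e, mul_assoc]
  rw [integral_const_mul, integral_const_mul,
    line_integral_chi_mul_deriv (fun t => h.hasDerivAt_time t x) (h.integrable_time x)
      (h'.integrable_time x)]
  ring

lemma integral_space (h : HasSmoothDecay Z lam u) (hl : 1 ≤ lam) {c : ℝ}
    (hc : IsFrequency Z lam c) (t : ℝ) :
    ∫ x, chi (-(x * c)) * _root_.fderiv ℝ u (t, x) (0, 1) ∂(spaceMeasure Z lam)
      = Complex.I * c * ∫ x, chi (-(x * c)) * u (t, x) ∂(spaceMeasure Z lam) := by
  have h' := h.fderiv (0, 1)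
  cases Z with
  | line =>
      exact line_integral_chi_mul_deriv (fun x => h.hasDerivAt_space t x)
        (h.integrable_space t) (h'.integrable_space t) c
  | torus =>
      have c1 : Continuous fun x => _root_.fderiv ℝ u (t, x) (0, 1) :=
        h'.contDiff.continuous.comp (by fun_prop : Continuous fun x : ℝ => (t, x))
      exact torus_integral_chi_mul_deriv (by linarith) (fun x => h.hasDerivAt_space t x)
        c1 (h.periodic rfl t) (hc rfl)

lemma stFourier_space (h : HasSmoothDecay Z lam u) (hl : 1 ≤ lam) {q : ℝ × ℝ}
    (hq : IsFrequency Z lam q.2) :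
    stFourier Z lam (fun p => _root_.fderiv ℝ u p (0, 1)) q
      = Complex.I * q.2 * stFourier Z lam u q := by
  have h' := h.fderiv (0, 1)
  rw [stFourier_eq, stFourier_eq, mul_left_comm]
  congr 1
  unfold physMeasure
  rw [integral_prod _ (integrable_chi_mul (by fun_prop) h'.integrable),
    integral_prod _ (integrable_chi_mul (by fun_prop) h.integrable), ← integral_const_mul]
  congr 1
  funext t
  have e : ∀ x : ℝ, chi (-(t * q.1 + x * q.2)) = chi (-(t * q.1)) * chi (-(x * q.2)) := fun x => by
    rw [← chi_add]; congr 1; ring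
  simp only [e, mul_assoc]
  rw [integral_const_mul, integral_const_mul, h.integral_space hl hq]
  ring

end HasSmoothDecay

lemma norm_stFourier_le (q : ℝ × ℝ) :
    ‖stFourier Z lam u q‖ ≤ ∫ p, ‖u p‖ ∂(physMeasure Z lam) := by
  have hpi : 1 / (2 * Real.pi) ≤ 1 := by
    rw [div_le_one (by positivity)]; linarith [Real.pi_gt_three]
  rw [stFourier_eq, norm_mul, Complex.norm_real, Real.norm_of_nonneg (by positivity)]
  refine (mul_le_of_le_one_left (norm_nonneg _) hpi).trans
    ((norm_integral_le_integral_norm _).trans (le_of_eq ?_))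
  simp only [norm_mul, norm_chi, one_mul]

lemma aestronglyMeasurable_stFourier (hu : Measurable u) :
    AEStronglyMeasurable (stFourier Z lam u) (specMeasure Z lam) := by
  have hm : Measurable fun z : (ℝ × ℝ) × (ℝ × ℝ) =>
      chi (-(z.2.1 * z.1.1 + z.2.2 * z.1.2)) * u z.2 := by fun_prop
  have h2 := hm.stronglyMeasurable.integral_prod_right' (ν := physMeasure Z lam)
  have e : stFourier Z lam u = fun q => ((1 / (2 * Real.pi) : ℝ) : ℂ) *
      ∫ p, chi (-(p.1 * q.1 + p.2 * q.2)) * u p ∂(physMeasure Z lam) := funext stFourier_eq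
  rw [e]
  exact (h2.measurable.const_mul _).aestronglyMeasurable

lemma integrable_inv_one_add_sq_freqMeasure (Z : Geometry) (hl : 1 ≤ lam) :
    Integrable (fun ξ : ℝ => (1 + ξ ^ 2)⁻¹) (freqMeasure Z lam) := by
  obtain ⟨C, hC⟩ := exists_lintegral_inv_bracket_sq_le
  refine ⟨Measurable.aestronglyMeasurable (by fun_prop), ?_⟩
  rw [hasFiniteIntegral_iff_ofReal (Filter.Eventually.of_forall fun ξ => by positivity)]
  refine lt_of_le_of_lt (le_of_eq ?_) ((hC _ (isFreqMeasure Z hl) 0).trans_lt ENNReal.coe_lt_top)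
  simp only [bracket_sq, sub_zero]

/-- Two derivatives in time and two in space give the decay `((1 + τ ^ 2) (1 + ξ ^ 2))⁻¹`. -/
lemma HasSmoothDecay.integrable_stFourier (h : HasSmoothDecay Z lam u) (hl : 1 ≤ lam) :
    Integrable (stFourier Z lam u) (specMeasure Z lam) := by
  have htt := (h.fderiv (1, 0)).fderiv (1, 0)
  have hx := h.fderiv (0, 1)
  have hxx := hx.fderiv (0, 1)
  have hxxt := hxx.fderiv (1, 0)
  set A₁ := ∫ p, ‖u p‖ ∂(physMeasure Z lam) with hA₁
  set A₂ := ∫ p, ‖_root_.fderiv ℝ (fun p => _root_.fderiv ℝ u p (1, 0)) p (1, 0)‖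
    ∂(physMeasure Z lam) with hA₂
  set w := fun p => _root_.fderiv ℝ (fun p => _root_.fderiv ℝ u p (0, 1)) p (0, 1) with hw
  set A₃ := ∫ p, ‖w p‖ ∂(physMeasure Z lam) with hA₃
  set A₄ := ∫ p, ‖_root_.fderiv ℝ (fun p => _root_.fderiv ℝ w p (1, 0)) p (1, 0)‖
    ∂(physMeasure Z lam) with hA₄
  have hi := ((integrable_inv_one_add_sq.mul_prod
    (integrable_inv_one_add_sq_freqMeasure Z hl)).const_mul (A₁ + A₂ + A₃ + A₄))
  refine hi.mono' (aestronglyMeasurable_stFourier h.contDiff.continuous.measurable) ?_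
  filter_upwards [Measure.quasiMeasurePreserving_snd.ae (ae_isFrequency Z hl)] with q hq
  have n1 : ‖stFourier Z lam u q‖ ≤ A₁ := norm_stFourier_le q
  have n2 := norm_stFourier_le (Z := Z) (lam := lam)
    (u := fun p => _root_.fderiv ℝ (fun p => _root_.fderiv ℝ u p (1, 0)) p (1, 0)) q
  have n3 := norm_stFourier_le (Z := Z) (lam := lam) (u := w) q
  have n4 := norm_stFourier_le (Z := Z) (lam := lam)
    (u := fun p => _root_.fderiv ℝ (fun p => _root_.fderiv ℝ w p (1, 0)) p (1, 0)) q
  have ew : stFourier Z lam w q = Complex.I * q.2 * (Complex.I * q.2 * stFourier Z lam u q) := by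
    rw [hw, hx.stFourier_space hl hq, h.stFourier_space hl hq]
  rw [(h.fderiv (1, 0)).stFourier_time, h.stFourier_time] at n2
  rw [hxxt.stFourier_time, hxx.stFourier_time, ew] at n4
  rw [ew] at n3
  simp only [norm_mul, Complex.norm_I, Complex.norm_real, one_mul, Real.norm_eq_abs] at n2 n3 n4
  set N := ‖stFourier Z lam u q‖
  have t2 : |q.1| * |q.1| = q.1 ^ 2 := by rw [abs_mul_abs_self, sq]
  have x2 : |q.2| * |q.2| = q.2 ^ 2 := by rw [abs_mul_abs_self, sq]
  rw [← mul_assoc, t2] at n2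
  rw [← mul_assoc, x2] at n3
  rw [← mul_assoc, ← mul_assoc |q.2|, t2, x2] at n4
  rw [← mul_inv, ← div_eq_mul_inv, le_div_iff₀ (by positivity)]
  calc N * ((1 + q.1 ^ 2) * (1 + q.2 ^ 2))
      = N + q.1 ^ 2 * N + q.2 ^ 2 * N + q.1 ^ 2 * (q.2 ^ 2 * N) := by ring
    _ ≤ _ := by gcongr

lemma space_inversion (hl : 1 ≤ lam) {g : ℝ → ℂ} (hc : Continuous g)
    (hp : Z = .torus → ∀ x, g (x + 2 * Real.pi * lam) = g x)
    (hi : Integrable g (spaceMeasure Z lam))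
    (hi' : Integrable (fun ξ => ∫ y, chi (-(y * ξ)) * g y ∂(spaceMeasure Z lam))
      (freqMeasure Z lam)) (x : ℝ) :
    g x = ((1 / (2 * Real.pi) : ℝ) : ℂ) * ∫ ξ, chi (x * ξ) *
      ∫ y, chi (-(y * ξ)) * g y ∂(spaceMeasure Z lam) ∂(freqMeasure Z lam) := by
  cases Z with
  | line => exact line_inversion hc hi hi' x
  | torus => exact torus_inversion (by linarith) hc (hp rfl) hi' x

/-- Inversion in time at a fixed spatial frequency. -/
lemma HasSmoothDecay.time_inversion (h : HasSmoothDecay Z lam u) {ξ : ℝ}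
    (hξ : Integrable fun τ => stFourier Z lam u (τ, ξ)) (t : ℝ) :
    ∫ y, chi (-(y * ξ)) * u (t, y) ∂(spaceMeasure Z lam)
      = ∫ τ, chi (t * τ) * stFourier Z lam u (τ, ξ) := by
  set g : ℝ → ℂ := fun t => ∫ y, chi (-(y * ξ)) * u (t, y) ∂(spaceMeasure Z lam) with hg
  have hc := h.contDiff.continuous
  have hpi : ((1 / (2 * Real.pi) : ℝ) : ℂ) ≠ 0 := by
    exact_mod_cast (by positivity : (1 / (2 * Real.pi) : ℝ) ≠ 0)
  have hgc : Continuous g := by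
    obtain ⟨C, hC0, hC⟩ := h.exists_norm_le
    refine continuous_of_dominated (bound := fun x => C * (spaceDecay Z x)⁻¹)
      (fun t => Continuous.aestronglyMeasurable (by fun_prop)) (fun t =>
      Filter.Eventually.of_forall fun x => ?_) ((integrable_inv_spaceDecay Z lam).const_mul C)
      (Filter.Eventually.of_forall fun x => by fun_prop)
    rw [norm_mul, norm_chi, one_mul]
    refine (hC t x).trans ?_
    have := one_le_spaceDecay Z x
    gcongr
    exact mul_le_of_le_one_left (by positivity) (inv_le_one_of_one_le₀ (by nlinarith))
  have hgi : Integrable g :=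
    (integrable_chi_mul (ν := physMeasure Z lam) (θ := fun p : ℝ × ℝ => -(p.2 * ξ)) (by fun_prop)
      h.integrable).integral_prod_left
  have hG : ∀ τ, stFourier Z lam u (τ, ξ)
      = ((1 / (2 * Real.pi) : ℝ) : ℂ) * ∫ t, chi (-(t * τ)) * g t := by
    intro τ
    rw [stFourier_eq]
    congr 1
    unfold physMeasure
    rw [integral_prod _ (integrable_chi_mul (by fun_prop) h.integrable)]
    congr 1
    funext t
    rw [hg, ← integral_const_mul]
    congr 1
    funext x
    rw [← mul_assoc, ← chi_add]
    congr 2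
    ring
  have hGi : Integrable fun τ => ∫ t, chi (-(t * τ)) * g t := by
    simp only [hG] at hξ
    exact (integrable_const_mul_iff (IsUnit.mk0 _ hpi) _).1 hξ
  refine (line_inversion hgc hgi hGi t).trans ?_
  rw [← integral_const_mul]
  congr 1
  funext τ
  rw [hG, mul_left_comm]

lemma HasSmoothDecay.isInvertible (h : HasSmoothDecay Z lam u) (hl : 1 ≤ lam) :
    IsInvertible Z lam u where
  integrable := h.integrable
  integrable_stFourier := h.integrable_stFourier hl
  inversion p := by
    have hU := h.integrable_stFourier hl
    have hc := h.contDiff.continuous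
    have hae : ∀ᵐ ξ ∂(freqMeasure Z lam),
        ∫ y, chi (-(y * ξ)) * u (p.1, y) ∂(spaceMeasure Z lam)
          = ∫ τ, chi (p.1 * τ) * stFourier Z lam u (τ, ξ) := by
      filter_upwards [hU.prod_left_ae] with ξ hξ
      exact h.time_inversion hξ p.1
    have hUi : Integrable (fun q => chi (p.1 * q.1) * stFourier Z lam u q) (specMeasure Z lam) :=
      integrable_chi_mul (by fun_prop) hU
    have hinv := space_inversion (Z := Z) hl (g := fun x => u (p.1, x)) (by fun_prop)
      (fun hZ => h.periodic hZ p.1) (h.integrable_space p.1)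
      (hUi.integral_prod_right.congr (hae.mono fun ξ hξ => hξ.symm)) p.2
    refine hinv.trans ?_
    congr 1
    unfold specMeasure
    rw [integral_prod_symm _ (integrable_chi_mul (by fun_prop) hU)]
    refine integral_congr_ae (hae.mono fun ξ hξ => ?_)
    dsimp only
    rw [hξ, ← integral_const_mul]
    congr 1
    funext τ
    rw [← mul_assoc, ← chi_add, add_comm]

end


/-! ### The three products -/

section
variable {Z : Geometry} {lam s : ℝ} {f g : ℝ × ℝ → ℂ}

lemma ProductBound.mono {B B' : ℝ≥0∞} (h : ProductBound Z lam s f g B) (hB : B ≤ B') :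
    ProductBound Z lam s f g B' := ⟨h.1, h.2.1, h.2.2.trans hB⟩

/-- The estimate of `exists_product_le` for one of the three products `u v̄`, `u v`, `ū v̄`, with the
constants merged. -/
lemma exists_product_conj_le (hs : -1 / 2 ≤ s) (hs' : s ≤ -1 / 4) : ∃ C : ℝ≥0, ∀ (Z : Geometry)
    (lam : ℝ), 1 ≤ lam → ∀ (ε₁ ε₂ : ℝ) (f g F G : ℝ × ℝ → ℂ) (B : ℝ≥0∞), IsFactor ε₁ f F →
    IsFactor ε₂ g G → (ε₁ = 1 ∧ ε₂ = -1 ∧ B = ENNReal.ofReal (lossFactor s lam) ∨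
      ε₁ = ε₂ ∧ B = 1) →
    AEStronglyMeasurable f (specMeasure Z lam) → AEStronglyMeasurable g (specMeasure Z lam) →
    wNorm Z lam s (lambdaPow (-1) (omegaSq lam (prodHat Z lam F G)))
        ≤ C * B * wNorm Z lam s f * wNorm Z lam s g ∧
      (wNorm Z lam s f < ⊤ → wNorm Z lam s g < ⊤ →
        ProductBound Z lam s F G (C * B * wNorm Z lam s f * wNorm Z lam s g)) := by
  obtain ⟨C₁, hC₁⟩ := exists_product_le hs (by linarith)
  obtain ⟨C₂, hC₂⟩ := exists_isLowBound_conj hs hs'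
  refine ⟨C₁ * (C₂ + 48 ^ 3), fun Z lam hl ε₁ ε₂ f g F G B hF hG hB hfm hgm => ?_⟩
  have hμ : IsFreqMeasure (freqMeasure Z lam) := isFreqMeasure Z hl
  have hlow : ∃ B', B' ≠ ⊤ ∧ IsLowBound (freqMeasure Z lam) s lam ε₁ ε₂ B' ∧
      B' ≤ (C₂ + 48 ^ 3 : ℝ≥0) * B := by
    rcases hB with ⟨rfl, rfl, rfl⟩ | ⟨rfl, rfl⟩
    · refine ⟨_, ENNReal.mul_ne_top ENNReal.coe_ne_top ENNReal.ofReal_ne_top, hC₂ _ hμ lam hl, ?_⟩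
      gcongr
      exact le_self_add
    · refine ⟨_, ENNReal.coe_ne_top, isLowBound_same hμ s lam hF.sign, ?_⟩
      rw [mul_one]
      exact_mod_cast (le_add_self : (48 ^ 3 : ℝ≥0) ≤ C₂ + 48 ^ 3)
  obtain ⟨B', hB't, hB'l, hB'⟩ := hlow
  obtain ⟨h1, h2⟩ := hC₁ Z lam hl ε₁ ε₂ f g F G B' hF hG hB'l hB't hfm hgm
  have hle : C₁ * B' * wNorm Z lam s f * wNorm Z lam s g
      ≤ (C₁ * (C₂ + 48 ^ 3) : ℝ≥0) * B * wNorm Z lam s f * wNorm Z lam s g := by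
    rw [ENNReal.coe_mul, mul_assoc (C₁ : ℝ≥0∞) _ B]
    gcongr ?_ * _ * _
    exact mul_le_mul_right hB' _
  exact ⟨h1.trans hle, fun hf hg => (h2 hf hg).mono hle⟩

lemma isFactor_self (f : ℝ × ℝ → ℂ) : IsFactor 1 f f := Or.inl ⟨rfl, rfl⟩

lemma isFactor_conjHat (f : ℝ × ℝ → ℂ) : IsFactor (-1) f (conjHat f) := Or.inr ⟨rfl, rfl⟩

lemma IsSchwartz.isInvertible {u : ℝ × ℝ → ℂ} (hl : 1 ≤ lam) (hu : IsSchwartz Z lam u) :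
    IsInvertible Z lam u := hu.hasSmoothDecay.isInvertible hl

end

end GoodBoussinesq

/-- The bilinear estimate in `W^s`, with a constant depending only on `s`: first for all elements of
`W^s`, given by their spacetime Fourier transforms `f`, `g`; then for Schwartz functions `u`, `v`,
with the pointwise products. -/
theorem mainTheorem3 (s : ℝ) (hs_lower : -1 / 2 ≤ s) (hs_upper : s ≤ -1 / 4) :
    ∃ C : ℝ≥0, ∀ (Z : GoodBoussinesq.Geometry) (lam : ℝ), 1 ≤ lam →
      (∀ f g : ℝ × ℝ → ℂ, GoodBoussinesq.MemW Z lam s f → GoodBoussinesq.MemW Z lam s g →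
        GoodBoussinesq.ProductBound Z lam s f (GoodBoussinesq.conjHat g)
            (C * ENNReal.ofReal (GoodBoussinesq.lossFactor s lam)
              * GoodBoussinesq.wNorm Z lam s f * GoodBoussinesq.wNorm Z lam s g) ∧
          GoodBoussinesq.ProductBound Z lam s f g
            (C * GoodBoussinesq.wNorm Z lam s f * GoodBoussinesq.wNorm Z lam s g) ∧
          GoodBoussinesq.ProductBound Z lam s
            (GoodBoussinesq.conjHat f) (GoodBoussinesq.conjHat g)
            (C * GoodBoussinesq.wNorm Z lam s f * GoodBoussinesq.wNorm Z lam s g)) ∧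
      (∀ u v : ℝ × ℝ → ℂ, GoodBoussinesq.IsSchwartz Z lam u → GoodBoussinesq.IsSchwartz Z lam v →
        GoodBoussinesq.forcingNorm Z lam s (fun p => u p * conj (v p)) ≤
            C * ENNReal.ofReal (GoodBoussinesq.lossFactor s lam)
              * GoodBoussinesq.wNorm Z lam s (GoodBoussinesq.stFourier Z lam u)
              * GoodBoussinesq.wNorm Z lam s (GoodBoussinesq.stFourier Z lam v) ∧
          GoodBoussinesq.forcingNorm Z lam s (fun p => u p * v p) ≤
            C * GoodBoussinesq.wNorm Z lam s (GoodBoussinesq.stFourier Z lam u)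
              * GoodBoussinesq.wNorm Z lam s (GoodBoussinesq.stFourier Z lam v) ∧
          GoodBoussinesq.forcingNorm Z lam s (fun p => conj (u p) * conj (v p)) ≤
            C * GoodBoussinesq.wNorm Z lam s (GoodBoussinesq.stFourier Z lam u)
              * GoodBoussinesq.wNorm Z lam s (GoodBoussinesq.stFourier Z lam v)) := by
  obtain ⟨C, hC⟩ := GoodBoussinesq.exists_product_conj_le hs_lower hs_upper
  refine ⟨C, fun Z lam hl => ⟨fun f g hf hg => ?_, fun u v hu hv => ?_⟩⟩
  · have h1 := (hC Z lam hl 1 (-1) f g f (GoodBoussinesq.conjHat g) _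
      (GoodBoussinesq.isFactor_self f) (GoodBoussinesq.isFactor_conjHat g)
      (Or.inl ⟨rfl, rfl, rfl⟩) hf.1 hg.1).2 hf.2 hg.2
    have h2 := (hC Z lam hl 1 1 f g f g 1 (GoodBoussinesq.isFactor_self f)
      (GoodBoussinesq.isFactor_self g) (Or.inr ⟨rfl, rfl⟩) hf.1 hg.1).2 hf.2 hg.2
    have h3 := (hC Z lam hl (-1) (-1) f g _ _ 1 (GoodBoussinesq.isFactor_conjHat f)
      (GoodBoussinesq.isFactor_conjHat g) (Or.inr ⟨rfl, rfl⟩) hf.1 hg.1).2 hf.2 hg.2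
    rw [mul_one] at h2 h3
    exact ⟨h1, h2, h3⟩
  · have iu := hu.isInvertible hl
    have iv := hv.isInvertible hl
    have mu := iu.integrable_stFourier.aestronglyMeasurable
    have mv := iv.integrable_stFourier.aestronglyMeasurable
    have h1 := (hC Z lam hl 1 (-1) _ _ _ _ _ (GoodBoussinesq.isFactor_self _)
      (GoodBoussinesq.isFactor_conjHat _) (Or.inl ⟨rfl, rfl, rfl⟩) mu mv).1
    have h2 := (hC Z lam hl 1 1 _ _ _ _ 1 (GoodBoussinesq.isFactor_self _)
      (GoodBoussinesq.isFactor_self _) (Or.inr ⟨rfl, rfl⟩) mu mv).1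
    have h3 := (hC Z lam hl (-1) (-1) _ _ _ _ 1 (GoodBoussinesq.isFactor_conjHat _)
      (GoodBoussinesq.isFactor_conjHat _) (Or.inr ⟨rfl, rfl⟩) mu mv).1
    rw [mul_one] at h2 h3
    rw [← GoodBoussinesq.stFourier_conj, ← iu.stFourier_mul (iv.conj hl).integrable] at h1
    rw [← iu.stFourier_mul iv.integrable] at h2
    rw [← GoodBoussinesq.stFourier_conj, ← GoodBoussinesq.stFourier_conj,
      ← (iu.conj hl).stFourier_mul (iv.conj hl).integrable] at h3
    exact ⟨h1, h2, h3⟩
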